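/- Let $k$ be an algebraically closed field (of any characteristic) and let $G$ be an affine algebraic group over $k$, with function algebra $H=\mathcal{O}(G)$, a finitely generated commutative Hopf algebra. Products of linear functionals below are convolution products in $H^*$ and $(H\otimes H)^*$, and $m$ is the multiplication of $H$. A *Hopf 2-cocycle* for $G$ is an invertible $J\in(H\otimes H)^*$ with $\sum J(a_1b_1,c)J(a_2,b_2)=\sum J(a,b_1c_1)J(b_2,c_2)$ and $J(a,1)=\varepsilon(a)=J(1,a)$. It is *invariant* if $J*m=m*J$. For invertible $x\in H^*$ put $J^x=(x\circ m)*J*(x^{-1}\otimes x^{-1})$; if $L=J^x$ for some $x$, then $J$ and $L$ are *gauge equivalent*. Let $Z^2_{\rm inv}(G)$ be the group of invariant Hopf 2-cocycles, $B^2_{\rm inv}(G)$ its central subgroup of those of the form $(\varepsilon\otimes\varepsilon)^x$ with $x$ invertible and central in $H^*$, and $H^2_{\rm inv}(G)=Z^2_{\rm inv}(G)/B^2_{\rm inv}(G)$. Put $R^J=J_{21}^{-1}*J$. Closed subgroups are closed subgroup schemes. The *support* $\mathrm{Supp}(J)$ is the set of closed subgroups $A\subseteq G$ for which $J$ is gauge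 equivalent to the lift to $G$ of a *minimal* Hopf 2-cocycle $K$ for $A$, i.e. one with $R^K$ non-degenerate on $\mathcal{O}(A)$. Let $\mathcal{B}(G)$ be the set of pairs $(A,R)$ where $A$ is a commutative closed normal subgroup of $G$, $(\mathcal{O}(A),R)$ is a cotriangular Hopf algebra with $R$ non-degenerate and with trivial Drinfeld element, and $R$ is $G$-invariant. Put $e=(\{1\},\varepsilon\otimes\varepsilon)\in\mathcal{B}(G)$. Let $\mathrm{Int}(G)$ be the group of Hopf algebra automorphisms of $H$ of the form $\mathrm{Ad}(x)=x*\mathrm{id}*x^{-1}$ with $x\in H^*$ invertible, and $\mathrm{Inn}(G)$ its normal subgroup of those with $x\in G(k)$, i.e. $x:H\to k$ an algebra homomorphism. **Theorem.** 1. For every $J\in Z^2_{\rm inv}(G)$ the set $\mathrm{Supp}(J)$ consists of a single closed subgroup $A$, the form $R^J$ descends to $\mathcal{O}(A)$, and the pair $(A,R^J)$ is in $\mathcal{B}(G)$ and depends only on the class $[J]$. Hence $\Theta:H^2_{\rm inv}(G)\to\mathcal{B}(G)$, $[J]\mapsto(\mathrm{Supp}(J),R^J)$, is a well-defined map of sets.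 2. The rule $\mathrm{Ad}(x)\mapsto[(\varepsilon\otimes\varepsilon)^x]$, with $x$ normalized by $x(1)=1$, gives a well-defined injective group homomorphism $\mathrm{Int}(G)/\mathrm{Inn}(G)\to H^2_{\rm inv}(G)$. Let $N$ be its image. The non-empty fibers of $\Theta$ are exactly the cosets $N\cdot[J]=\{n[J]: n\in N\}$. In particular, $\Theta$ is injective if and only if $\mathrm{Int}(G)=\mathrm{Inn}(G)$. 3. $\Theta^{-1}(e)=N$; in particular $\Theta^{-1}(e)$ is a subgroup of $H^2_{\rm inv}(G)$, isomorphic to $\mathrm{Int}(G)/\mathrm{Inn}(G)$ as a group. -/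

import Mathlib

open TensorProduct WithConv

/-!
Throughout, `k` is a field and an affine algebraic group `G` over `k` is given by its algebra of
regular functions `H = O(G)`, a commutative Hopf algebra.  For a coalgebra `C` and an algebra `B`,
`WithConv (C →ₗ[k] B)` is the convolution algebra: `(f * g) c = ∑ f c₁ * g c₂`, with unit
`c ↦ ε c`.  In particular `WithConv (H →ₗ[k] k)` is the algebra `H*` and
`WithConv (H ⊗[k] H →ₗ[k] k)` is the algebra `(H ⊗ H)*`.
-/

namespace InvCocycle

noncomputable section

universe u v

section Convolution

variable {k : Type u} [Field k]

/-- The algebra map `D* → C*` (or `Hom(D, B) → Hom(C, B)`) given by composition with a coalgebra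
map `C → D`. -/
def pull {C D : Type*} [AddCommGroup C] [Module k C] [Coalgebra k C]
    [AddCommGroup D] [Module k D] [Coalgebra k D] (φ : C →ₗc[k] D) (B : Type*) [Ring B]
    [Algebra k B] : WithConv (D →ₗ[k] B) →* WithConv (C →ₗ[k] B) where
  toFun f := toConv (f.ofConv ∘ₗ φ.toLinearMap)
  map_one' := by
    ext c
    simp [LinearMap.convOne_def]
  map_mul' f g := by
    apply WithConv.ext
    exact LinearMap.convMul_comp_coalgHom_distrib f g φ

/-- A functional on the coalgebra `C`, seen as a map from `C` to the algebra `B`. -/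
def scal {C : Type*} [AddCommGroup C] [Module k C] [Coalgebra k C] (B : Type*) [Ring B]
    [Algebra k B] : WithConv (C →ₗ[k] k) →* WithConv (C →ₗ[k] B) where
  toFun f := toConv (Algebra.linearMap k B ∘ₗ f.ofConv)
  map_one' := by
    ext c
    simp [LinearMap.convOne_def]
  map_mul' f g := by
    apply WithConv.ext
    exact LinearMap.algHom_comp_convMul_distrib (Algebra.ofId k B) f g

section Lemmas

variable {C : Type*} [AddCommGroup C] [Module k C] [Coalgebra k C]
  {B : Type*} [Ring B] [Algebra k B] {E : Type*} [Ring E] [Algebra k E]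

theorem comp_scal_mul (L : B →ₗ[k] E) (f : WithConv (C →ₗ[k] k)) (Y : WithConv (C →ₗ[k] B)) :
    toConv (L ∘ₗ (scal B f * Y).ofConv) = scal E f * toConv (L ∘ₗ Y.ofConv) := by
  ext c
  change L ((scal B f * Y) c) = (scal E f * toConv (L ∘ₗ Y.ofConv)) c
  rw [(Coalgebra.Repr.arbitrary k c).convMul_apply, (Coalgebra.Repr.arbitrary k c).convMul_apply]
  simp [scal, ← Algebra.smul_def]

theorem comp_mul_scal (L : B →ₗ[k] E) (f : WithConv (C →ₗ[k] k)) (Y : WithConv (C →ₗ[k] B)) :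
    toConv (L ∘ₗ (Y * scal B f).ofConv) = toConv (L ∘ₗ Y.ofConv) * scal E f := by
  ext c
  change L ((Y * scal B f) c) = (toConv (L ∘ₗ Y.ofConv) * scal E f) c
  rw [(Coalgebra.Repr.arbitrary k c).convMul_apply, (Coalgebra.Repr.arbitrary k c).convMul_apply]
  simp [scal, ← Algebra.commutes, ← Algebra.smul_def]

theorem scal_self (f : WithConv (C →ₗ[k] k)) : scal k f = f := by
  ext c
  simp [scal]

/-- If `f` commutes with `Y : C → B`, it commutes with every functional factoring through `Y`. -/
theorem commute_comp {f : WithConv (C →ₗ[k] k)} {Y : WithConv (C →ₗ[k] B)}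
    (h : Commute (scal B f) Y) (L : B →ₗ[k] k) : Commute f (toConv (L ∘ₗ Y.ofConv)) := by
  have h1 := comp_scal_mul L f Y
  have h2 := comp_mul_scal L f Y
  rw [scal_self] at h1 h2
  rw [Commute, SemiconjBy, ← h1, ← h2, h.eq]

end Lemmas

end Convolution

section Hopf

variable (k : Type u) [Field k] (H : Type v) [CommRing H] [HopfAlgebra k H]

/-- The algebra `H*`. -/
abbrev Dual1 : Type _ := WithConv (H →ₗ[k] k)

/-- The algebra `(H ⊗ H)*`. -/
abbrev Dual2 : Type _ := WithConv (H ⊗[k] H →ₗ[k] k)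

/-- `a ⊗ b ↦ ε(a) b`. -/
def p₂ : H ⊗[k] H →ₗc[k] H :=
  (Coalgebra.TensorProduct.lid k H : k ⊗[k] H →ₗc[k] H).comp
    (Coalgebra.TensorProduct.map (Coalgebra.counitCoalgHom k H) (CoalgHom.id k H))

/-- `a ⊗ b ↦ b ⊗ a`. -/
def flipHom : H ⊗[k] H →ₗc[k] H ⊗[k] H :=
  (Bialgebra.TensorProduct.comm k H H : H ⊗[k] H →ₗc[k] H ⊗[k] H)

/-- `(a ⊗ b) ⊗ c ↦ ab ⊗ c`. -/
def q₁ : (H ⊗[k] H) ⊗[k] H →ₗc[k] H ⊗[k] H :=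
  Coalgebra.TensorProduct.map (Bialgebra.mulCoalgHom k H) (CoalgHom.id k H)

/-- `(a ⊗ b) ⊗ c ↦ ε(c) a ⊗ b`. -/
def q₂ : (H ⊗[k] H) ⊗[k] H →ₗc[k] H ⊗[k] H :=
  (Coalgebra.TensorProduct.rid k k (H ⊗[k] H) : (H ⊗[k] H) ⊗[k] k →ₗc[k] H ⊗[k] H).comp
    (Coalgebra.TensorProduct.map (CoalgHom.id k (H ⊗[k] H)) (Coalgebra.counitCoalgHom k H))

/-- `(a ⊗ b) ⊗ c ↦ a ⊗ bc`. -/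
def q₃ : (H ⊗[k] H) ⊗[k] H →ₗc[k] H ⊗[k] H :=
  (Coalgebra.TensorProduct.map (CoalgHom.id k H) (Bialgebra.mulCoalgHom k H)).comp
    (Coalgebra.TensorProduct.assoc k k H H H : (H ⊗[k] H) ⊗[k] H →ₗc[k] H ⊗[k] (H ⊗[k] H))

/-- `(a ⊗ b) ⊗ c ↦ ε(a) b ⊗ c`. -/
def q₄ : (H ⊗[k] H) ⊗[k] H →ₗc[k] H ⊗[k] H :=
  Coalgebra.TensorProduct.map (p₂ k H) (CoalgHom.id k H)

theorem p₂_apply (a b : H) : p₂ k H (a ⊗ₜ b) = Coalgebra.counit (R := k) a • b := rfl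
theorem flipHom_apply (a b : H) : flipHom k H (a ⊗ₜ b) = b ⊗ₜ a := rfl
theorem q₁_apply (a b c : H) : q₁ k H ((a ⊗ₜ b) ⊗ₜ c) = (a * b) ⊗ₜ c := rfl
theorem q₂_apply (a b c : H) :
    q₂ k H ((a ⊗ₜ b) ⊗ₜ c) = Coalgebra.counit (R := k) c • (a ⊗ₜ[k] b) := rfl
theorem q₃_apply (a b c : H) : q₃ k H ((a ⊗ₜ b) ⊗ₜ c) = a ⊗ₜ (b * c) := rfl
theorem q₄_apply (a b c : H) :
    q₄ k H ((a ⊗ₜ b) ⊗ₜ c) = (Coalgebra.counit (R := k) a • b) ⊗ₜ c := rfl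

variable {k H}

/-- The multiplication of `H` as an element of the convolution algebra `Hom(H ⊗ H, H)`. -/
def mulConv : WithConv (H ⊗[k] H →ₗ[k] H) := toConv (LinearMap.mul' k H)

/-- `x ↦ x ∘ m`, the coproduct of `H*`. -/
def coprod : (Dual1 k H)ˣ →* (Dual2 k H)ˣ := Units.map (pull (Bialgebra.mulCoalgHom k H) k)

/-- `a ⊗ b ↦ f(a) g(b)`. -/
def outer (f g : Dual1 k H) : Dual2 k H :=
  toConv ((Algebra.TensorProduct.lid k k).toAlgHom.toLinearMap ∘ₗ
    TensorProduct.map f.ofConv g.ofConv)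

theorem outer_apply (f g : Dual1 k H) (a b : H) : outer f g (a ⊗ₜ b) = f a * g b := rfl

theorem outer_mul (f g f' g' : Dual1 k H) :
    outer f g * outer f' g' = outer (f * f') (g * g') := by
  apply WithConv.ext
  have h := LinearMap.algHom_comp_convMul_distrib (Algebra.TensorProduct.lid k k).toAlgHom
    (toConv (TensorProduct.map f.ofConv g.ofConv)) (toConv (TensorProduct.map f'.ofConv g'.ofConv))
  rw [TensorProduct.map_convMul_map] at h
  exact h.symm

theorem outer_one : outer (1 : Dual1 k H) 1 = 1 := by
  apply WithConv.ext
  ext a b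
  change Coalgebra.counit (R := k) a * Coalgebra.counit (R := k) b = _
  simp [mul_comm]

/-- `x ⊗ x`, i.e. `a ⊗ b ↦ x(a) x(b)`. -/
def tensorSq : (Dual1 k H)ˣ →* (Dual2 k H)ˣ :=
  Units.map
    { toFun := fun x => outer x x
      map_one' := outer_one
      map_mul' := fun x y => (outer_mul x x y y).symm }

/-- `J₂₁ : a ⊗ b ↦ J(b, a)`. -/
def swap : (Dual2 k H)ˣ →* (Dual2 k H)ˣ := Units.map (pull (flipHom k H) k)

/-- Hopf 2-cocycles:
`∑ J(a₁b₁, c) J(a₂, b₂) = ∑ J(a, b₁c₁) J(b₂, c₂)` and `J(a, 1) = ε(a) = J(1, a)`. -/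
structure IsHopf2Cocycle (J : (Dual2 k H)ˣ) : Prop where
  cocycle : pull (q₁ k H) k J.val * pull (q₂ k H) k J.val =
    pull (q₃ k H) k J.val * pull (q₄ k H) k J.val
  right_one : ∀ a : H, J.val (a ⊗ₜ 1) = Coalgebra.counit (R := k) a
  left_one : ∀ a : H, J.val (1 ⊗ₜ a) = Coalgebra.counit (R := k) a

/-- Invariance of a functional on `H ⊗ H`: `J * m = m * J`, i.e.
`∑ J(a₁, b₁) a₂b₂ = ∑ a₁b₁ J(a₂, b₂)`. -/
def IsInvariant (J : (Dual2 k H)ˣ) : Prop := Commute (scal H J.val) mulConv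

/-- The gauge action: `J^x(a, b) = ∑ x(a₁b₁) J(a₂, b₂) x⁻¹(a₃) x⁻¹(b₃)`. -/
def gauge (x : (Dual1 k H)ˣ) (J : (Dual2 k H)ˣ) : (Dual2 k H)ˣ :=
  coprod x * J * tensorSq x⁻¹

/-- `∂(x)(a, b) = ∑ x(a₁b₁) x⁻¹(a₂) x⁻¹(b₂)`. -/
def coboundary (x : (Dual1 k H)ˣ) : (Dual2 k H)ˣ := coprod x * tensorSq x⁻¹

/-- `R^J = J₂₁⁻¹ * J`. -/
def rMatrix (J : (Dual2 k H)ˣ) : (Dual2 k H)ˣ := (swap J)⁻¹ * J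

/-! ### The groups `Z²_inv`, `B²_inv` and `H²_inv` -/

/-- `a ↦ a ⊗ 1`. -/
def inl : H →ₗc[k] H ⊗[k] H :=
  (Coalgebra.TensorProduct.map (CoalgHom.id k H) (Bialgebra.unitBialgHom k H : k →ₗc[k] H)).comp
    ((Coalgebra.TensorProduct.rid k k H).symm : H →ₗc[k] H ⊗[k] k)

/-- `a ↦ 1 ⊗ a`. -/
def inr : H →ₗc[k] H ⊗[k] H :=
  (Coalgebra.TensorProduct.map (Bialgebra.unitBialgHom k H : k →ₗc[k] H) (CoalgHom.id k H)).comp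
    ((Coalgebra.TensorProduct.lid k H).symm : H →ₗc[k] k ⊗[k] H)

theorem inl_apply (a : H) : (inl : H →ₗc[k] H ⊗[k] H) a = a ⊗ₜ 1 := by
  change a ⊗ₜ[k] (algebraMap k H 1) = _
  rw [map_one]

theorem inr_apply (a : H) : (inr : H →ₗc[k] H ⊗[k] H) a = 1 ⊗ₜ a := by
  change (algebraMap k H 1) ⊗ₜ[k] a = _
  rw [map_one]

theorem right_one_iff (J : Dual2 k H) :
    (∀ a : H, J (a ⊗ₜ 1) = Coalgebra.counit (R := k) a) ↔ pull inl k J = 1 := by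
  constructor
  · intro h
    ext a
    change J.ofConv ((inl : H →ₗc[k] H ⊗[k] H) a) = Coalgebra.counit (R := k) a
    rw [inl_apply]
    exact h a
  · intro h a
    have h1 := congrArg (fun f : Dual1 k H => f a) h
    change J.ofConv ((inl : H →ₗc[k] H ⊗[k] H) a) = Coalgebra.counit (R := k) a at h1
    rwa [inl_apply] at h1

theorem left_one_iff (J : Dual2 k H) :
    (∀ a : H, J (1 ⊗ₜ a) = Coalgebra.counit (R := k) a) ↔ pull inr k J = 1 := by
  constructor
  · intro h
    ext a
    change J.ofConv ((inr : H →ₗc[k] H ⊗[k] H) a) = Coalgebra.counit (R := k) a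
    rw [inr_apply]
    exact h a
  · intro h a
    have h1 := congrArg (fun f : Dual1 k H => f a) h
    change J.ofConv ((inr : H →ₗc[k] H ⊗[k] H) a) = Coalgebra.counit (R := k) a at h1
    rwa [inr_apply] at h1

theorem commute_of_isInvariant {J : (Dual2 k H)ˣ} (hJ : IsInvariant J) (f : Dual1 k H) :
    Commute J.val (pull (Bialgebra.mulCoalgHom k H) k f) :=
  commute_comp hJ f.ofConv

theorem commute_q₁_q₂ {J : (Dual2 k H)ˣ} (hJ : IsInvariant J) (F : Dual2 k H) :
    Commute (pull (q₂ k H) k J.val) (pull (q₁ k H) k F) := by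
  have e1 : scal (H ⊗[k] H) (pull (q₂ k H) k J.val) =
      toConv (TensorProduct.map (scal H J.val).ofConv (1 : WithConv (H →ₗ[k] H)).ofConv) := by
    apply WithConv.ext
    ext a b c
    change algebraMap k (H ⊗[k] H) (J.val.ofConv (Coalgebra.counit (R := k) c • (a ⊗ₜ[k] b))) =
      (algebraMap k H (J.val.ofConv (a ⊗ₜ[k] b))) ⊗ₜ (algebraMap k H (Coalgebra.counit (R := k) c))
    rw [map_smul, smul_eq_mul]
    simp only [Algebra.algebraMap_eq_smul_one,
      Algebra.TensorProduct.one_def, TensorProduct.smul_tmul', TensorProduct.tmul_smul, smul_smul]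
  have e2 : toConv (q₁ k H).toLinearMap =
      toConv (TensorProduct.map (mulConv (k := k) (H := H)).ofConv
        (toConv (LinearMap.id : H →ₗ[k] H)).ofConv) := rfl
  refine commute_comp (Y := toConv (q₁ k H).toLinearMap) ?_ F.ofConv
  rw [e1, e2, Commute, SemiconjBy, TensorProduct.map_convMul_map, TensorProduct.map_convMul_map,
    hJ.eq, one_mul, mul_one]

theorem commute_q₃_q₄ {J : (Dual2 k H)ˣ} (hJ : IsInvariant J) (F : Dual2 k H) :
    Commute (pull (q₄ k H) k J.val) (pull (q₃ k H) k F) := by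
  have e1 : scal (H ⊗[k] H) (pull (Coalgebra.TensorProduct.assoc k k H H H).symm.toCoalgHom k
      (pull (q₄ k H) k J.val)) =
      toConv (TensorProduct.map (1 : WithConv (H →ₗ[k] H)).ofConv (scal H J.val).ofConv) := by
    apply WithConv.ext
    ext a b c
    change algebraMap k (H ⊗[k] H) (J.val.ofConv ((Coalgebra.counit (R := k) a • b) ⊗ₜ[k] c)) =
      (algebraMap k H (Coalgebra.counit (R := k) a)) ⊗ₜ (algebraMap k H (J.val.ofConv (b ⊗ₜ[k] c)))
    rw [← TensorProduct.smul_tmul', map_smul, smul_eq_mul]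
    simp only [Algebra.algebraMap_eq_smul_one, Algebra.TensorProduct.one_def,
      TensorProduct.smul_tmul', TensorProduct.tmul_smul, smul_smul, mul_comm]
  have key : Commute (pull (Coalgebra.TensorProduct.assoc k k H H H).symm.toCoalgHom k
      (pull (q₄ k H) k J.val)) (toConv (F.ofConv ∘ₗ TensorProduct.map
        (toConv (LinearMap.id : H →ₗ[k] H)).ofConv (mulConv (k := k) (H := H)).ofConv)) := by
    refine commute_comp (Y := toConv (TensorProduct.map
        (toConv (LinearMap.id : H →ₗ[k] H)).ofConv (mulConv (k := k) (H := H)).ofConv)) ?_ F.ofConv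
    rw [e1, Commute, SemiconjBy, TensorProduct.map_convMul_map, TensorProduct.map_convMul_map,
      hJ.eq, one_mul, mul_one]
  have h2 := key.map (pull (Coalgebra.TensorProduct.assoc k k H H H).toCoalgHom k)
  have e3 : pull (Coalgebra.TensorProduct.assoc k k H H H).toCoalgHom k
      (pull (Coalgebra.TensorProduct.assoc k k H H H).symm.toCoalgHom k
      (pull (q₄ k H) k J.val)) = pull (q₄ k H) k J.val := by
    apply WithConv.ext
    ext a b c
    rfl
  rw [e3] at h2
  exact h2

theorem IsInvariant.one : IsInvariant (1 : (Dual2 k H)ˣ) := by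
  simp [IsInvariant]

theorem IsInvariant.mul {J F : (Dual2 k H)ˣ} (hJ : IsInvariant J) (hF : IsInvariant F) :
    IsInvariant (J * F) := by
  have := Commute.mul_left hJ hF
  rwa [← map_mul] at this

theorem IsInvariant.inv {J : (Dual2 k H)ˣ} (hJ : IsInvariant J) : IsInvariant J⁻¹ :=
  Commute.units_inv_left (u := Units.map (scal H) J) hJ

/-- The group `Z²_inv(H)` of invariant Hopf 2-cocycles, under convolution. -/
def Z2inv (k : Type u) [Field k] (H : Type v) [CommRing H] [HopfAlgebra k H] :
    Subgroup (Dual2 k H)ˣ where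
  carrier := {J | IsHopf2Cocycle J ∧ IsInvariant J}
  one_mem' := by
    refine ⟨⟨by simp, ?_, ?_⟩, IsInvariant.one⟩
    · rw [right_one_iff]; simp
    · rw [left_one_iff]; simp
  mul_mem' := by
    rintro J F ⟨hJ, iJ⟩ ⟨hF, iF⟩
    refine ⟨⟨?_, ?_, ?_⟩, iJ.mul iF⟩
    · simp only [Units.val_mul, map_mul]
      rw [mul_assoc, ← mul_assoc (pull (q₁ k H) k F.val), ← (commute_q₁_q₂ iJ F.val).eq,
        mul_assoc, ← mul_assoc, hJ.cocycle, hF.cocycle, mul_assoc,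
        ← mul_assoc (pull (q₄ k H) k J.val), (commute_q₃_q₄ iJ F.val).eq]
      simp only [mul_assoc]
    · rw [right_one_iff, Units.val_mul, map_mul, (right_one_iff _).1 hJ.right_one,
        (right_one_iff _).1 hF.right_one, one_mul]
    · rw [left_one_iff, Units.val_mul, map_mul, (left_one_iff _).1 hJ.left_one,
        (left_one_iff _).1 hF.left_one, one_mul]
  inv_mem' := by
    rintro J ⟨hJ, iJ⟩
    refine ⟨⟨?_, ?_, ?_⟩, iJ.inv⟩
    · have h := hJ.cocycle
      have hu : Units.map (pull (q₁ k H) k) J * Units.map (pull (q₂ k H) k) J =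
          Units.map (pull (q₃ k H) k) J * Units.map (pull (q₄ k H) k) J := Units.ext h
      have h1 : Commute (Units.map (pull (q₂ k H) k) J) (Units.map (pull (q₁ k H) k) J) :=
        Units.ext (commute_q₁_q₂ iJ J.val)
      have h2 : Commute (Units.map (pull (q₄ k H) k) J) (Units.map (pull (q₃ k H) k) J) :=
        Units.ext (commute_q₃_q₄ iJ J.val)
      have h3 := congrArg (·⁻¹) hu
      simp only [mul_inv_rev] at h3
      rw [h1.inv_inv.eq, h2.inv_inv.eq] at h3
      exact congrArg Units.val h3
    · have h := (right_one_iff _).1 hJ.right_one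
      rw [right_one_iff]
      have hu : Units.map (pull inl k) J = 1 := Units.ext h
      have h3 : Units.map (pull inl k) J⁻¹ = 1 := by rw [map_inv, hu, inv_one]
      exact congrArg Units.val h3
    · have h := (left_one_iff _).1 hJ.left_one
      rw [left_one_iff]
      have hu : Units.map (pull inr k) J = 1 := Units.ext h
      have h3 : Units.map (pull inr k) J⁻¹ = 1 := by rw [map_inv, hu, inv_one]
      exact congrArg Units.val h3

/-- `x` is central in `H*`. -/
def IsCentral (x : (Dual1 k H)ˣ) : Prop := ∀ f : Dual1 k H, Commute x.val f

theorem IsCentral.outer {x : (Dual1 k H)ˣ} (hx : IsCentral x) (J : Dual2 k H) :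
    Commute (tensorSq x).val J := by
  have h0 : Commute (scal H x.val) (toConv (LinearMap.id : H →ₗ[k] H)) := by
    apply WithConv.ext
    apply LinearMap.ext
    intro a
    rw [← sub_eq_zero, ← Module.forall_dual_apply_eq_zero_iff k]
    intro f
    rw [map_sub, sub_eq_zero]
    have h1 := comp_scal_mul f x.val (toConv (LinearMap.id : H →ₗ[k] H))
    have h2 := comp_mul_scal f x.val (toConv (LinearMap.id : H →ₗ[k] H))
    rw [scal_self] at h1 h2
    have h3 : toConv (f ∘ₗ (scal H x.val * toConv (LinearMap.id : H →ₗ[k] H)).ofConv) =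
        toConv (f ∘ₗ (toConv (LinearMap.id : H →ₗ[k] H) * scal H x.val).ofConv) := by
      rw [h1, h2]
      exact hx _
    exact congrArg (fun g : Dual1 k H => g a) h3
  have e1 : scal (H ⊗[k] H) (tensorSq x).val =
      toConv (TensorProduct.map (scal H x.val).ofConv (scal H x.val).ofConv) := by
    apply WithConv.ext
    ext a b
    change algebraMap k (H ⊗[k] H) (x.val.ofConv a * x.val.ofConv b) =
      (algebraMap k H (x.val.ofConv a)) ⊗ₜ (algebraMap k H (x.val.ofConv b))
    simp only [Algebra.algebraMap_eq_smul_one, Algebra.TensorProduct.one_def,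
      TensorProduct.smul_tmul', TensorProduct.tmul_smul, smul_smul, mul_comm]
  have e2 : toConv (LinearMap.id : H ⊗[k] H →ₗ[k] H ⊗[k] H) =
      toConv (TensorProduct.map (toConv (LinearMap.id : H →ₗ[k] H)).ofConv
        (toConv (LinearMap.id : H →ₗ[k] H)).ofConv) := by
    apply WithConv.ext
    ext a b
    rfl
  refine commute_comp (Y := toConv (LinearMap.id : H ⊗[k] H →ₗ[k] H ⊗[k] H)) ?_ J.ofConv
  rw [e1, e2, Commute, SemiconjBy, TensorProduct.map_convMul_map, TensorProduct.map_convMul_map,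
    h0.eq]

theorem IsCentral.inv {x : (Dual1 k H)ˣ} (hx : IsCentral x) : IsCentral x⁻¹ :=
  fun f => (hx f).units_inv_left

theorem coboundary_mul {x y : (Dual1 k H)ˣ} (hx : IsCentral x) :
    coboundary (x * y) = coboundary x * coboundary y := by
  have h : Commute (tensorSq x⁻¹) (coprod y * tensorSq y⁻¹) := Units.ext (hx.inv.outer _)
  have h' : x * y = y * x := Units.ext (hx _)
  unfold coboundary
  rw [mul_assoc (coprod x), h.eq, mul_inv_rev, map_mul, map_mul]
  simp only [mul_assoc]

/-- The group `B²_inv(H)` of those invariant Hopf 2-cocycles that are of the form `∂(x)` with `x`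
central in `H*`. -/
def B2inv (k : Type u) [Field k] (H : Type v) [CommRing H] [HopfAlgebra k H] :
    Subgroup (Z2inv k H) where
  carrier := {J | ∃ x : (Dual1 k H)ˣ, IsCentral x ∧ J.val = coboundary x}
  one_mem' := ⟨1, fun f => Commute.one_left f, by simp [coboundary]⟩
  mul_mem' := by
    rintro J F ⟨x, hx, hJ⟩ ⟨y, hy, hF⟩
    refine ⟨x * y, fun f => (hx f).mul_left (hy f), ?_⟩
    rw [coboundary_mul hx, ← hJ, ← hF]
    rfl
  inv_mem' := by
    rintro J ⟨x, hx, hJ⟩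
    refine ⟨x⁻¹, hx.inv, ?_⟩
    have h := coboundary_mul (y := x⁻¹) hx
    rw [mul_inv_cancel] at h
    have h1 : coboundary (1 : (Dual1 k H)ˣ) = 1 := by simp [coboundary]
    rw [h1, ← hJ] at h
    exact (eq_inv_of_mul_eq_one_right h.symm).symm

instance : (B2inv k H).Normal where
  conj_mem := by
    rintro J ⟨x, hx, hJ⟩ F
    have h : F * J = J * F := by
      apply Subtype.ext
      change F.val * J.val = J.val * F.val
      rw [hJ]
      apply Units.ext
      exact (commute_of_isInvariant F.2.2 x.val).mul_right (hx.inv.outer F.val.val).symm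
    rw [h, mul_inv_cancel_right]
    exact ⟨x, hx, hJ⟩

/-- The second invariant cohomology group `H²_inv(H) = Z²_inv(H) / B²_inv(H)`. -/
abbrev H2inv (k : Type u) [Field k] (H : Type v) [CommRing H] [HopfAlgebra k H] : Type _ :=
  Z2inv k H ⧸ B2inv k H

/-! ### Cointernal and coinner automorphisms -/

/-- Hopf algebra automorphisms form a group under composition: `(f * g) h = f (g h)`. -/
instance : Group (H ≃ₐc[k] H) where
  mul f g := g.trans f
  one := BialgEquiv.refl k H
  inv f := f.symm
  mul_assoc _ _ _ := rfl
  one_mul _ := rfl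
  mul_one _ := rfl
  inv_mul_cancel f := by
    apply BialgEquiv.ext
    intro h
    exact f.toEquiv.symm_apply_apply h

/-- `Ad(x) = x * id * x⁻¹`, i.e. `h ↦ ∑ x(h₁) h₂ x⁻¹(h₃)`. -/
def Ad (x : (Dual1 k H)ˣ) : H →ₗ[k] H :=
  (scal H x.val * toConv LinearMap.id * scal H x⁻¹.val).ofConv

theorem Ad_one : Ad (1 : (Dual1 k H)ˣ) = LinearMap.id := by
  simp [Ad]

theorem comp_Ad (L : H →ₗ[k] H) (x : (Dual1 k H)ˣ) :
    toConv (L ∘ₗ Ad x) = scal H x.val * toConv L * scal H x⁻¹.val := by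
  rw [Ad, comp_mul_scal, comp_scal_mul]
  rfl

theorem Ad_comp_Ad (x y : (Dual1 k H)ˣ) : Ad x ∘ₗ Ad y = Ad (y * x) := by
  apply WithConv.toConv_injective
  rw [comp_Ad, Ad, Ad]
  simp only [mul_inv_rev, Units.val_mul, map_mul, mul_assoc, WithConv.toConv_ofConv]

/-- The group `CoInt(H)` of cointernal automorphisms: the Hopf algebra automorphisms of the form
`Ad(x)` with `x` an invertible element of `H*`.  For `H = O(G)` this is `Int(G)`. -/
def CoInt (k : Type u) [Field k] (H : Type v) [CommRing H] [HopfAlgebra k H] :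
    Subgroup (H ≃ₐc[k] H) where
  carrier := {f | ∃ x : (Dual1 k H)ˣ, ∀ h : H, f h = Ad x h}
  one_mem' := ⟨1, fun h => by rw [Ad_one]; rfl⟩
  mul_mem' := by
    rintro f g ⟨x, hx⟩ ⟨y, hy⟩
    refine ⟨y * x, fun h => ?_⟩
    rw [← Ad_comp_Ad]
    change f (g h) = _
    rw [hx, hy]
    rfl
  inv_mem' := by
    rintro f ⟨x, hx⟩
    refine ⟨x⁻¹, fun h => ?_⟩
    apply f.toEquiv.injective
    change f (f.symm h) = f (Ad x⁻¹ h)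
    rw [hx (Ad x⁻¹ h)]
    have h1 := LinearMap.congr_fun (Ad_comp_Ad x x⁻¹) h
    rw [inv_mul_cancel, Ad_one] at h1
    exact (f.toEquiv.apply_symm_apply h).trans h1.symm

/-- A point `g` of `G(k)`, i.e. an algebra homomorphism `H → k`, as an invertible element of `H*`.
These are the grouplike elements of `H*`. -/
def pointUnit : WithConv (H →ₐ[k] k) →* (Dual1 k H)ˣ :=
  MonoidHom.toHomUnits
    { toFun := fun g => toConv g.ofConv.toLinearMap
      map_one' := rfl
      map_mul' := fun _ _ => rfl }

/-- The group `CoInn(H)` of coinner automorphisms: the maps `Ad(g)` with `g` a point of `G(k)`.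
For `H = O(G)` this is `Inn(G)`. -/
def CoInn (k : Type u) [Field k] (H : Type v) [CommRing H] [HopfAlgebra k H] :
    Subgroup (H ≃ₐc[k] H) where
  carrier := {f | ∃ g : WithConv (H →ₐ[k] k), ∀ h : H, f h = Ad (pointUnit g) h}
  one_mem' := ⟨1, fun h => by rw [map_one, Ad_one]; rfl⟩
  mul_mem' := by
    rintro f g ⟨x, hx⟩ ⟨y, hy⟩
    refine ⟨y * x, fun h => ?_⟩
    rw [map_mul, ← Ad_comp_Ad]
    change f (g h) = _
    rw [hx, hy]
    rfl
  inv_mem' := by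
    rintro f ⟨x, hx⟩
    refine ⟨x⁻¹, fun h => ?_⟩
    apply f.toEquiv.injective
    change f (f.symm h) = f (Ad (pointUnit x⁻¹) h)
    rw [hx (Ad (pointUnit x⁻¹) h), map_inv]
    have h1 := LinearMap.congr_fun (Ad_comp_Ad (pointUnit x) (pointUnit x)⁻¹) h
    rw [inv_mul_cancel, Ad_one] at h1
    exact (f.toEquiv.apply_symm_apply h).trans h1.symm

instance : (CoInn k H).Normal where
  conj_mem := by
    rintro f ⟨x, hx⟩ φ
    refine ⟨toConv (x.ofConv.comp ((φ⁻¹ : H ≃ₐc[k] H) : H →ₐ[k] H)), fun h => ?_⟩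
    have h1 : (φ.toCoalgEquiv : H →ₗ[k] H) ∘ₗ Ad (pointUnit x) ∘ₗ
        (φ⁻¹.toCoalgEquiv : H →ₗ[k] H) =
        Ad (pointUnit (toConv (x.ofConv.comp ((φ⁻¹ : H ≃ₐc[k] H) : H →ₐ[k] H)))) := by
      apply WithConv.toConv_injective
      rw [← LinearMap.comp_assoc]
      have h2 := congrArg (pull (φ⁻¹.toCoalgEquiv : H →ₗc[k] H) H)
        (comp_Ad (φ.toCoalgEquiv : H →ₗ[k] H) (pointUnit x))
      rw [map_mul, map_mul] at h2
      refine h2.trans ?_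
      have h3 : pull (φ⁻¹.toCoalgEquiv : H →ₗc[k] H) H
          (toConv (φ.toCoalgEquiv : H →ₗ[k] H)) = toConv LinearMap.id := by
        apply WithConv.ext
        ext a
        exact φ.toEquiv.apply_symm_apply a
      have h4 : pointUnit (toConv (x.ofConv.comp ((φ⁻¹ : H ≃ₐc[k] H) : H →ₐ[k] H))) =
          Units.map (pull (φ⁻¹.toCoalgEquiv : H →ₗc[k] H) k) (pointUnit x) := Units.ext rfl
      rw [h3, h4, Ad, ← map_inv]
      rfl
    have h2 := LinearMap.congr_fun h1 h
    rw [← h2]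
    change φ (f (φ⁻¹ h)) = φ (Ad (pointUnit x) (φ⁻¹ h))
    rw [hx]

/-- The group `CoInt(H) / CoInn(H)`, i.e. `Int(G) / Inn(G)`. -/
abbrev IntModInn (k : Type u) [Field k] (H : Type v) [CommRing H] [HopfAlgebra k H] : Type _ :=
  CoInt k H ⧸ (CoInn k H).subgroupOf (CoInt k H)

/-! ### Closed subgroups, supports and the set `𝓑(G)` -/

/-- Closed subgroups (closed subgroup schemes) of `G`, given by Hopf ideals of `H = O(G)`. -/
structure ClosedSubgroup (k : Type u) [Field k] (H : Type v) [CommRing H] [HopfAlgebra k H] where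
  ideal : Ideal H
  isHopfIdeal : ideal.IsHopfIdeal k

instance (A : ClosedSubgroup k H) : A.ideal.IsHopfIdeal k := A.isHopfIdeal

/-- The function algebra `O(A) = O(G) / I` of a closed subgroup. -/
abbrev ClosedSubgroup.Fun (A : ClosedSubgroup k H) : Type v := H ⧸ A.ideal

/-- The restriction map `O(G) → O(A)` on `O(G) ⊗ O(G)`. -/
def ClosedSubgroup.proj₂ (A : ClosedSubgroup k H) : H ⊗[k] H →ₗc[k] A.Fun ⊗[k] A.Fun :=
  Coalgebra.TensorProduct.map (Bialgebra.Quotient.mkBialgHom (R := k) A.ideal).toCoalgHom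
    (Bialgebra.Quotient.mkBialgHom (R := k) A.ideal).toCoalgHom

/-- The lift of a functional on `O(A) ⊗ O(A)` to `O(G) ⊗ O(G)`. -/
def ClosedSubgroup.lift (A : ClosedSubgroup k H) : (Dual2 k A.Fun)ˣ →* (Dual2 k H)ˣ :=
  Units.map (pull A.proj₂ k)

theorem ClosedSubgroup.lift_apply (A : ClosedSubgroup k H) (J : (Dual2 k A.Fun)ˣ) (a b : H) :
    (A.lift J).val (a ⊗ₜ b) =
      J.val (Ideal.Quotient.mk A.ideal a ⊗ₜ Ideal.Quotient.mk A.ideal b) := rfl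

/-- `A` is normal in `G`: for every commutative `k`-algebra `B`, the subgroup
`A(B) = {a : H → B | a(I) = 0}` of `G(B)` is stable under conjugation by every `g` in `G(B)`, the
inverse of `g` being `g ∘ S`. -/
def ClosedSubgroup.IsNormal (A : ClosedSubgroup k H) : Prop :=
  ∀ (B : Type v) [CommRing B] [Algebra k B] (g a : WithConv (H →ₐ[k] B)),
    (∀ h ∈ A.ideal, a h = 0) →
      ∀ h ∈ A.ideal,
        (g * a * toConv (g.ofConv.comp (HopfAlgebra.antipodeAlgHom k H))) h = 0

/-- `A` is commutative, i.e. `O(A)` is cocommutative. -/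
def ClosedSubgroup.IsCommutative (A : ClosedSubgroup k H) : Prop := Coalgebra.IsCocomm k A.Fun

/-- The functional `R` on `H ⊗ H` is `G`-invariant: it commutes with `g ⊗ g` for every point `g` of
`G` in a commutative `k`-algebra `B`; here `g ⊗ g : a ⊗ b ↦ g(a) g(b) = g(ab)`. -/
def IsGInvariant (R : (Dual2 k H)ˣ) : Prop :=
  ∀ (B : Type v) [CommRing B] [Algebra k B] (g : H →ₐ[k] B),
    Commute (scal B R.val) (toConv (g.toLinearMap ∘ₗ LinearMap.mul' k H))

/-- The right radical of `R` is zero. -/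
def IsNondegenerate (R : (Dual2 k H)ˣ) : Prop :=
  ∀ a : H, (∀ b : H, R.val (b ⊗ₜ a) = 0) → a = 0

/-- The axioms of a cotriangular structure `R` on `H`. -/
structure IsCotriangular (R : (Dual2 k H)ˣ) : Prop where
  /-- `∑ R(h₁, g₁) R(g₂, h₂) = ε(g) ε(h)` -/
  unitary : R * swap R = 1
  /-- `R(h, gl) = ∑ R(h₁, g) R(h₂, l)` -/
  mul_right : ∀ h g l : H, R.val (h ⊗ₜ (g * l)) =
    ((toConv (R.val.ofConv ∘ₗ (TensorProduct.mk k H H).flip g) *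
      toConv (R.val.ofConv ∘ₗ (TensorProduct.mk k H H).flip l) : Dual1 k H)) h
  /-- `R(hg, l) = ∑ R(g, l₁) R(h, l₂)` -/
  mul_left : ∀ h g l : H, R.val ((h * g) ⊗ₜ l) =
    ((toConv (R.val.ofConv ∘ₗ TensorProduct.mk k H H g) *
      toConv (R.val.ofConv ∘ₗ TensorProduct.mk k H H h) : Dual1 k H)) l
  /-- `∑ R(h₁, g₁) g₂h₂ = ∑ h₁g₁ R(h₂, g₂)` -/
  comm : scal H R.val * toConv (LinearMap.mul' k H ∘ₗ (TensorProduct.comm k H H).toLinearMap) =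
    toConv (LinearMap.mul' k H) * scal H R.val

/-- The Drinfeld element `u(h) = ∑ R(S(h₂), h₁)`. -/
def drinfeldElement (R : (Dual2 k H)ˣ) : Dual1 k H :=
  toConv (R.val.ofConv ∘ₗ TensorProduct.map (HopfAlgebra.antipode k) LinearMap.id ∘ₗ
    (TensorProduct.comm k H H).toLinearMap ∘ₗ Coalgebra.comul)

/-- `Supp(J)`: the set of closed subgroups `A` of `G` such that `J` is gauge equivalent to the lift
of a minimal Hopf 2-cocycle `K` for `A` (minimal: `K₂₁⁻¹ * K` is non-degenerate). -/
def Supp (J : (Dual2 k H)ˣ) : Set (ClosedSubgroup k H) :=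
  {A | ∃ K : (Dual2 k A.Fun)ˣ, IsHopf2Cocycle K ∧ IsNondegenerate (rMatrix K) ∧
    ∃ x : (Dual1 k H)ˣ, J = gauge x (A.lift K)}

/-- The set `𝓑(G)` of pairs `(A, R)` such that `A` is a commutative closed normal subgroup of `G`,
`(O(A), R)` is a minimal cotriangular Hopf algebra with trivial Drinfeld element, and `R` is
`G`-invariant. -/
structure BSet (k : Type u) [Field k] (H : Type v) [CommRing H] [HopfAlgebra k H] where
  A : ClosedSubgroup k H
  R : (Dual2 k A.Fun)ˣ
  commutative : A.IsCommutative
  normal : A.IsNormal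
  cotriangular : IsCotriangular R
  minimal : IsNondegenerate R
  drinfeld : drinfeldElement R = 1
  invariant : IsGInvariant (A.lift R)

theorem mk_eq_counit_smul {I : Ideal H} (hI : I = RingHom.ker (Bialgebra.counitAlgHom k H)) (x : H) :
    Ideal.Quotient.mk I x = Coalgebra.counit (R := k) x • (1 : H ⧸ I) := by
  have h : x - algebraMap k H (Coalgebra.counit (R := k) x) ∈ I := by
    rw [hI, RingHom.mem_ker]
    simp
  have h1 := Ideal.Quotient.eq.2 h
  rw [h1]
  change algebraMap k (H ⧸ I) _ = _
  rw [Algebra.algebraMap_eq_smul_one]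

theorem map_mk_comul {I : Ideal H} (hI : I = RingHom.ker (Bialgebra.counitAlgHom k H)) (x : H) :
    TensorProduct.map (Ideal.Quotient.mkₐ k I).toLinearMap (Ideal.Quotient.mkₐ k I).toLinearMap
      (Coalgebra.comul x) = Coalgebra.counit (R := k) x • ((1 : H ⧸ I) ⊗ₜ[k] (1 : H ⧸ I)) := by
  let r := Coalgebra.Repr.arbitrary k x
  have h1 : ∑ i ∈ r.index, Coalgebra.counit (R := k) (r.left i) * Coalgebra.counit (R := k)
      (r.right i) = Coalgebra.counit (R := k) x := by
    simpa [map_sum] using congrArg (Coalgebra.counit (R := k)) (Coalgebra.sum_counit_smul r)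
  rw [← r.eq, map_sum, ← h1, Finset.sum_smul]
  refine Finset.sum_congr rfl fun i _ => ?_
  change (Ideal.Quotient.mk I (r.left i)) ⊗ₜ[k] (Ideal.Quotient.mk I (r.right i)) = _
  rw [mk_eq_counit_smul hI, mk_eq_counit_smul hI, TensorProduct.smul_tmul_smul]

/-- The trivial subgroup `{1}` of `G`. -/
def trivialSubgroup (k : Type u) [Field k] (H : Type v) [CommRing H] [HopfAlgebra k H] :
    ClosedSubgroup k H where
  ideal := RingHom.ker (Bialgebra.counitAlgHom k H)
  isHopfIdeal :=
    { counit_eq_zero := fun x hx => hx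
      map_mkQ_comul_eq_zero := by
        intro x hx
        exact (map_mk_comul (k := k) (I := RingHom.ker (Bialgebra.counitAlgHom k H)) rfl x).trans
          (by rw [show Coalgebra.counit (R := k) x = 0 from hx, zero_smul]; rfl)
      antipode_mem := by
        intro x hx
        rw [RingHom.mem_ker] at hx ⊢
        change Coalgebra.counit (R := k) (HopfAlgebra.antipode k x) = 0
        rw [HopfAlgebra.counit_antipode]
        exact hx }

theorem isCotriangular_one [Coalgebra.IsCocomm k H] : IsCotriangular (1 : (Dual2 k H)ˣ) := by
  have hr (g : H) : toConv ((1 : Dual2 k H).ofConv ∘ₗ (TensorProduct.mk k H H).flip g) =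
      Coalgebra.counit (R := k) g • (1 : Dual1 k H) := by
    apply WithConv.ext
    ext a
    change (1 : Dual2 k H).ofConv (a ⊗ₜ g) =
      Coalgebra.counit (R := k) g * Coalgebra.counit (R := k) a
    simp [LinearMap.convOne_def]
  have hl (g : H) : toConv ((1 : Dual2 k H).ofConv ∘ₗ TensorProduct.mk k H H g) =
      Coalgebra.counit (R := k) g • (1 : Dual1 k H) := by
    apply WithConv.ext
    ext a
    change (1 : Dual2 k H).ofConv (g ⊗ₜ a) =
      Coalgebra.counit (R := k) g * Coalgebra.counit (R := k) a
    simp [LinearMap.convOne_def, mul_comm]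
  refine ⟨by simp, fun h g l => ?_, fun h g l => ?_, ?_⟩
  · rw [Units.val_one, hr, hr, smul_mul_smul_comm, mul_one]
    change (1 : Dual2 k H).ofConv (h ⊗ₜ (g * l)) =
      (Coalgebra.counit (R := k) g * Coalgebra.counit (R := k) l) * Coalgebra.counit (R := k) h
    simp [LinearMap.convOne_def]
  · rw [Units.val_one, hl, hl, smul_mul_smul_comm, mul_one]
    change (1 : Dual2 k H).ofConv ((h * g) ⊗ₜ l) =
      (Coalgebra.counit (R := k) g * Coalgebra.counit (R := k) h) * Coalgebra.counit (R := k) l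
    simp [LinearMap.convOne_def, mul_comm]
  · rw [Units.val_one, map_one, one_mul, mul_one]
    apply WithConv.ext
    ext a b
    exact mul_comm b a

/-- The element `e = ({1}, ε ⊗ ε)` of `𝓑(G)`. -/
def BSet.e (k : Type u) [Field k] (H : Type v) [CommRing H] [HopfAlgebra k H] : BSet k H :=
  have hc : Coalgebra.IsCocomm k (trivialSubgroup k H).Fun := by
    refine ⟨?_⟩
    apply LinearMap.ext
    intro a
    obtain ⟨x, rfl⟩ := Ideal.Quotient.mk_surjective a
    change TensorProduct.comm k _ _ (Coalgebra.comul (Ideal.Quotient.mk _ x)) =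
      Coalgebra.comul (Ideal.Quotient.mk _ x)
    rw [Bialgebra.Quotient.comul_mk, map_mk_comul (I := (trivialSubgroup k H).ideal) rfl]
    simp
  { A := trivialSubgroup k H
    R := 1
    commutative := hc
    normal := by
      intro B _ _ g a ha h hh
      have h1 : a = 1 := by
        apply WithConv.ext
        apply AlgHom.ext
        intro x
        have h2 := ha (x - algebraMap k H (Coalgebra.counit (R := k) x)) (by
          change Bialgebra.counitAlgHom k H _ = 0
          simp)
        have h3 : a.ofConv x = a.ofConv (algebraMap k H (Coalgebra.counit (R := k) x)) := by
          rw [← sub_eq_zero, ← map_sub]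
          exact h2
        rw [h3, AlgHom.commutes]
        rfl
      rw [h1, mul_one]
      have h4 := AlgHom.comp_convMul_distrib g.ofConv (toConv (AlgHom.id k H))
        (toConv (HopfAlgebra.antipodeAlgHom k H))
      have h5 : (toConv (AlgHom.id k H) * toConv (HopfAlgebra.antipodeAlgHom k H) :
          WithConv (H →ₐ[k] H)) = 1 := by
        apply WithConv.ext
        apply AlgHom.toLinearMap_injective
        exact congrArg WithConv.ofConv (LinearMap.id_mul_antipode (R := k) (C := H))
      rw [h5] at h4
      have h6 := congrArg (fun f : H →ₐ[k] B => f h) h4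
      refine h6.symm.trans ?_
      change g.ofConv (algebraMap k H (Coalgebra.counit (R := k) h)) = 0
      rw [show Coalgebra.counit (R := k) h = 0 from hh, map_zero, map_zero]
    cotriangular := isCotriangular_one
    minimal := by
      intro a ha
      obtain ⟨x, rfl⟩ := Ideal.Quotient.mk_surjective a
      have h := ha 1
      change (1 : Dual2 k (trivialSubgroup k H).Fun).ofConv _ = 0 at h
      simp [LinearMap.convOne_def] at h
      rw [Ideal.Quotient.eq_zero_iff_mem]
      exact h
    drinfeld := by
      apply WithConv.ext
      apply LinearMap.ext
      intro a
      obtain ⟨x, rfl⟩ := Ideal.Quotient.mk_surjective a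
      change (1 : Dual2 k (trivialSubgroup k H).Fun).ofConv (TensorProduct.map _ _
        (TensorProduct.comm k _ _ (Coalgebra.comul (Ideal.Quotient.mk _ x)))) =
          Coalgebra.counit (R := k) x
      rw [Bialgebra.Quotient.comul_mk, map_mk_comul (I := (trivialSubgroup k H).ideal) rfl]
      simp [LinearMap.convOne_def]
    invariant := by
      intro B _ _ g
      simp }

/-- `Θ` is given by `[J] ↦ (Supp(J), R^J)`: for every invariant Hopf 2-cocycle `J`, the subgroup
`A` of `Θ [J] = (A, R)` is the support of `J`, and `R^J` is (the lift of) `R`. -/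
def IsTheta (Θ : H2inv k H → BSet k H) : Prop :=
  ∀ J : Z2inv k H, Supp J.val = {(Θ (J : H2inv k H)).A} ∧
    (Θ (J : H2inv k H)).A.lift (Θ (J : H2inv k H)).R = rMatrix J.val

end Hopf

end

end InvCocycle

/-! # Invariant Hopf 2-cocycles of an affine algebraic group

All three assertions follow once it is known that the support of an invariant Hopf 2-cocycle `J`
consists of one subgroup, the radical of `R^J` (`supp_eq`).

As `J` is invariant, `R^J = J₂₁⁻¹ * J` is a cotriangular structure on `O(G)` itself, with its own
commutative product (`isCotriangular_rMatrix`). The elements that pair trivially with everything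
form a Hopf ideal, which defines a closed subgroup `A`. It is commutative because the functionals
`R^J(g, -)` separate the elements of `O(A)` and multiply in the same way in both orders, and normal
because `R^J` commutes with `m` (`IsCotriangular.radical_isCommutative`,
`IsCotriangular.radical_isNormal`).

The main step is that `J` is gauge equivalent to the lift of a Hopf 2-cocycle for `A`. In the
algebra `H_J`, the space `O(G)` with the product `a · b = ∑ a₁b₁ J(a₂, b₂)`, elements commute up to
`R' = J * J₂₁⁻¹` (`tw_mul_comm`). Since `R'` is the inverse of `R^{J⁻¹}`, it descends to the radical
of `R^{J⁻¹}`, which turns out to be `A`. Hence the functions on `G` that are constant on the cosets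
of `A` are central in `H_J`. There are enough of them: finitely many such functions, minus their
values at the identity, generate the ideal of `A` (`exists_quotient`). Such functions arise by
multiplying minors of matrix coefficients, which `A` moves by a character, with a function that `A`
moves by the inverse character (`exists_semiInvariant`). The latter exists because `A` is
commutative; its construction uses the Nullstellensatz and either Frobenius powers in positive
characteristic or Cartier's theorem in characteristic zero.

Dividing `H_J` by the ideal of a point of that central subalgebra yields an algebra `B` that is not
zero (`one_notMem_span`) and is a Galois object over `O(A)` (`exists_isGaloisObject`). Over an
algebraically closed field all simple comodules of the cocommutative Hopf algebra `O(A)` are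
one-dimensional, and this makes `B` isomorphic to `O(A)` as a comodule, that is, cleft
(`IsGaloisObject.exists_bijective`). Transporting the product of `B` to `O(A)` gives a Hopf
2-cocycle `K` for `A` and an `x` with `J` gauge equivalent to the lift of `K`
(`exists_lift_eq_gauge`). It is minimal, because over the commutative group `A` one has
`R^K = K * K₂₁⁻¹`, and `J * J₂₁⁻¹` is unchanged by gauge transformations. Comparison of ideals shows
that no other subgroup is in the support, and the Drinfeld element is trivial because the
restriction of `R^K` to the diagonal of a commutative group is (`drinfeldElement_eq_one`).

For the fibres of `Θ`, write `∂(x) = (ε ⊗ ε)^x`. It is invariant if and only if `Ad(x)` is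
multiplicative (`isInvariant_coboundary_iff`), and it is trivial if and only if `x` is a point of
`G` (`coboundary_eq_one_iff`); this gives the injection of `Int(G)/Inn(G)`. Finally, `Θ[J]`
amounts to `R^J`, and `R^J = R^{J'}` means that `J' * J⁻¹` is symmetric. A symmetric invariant
cocycle has the trivial group as its support, hence is some `∂(x)` (`exists_eq_coboundary`), so
that the fibres are the cosets of the image of `Int(G)/Inn(G)` (`mem_fiber_iff`). -/

open TensorProduct WithConv

namespace InvCocycle

noncomputable section

universe u v

/-! ### Contractions of tensors and local finiteness -/

section Contraction

variable {k : Type*} [Field k] {V W : Type*} [AddCommGroup V] [Module k V]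
  [AddCommGroup W] [Module k W]

/-- `v ⊗ w ↦ f(v) w`. -/
def contractL (f : V →ₗ[k] k) : V ⊗[k] W →ₗ[k] W :=
  (TensorProduct.lid k W).toLinearMap ∘ₗ LinearMap.rTensor W f

/-- `v ⊗ w ↦ g(w) v`. -/
def contractR (g : W →ₗ[k] k) : V ⊗[k] W →ₗ[k] V :=
  (TensorProduct.rid k V).toLinearMap ∘ₗ LinearMap.lTensor V g

@[simp] theorem contractL_tmul (f : V →ₗ[k] k) (v : V) (w : W) :
    contractL f (v ⊗ₜ[k] w) = f v • w := by simp [contractL]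

@[simp] theorem contractR_tmul (g : W →ₗ[k] k) (v : V) (w : W) :
    contractR g (v ⊗ₜ[k] w) = g w • v := by simp [contractR]

/-- Contractions separate the elements of a tensor product over a field. -/
theorem eq_zero_of_contractL {t : V ⊗[k] W} (h : ∀ f : V →ₗ[k] k, contractL f t = 0) : t = 0 := by
  classical
  let b := Module.Basis.ofVectorSpace k V
  apply (TensorProduct.equivFinsuppOfBasisLeft (N := W) b).injective
  ext i
  have h1 := h (b.coord i)
  rw [map_zero, Finsupp.zero_apply, ← h1]
  clear h h1
  induction t with
  | zero => simp
  | add x y hx hy => simp [hx, hy]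
  | tmul v w => simp

theorem eq_zero_of_contractR {t : V ⊗[k] W} (h : ∀ f : W →ₗ[k] k, contractR f t = 0) : t = 0 := by
  apply (TensorProduct.comm k V W).injective
  rw [map_zero]
  refine eq_zero_of_contractL fun f => ?_
  rw [← h f]
  clear h
  induction t with
  | zero => simp
  | add x y hx hy => simp [hx, hy]
  | tmul v w => simp

theorem contractL_lTensor {X : Type*} [AddCommGroup X] [Module k X] (f : V →ₗ[k] k)
    (L : W →ₗ[k] X) (t : V ⊗[k] W) :
    contractL f (LinearMap.lTensor V L t) = L (contractL f t) := by
  induction t with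
  | zero => simp
  | add x y hx hy => simp [hx, hy]
  | tmul v w => simp

theorem contractR_rTensor {X : Type*} [AddCommGroup X] [Module k X] (f : W →ₗ[k] k)
    (L : V →ₗ[k] X) (t : V ⊗[k] W) :
    contractR f (LinearMap.rTensor W L t) = L (contractR f t) := by
  induction t with
  | zero => simp
  | add x y hx hy => simp [hx, hy]
  | tmul v w => simp

theorem mem_range_lTensor {U : Submodule k W} {t : V ⊗[k] W}
    (h : ∀ f : V →ₗ[k] k, contractL f t ∈ U) :
    t ∈ LinearMap.range (LinearMap.lTensor V U.subtype) := by
  have hex := lTensor_exact V (f := U.subtype) (g := U.mkQ)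
    (by rw [LinearMap.exact_iff]; simp) U.mkQ_surjective
  rw [LinearMap.exact_iff] at hex
  rw [← hex, LinearMap.mem_ker]
  refine eq_zero_of_contractL fun f => ?_
  rw [contractL_lTensor, Submodule.mkQ_apply, Submodule.Quotient.mk_eq_zero]
  exact h f

/-- A tensor lies in `U ⊗ U'` as soon as its contractions on both sides do. -/
theorem mem_range_map {U : Submodule k V} {U' : Submodule k W} {t : V ⊗[k] W}
    (h : ∀ f : V →ₗ[k] k, contractL f t ∈ U') (h' : ∀ g : W →ₗ[k] k, contractR g t ∈ U) :
    t ∈ LinearMap.range (TensorProduct.map U.subtype U'.subtype) := by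
  obtain ⟨s, rfl⟩ := mem_range_lTensor h
  have hs : s ∈ LinearMap.range (LinearMap.rTensor U' U.subtype) := by
    have hex := rTensor_exact U' (f := U.subtype) (g := U.mkQ)
      (by rw [LinearMap.exact_iff]; simp) U.mkQ_surjective
    rw [LinearMap.exact_iff] at hex
    rw [← hex, LinearMap.mem_ker]
    refine eq_zero_of_contractR fun f => ?_
    obtain ⟨g, rfl⟩ := LinearMap.exists_extend f
    rw [contractR_rTensor, Submodule.mkQ_apply, Submodule.Quotient.mk_eq_zero]
    convert h' g using 1
    clear h h'
    induction s with
    | zero => simp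
    | add x y hx hy => simp [hx, hy]
    | tmul v w => simp
  obtain ⟨r, rfl⟩ := hs
  refine ⟨r, ?_⟩
  rw [← LinearMap.comp_apply, LinearMap.lTensor_comp_rTensor]

/-- The contractions of a tensor span a finite-dimensional space. -/
theorem exists_finite_contractL (t : V ⊗[k] W) :
    ∃ U : Submodule k W, FiniteDimensional k U ∧ ∀ f : V →ₗ[k] k, contractL f t ∈ U := by
  induction t with
  | zero => exact ⟨⊥, inferInstance, fun f => by simp⟩
  | add x y hx hy =>
    obtain ⟨U, hU, h⟩ := hx
    obtain ⟨U', hU', h'⟩ := hy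
    refine ⟨U ⊔ U', inferInstance, fun f => ?_⟩
    rw [map_add]
    exact Submodule.add_mem_sup (h f) (h' f)
  | tmul v w =>
    refine ⟨k ∙ w, inferInstance, fun f => ?_⟩
    rw [contractL_tmul]
    exact Submodule.smul_mem _ _ (Submodule.mem_span_singleton_self w)

theorem exists_finite_contractR (t : V ⊗[k] W) :
    ∃ U : Submodule k V, FiniteDimensional k U ∧ ∀ f : W →ₗ[k] k, contractR f t ∈ U := by
  induction t with
  | zero => exact ⟨⊥, inferInstance, fun f => by simp⟩
  | add x y hx hy =>
    obtain ⟨U, hU, h⟩ := hx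
    obtain ⟨U', hU', h'⟩ := hy
    refine ⟨U ⊔ U', inferInstance, fun f => ?_⟩
    rw [map_add]
    exact Submodule.add_mem_sup (h f) (h' f)
  | tmul v w =>
    refine ⟨k ∙ v, inferInstance, fun f => ?_⟩
    rw [contractR_tmul]
    exact Submodule.smul_mem _ _ (Submodule.mem_span_singleton_self v)

end Contraction

section Finiteness

variable {k : Type*} [Field k] {C : Type*} [AddCommGroup C] [Module k C] [Coalgebra k C]
  {M : Type*} [AddCommGroup M] [Module k M]

/-- Contracting a coaction by `g` and then by `f` is contracting it once by the convolution product
`g * f`. -/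
theorem contractL_comul_comp (f g : C →ₗ[k] k) (ρ : M →ₗ[k] C ⊗[k] M)
    (hρ : LinearMap.lTensor C ρ ∘ₗ ρ =
      (TensorProduct.assoc k C C M).toLinearMap ∘ₗ LinearMap.rTensor M Coalgebra.comul ∘ₗ ρ)
    (m : M) :
    contractL f (ρ (contractL g (ρ m))) = contractL ((toConv g * toConv f).ofConv) (ρ m) := by
  have h := congrArg (fun t => contractL f (contractL g t)) (LinearMap.congr_fun hρ m)
  simp only [LinearMap.comp_apply, contractL_lTensor] at h
  rw [h]
  generalize ρ m = t
  induction t with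
  | zero => simp
  | add x y hx hy => simp only [map_add, hx, hy]
  | tmul c m =>
    have key : ∀ s : C ⊗[k] C, contractL f (contractL g (TensorProduct.assoc k C C M (s ⊗ₜ m))) =
        (LinearMap.mul' k k (TensorProduct.map g f s)) • m := by
      intro s
      induction s with
      | zero => simp
      | add x y hx hy => simp only [map_add, TensorProduct.add_tmul, hx, hy, add_smul]
      | tmul a b => simp [smul_smul]
    simpa using key (Coalgebra.comul c)

/-- Local finiteness of comodules: every element of a left comodule lies in a finite-dimensional
subspace which is stable under all contractions of the coaction. -/
theorem exists_finite_subcomodule (ρ : M →ₗ[k] C ⊗[k] M)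
    (hρ : LinearMap.lTensor C ρ ∘ₗ ρ =
      (TensorProduct.assoc k C C M).toLinearMap ∘ₗ LinearMap.rTensor M Coalgebra.comul ∘ₗ ρ)
    (hε : ∀ m, contractL Coalgebra.counit (ρ m) = m) (m : M) :
    ∃ U : Submodule k M, FiniteDimensional k U ∧ m ∈ U ∧
      ∀ n ∈ U, ∀ f : C →ₗ[k] k, contractL f (ρ n) ∈ U := by
  let L : (C →ₗ[k] k) →ₗ[k] M :=
    { toFun := fun f => contractL f (ρ m)
      map_add' := fun f g => by simp [contractL, LinearMap.rTensor_add]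
      map_smul' := fun c f => by simp [contractL, LinearMap.rTensor_smul] }
  obtain ⟨U, hU, h⟩ := exists_finite_contractL (ρ m)
  have hle : LinearMap.range L ≤ U := by
    rintro _ ⟨f, rfl⟩
    exact h f
  refine ⟨LinearMap.range L, Submodule.finiteDimensional_of_le hle, ⟨Coalgebra.counit, hε m⟩, ?_⟩
  rintro _ ⟨g, rfl⟩ f
  exact ⟨(toConv g * toConv f).ofConv, (contractL_comul_comp f g ρ hρ m).symm⟩

theorem lTensor_comul_comp_comul : LinearMap.lTensor C (Coalgebra.comul (R := k)) ∘ₗ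
    (Coalgebra.comul : C →ₗ[k] C ⊗[k] C) = (TensorProduct.assoc k C C C).toLinearMap ∘ₗ
      LinearMap.rTensor C Coalgebra.comul ∘ₗ Coalgebra.comul := by
  rw [Coalgebra.coassoc]

theorem contractL_counit_comul (c : C) :
    contractL Coalgebra.counit (Coalgebra.comul (R := k) c) = c := by
  rw [contractL, LinearMap.comp_apply, Coalgebra.rTensor_counit_comul]
  simp

theorem contractR_counit_comul (c : C) :
    contractR Coalgebra.counit (Coalgebra.comul (R := k) c) = c := by
  rw [contractR, LinearMap.comp_apply, Coalgebra.lTensor_counit_comul]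
  simp

/-- Contracting the coproduct on the right by `g` and then by `f` is contracting it once by `f * g`.
-/
theorem contractR_comul_contractR (f g : C →ₗ[k] k) (c : C) :
    contractR f (Coalgebra.comul (contractR g (Coalgebra.comul (R := k) c))) =
      contractR ((toConv f * toConv g).ofConv) (Coalgebra.comul (R := k) c) := by
  have h := congrArg (fun t => contractR f (contractR g t))
    (Coalgebra.coassoc_symm_apply (R := k) c)
  have e1 : ∀ t : C ⊗[k] C, contractR g ((TensorProduct.assoc k C C C).symm
      (LinearMap.lTensor C Coalgebra.comul t)) =
      LinearMap.lTensor C (contractR g ∘ₗ Coalgebra.comul) t := by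
    intro t
    induction t with
    | zero => simp
    | add x y hx hy => simp only [map_add, hx, hy]
    | tmul a b =>
      simp only [LinearMap.lTensor_tmul, LinearMap.comp_apply]
      generalize Coalgebra.comul (R := k) b = s
      induction s with
      | zero => simp
      | add x y hx hy => simp only [map_add, TensorProduct.tmul_add, hx, hy]
      | tmul a b => simp
  have e2 : ∀ t : C ⊗[k] C, contractR f (LinearMap.lTensor C (contractR g ∘ₗ Coalgebra.comul) t) =
      contractR ((toConv f * toConv g).ofConv) t := by
    intro t
    induction t with
    | zero => simp
    | add x y hx hy => simp only [map_add, hx, hy]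
    | tmul a b =>
      simp only [LinearMap.lTensor_tmul, contractR_tmul, LinearMap.comp_apply]
      congr 1
      change _ = LinearMap.mul' k k (TensorProduct.map f g (Coalgebra.comul b))
      generalize Coalgebra.comul (R := k) b = s
      induction s with
      | zero => simp
      | add x y hx hy => simp only [map_add, hx, hy]
      | tmul a b => simp [mul_comm]
  simp only [e1, e2] at h
  rw [h]
  rw [contractR_rTensor]

/-- Every element of a coalgebra lies in a finite-dimensional subspace stable under
`c ↦ ∑ f(c₂) c₁` for all functionals `f`. -/
theorem exists_finite_contractR_stable (c : C) :
    ∃ U : Submodule k C, FiniteDimensional k U ∧ c ∈ U ∧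
      ∀ d ∈ U, ∀ f : C →ₗ[k] k, contractR f (Coalgebra.comul d) ∈ U := by
  let L : (C →ₗ[k] k) →ₗ[k] C :=
    { toFun := fun f => contractR f (Coalgebra.comul c)
      map_add' := fun f g => by simp [contractR, LinearMap.lTensor_add]
      map_smul' := fun a f => by simp [contractR, LinearMap.lTensor_smul] }
  obtain ⟨U, hU, h⟩ := exists_finite_contractR (Coalgebra.comul (R := k) c)
  have hle : LinearMap.range L ≤ U := by
    rintro _ ⟨f, rfl⟩
    exact h f
  refine ⟨LinearMap.range L, Submodule.finiteDimensional_of_le hle,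
    ⟨Coalgebra.counit, contractR_counit_comul c⟩, ?_⟩
  rintro _ ⟨g, rfl⟩ f
  exact ⟨(toConv f * toConv g).ofConv, (contractR_comul_contractR f g c).symm⟩

end Finiteness

/-! ### Invertibility of functionals -/

section Units

variable {k : Type*} [Field k] {C : Type*} [AddCommGroup C] [Module k C] [Coalgebra k C]
  {D : Type*} [AddCommGroup D] [Module k D] [Coalgebra k D]

/-- The left action `c ↦ ∑ f(c₂) c₁` of a functional on its coalgebra. -/
def rAct (f : WithConv (C →ₗ[k] k)) : C →ₗ[k] C := contractR f.ofConv ∘ₗ Coalgebra.comul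

theorem rAct_apply (f : WithConv (C →ₗ[k] k)) (c : C) :
    rAct f c = contractR f.ofConv (Coalgebra.comul c) := rfl

theorem rAct_rAct (f g : WithConv (C →ₗ[k] k)) (c : C) : rAct f (rAct g c) = rAct (f * g) c :=
  contractR_comul_contractR _ _ c

theorem rAct_one (c : C) : rAct (1 : WithConv (C →ₗ[k] k)) c = c := contractR_counit_comul c

theorem apply_rAct (f g : WithConv (C →ₗ[k] k)) (c : C) : g (rAct f c) = (g * f) c := by
  change g.ofConv (contractR f.ofConv (Coalgebra.comul c)) =
    LinearMap.mul' k k (TensorProduct.map g.ofConv f.ofConv (Coalgebra.comul c))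
  generalize Coalgebra.comul (R := k) c = t
  induction t with
  | zero => simp
  | add x y hx hy => simp only [map_add, hx, hy]
  | tmul a b => simp [mul_comm]

theorem rAct_injective_left : Function.Injective (rAct : WithConv (C →ₗ[k] k) → _) := by
  intro f g h
  ext c
  have h1 := congrArg (fun L => (1 : WithConv (C →ₗ[k] k)) (L c)) h
  simp only [apply_rAct, one_mul] at h1
  exact h1

/-- A functional whose action on the coalgebra is injective is invertible: by local finiteness the
action is then bijective. -/
theorem isUnit_of_rAct_injective {f : WithConv (C →ₗ[k] k)}
    (hf : ∀ c, rAct f c = 0 → c = 0) : IsUnit f := by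
  have hinj : Function.Injective (rAct f) := by
    rw [injective_iff_map_eq_zero]
    exact hf
  have hsurj : Function.Surjective (rAct f) := by
    intro c
    obtain ⟨U, hU, hc, hst⟩ := exists_finite_contractR_stable (k := k) c
    have h1 : Function.Injective ((rAct f).restrict fun d hd => hst d hd f.ofConv) := by
      intro x y hxy
      apply Subtype.ext
      apply hinj
      exact congrArg Subtype.val hxy
    obtain ⟨x, hx⟩ := LinearMap.injective_iff_surjective.1 h1 ⟨c, hc⟩
    exact ⟨x, congrArg Subtype.val hx⟩
  let e := LinearEquiv.ofBijective (rAct f) ⟨hinj, hsurj⟩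
  let g : WithConv (C →ₗ[k] k) := toConv (Coalgebra.counit ∘ₗ e.symm.toLinearMap)
  have hgf : g * f = 1 := by
    ext c
    rw [← apply_rAct]
    change Coalgebra.counit (R := k) (e.symm (e c)) = _
    rw [e.symm_apply_apply]
    rfl
  have hfg : f * g = 1 := by
    apply rAct_injective_left
    apply LinearMap.ext
    intro c
    obtain ⟨d, rfl⟩ := hsurj c
    rw [← rAct_rAct, rAct_rAct g, hgf, rAct_one, rAct_one]
  exact ⟨⟨f, g, hfg, hgf⟩, rfl⟩

theorem rAct_pull (π : C →ₗc[k] D) (f : WithConv (D →ₗ[k] k)) (c : C) :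
    π (rAct (pull π k f) c) = rAct f (π c) := by
  have h := LinearMap.congr_fun π.map_comp_comul c
  rw [rAct_apply, rAct_apply]
  change π.toLinearMap (contractR (f.ofConv ∘ₗ π.toLinearMap) _) =
    contractR f.ofConv (Coalgebra.comul (π.toLinearMap c))
  rw [LinearMap.comp_apply, LinearMap.comp_apply] at h
  rw [← h]
  generalize Coalgebra.comul (R := k) c = t
  induction t with
  | zero => simp
  | add x y hx hy => simp only [map_add, hx, hy]
  | tmul a b => simp

theorem pull_injective {π : C →ₗc[k] D} (hπ : Function.Surjective π) (B : Type*) [Ring B]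
    [Algebra k B] : Function.Injective (pull π B) := by
  intro f g h
  ext d
  obtain ⟨c, rfl⟩ := hπ d
  exact congrArg (fun F : WithConv (C →ₗ[k] B) => F c) h

/-- Restriction to a closed subgroup reflects invertibility of functionals. -/
theorem isUnit_of_isUnit_pull {π : C →ₗc[k] D} (hπ : Function.Surjective π)
    {f : WithConv (D →ₗ[k] k)} (hf : IsUnit (pull π k f)) : IsUnit f := by
  obtain ⟨F, hF⟩ := hf
  apply isUnit_of_rAct_injective
  intro d hd
  obtain ⟨c, rfl⟩ := hπ d
  obtain ⟨U, hU, hc, hst⟩ := exists_finite_contractR_stable (k := k) c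
  -- the action of `f` is onto on the image of `U`, hence injective there
  have hmap : ∀ x ∈ U.map π.toLinearMap, rAct f x ∈ U.map π.toLinearMap := by
    rintro _ ⟨x, hx, rfl⟩
    exact ⟨_, hst x hx (pull π k f).ofConv, rAct_pull π f x⟩
  have hsurj : Function.Surjective ((rAct f).restrict hmap) := by
    rintro ⟨_, x, hx, rfl⟩
    refine ⟨⟨π.toLinearMap (rAct F⁻¹.val x), _, hst x hx _, rfl⟩, ?_⟩
    apply Subtype.ext
    change rAct f (π (rAct F⁻¹.val x)) = π x
    rw [← rAct_pull, ← hF, rAct_rAct, Units.mul_inv, rAct_one]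
  have hinj := LinearMap.injective_iff_surjective.2 hsurj
  have h0 : (⟨π.toLinearMap c, c, hc, rfl⟩ : U.map π.toLinearMap) = 0 := by
    apply hinj
    rw [map_zero]
    apply Subtype.ext
    exact hd
  exact congrArg Subtype.val h0

end Units

/-! ### Sweedler sums and projections -/

section Sweedler

variable {k : Type*} [Field k] {V W : Type*} [AddCommGroup V] [Module k V] [Coalgebra k V]
  [AddCommGroup W] [Module k W] [Coalgebra k W] {B : Type*} [Ring B] [Algebra k B]

theorem comul_tmul_eq_sum {ι κ : Type*} {v : V} {w : W} (r : Coalgebra.Repr k v ι)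
    (s : Coalgebra.Repr k w κ) : Coalgebra.comul (R := k) (v ⊗ₜ[k] w) =
      ∑ i ∈ r.index, ∑ j ∈ s.index,
        (r.left i ⊗ₜ[k] s.left j) ⊗ₜ[k] (r.right i ⊗ₜ[k] s.right j) := by
  rw [TensorProduct.comul_tmul, ← r.eq, ← s.eq, TensorProduct.sum_tmul, map_sum]
  refine Finset.sum_congr rfl fun i _ => ?_
  rw [TensorProduct.tmul_sum, map_sum]
  rfl

theorem conv_tmul {ι κ : Type*} {v : V} {w : W} (r : Coalgebra.Repr k v ι)
    (s : Coalgebra.Repr k w κ) (F G : WithConv (V ⊗[k] W →ₗ[k] B)) :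
    (F * G) (v ⊗ₜ[k] w) = ∑ i ∈ r.index, ∑ j ∈ s.index,
      F (r.left i ⊗ₜ[k] s.left j) * G (r.right i ⊗ₜ[k] s.right j) := by
  rw [LinearMap.convMul_apply, comul_tmul_eq_sum r s]
  simp

theorem sum_counit_smul_right {ι : Type*} {v : V} (r : Coalgebra.Repr k v ι) :
    ∑ i ∈ r.index, Coalgebra.counit (R := k) (r.right i) • r.left i = v := by
  have h := contractR_counit_comul (k := k) v
  rw [← r.eq, map_sum] at h
  simpa using h

end Sweedler

section Projections

variable (k : Type u) [Field k] (H : Type v) [CommRing H] [HopfAlgebra k H]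

/-- `a ⊗ b ↦ ε(b) a`. -/
def p₁ : H ⊗[k] H →ₗc[k] H :=
  (Coalgebra.TensorProduct.rid k k H : H ⊗[k] k →ₗc[k] H).comp
    (Coalgebra.TensorProduct.map (CoalgHom.id k H) (Coalgebra.counitCoalgHom k H))

theorem p₁_apply (a b : H) : p₁ k H (a ⊗ₜ b) = Coalgebra.counit (R := k) b • a := rfl

variable {k H} {B : Type*} [Ring B] [Algebra k B]

theorem pull_p₂_mul {ι : Type*} {b : H} (s : Coalgebra.Repr k b ι) (a : H)
    (f : WithConv (H →ₗ[k] B)) (F : WithConv (H ⊗[k] H →ₗ[k] B)) :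
    (pull (p₂ k H) B f * F) (a ⊗ₜ b) = ∑ j ∈ s.index, f (s.left j) * F (a ⊗ₜ s.right j) := by
  rw [conv_tmul (Coalgebra.Repr.arbitrary k a) s, Finset.sum_comm]
  refine Finset.sum_congr rfl fun j _ => ?_
  conv_rhs => rw [← Coalgebra.sum_counit_smul (Coalgebra.Repr.arbitrary k a)]
  rw [TensorProduct.sum_tmul]
  change _ = _ * F.ofConv _
  rw [map_sum, Finset.mul_sum]
  refine Finset.sum_congr rfl fun i _ => ?_
  change f.ofConv (Coalgebra.counit (R := k) _ • _) * F.ofConv _ = f.ofConv _ * F.ofConv _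
  rw [← TensorProduct.smul_tmul', map_smul, map_smul, smul_mul_assoc, mul_smul_comm]
  rfl

theorem mul_pull_p₂ {ι : Type*} {b : H} (s : Coalgebra.Repr k b ι) (a : H)
    (f : WithConv (H →ₗ[k] B)) (F : WithConv (H ⊗[k] H →ₗ[k] B)) :
    (F * pull (p₂ k H) B f) (a ⊗ₜ b) = ∑ j ∈ s.index, F (a ⊗ₜ s.left j) * f (s.right j) := by
  rw [conv_tmul (Coalgebra.Repr.arbitrary k a) s, Finset.sum_comm]
  refine Finset.sum_congr rfl fun j _ => ?_
  conv_rhs => rw [← sum_counit_smul_right (Coalgebra.Repr.arbitrary k a)]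
  rw [TensorProduct.sum_tmul]
  change _ = F.ofConv _ * _
  rw [map_sum, Finset.sum_mul]
  refine Finset.sum_congr rfl fun i _ => ?_
  change F.ofConv _ * f.ofConv (Coalgebra.counit (R := k) _ • _) = F.ofConv _ * f.ofConv _
  rw [← TensorProduct.smul_tmul', map_smul, map_smul, smul_mul_assoc, mul_smul_comm]
  rfl

theorem pull_p₁_mul {ι : Type*} {a : H} (s : Coalgebra.Repr k a ι) (b : H)
    (f : WithConv (H →ₗ[k] B)) (F : WithConv (H ⊗[k] H →ₗ[k] B)) :
    (pull (p₁ k H) B f * F) (a ⊗ₜ b) = ∑ j ∈ s.index, f (s.left j) * F (s.right j ⊗ₜ b) := by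
  rw [conv_tmul s (Coalgebra.Repr.arbitrary k b)]
  refine Finset.sum_congr rfl fun j _ => ?_
  conv_rhs => rw [← Coalgebra.sum_counit_smul (Coalgebra.Repr.arbitrary k b)]
  rw [TensorProduct.tmul_sum]
  change _ = _ * F.ofConv _
  rw [map_sum, Finset.mul_sum]
  refine Finset.sum_congr rfl fun i _ => ?_
  change f.ofConv (Coalgebra.counit (R := k) _ • _) * F.ofConv _ = f.ofConv _ * F.ofConv _
  rw [TensorProduct.tmul_smul, map_smul, map_smul, smul_mul_assoc, mul_smul_comm]
  rfl

theorem mul_pull_p₁ {ι : Type*} {a : H} (s : Coalgebra.Repr k a ι) (b : H)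
    (f : WithConv (H →ₗ[k] B)) (F : WithConv (H ⊗[k] H →ₗ[k] B)) :
    (F * pull (p₁ k H) B f) (a ⊗ₜ b) = ∑ j ∈ s.index, F (s.left j ⊗ₜ b) * f (s.right j) := by
  rw [conv_tmul s (Coalgebra.Repr.arbitrary k b)]
  refine Finset.sum_congr rfl fun j _ => ?_
  conv_rhs => rw [← sum_counit_smul_right (Coalgebra.Repr.arbitrary k b)]
  rw [TensorProduct.tmul_sum]
  change _ = F.ofConv _ * _
  rw [map_sum, Finset.sum_mul]
  refine Finset.sum_congr rfl fun i _ => ?_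
  change F.ofConv _ * f.ofConv (Coalgebra.counit (R := k) _ • _) = F.ofConv _ * f.ofConv _
  rw [TensorProduct.tmul_smul, map_smul, map_smul, smul_mul_assoc, mul_smul_comm]
  rfl

/-- The multiplication of `H` is the convolution product of the two projections. -/
theorem mulConv_eq : (mulConv : WithConv (H ⊗[k] H →ₗ[k] H)) =
    pull (p₁ k H) H (toConv LinearMap.id) * pull (p₂ k H) H (toConv LinearMap.id) := by
  apply WithConv.ext
  ext a b
  change a * b = (pull (p₁ k H) H (toConv LinearMap.id) *
    pull (p₂ k H) H (toConv LinearMap.id)) (a ⊗ₜ b)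
  rw [mul_pull_p₂ (Coalgebra.Repr.arbitrary k b)]
  conv_lhs => rw [← Coalgebra.sum_counit_smul (Coalgebra.Repr.arbitrary k b)]
  rw [Finset.mul_sum]
  refine Finset.sum_congr rfl fun j _ => ?_
  change a * (Coalgebra.counit _ • _) = (Coalgebra.counit (R := k) _ • a) * _
  simp

/-- `f ⊗ g` is the convolution product of the pull-backs along the two projections. -/
theorem outer_eq (f g : Dual1 k H) :
    outer f g = pull (p₁ k H) k f * pull (p₂ k H) k g := by
  apply WithConv.ext
  ext a b
  change f.ofConv a * g.ofConv b = (pull (p₁ k H) k f * pull (p₂ k H) k g) (a ⊗ₜ b)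
  rw [mul_pull_p₂ (Coalgebra.Repr.arbitrary k b)]
  conv_lhs => rw [← Coalgebra.sum_counit_smul (Coalgebra.Repr.arbitrary k b)]
  rw [map_sum, Finset.mul_sum]
  refine Finset.sum_congr rfl fun j _ => ?_
  change f.ofConv a * g.ofConv (_ • _) = f.ofConv (Coalgebra.counit (R := k) _ • a) * g.ofConv _
  simp only [map_smul, smul_eq_mul]
  ring

end Projections

/-! ### The cotriangular structure of an invariant cocycle -/

section Triple

variable (k : Type u) [Field k] (H : Type v) [CommRing H] [HopfAlgebra k H]

/-- `(a ⊗ b) ⊗ c ↦ (b ⊗ a) ⊗ c`. -/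
def s₁₂ : (H ⊗[k] H) ⊗[k] H →ₗc[k] (H ⊗[k] H) ⊗[k] H :=
  Coalgebra.TensorProduct.map (flipHom k H) (CoalgHom.id k H)

/-- `(a ⊗ b) ⊗ c ↦ (b ⊗ c) ⊗ a`. -/
def cyc : (H ⊗[k] H) ⊗[k] H →ₗc[k] (H ⊗[k] H) ⊗[k] H :=
  (Bialgebra.TensorProduct.comm k H (H ⊗[k] H) : H ⊗[k] (H ⊗[k] H) →ₗc[k] (H ⊗[k] H) ⊗[k] H).comp
    (Coalgebra.TensorProduct.assoc k k H H H : (H ⊗[k] H) ⊗[k] H →ₗc[k] H ⊗[k] (H ⊗[k] H))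

/-- `(a ⊗ b) ⊗ c ↦ ε(b) a ⊗ c`. -/
def q₁₃ : (H ⊗[k] H) ⊗[k] H →ₗc[k] H ⊗[k] H := (q₄ k H).comp (s₁₂ k H)

/-- The pull-back of an invertible functional along a coalgebra map. -/
abbrev upull {k : Type*} [Field k] {C D : Type*} [AddCommGroup C] [Module k C] [Coalgebra k C]
    [AddCommGroup D] [Module k D] [Coalgebra k D] (φ : C →ₗc[k] D) :
    (WithConv (D →ₗ[k] k))ˣ →* (WithConv (C →ₗ[k] k))ˣ := Units.map (pull φ k)

theorem upull_comp {k : Type*} [Field k] {C D E : Type*} [AddCommGroup C] [Module k C]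
    [Coalgebra k C] [AddCommGroup D] [Module k D] [Coalgebra k D] [AddCommGroup E] [Module k E]
    [Coalgebra k E] (φ : C →ₗc[k] D) (ψ : D →ₗc[k] E) (F : (WithConv (E →ₗ[k] k))ˣ) :
    upull φ (upull ψ F) = upull (ψ.comp φ) F := rfl

variable {k H}

/-- Pull-backs along coalgebra maps from `H ⊗ H ⊗ H` are determined on pure tensors; most of the
bookkeeping of legs below is done by this lemma. -/
theorem upull_ext_triple {φ ψ : (H ⊗[k] H) ⊗[k] H →ₗc[k] H ⊗[k] H}
    (h : ∀ a b c : H, φ ((a ⊗ₜ b) ⊗ₜ c) = ψ ((a ⊗ₜ b) ⊗ₜ c)) (F : (Dual2 k H)ˣ) :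
    upull φ F = upull ψ F := by
  apply Units.ext
  apply WithConv.ext
  ext a b c
  exact congrArg F.val.ofConv (h a b c)

theorem upull_swap {C : Type*} [AddCommGroup C] [Module k C] [Coalgebra k C]
    (φ : C →ₗc[k] H ⊗[k] H) (F : (Dual2 k H)ˣ) :
    upull φ (swap F) = upull ((flipHom k H).comp φ) F := rfl

/-- The product `F₁₃ * G₁₂` in Sweedler notation: `∑ F(a₁, c) G(a₂, b)`. -/
theorem flip_q₁₃_mul_q₂ (F G : Dual2 k H) (a b c : H) :
    (pull (q₁₃ k H) k F * pull (q₂ k H) k G) ((a ⊗ₜ b) ⊗ₜ c) =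
      ∑ i ∈ (Coalgebra.Repr.arbitrary k a).index,
        F ((Coalgebra.Repr.arbitrary k a).left i ⊗ₜ c) *
          G ((Coalgebra.Repr.arbitrary k a).right i ⊗ₜ b) := by
  set ra := Coalgebra.Repr.arbitrary k a
  let rb := Coalgebra.Repr.arbitrary k b
  let rc := Coalgebra.Repr.arbitrary k c
  have hab : Coalgebra.comul (R := k) (a ⊗ₜ[k] b) = ∑ p ∈ ra.index ×ˢ rb.index,
      (ra.left p.1 ⊗ₜ[k] rb.left p.2) ⊗ₜ[k] (ra.right p.1 ⊗ₜ[k] rb.right p.2) := by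
    rw [comul_tmul_eq_sum ra rb, Finset.sum_product]
  let rab : Coalgebra.Repr k (a ⊗ₜ[k] b) _ :=
    { index := ra.index ×ˢ rb.index
      left := fun p => ra.left p.1 ⊗ₜ[k] rb.left p.2
      right := fun p => ra.right p.1 ⊗ₜ[k] rb.right p.2
      eq := hab.symm }
  rw [conv_tmul rab rc]
  change ∑ p ∈ ra.index ×ˢ rb.index, _ = _
  rw [Finset.sum_product]
  refine Finset.sum_congr rfl fun i _ => ?_
  conv_rhs => rw [← sum_counit_smul_right rc, ← Coalgebra.sum_counit_smul rb]
  change _ = F.ofConv _ * G.ofConv _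
  rw [TensorProduct.tmul_sum, TensorProduct.tmul_sum, map_sum, map_sum, Finset.sum_mul_sum,
    Finset.sum_comm]
  refine Finset.sum_congr rfl fun l _ => Finset.sum_congr rfl fun j _ => ?_
  change F.ofConv ((Coalgebra.counit (R := k) (rb.left j) • ra.left i) ⊗ₜ rc.left l) *
    G.ofConv (Coalgebra.counit (R := k) (rc.right l) • (ra.right i ⊗ₜ rb.right j)) = _
  rw [← TensorProduct.smul_tmul', TensorProduct.tmul_smul, TensorProduct.tmul_smul]
  simp only [map_smul, smul_eq_mul]
  ring

/-- The product `F₂₃ * G₁₃` in Sweedler notation: `∑ F(b, c₁) G(a, c₂)`. -/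
theorem q₄_mul_q₁₃ (F G : Dual2 k H) (a b c : H) :
    (pull (q₄ k H) k F * pull (q₁₃ k H) k G) ((a ⊗ₜ b) ⊗ₜ c) =
      ∑ i ∈ (Coalgebra.Repr.arbitrary k c).index,
        F (b ⊗ₜ (Coalgebra.Repr.arbitrary k c).left i) *
          G (a ⊗ₜ (Coalgebra.Repr.arbitrary k c).right i) := by
  set rc := Coalgebra.Repr.arbitrary k c
  let ra := Coalgebra.Repr.arbitrary k a
  let rb := Coalgebra.Repr.arbitrary k b
  have hab : Coalgebra.comul (R := k) (a ⊗ₜ[k] b) = ∑ p ∈ ra.index ×ˢ rb.index,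
      (ra.left p.1 ⊗ₜ[k] rb.left p.2) ⊗ₜ[k] (ra.right p.1 ⊗ₜ[k] rb.right p.2) := by
    rw [comul_tmul_eq_sum ra rb, Finset.sum_product]
  let rab : Coalgebra.Repr k (a ⊗ₜ[k] b) _ :=
    { index := ra.index ×ˢ rb.index
      left := fun p => ra.left p.1 ⊗ₜ[k] rb.left p.2
      right := fun p => ra.right p.1 ⊗ₜ[k] rb.right p.2
      eq := hab.symm }
  rw [conv_tmul rab rc]
  change ∑ p ∈ ra.index ×ˢ rb.index, _ = _
  rw [Finset.sum_comm]
  refine Finset.sum_congr rfl fun l _ => ?_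
  rw [Finset.sum_product]
  conv_rhs => rw [← sum_counit_smul_right rb, ← Coalgebra.sum_counit_smul ra]
  change _ = F.ofConv _ * G.ofConv _
  rw [TensorProduct.sum_tmul, TensorProduct.sum_tmul, map_sum, map_sum, Finset.sum_mul_sum,
    Finset.sum_comm]
  refine Finset.sum_congr rfl fun i _ => Finset.sum_congr rfl fun j _ => ?_
  change F.ofConv ((Coalgebra.counit (R := k) (ra.left j) • rb.left i) ⊗ₜ rc.left l) *
    G.ofConv ((Coalgebra.counit (R := k) (rb.right i) • ra.right j) ⊗ₜ rc.right l) = _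
  simp only [← TensorProduct.smul_tmul', map_smul, smul_eq_mul]
  ring

theorem swap_swap (F : (Dual2 k H)ˣ) : swap (swap F) = F := by
  apply Units.ext
  apply WithConv.ext
  ext a b
  rfl

theorem swap_rMatrix (J : (Dual2 k H)ˣ) : swap (rMatrix J) = (rMatrix J)⁻¹ := by
  simp [rMatrix, swap_swap]

theorem IsInvariant.swap {J : (Dual2 k H)ˣ} (hJ : IsInvariant J) :
    IsInvariant (InvCocycle.swap J) := by
  have h := Commute.map hJ (pull (flipHom k H) H)
  have e : pull (flipHom k H) H (mulConv (k := k) (H := H)) = mulConv := by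
    apply WithConv.ext
    ext a b
    exact mul_comm b a
  rw [e] at h
  exact h

theorem isInvariant_rMatrix {J : (Dual2 k H)ˣ} (hJ : IsInvariant J) : IsInvariant (rMatrix J) :=
  hJ.swap.inv.mul hJ

/-- The manipulation in the group of units of `(H ⊗ H ⊗ H)*` that turns three instances of the
cocycle equation, with permuted legs, into the hexagon identity for `J₂₁⁻¹ * J`. -/
theorem group_identity {G : Type*} [Group G] {A C E F a b c d e : G} (h1 : A * a = C * e)
    (h2 : F * e = E * d) (h3 : A * b = E * c) (hc : Commute e (F⁻¹ * C)) :
    F⁻¹ * C = d⁻¹ * c * (b⁻¹ * a) := by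
  have hF : F = E * d * e⁻¹ := eq_mul_inv_of_mul_eq h2
  have hC : C = A * a * e⁻¹ := eq_mul_inv_of_mul_eq h1.symm
  have hA : A = E * c * b⁻¹ := eq_mul_inv_of_mul_eq h3
  have h4 : F⁻¹ * C * e = e * (d⁻¹ * c * (b⁻¹ * a)) := by
    rw [hF, hC, hA]
    group
  rw [← hc.eq] at h4
  exact mul_left_cancel h4

section

variable {J : (Dual2 k H)ˣ} (hJ : IsHopf2Cocycle J) (iJ : IsInvariant J)
include hJ iJ

/-- `R(a, bc) = ∑ R(a₁, c) R(a₂, b)` for `R = J₂₁⁻¹ * J`. -/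
theorem upull_q₃_rMatrix : upull (q₃ k H) (rMatrix J) =
    upull (q₁₃ k H) (rMatrix J) * upull (q₂ k H) (rMatrix J) := by
  have h1 : upull (q₁ k H) J * upull (q₂ k H) J = upull (q₃ k H) J * upull (q₄ k H) J :=
    Units.ext hJ.cocycle
  have h2 := congrArg (upull (cyc k H)) h1
  have h3 := congrArg (upull (s₁₂ k H)) h1
  simp only [map_mul, upull_comp] at h2 h3
  rw [upull_ext_triple (φ := (q₁ k H).comp (cyc k H)) (ψ := (flipHom k H).comp (q₃ k H))
      (fun a b c => rfl),
    upull_ext_triple (φ := (q₂ k H).comp (cyc k H)) (ψ := q₄ k H) (fun a b c => by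
      change Coalgebra.counit (R := k) a • (b ⊗ₜ[k] c) = (Coalgebra.counit (R := k) a • b) ⊗ₜ[k] c
      rw [TensorProduct.smul_tmul']),
    upull_ext_triple (φ := (q₄ k H).comp (cyc k H)) (ψ := (flipHom k H).comp (q₁₃ k H))
      (fun a b c => by
      change (Coalgebra.counit (R := k) b • c) ⊗ₜ[k] a = c ⊗ₜ[k] (Coalgebra.counit (R := k) b • a)
      rw [TensorProduct.smul_tmul])] at h2
  rw [upull_ext_triple (φ := (q₁ k H).comp (s₁₂ k H)) (ψ := q₁ k H)
      (fun a b c => congrArg (· ⊗ₜ[k] c) (mul_comm b a)),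
    upull_ext_triple (φ := (q₂ k H).comp (s₁₂ k H)) (ψ := (flipHom k H).comp (q₂ k H))
      (fun a b c => by
      change Coalgebra.counit (R := k) c • (b ⊗ₜ[k] a) =
        flipHom k H (Coalgebra.counit (R := k) c • (a ⊗ₜ[k] b))
      rw [map_smul, flipHom_apply]),
    upull_ext_triple (φ := (q₃ k H).comp (s₁₂ k H)) (ψ := (q₃ k H).comp (cyc k H))
      (fun a b c => congrArg (b ⊗ₜ[k] ·) (mul_comm a c))] at h3
  have hc : Commute (upull (q₄ k H) J) (upull (q₃ k H) (rMatrix J)) :=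
    Units.ext (commute_q₃_q₄ iJ _)
  have e1 : upull (q₃ k H) (rMatrix J) =
      (upull ((flipHom k H).comp (q₃ k H)) J)⁻¹ * upull (q₃ k H) J := by
    rw [rMatrix, map_mul, map_inv, upull_swap]
  have e2 : upull (q₁₃ k H) (rMatrix J) =
      (upull ((flipHom k H).comp (q₁₃ k H)) J)⁻¹ * upull (q₁₃ k H) J := by
    rw [rMatrix, map_mul, map_inv, upull_swap]
  have e3 : upull (q₂ k H) (rMatrix J) =
      (upull ((flipHom k H).comp (q₂ k H)) J)⁻¹ * upull (q₂ k H) J := by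
    rw [rMatrix, map_mul, map_inv, upull_swap]
  rw [e1] at hc ⊢
  rw [e2, e3]
  exact group_identity h1 h2 h3 hc

/-- `R(ab, c) = ∑ R(b, c₁) R(a, c₂)` for `R = J₂₁⁻¹ * J`. -/
theorem upull_q₁_rMatrix : upull (q₁ k H) (rMatrix J) =
    upull (q₄ k H) (rMatrix J) * upull (q₁₃ k H) (rMatrix J) := by
  have h := congrArg (upull ((cyc k H).comp (cyc k H)))
    (upull_q₃_rMatrix hJ iJ)
  simp only [map_mul, upull_comp] at h
  rw [upull_ext_triple (φ := (q₃ k H).comp ((cyc k H).comp (cyc k H)))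
      (ψ := (flipHom k H).comp (q₁ k H)) (fun a b c => rfl),
    upull_ext_triple (φ := (q₁₃ k H).comp ((cyc k H).comp (cyc k H)))
      (ψ := (flipHom k H).comp (q₄ k H)) (fun a b c => by
      change (Coalgebra.counit (R := k) a • c) ⊗ₜ[k] b = c ⊗ₜ[k] (Coalgebra.counit (R := k) a • b)
      rw [TensorProduct.smul_tmul]),
    upull_ext_triple (φ := (q₂ k H).comp ((cyc k H).comp (cyc k H)))
      (ψ := (flipHom k H).comp (q₁₃ k H)) (fun a b c => by
      change Coalgebra.counit (R := k) b • (c ⊗ₜ[k] a) = c ⊗ₜ[k] (Coalgebra.counit (R := k) b • a)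
      rw [TensorProduct.tmul_smul]), ← upull_swap, ← upull_swap, ← upull_swap, swap_rMatrix] at h
  simp only [map_inv] at h
  rw [← mul_inv_rev, inv_inj] at h
  have h' := congrArg (upull (s₁₂ k H)) h
  simp only [map_mul, upull_comp] at h'
  rw [upull_ext_triple (φ := (q₁ k H).comp (s₁₂ k H)) (ψ := q₁ k H)
      (fun a b c => congrArg (· ⊗ₜ[k] c) (mul_comm b a)),
    upull_ext_triple (φ := (q₁₃ k H).comp (s₁₂ k H)) (ψ := q₄ k H) (fun a b c => rfl)] at h'
  exact h'

end

theorem comm_of_isInvariant {R : (Dual2 k H)ˣ} (iR : IsInvariant R) :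
    scal H R.val * toConv (LinearMap.mul' k H ∘ₗ (TensorProduct.comm k H H).toLinearMap) =
    toConv (LinearMap.mul' k H) * scal H R.val := by
  have e : toConv (LinearMap.mul' k H ∘ₗ (TensorProduct.comm k H H).toLinearMap) =
      mulConv (k := k) (H := H) := by
    apply WithConv.ext
    ext a b
    exact mul_comm b a
  rw [e]
  exact iR.eq

/-- The `R`-matrix of an invariant cocycle is a cotriangular structure. -/
theorem isCotriangular_rMatrix {J : (Dual2 k H)ˣ} (hJ : IsHopf2Cocycle J) (iJ : IsInvariant J) :
    IsCotriangular (rMatrix J) := by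
  refine ⟨by rw [swap_rMatrix, mul_inv_cancel], fun a b c => ?_, fun a b c => ?_,
    comm_of_isInvariant (isInvariant_rMatrix iJ)⟩
  · have h := congrArg (fun F : (WithConv ((H ⊗[k] H) ⊗[k] H →ₗ[k] k))ˣ =>
      F.val ((a ⊗ₜ c) ⊗ₜ b)) (upull_q₃_rMatrix hJ iJ)
    rw [mul_comm b c]
    refine h.trans ((flip_q₁₃_mul_q₂ _ _ a c b).trans ?_)
    rw [(Coalgebra.Repr.arbitrary k a).convMul_apply]
    rfl
  · have h := congrArg (fun F : (WithConv ((H ⊗[k] H) ⊗[k] H →ₗ[k] k))ˣ =>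
      F.val ((a ⊗ₜ b) ⊗ₜ c)) (upull_q₁_rMatrix hJ iJ)
    refine h.trans ((q₄_mul_q₁₃ _ _ a b c).trans ?_)
    rw [(Coalgebra.Repr.arbitrary k c).convMul_apply]
    rfl

end Triple

section Cotriangular

variable {k : Type u} [Field k] {H : Type v} [CommRing H] [HopfAlgebra k H]

namespace IsCotriangular

variable {R : (Dual2 k H)ˣ} (hR : IsCotriangular R)
include hR

theorem swap_eq_inv : swap R = R⁻¹ := (inv_eq_of_mul_eq_one_right hR.unitary).symm

theorem apply_mul_right {ι : Type*} {h : H} (r : Coalgebra.Repr k h ι) (g l : H) :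
    R.val (h ⊗ₜ (g * l)) = ∑ i ∈ r.index, R.val (r.left i ⊗ₜ g) * R.val (r.right i ⊗ₜ l) := by
  rw [hR.mul_right, r.convMul_apply]
  rfl

theorem apply_mul_left {ι : Type*} {l : H} (r : Coalgebra.Repr k l ι) (h g : H) :
    R.val ((h * g) ⊗ₜ l) = ∑ i ∈ r.index, R.val (g ⊗ₜ r.left i) * R.val (h ⊗ₜ r.right i) := by
  rw [hR.mul_left, r.convMul_apply]
  rfl

theorem one_left (a : H) : R.val (1 ⊗ₜ a) = Coalgebra.counit (R := k) a := by
  have h1 : upull inr R * upull inr R = upull inr R := by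
    apply Units.ext
    apply WithConv.ext
    ext a
    have h := hR.mul_left 1 1 a
    rw [mul_one] at h
    have e : toConv (R.val.ofConv ∘ₗ TensorProduct.mk k H H 1) = pull inr k R.val := by
      apply WithConv.ext
      ext b
      change R.val.ofConv (1 ⊗ₜ b) = R.val.ofConv ((inr : H →ₗc[k] H ⊗[k] H) b)
      rw [inr_apply]
    rw [e] at h
    refine h.symm.trans ?_
    change R.val.ofConv (1 ⊗ₜ a) = R.val.ofConv ((inr : H →ₗc[k] H ⊗[k] H) a)
    rw [inr_apply]
  have h2 : upull inr R = 1 := by simpa using h1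
  exact (left_one_iff R.val).2 (congrArg Units.val h2) a

theorem one_right (a : H) : R.val (a ⊗ₜ 1) = Coalgebra.counit (R := k) a := by
  have h : (swap R)⁻¹ = R := by rw [hR.swap_eq_inv, inv_inv]
  have h1 : upull inr R = 1 := Units.ext ((left_one_iff R.val).1 hR.one_left)
  have h2 : upull inl (swap R) = 1 := by
    rw [← h1]
    apply Units.ext
    apply WithConv.ext
    ext a
    change R.val.ofConv (flipHom k H ((inl : H →ₗc[k] H ⊗[k] H) a)) =
      R.val.ofConv ((inr : H →ₗc[k] H ⊗[k] H) a)
    rw [inr_apply, inl_apply, flipHom_apply]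
  have h3 : upull inl R = 1 := by rw [← h, map_inv, h2, inv_one]
  exact (right_one_iff R.val).2 (congrArg Units.val h3) a

/-- `R(S(a), b) = R(b, a)`: convolution inversion in the first argument is `a ↦ S(a)`, and `R₂₁` is
the inverse of `R`. -/
theorem antipode_left (a b : H) :
    R.val (HopfAlgebra.antipode k a ⊗ₜ b) = R.val (b ⊗ₜ a) := by
  let F : Dual2 k H := toConv (R.val.ofConv ∘ₗ
    TensorProduct.map (HopfAlgebra.antipode k) LinearMap.id)
  have h1 : R.val * F = 1 := by
    apply WithConv.ext
    ext a b
    change (R.val * F) (a ⊗ₜ b) = (1 : Dual2 k H) (a ⊗ₜ b)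
    let ra := Coalgebra.Repr.arbitrary k a
    let rb := Coalgebra.Repr.arbitrary k b
    rw [conv_tmul ra rb]
    have h2 : ∀ i ∈ ra.index, ∑ j ∈ rb.index, R.val (ra.left i ⊗ₜ rb.left j) *
        F (ra.right i ⊗ₜ rb.right j) =
        R.val.ofConv ((ra.left i * HopfAlgebra.antipode k (ra.right i)) ⊗ₜ b) := by
      intro i _
      rw [mul_comm (ra.left i)]
      exact (hR.apply_mul_left rb (HopfAlgebra.antipode k (ra.right i)) (ra.left i)).symm
    rw [Finset.sum_congr rfl h2, ← map_sum, ← TensorProduct.sum_tmul,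
      HopfAlgebra.sum_mul_antipode_eq_algebraMap_counit, Algebra.algebraMap_eq_smul_one,
      ← TensorProduct.smul_tmul', map_smul]
    change _ • R.val (1 ⊗ₜ b) = _
    rw [hR.one_left]
    simp [LinearMap.convOne_apply, mul_comm]
  have h3 : F = (swap R).val := by
    rw [hR.swap_eq_inv]
    exact (Units.inv_eq_of_mul_eq_one_right h1).symm
  exact congrArg (fun f : Dual2 k H => f (a ⊗ₜ b)) h3

/-- `R(a, S(b)) = R(b, a)`, for the same reason. -/
theorem antipode_right (a b : H) :
    R.val (a ⊗ₜ HopfAlgebra.antipode k b) = R.val (b ⊗ₜ a) := by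
  let F : Dual2 k H := toConv (R.val.ofConv ∘ₗ
    TensorProduct.map LinearMap.id (HopfAlgebra.antipode k))
  have h1 : R.val * F = 1 := by
    apply WithConv.ext
    ext a b
    change (R.val * F) (a ⊗ₜ b) = (1 : Dual2 k H) (a ⊗ₜ b)
    let ra := Coalgebra.Repr.arbitrary k a
    let rb := Coalgebra.Repr.arbitrary k b
    rw [conv_tmul ra rb, Finset.sum_comm]
    have h2 : ∀ j ∈ rb.index, ∑ i ∈ ra.index, R.val (ra.left i ⊗ₜ rb.left j) *
        F (ra.right i ⊗ₜ rb.right j) =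
        R.val.ofConv (a ⊗ₜ (rb.left j * HopfAlgebra.antipode k (rb.right j))) := by
      intro j _
      exact (hR.apply_mul_right ra (rb.left j) (HopfAlgebra.antipode k (rb.right j))).symm
    rw [Finset.sum_congr rfl h2, ← map_sum, ← TensorProduct.tmul_sum,
      HopfAlgebra.sum_mul_antipode_eq_algebraMap_counit, Algebra.algebraMap_eq_smul_one,
      TensorProduct.tmul_smul, map_smul]
    change _ • R.val (a ⊗ₜ 1) = _
    rw [hR.one_right]
    simp [LinearMap.convOne_apply]
  have h3 : F = (swap R).val := by
    rw [hR.swap_eq_inv]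
    exact (Units.inv_eq_of_mul_eq_one_right h1).symm
  exact congrArg (fun f : Dual2 k H => f (a ⊗ₜ b)) h3

end IsCotriangular

end Cotriangular

section Separating

variable {k : Type*} [Field k] {V W : Type*} [AddCommGroup V] [Module k V]
  [AddCommGroup W] [Module k W]

theorem apply_contractL_eq (φ : V →ₗ[k] k) (ψ : W →ₗ[k] k) (t : V ⊗[k] W) :
    ψ (contractL φ t) = φ (contractR ψ t) := by
  induction t with
  | zero => simp
  | add x y hx hy => simp only [map_add, hx, hy]
  | tmul v w => simp [mul_comm]

/-- Separating families of functionals separate tensors. -/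
theorem eq_zero_of_separating {ι κ : Type*} {φ : ι → V →ₗ[k] k} {ψ : κ → W →ₗ[k] k}
    (hφ : ∀ v, (∀ i, φ i v = 0) → v = 0) (hψ : ∀ w, (∀ j, ψ j w = 0) → w = 0) {t : V ⊗[k] W}
    (h : ∀ i j, ψ j (contractL (φ i) t) = 0) : t = 0 := by
  refine eq_zero_of_contractR fun g => hφ _ fun i => ?_
  rw [← apply_contractL_eq, hψ _ (h i), map_zero]

end Separating

/-! ### The radical of a cotriangular structure -/

section Radical

variable {k : Type u} [Field k] {H : Type v} [CommRing H] [HopfAlgebra k H]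

namespace IsCotriangular

variable {R : (Dual2 k H)ˣ} (hR : IsCotriangular R)

/-- The right radical of a cotriangular structure. -/
def radicalIdeal (hR : IsCotriangular R) : Ideal H where
  carrier := {a | ∀ b : H, R.val (b ⊗ₜ a) = 0}
  zero_mem' b := by
    change R.val.ofConv _ = 0
    rw [TensorProduct.tmul_zero, map_zero]
  add_mem' {a a'} ha ha' b := by
    change R.val.ofConv _ = 0
    rw [TensorProduct.tmul_add, map_add]
    exact (congrArg₂ (· + ·) (ha b) (ha' b)).trans (add_zero 0)
  smul_mem' c a ha b := by
    rw [smul_eq_mul, hR.apply_mul_right (Coalgebra.Repr.arbitrary k b)]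
    exact Finset.sum_eq_zero fun i _ => by rw [ha, mul_zero]

theorem mem_radicalIdeal {a : H} : a ∈ hR.radicalIdeal ↔ ∀ b : H, R.val (b ⊗ₜ a) = 0 := Iff.rfl

theorem apply_eq_zero_of_mem_left {a : H} (ha : a ∈ hR.radicalIdeal) (b : H) :
    R.val (a ⊗ₜ b) = 0 := by
  rw [← hR.antipode_left]
  exact ha _

/-- The functional `R(a, -)` on the quotient by the radical. -/
def form (a : H) : (H ⧸ hR.radicalIdeal) →ₗ[k] k :=
  Submodule.liftQ (hR.radicalIdeal.restrictScalars k) (R.val.ofConv ∘ₗ TensorProduct.mk k H H a)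
    (fun _ hx => hx a)

theorem eq_zero_of_form (v : H ⧸ hR.radicalIdeal) (h : ∀ a, hR.form a v = 0) : v = 0 := by
  obtain ⟨b, rfl⟩ := Ideal.Quotient.mk_surjective v
  rw [Ideal.Quotient.eq_zero_iff_mem]
  exact h

/-- Multiplicativity of `R` in its first argument, read in the quotient by the radical; it shows
that the radical is a coideal. -/
theorem form_contractL (g h l : H) : hR.form h (contractL (hR.form g)
    (TensorProduct.map (Ideal.Quotient.mkₐ k hR.radicalIdeal).toLinearMap
      (Ideal.Quotient.mkₐ k hR.radicalIdeal).toLinearMap (Coalgebra.comul l))) =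
      R.val ((h * g) ⊗ₜ l) := by
  rw [hR.apply_mul_left (Coalgebra.Repr.arbitrary k l)]
  conv_lhs => rw [← (Coalgebra.Repr.arbitrary k l).eq]
  simp only [map_sum, TensorProduct.map_tmul, contractL_tmul, map_smul, smul_eq_mul]
  rfl

/-- The radical of a cotriangular structure as a closed subgroup. -/
def radical : ClosedSubgroup k H where
  ideal := hR.radicalIdeal
  isHopfIdeal :=
    { counit_eq_zero := fun a ha => by
        rw [← hR.one_left]
        exact ha 1
      map_mkQ_comul_eq_zero := fun a ha => by
        refine eq_zero_of_separating hR.eq_zero_of_form hR.eq_zero_of_form fun g h => ?_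
        exact (hR.form_contractL g h a).trans (ha _)
      antipode_mem := fun a ha b => by
        rw [hR.antipode_right]
        exact hR.apply_eq_zero_of_mem_left ha b }

/-- The functional `R(a, -)` on the functions of the radical subgroup. -/
def radicalForm (a : H) : hR.radical.Fun →ₗ[k] k := hR.form a

theorem eq_zero_of_radicalForm (v : hR.radical.Fun) (h : ∀ a, hR.radicalForm a v = 0) : v = 0 :=
  hR.eq_zero_of_form v h

/-- `O(A)` is cocommutative for the radical `A`: evaluating the coproduct against `R(g, -) ⊗ R(h,
-)` gives `R(hg, -)`, and `H` is commutative. -/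
theorem radical_isCommutative : hR.radical.IsCommutative := by
  refine ⟨LinearMap.ext fun v => ?_⟩
  obtain ⟨l, rfl⟩ := Ideal.Quotient.mk_surjective v
  have key : TensorProduct.comm k (H ⧸ hR.radicalIdeal) (H ⧸ hR.radicalIdeal)
      (TensorProduct.map (Ideal.Quotient.mkₐ k hR.radicalIdeal).toLinearMap
        (Ideal.Quotient.mkₐ k hR.radicalIdeal).toLinearMap (Coalgebra.comul l)) =
      TensorProduct.map (Ideal.Quotient.mkₐ k hR.radicalIdeal).toLinearMap
        (Ideal.Quotient.mkₐ k hR.radicalIdeal).toLinearMap (Coalgebra.comul l) := by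
    rw [← sub_eq_zero]
    refine eq_zero_of_separating hR.eq_zero_of_form hR.eq_zero_of_form fun g h => ?_
    have e : ∀ t : (H ⧸ hR.radicalIdeal) ⊗[k] (H ⧸ hR.radicalIdeal),
        hR.form h (contractL (hR.form g) (TensorProduct.comm k _ _ t)) =
        hR.form g (contractL (hR.form h) t) := by
      intro t
      induction t with
      | zero => simp
      | add x y hx hy => simp only [map_add, hx, hy]
      | tmul v w => simp [mul_comm]
    rw [map_sub, map_sub, e, hR.form_contractL, hR.form_contractL, mul_comm, sub_self]
  change TensorProduct.comm k _ _ (Coalgebra.comul (Ideal.Quotient.mk hR.radical.ideal l)) =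
    Coalgebra.comul (Ideal.Quotient.mk hR.radical.ideal l)
  rw [Bialgebra.Quotient.comul_mk]
  exact key

end IsCotriangular

end Radical

section Descent

variable {k : Type u} [Field k] {H : Type v} [CommRing H] [HopfAlgebra k H]

theorem ClosedSubgroup.proj₂_surjective (A : ClosedSubgroup k H) :
    Function.Surjective A.proj₂ :=
  TensorProduct.map_surjective Ideal.Quotient.mk_surjective Ideal.Quotient.mk_surjective

theorem ClosedSubgroup.lift_injective (A : ClosedSubgroup k H) : Function.Injective A.lift :=
  Units.map_injective (pull_injective A.proj₂_surjective k)

theorem ClosedSubgroup.lift_swap (A : ClosedSubgroup k H) (F : (Dual2 k A.Fun)ˣ) :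
    A.lift (swap F) = swap (A.lift F) := by
  apply Units.ext
  apply WithConv.ext
  ext a b
  rfl

theorem ClosedSubgroup.lift_rMatrix (A : ClosedSubgroup k H) (F : (Dual2 k A.Fun)ˣ) :
    A.lift (rMatrix F) = rMatrix (A.lift F) := by
  simp [rMatrix, lift_swap]

/-- An invertible functional on `O(G) ⊗ O(G)` that kills the ideal of `A` on both sides descends to
an invertible functional on `O(A) ⊗ O(A)`. -/
theorem ClosedSubgroup.exists_lift_eq (A : ClosedSubgroup k H) (F : (Dual2 k H)ˣ)
    (hl : ∀ a ∈ A.ideal, ∀ b, F.val (a ⊗ₜ b) = 0) (hr : ∀ a ∈ A.ideal, ∀ b, F.val (b ⊗ₜ a) = 0) :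
    ∃ f : (Dual2 k A.Fun)ˣ, A.lift f = F := by
  obtain ⟨σ, hσ⟩ := LinearMap.exists_rightInverse_of_surjective
    (Ideal.Quotient.mkₐ k A.ideal).toLinearMap
    (LinearMap.range_eq_top.2 Ideal.Quotient.mk_surjective)
  have hσ' : ∀ a : H, a - σ (Ideal.Quotient.mk A.ideal a) ∈ A.ideal := fun a => by
    rw [← Ideal.Quotient.eq_zero_iff_mem, map_sub, sub_eq_zero]
    exact (LinearMap.congr_fun hσ (Ideal.Quotient.mk A.ideal a)).symm
  let f : Dual2 k A.Fun := toConv (F.val.ofConv ∘ₗ TensorProduct.map σ σ)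
  have hf : pull A.proj₂ k f = F.val := by
    apply WithConv.ext
    ext a b
    change F.val.ofConv (σ (Ideal.Quotient.mk A.ideal a) ⊗ₜ σ (Ideal.Quotient.mk A.ideal b)) =
      F.val.ofConv (a ⊗ₜ b)
    have h1 := hl _ (hσ' a) b
    have h2 := hr _ (hσ' b) (σ (Ideal.Quotient.mk A.ideal a))
    change F.val.ofConv _ = 0 at h1 h2
    rw [TensorProduct.sub_tmul, map_sub, sub_eq_zero] at h1
    rw [TensorProduct.tmul_sub, map_sub, sub_eq_zero] at h2
    rw [h1, h2]
  have hu : IsUnit f := isUnit_of_isUnit_pull A.proj₂_surjective (by rw [hf]; exact F.isUnit)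
  obtain ⟨f', hf'⟩ := hu
  refine ⟨f', Units.ext ?_⟩
  change pull A.proj₂ k f'.val = _
  rw [hf', hf]

theorem ClosedSubgroup.lift_ideal_right (A : ClosedSubgroup k H) (F : (Dual2 k A.Fun)ˣ) {a : H}
    (ha : a ∈ A.ideal) (b : H) : (A.lift F).val (b ⊗ₜ a) = 0 := by
  rw [A.lift_apply, Ideal.Quotient.eq_zero_iff_mem.2 ha]
  change F.val.ofConv _ = 0
  rw [TensorProduct.tmul_zero, map_zero]

/-- The ideal of `A` is the right radical of the lift of a non-degenerate functional. -/
theorem ClosedSubgroup.mem_ideal_iff (A : ClosedSubgroup k H) {F : (Dual2 k A.Fun)ˣ}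
    (hF : IsNondegenerate F) {a : H} : a ∈ A.ideal ↔ ∀ b, (A.lift F).val (b ⊗ₜ a) = 0 := by
  refine ⟨fun ha b => A.lift_ideal_right F ha b, fun h => ?_⟩
  rw [← Ideal.Quotient.eq_zero_iff_mem]
  refine hF _ fun b => ?_
  obtain ⟨b, rfl⟩ := Ideal.Quotient.mk_surjective b
  exact h b

/-- The quotient map `O(G) → O(A)` as a coalgebra map. -/
abbrev ClosedSubgroup.proj (A : ClosedSubgroup k H) : H →ₗc[k] A.Fun :=
  (Bialgebra.Quotient.mkBialgHom (R := k) A.ideal).toCoalgHom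

/-- As `O(G) → O(A)` is surjective, the axioms of a cotriangular structure descend. -/
theorem IsCotriangular.of_lift (A : ClosedSubgroup k H) {r : (Dual2 k A.Fun)ˣ}
    (h : IsCotriangular (A.lift r)) : IsCotriangular r := by
  refine ⟨?_, fun a b c => ?_, fun a b c => ?_, ?_⟩
  · apply A.lift_injective
    rw [map_mul, A.lift_swap, h.unitary, map_one]
  · obtain ⟨a, rfl⟩ := Ideal.Quotient.mk_surjective a
    obtain ⟨b, rfl⟩ := Ideal.Quotient.mk_surjective b
    obtain ⟨c, rfl⟩ := Ideal.Quotient.mk_surjective c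
    refine (h.mul_right a b c).trans ?_
    have e := map_mul (pull A.proj k)
      (toConv (r.val.ofConv ∘ₗ (TensorProduct.mk k A.Fun A.Fun).flip (Ideal.Quotient.mk _ b)))
      (toConv (r.val.ofConv ∘ₗ (TensorProduct.mk k A.Fun A.Fun).flip (Ideal.Quotient.mk _ c)))
    exact (congrArg (fun f : Dual1 k H => f a) e).symm
  · obtain ⟨a, rfl⟩ := Ideal.Quotient.mk_surjective a
    obtain ⟨b, rfl⟩ := Ideal.Quotient.mk_surjective b
    obtain ⟨c, rfl⟩ := Ideal.Quotient.mk_surjective c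
    refine (h.mul_left a b c).trans ?_
    have e := map_mul (pull A.proj k)
      (toConv (r.val.ofConv ∘ₗ TensorProduct.mk k A.Fun A.Fun (Ideal.Quotient.mk _ b)))
      (toConv (r.val.ofConv ∘ₗ TensorProduct.mk k A.Fun A.Fun (Ideal.Quotient.mk _ a)))
    exact (congrArg (fun f : Dual1 k H => f c) e).symm
  · apply pull_injective A.proj₂_surjective
    rw [map_mul, map_mul]
    let L : H →ₗ[k] A.Fun := (Ideal.Quotient.mkₐ k A.ideal).toLinearMap
    have e1 : pull A.proj₂ A.Fun (scal A.Fun r.val) = scal A.Fun (A.lift r).val := rfl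
    have e2 : pull A.proj₂ A.Fun (toConv (LinearMap.mul' k A.Fun ∘ₗ
        (TensorProduct.comm k A.Fun A.Fun).toLinearMap)) = toConv (L ∘ₗ (LinearMap.mul' k H ∘ₗ
        (TensorProduct.comm k H H).toLinearMap)) := by
      apply WithConv.ext
      ext a b
      exact (map_mul (Ideal.Quotient.mk A.ideal) b a).symm
    have e3 : pull A.proj₂ A.Fun (toConv (LinearMap.mul' k A.Fun)) =
        toConv (L ∘ₗ LinearMap.mul' k H) := by
      apply WithConv.ext
      ext a b
      exact (map_mul (Ideal.Quotient.mk A.ideal) a b).symm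
    have h1 := congrArg (fun f => toConv (L ∘ₗ f.ofConv)) h.comm
    rw [comp_scal_mul, comp_mul_scal] at h1
    rw [e1, e2, e3]
    exact h1

theorem IsInvariant.isGInvariant {R : (Dual2 k H)ˣ} (iR : IsInvariant R) : IsGInvariant R := by
  intro B _ _ g
  have h1 := congrArg (fun f => toConv (g.toLinearMap ∘ₗ f.ofConv)) iR.eq
  rw [comp_scal_mul, comp_mul_scal] at h1
  exact h1

end Descent

section Normal

variable {k : Type u} [Field k] {H : Type v} [CommRing H] [HopfAlgebra k H]

/-- The map `h ↦ ∑ h₁ S(h₃) ⊗ h₂` to `O(G) ⊗ O(A)`, the conjugation action of `G` on `A`, is the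
conjugate of the generic point of `A` by the generic point of `G`. -/
def ClosedSubgroup.conj (A : ClosedSubgroup k H) : WithConv (H →ₐ[k] H ⊗[k] A.Fun) :=
  toConv (Algebra.TensorProduct.includeLeft) *
    toConv ((Algebra.TensorProduct.includeRight).comp (Ideal.Quotient.mkₐ k A.ideal)) *
    toConv ((Algebra.TensorProduct.includeLeft).comp (HopfAlgebra.antipodeAlgHom k H))

theorem ClosedSubgroup.conj_apply (A : ClosedSubgroup k H) (h : H) :
    A.conj h = ∑ i ∈ (Coalgebra.Repr.arbitrary k h).index,
      ∑ j ∈ (Coalgebra.Repr.arbitrary k ((Coalgebra.Repr.arbitrary k h).left i)).index,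
        ((Coalgebra.Repr.arbitrary k ((Coalgebra.Repr.arbitrary k h).left i)).left j *
          HopfAlgebra.antipode k ((Coalgebra.Repr.arbitrary k h).right i)) ⊗ₜ
        Ideal.Quotient.mk A.ideal
          ((Coalgebra.Repr.arbitrary k ((Coalgebra.Repr.arbitrary k h).left i)).right j) := by
  let f₁ : H →ₐ[k] H ⊗[k] A.Fun := Algebra.TensorProduct.includeLeft
  let f₂ : H →ₐ[k] H ⊗[k] A.Fun :=
    (Algebra.TensorProduct.includeRight).comp (Ideal.Quotient.mkₐ k A.ideal)
  let f₃ : H →ₐ[k] H ⊗[k] A.Fun :=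
    (Algebra.TensorProduct.includeLeft).comp (HopfAlgebra.antipodeAlgHom k H)
  change (toConv f₁.toLinearMap * toConv f₂.toLinearMap * toConv f₃.toLinearMap :
    WithConv (H →ₗ[k] H ⊗[k] A.Fun)) h = _
  rw [(Coalgebra.Repr.arbitrary k h).convMul_apply]
  refine Finset.sum_congr rfl fun i _ => ?_
  rw [(Coalgebra.Repr.arbitrary k _).convMul_apply, Finset.sum_mul]
  refine Finset.sum_congr rfl fun j _ => ?_
  change (_ ⊗ₜ[k] (1 : A.Fun)) * ((1 : H) ⊗ₜ[k] _) * (_ ⊗ₜ[k] (1 : A.Fun)) = _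
  rw [Algebra.TensorProduct.tmul_mul_tmul, Algebra.TensorProduct.tmul_mul_tmul, one_mul, mul_one,
    mul_one]
  rfl

/-- It suffices to check normality on the generic point of `A` and the generic point of `G`. -/
theorem ClosedSubgroup.isNormal_of_conj (A : ClosedSubgroup k H) (h : ∀ a ∈ A.ideal, A.conj a = 0) :
    A.IsNormal := by
  intro B _ _ g x hx a ha
  let x' : A.Fun →ₐ[k] B := Ideal.Quotient.liftₐ A.ideal x.ofConv hx
  let L : H ⊗[k] A.Fun →ₐ[k] B := Algebra.TensorProduct.lift g.ofConv x' (fun _ _ => mul_comm _ _)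
  have e1 : L.comp Algebra.TensorProduct.includeLeft = g.ofConv := by
    ext b
    change g.ofConv b * x' 1 = g.ofConv b
    rw [map_one, mul_one]
  have e2 : L.comp ((Algebra.TensorProduct.includeRight).comp (Ideal.Quotient.mkₐ k A.ideal)) =
      x.ofConv := by
    ext b
    change g.ofConv 1 * x.ofConv b = x.ofConv b
    rw [map_one, one_mul]
  have e : g * x * toConv (g.ofConv.comp (HopfAlgebra.antipodeAlgHom k H)) =
      toConv (L.comp A.conj.ofConv) := by
    rw [ClosedSubgroup.conj, AlgHom.comp_convMul_distrib, AlgHom.comp_convMul_distrib]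
    simp only [← AlgHom.comp_assoc] at e2 ⊢
    rw [e2, e1]
  rw [e]
  change L (A.conj a) = 0
  rw [h a ha, map_zero]

namespace IsCotriangular

variable {R : (Dual2 k H)ˣ} (hR : IsCotriangular R)

/-- Pairing the conjugate `∑ b₁S(b₃) ⊗ b₂` of an element `b` of the radical with `R(a, -)` gives
zero. This is invariance of `R`, rewritten by moving factors of the product `m` to the other side
with the antipode. -/
theorem sum_conj_eq_zero (iR : IsInvariant R) {b : H} (hb : b ∈ hR.radicalIdeal) (a : H) :
    ∑ i ∈ (Coalgebra.Repr.arbitrary k b).index,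
      ∑ j ∈ (Coalgebra.Repr.arbitrary k ((Coalgebra.Repr.arbitrary k b).left i)).index,
        R.val (a ⊗ₜ (Coalgebra.Repr.arbitrary k ((Coalgebra.Repr.arbitrary k b).left i)).right j) •
        ((Coalgebra.Repr.arbitrary k ((Coalgebra.Repr.arbitrary k b).left i)).left j *
          HopfAlgebra.antipode k ((Coalgebra.Repr.arbitrary k b).right i)) = 0 := by
  let X : WithConv (H ⊗[k] H →ₗ[k] H) := pull (p₁ k H) H (toConv LinearMap.id)
  let Y : WithConv (H ⊗[k] H →ₗ[k] H) := pull (p₂ k H) H (toConv LinearMap.id)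
  let X' : WithConv (H ⊗[k] H →ₗ[k] H) := pull (p₁ k H) H (toConv (HopfAlgebra.antipode k))
  let Y' : WithConv (H ⊗[k] H →ₗ[k] H) := pull (p₂ k H) H (toConv (HopfAlgebra.antipode k))
  have hX : X' * X = 1 := by
    rw [← map_mul, LinearMap.antipode_mul_id, map_one]
  have hY : Y * Y' = 1 := by
    rw [← map_mul, LinearMap.id_mul_antipode, map_one]
  have h : scal H R.val * (X * Y) = X * Y * scal H R.val := by
    rw [← mulConv_eq]
    exact iR.eq
  have h1 : X' * (scal H R.val * X) = Y * scal H R.val * Y' := by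
    calc X' * (scal H R.val * X) = X' * (scal H R.val * (X * Y)) * Y' := by
          simp only [mul_assoc, hY, mul_one]
      _ = (X' * X) * (Y * scal H R.val) * Y' := by rw [h]; simp only [mul_assoc]
      _ = _ := by rw [hX, one_mul]
  have h2 := congrArg (fun f : WithConv (H ⊗[k] H →ₗ[k] H) => f (a ⊗ₜ b)) h1
  change (X' * (scal H R.val * X)) (a ⊗ₜ b) = (Y * scal H R.val * Y') (a ⊗ₜ b) at h2
  rw [pull_p₁_mul (Coalgebra.Repr.arbitrary k a), mul_pull_p₂ (Coalgebra.Repr.arbitrary k b)] at h2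
  have h3 : ∀ c, (scal H R.val * X) (c ⊗ₜ b) = 0 := by
    intro c
    rw [mul_pull_p₁ (Coalgebra.Repr.arbitrary k c)]
    refine Finset.sum_eq_zero fun i _ => ?_
    change algebraMap k H (R.val (_ ⊗ₜ b)) * _ = 0
    rw [hb, map_zero, zero_mul]
  rw [Finset.sum_eq_zero fun i _ => by rw [h3, mul_zero]] at h2
  rw [h2]
  refine Finset.sum_congr rfl fun i _ => ?_
  rw [pull_p₂_mul (Coalgebra.Repr.arbitrary k _), Finset.sum_mul]
  refine Finset.sum_congr rfl fun j _ => ?_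
  change _ = (_ * algebraMap k H (R.val.ofConv _)) * HopfAlgebra.antipode k _
  rw [← Algebra.commutes, ← Algebra.smul_def, smul_mul_assoc]
  rfl

theorem radical_isNormal (iR : IsInvariant R) : hR.radical.IsNormal := by
  refine hR.radical.isNormal_of_conj fun b hb => ?_
  rw [ClosedSubgroup.conj_apply]
  refine eq_zero_of_separating (φ := fun f : H →ₗ[k] k => f) (ψ := hR.radicalForm)
    (fun v hv => (Module.forall_dual_apply_eq_zero_iff k v).1 hv)
    hR.eq_zero_of_radicalForm fun f a => ?_
  rw [apply_contractL_eq, ← map_zero f]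
  congr 1
  rw [← hR.sum_conj_eq_zero iR hb a, map_sum]
  refine Finset.sum_congr rfl fun i _ => ?_
  rw [map_sum]
  refine Finset.sum_congr rfl fun j _ => ?_
  rw [contractR_tmul]
  rfl

end IsCotriangular

end Normal

section Main

variable {k : Type u} [Field k] {H : Type v} [CommRing H] [HopfAlgebra k H]

/-- An invariant cotriangular structure descends to its radical. -/
theorem IsCotriangular.exists_lift {R : (Dual2 k H)ˣ} (hR : IsCotriangular R) :
    ∃ r : (Dual2 k hR.radical.Fun)ˣ, hR.radical.lift r = R ∧ IsCotriangular r ∧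
      IsNondegenerate r := by
  obtain ⟨r, hr⟩ := hR.radical.exists_lift_eq R (fun a ha b => hR.apply_eq_zero_of_mem_left ha b)
    (fun a ha b => ha b)
  refine ⟨r, hr, IsCotriangular.of_lift _ (by rwa [hr]), fun v hv => ?_⟩
  obtain ⟨a, rfl⟩ := Ideal.Quotient.mk_surjective v
  rw [Ideal.Quotient.eq_zero_iff_mem]
  intro b
  rw [← hr]
  exact hv (Ideal.Quotient.mk _ b)

end Main

/-! ### Points, invariants and subcoalgebras -/

section Points

variable {k : Type u} [Field k] {H : Type v} [CommRing H] [HopfAlgebra k H]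

/-- The points of `G` with values in a commutative algebra form a group under convolution. -/
instance pointGroup {B : Type*} [CommRing B] [Algebra k B] : Group (WithConv (H →ₐ[k] B)) :=
  { (inferInstance : Monoid (WithConv (H →ₐ[k] B))) with
    inv := fun g => toConv (g.ofConv.comp (HopfAlgebra.antipodeAlgHom k H))
    inv_mul_cancel := fun g => by
      have h := AlgHom.comp_convMul_distrib g.ofConv (toConv (HopfAlgebra.antipodeAlgHom k H))
        (toConv (AlgHom.id k H))
      rw [AlgHom.antipode_id_cancel] at h
      apply WithConv.ext
      refine h.symm.trans ?_
      ext a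
      exact g.ofConv.commutes _ }

/-- The points of a closed subgroup, as points of the ambient group. -/
def ClosedSubgroup.res (A : ClosedSubgroup k H) {B : Type*} [CommRing B] [Algebra k B] :
    WithConv (A.Fun →ₐ[k] B) →* WithConv (H →ₐ[k] B) where
  toFun f := toConv (f.ofConv.comp (Ideal.Quotient.mkₐ k A.ideal))
  map_one' := by
    apply WithConv.ext
    ext a
    rfl
  map_mul' f g := by
    apply WithConv.ext
    exact AlgHom.convMul_comp_bialgHom_distrib f g (Bialgebra.Quotient.mkBialgHom (R := k) A.ideal)

variable {A : ClosedSubgroup k H}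

theorem ClosedSubgroup.res_apply {B : Type*} [CommRing B] [Algebra k B]
    (f : WithConv (A.Fun →ₐ[k] B)) (a : H) : A.res f a = f (Ideal.Quotient.mk A.ideal a) := rfl

/-- The conjugate of a point of a normal subgroup is a point of the subgroup. -/
theorem ClosedSubgroup.IsNormal.exists_res (hA : A.IsNormal) {B : Type v} [CommRing B]
    [Algebra k B] (g : WithConv (H →ₐ[k] B)) (f : WithConv (A.Fun →ₐ[k] B)) :
    ∃ f', g * A.res f * g⁻¹ = A.res f' := by
  have h := hA B g (A.res f) (fun a ha => by
    rw [A.res_apply, Ideal.Quotient.eq_zero_iff_mem.2 ha]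
    exact map_zero f.ofConv)
  refine ⟨toConv (Ideal.Quotient.liftₐ A.ideal (g * A.res f * g⁻¹).ofConv h), ?_⟩
  apply WithConv.ext
  ext a
  rfl

theorem point_mul_apply {B : Type*} [CommRing B] [Algebra k B] (g g' : WithConv (H →ₐ[k] B))
    (a : H) : (g * g') a = LinearMap.mul' k B (TensorProduct.map g.ofConv.toLinearMap
      g'.ofConv.toLinearMap (Coalgebra.comul (R := k) a)) := rfl

theorem comp_point_mul {B E : Type*} [CommRing B] [Algebra k B] [CommRing E] [Algebra k E]
    (L : B →ₐ[k] E) (g g' : WithConv (H →ₐ[k] B)) :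
    toConv (L.comp (g * g').ofConv) = toConv (L.comp g.ofConv) * toConv (L.comp g'.ofConv) := by
  apply WithConv.ext
  exact AlgHom.comp_convMul_distrib L g g'

theorem point_inv_apply {B : Type*} [CommRing B] [Algebra k B] (g : WithConv (H →ₐ[k] B)) (a : H) :
    g⁻¹ a = g (HopfAlgebra.antipode k a) := rfl

/-- The functions on `G` invariant under right translations by the closed subgroup `A`. -/
def ClosedSubgroup.invariants (A : ClosedSubgroup k H) : Subalgebra k H where
  carrier := {z | ∀ (B : Type v) [CommRing B] [Algebra k B] (g : WithConv (H →ₐ[k] B))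
    (f : WithConv (A.Fun →ₐ[k] B)), (g * A.res f) z = g z}
  mul_mem' {a b} ha hb B _ _ g f := by
    rw [map_mul, map_mul, ha, hb]
  add_mem' {a b} ha hb B _ _ g f := by
    rw [map_add, map_add, ha, hb]
  algebraMap_mem' c B _ _ g f := by
    change (g * A.res f).ofConv _ = g.ofConv _
    rw [AlgHom.commutes, AlgHom.commutes]

theorem ClosedSubgroup.mem_invariants {z : H} : z ∈ A.invariants ↔
    ∀ (B : Type v) [CommRing B] [Algebra k B] (g : WithConv (H →ₐ[k] B))
    (f : WithConv (A.Fun →ₐ[k] B)), (g * A.res f) z = g z := Iff.rfl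

/-- For a normal subgroup, right invariant functions are left invariant. -/
theorem ClosedSubgroup.IsNormal.left_invariant (hA : A.IsNormal) {z : H} (hz : z ∈ A.invariants)
    {B : Type v} [CommRing B] [Algebra k B] (g : WithConv (H →ₐ[k] B))
    (f : WithConv (A.Fun →ₐ[k] B)) : (A.res f * g) z = g z := by
  obtain ⟨f', hf'⟩ := hA.exists_res g⁻¹ f
  rw [← hz B g f', ← hf', inv_inv]
  simp only [← mul_assoc, mul_inv_cancel, one_mul]

/-- An invariant function is constant on `A`. -/
theorem ClosedSubgroup.sub_counit_mem {z : H} (hz : z ∈ A.invariants) :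
    z - algebraMap k H (Coalgebra.counit z) ∈ A.ideal := by
  have h := hz A.Fun 1 (toConv (AlgHom.id k A.Fun))
  rw [one_mul] at h
  change Ideal.Quotient.mk A.ideal z = algebraMap k A.Fun (Coalgebra.counit z) at h
  rw [← Ideal.Quotient.eq_zero_iff_mem, map_sub, h]
  exact sub_self _

/-- The invariants are stable under left translations. -/
theorem ClosedSubgroup.contractL_mem_invariants {z : H} (hz : z ∈ A.invariants) (φ : H →ₗ[k] k) :
    contractL φ (Coalgebra.comul z) ∈ A.invariants := by
  intro B _ _ g f
  let x : WithConv (H →ₐ[k] H ⊗[k] B) := toConv Algebra.TensorProduct.includeLeft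
  let L : B →ₐ[k] H ⊗[k] B := Algebra.TensorProduct.includeRight
  have key : ∀ g' : WithConv (H →ₐ[k] B), contractL φ ((x * toConv (L.comp g'.ofConv)) z) =
      g' (contractL φ (Coalgebra.comul z)) := by
    intro g'
    rw [point_mul_apply]
    generalize Coalgebra.comul (R := k) z = t
    induction t with
    | zero => simp
    | add a b ha hb => simp only [map_add, ha, hb]
    | tmul a b =>
      change contractL φ ((a ⊗ₜ[k] (1 : B)) * ((1 : H) ⊗ₜ[k] g'.ofConv b)) = g'.ofConv _
      rw [Algebra.TensorProduct.tmul_mul_tmul, mul_one, one_mul, contractL_tmul, contractL_tmul,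
        map_smul]
  rw [← key, ← key, comp_point_mul, ← mul_assoc]
  exact congrArg _ (hz _ _ (toConv (L.comp f.ofConv)))

/-- For a normal subgroup the invariants are also stable under right translations. -/
theorem ClosedSubgroup.IsNormal.contractR_mem_invariants (hA : A.IsNormal) {z : H}
    (hz : z ∈ A.invariants) (φ : H →ₗ[k] k) :
    contractR φ (Coalgebra.comul z) ∈ A.invariants := by
  intro B _ _ g f
  obtain ⟨f₁, hf₁⟩ := hA.exists_res g f
  have hf₂ : g * A.res f = A.res f₁ * g := by
    rw [← hf₁]
    group
  let x : WithConv (H →ₐ[k] B ⊗[k] H) := toConv Algebra.TensorProduct.includeRight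
  let L : B →ₐ[k] B ⊗[k] H := Algebra.TensorProduct.includeLeft
  have key : ∀ g' : WithConv (H →ₐ[k] B), contractR φ ((toConv (L.comp g'.ofConv) * x) z) =
      g' (contractR φ (Coalgebra.comul z)) := by
    intro g'
    rw [point_mul_apply]
    generalize Coalgebra.comul (R := k) z = t
    induction t with
    | zero => simp
    | add a b ha hb => simp only [map_add, ha, hb]
    | tmul a b =>
      change contractR φ ((g'.ofConv a ⊗ₜ[k] (1 : H)) * ((1 : B) ⊗ₜ[k] b)) = g'.ofConv _
      rw [Algebra.TensorProduct.tmul_mul_tmul, mul_one, one_mul, contractR_tmul, contractR_tmul,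
        map_smul]
  rw [hf₂, ← key, ← key, comp_point_mul, mul_assoc]
  exact congrArg _ (hA.left_invariant hz _ (toConv (L.comp f₁.ofConv)))

theorem ClosedSubgroup.IsNormal.antipode_mem_invariants (hA : A.IsNormal) {z : H}
    (hz : z ∈ A.invariants) : HopfAlgebra.antipode k z ∈ A.invariants := by
  intro B _ _ g f
  rw [← point_inv_apply, ← point_inv_apply, mul_inv_rev, ← map_inv]
  exact hA.left_invariant hz _ _

end Points

section Subcoalgebra

variable {k : Type u} [Field k] {C : Type v} [AddCommGroup C] [Module k C] [Coalgebra k C]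

theorem contractL_comul_contractL (f g : C →ₗ[k] k) (c : C) :
    contractL f (Coalgebra.comul (contractL g (Coalgebra.comul (R := k) c))) =
      contractL ((toConv g * toConv f).ofConv) (Coalgebra.comul (R := k) c) :=
  contractL_comul_comp f g Coalgebra.comul lTensor_comul_comp_comul c

theorem contractR_comul_contractL (f g : C →ₗ[k] k) (c : C) :
    contractR f (Coalgebra.comul (contractL g (Coalgebra.comul (R := k) c))) =
      contractL g (Coalgebra.comul (contractR f (Coalgebra.comul (R := k) c))) := by
  have h := congrArg (fun t => contractR f (contractL g t))
    (LinearMap.congr_fun (lTensor_comul_comp_comul (k := k) (C := C)) c)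
  simp only [LinearMap.comp_apply, contractL_lTensor] at h
  rw [h]
  have e1 : ∀ t : C ⊗[k] C, Coalgebra.comul (R := k) (contractR f t) =
      contractR f (LinearMap.rTensor C Coalgebra.comul t) := by
    intro t
    rw [contractR_rTensor]
  rw [e1]
  generalize LinearMap.rTensor C Coalgebra.comul (Coalgebra.comul (R := k) c) = t
  change contractR f (contractL g (TensorProduct.assoc k C C C t)) = _
  induction t with
  | zero => simp
  | add x y hx hy => simp only [map_add, hx, hy]
  | tmul s m =>
    induction s with
    | zero => simp
    | add x y hx hy => simp only [map_add, TensorProduct.add_tmul, hx, hy]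
    | tmul a b => simp [smul_smul, mul_comm]

/-- A subspace of a coalgebra stable under all contractions of the coproduct on both sides. -/
structure IsSubcoalgebra (D : Submodule k C) : Prop where
  left : ∀ d ∈ D, ∀ f : C →ₗ[k] k, contractL f (Coalgebra.comul d) ∈ D
  right : ∀ d ∈ D, ∀ f : C →ₗ[k] k, contractR f (Coalgebra.comul d) ∈ D

theorem IsSubcoalgebra.sup {D E : Submodule k C} (hD : IsSubcoalgebra D) (hE : IsSubcoalgebra E) :
    IsSubcoalgebra (D ⊔ E) := by
  constructor <;> intro x hx f <;> obtain ⟨d, hd, e, he, rfl⟩ := Submodule.mem_sup.1 hx <;>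
    rw [map_add, map_add]
  · exact Submodule.add_mem_sup (hD.left d hd f) (hE.left e he f)
  · exact Submodule.add_mem_sup (hD.right d hd f) (hE.right e he f)

/-- Every element of a coalgebra lies in a finite-dimensional subcoalgebra; it can be taken inside
any subspace that is stable under contractions. -/
theorem exists_finite_subcoalgebra {Z : Submodule k C} (hZ : IsSubcoalgebra Z) {c : C}
    (hc : c ∈ Z) : ∃ D : Submodule k C, FiniteDimensional k D ∧ IsSubcoalgebra D ∧ c ∈ D ∧
      D ≤ Z := by
  let L : (C →ₗ[k] k) →ₗ[k] (C →ₗ[k] C) := 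
    { toFun := fun f => contractL f ∘ₗ Coalgebra.comul
      map_add' := fun f g => by ext; simp [contractL, LinearMap.rTensor_add]
      map_smul' := fun a f => by ext; simp [contractL, LinearMap.rTensor_smul] }
  let R : (C →ₗ[k] k) →ₗ[k] C :=
    { toFun := fun f => contractR f (Coalgebra.comul c)
      map_add' := fun f g => by simp [contractR, LinearMap.lTensor_add]
      map_smul' := fun a f => by simp [contractR, LinearMap.lTensor_smul] }
  obtain ⟨V, hV, h⟩ := exists_finite_contractR (Coalgebra.comul (R := k) c)
  have hle : LinearMap.range R ≤ V := by
    rintro _ ⟨f, rfl⟩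
    exact h f
  have : FiniteDimensional k (LinearMap.range R) := Submodule.finiteDimensional_of_le hle
  obtain ⟨s, hs⟩ := (Module.Finite.iff_fg (N := LinearMap.range R)).1 inferInstance
  let D : Submodule k C := ⨆ x : s, LinearMap.range (L.flip x.1)
  have hfin : ∀ x : s, FiniteDimensional k (LinearMap.range (L.flip x.1)) := by
    intro x
    obtain ⟨W, hW, h'⟩ := exists_finite_contractL (Coalgebra.comul (R := k) x.1)
    refine Submodule.finiteDimensional_of_le (S₂ := W) ?_
    rintro _ ⟨f, rfl⟩
    exact h' f
  have hD : ∀ u ∈ LinearMap.range R, ∀ f, contractL f (Coalgebra.comul (R := k) u) ∈ D := by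
    intro u hu f
    rw [← hs] at hu
    induction hu using Submodule.span_induction with
    | mem x hx => exact Submodule.mem_iSup_of_mem ⟨x, hx⟩ ⟨f, rfl⟩
    | zero => simp
    | add x y _ _ hx hy => rw [map_add, map_add]; exact D.add_mem hx hy
    | smul a x _ hx => rw [map_smul, map_smul]; exact D.smul_mem a hx
  have hsR : ∀ x ∈ s, x ∈ LinearMap.range R := fun x hx => hs ▸ Submodule.subset_span hx
  have hind : ∀ (P : C → Prop),
      (∀ u ∈ LinearMap.range R, ∀ f, P (contractL f (Coalgebra.comul (R := k) u)))
      → P 0 → (∀ x y, P x → P y → P (x + y)) → ∀ d ∈ D, P d := by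
    intro P h1 h0 h2 d hd
    refine Submodule.iSup_induction _ (motive := P) hd (fun x y hy => ?_) h0 h2
    obtain ⟨f, rfl⟩ := hy
    exact h1 _ (hsR _ x.2) f
  refine ⟨D, inferInstance, ⟨fun d hd f => ?_, fun d hd f => ?_⟩, ?_, fun d hd => ?_⟩
  · refine hind (fun d => contractL f (Coalgebra.comul (R := k) d) ∈ D)
      (fun u hu g => ?_) (by simp) (fun x y hx hy => ?_) d hd
    · rw [contractL_comul_contractL]
      exact hD u hu _
    · rw [map_add, map_add]
      exact D.add_mem hx hy
  · refine hind (fun d => contractR f (Coalgebra.comul (R := k) d) ∈ D)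
      (fun u hu g => ?_) (by simp) (fun x y hx hy => ?_) d hd
    · rw [contractR_comul_contractL]
      obtain ⟨f', rfl⟩ := hu
      refine hD _ ⟨(toConv f * toConv f').ofConv, ?_⟩ g
      exact (contractR_comul_contractR _ _ _).symm
    · rw [map_add, map_add]
      exact D.add_mem hx hy
  · have h1 := hD c ⟨Coalgebra.counit, contractR_counit_comul c⟩ Coalgebra.counit
    rwa [contractL_counit_comul] at h1
  · refine hind (· ∈ Z) (fun u hu g => ?_) Z.zero_mem (fun x y => Z.add_mem) d hd
    obtain ⟨f', rfl⟩ := hu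
    exact hZ.left _ (hZ.right _ hc _) _

end Subcoalgebra

/-! ### The Nullstellensatz and Cartier's theorem -/

section Nullstellensatz

variable {k : Type*} [Field k] [IsAlgClosed k] {R : Type*} [CommRing R] [Algebra k R]
  [Algebra.FiniteType k R]

theorem nonempty_algHom [Nontrivial R] : Nonempty (R →ₐ[k] k) := by
  obtain ⟨M, hM⟩ := Ideal.exists_maximal R
  let _ : Field (R ⧸ M) := Ideal.Quotient.field M
  have : Algebra.FiniteType k (R ⧸ M) :=
    Algebra.FiniteType.of_surjective (Ideal.Quotient.mkₐ k M) Ideal.Quotient.mk_surjective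
  have : Module.Finite k (R ⧸ M) := finite_of_finite_type_of_isJacobsonRing k (R ⧸ M)
  have hb := IsAlgClosed.algebraMap_bijective_of_isIntegral (k := k) (K := R ⧸ M)
  exact ⟨((AlgEquiv.ofBijective (Algebra.ofId k (R ⧸ M)) hb).symm : (R ⧸ M) →ₐ[k] k).comp
    (Ideal.Quotient.mkₐ k M)⟩

/-- A proper ideal of a finitely generated algebra vanishes at some point. -/
theorem exists_point_of_ne_top {I : Ideal R} (hI : I ≠ ⊤) :
    ∃ g : R →ₐ[k] k, ∀ a ∈ I, g a = 0 := by
  have : Nontrivial (R ⧸ I) := Ideal.Quotient.nontrivial_iff.2 hI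
  have : Algebra.FiniteType k (R ⧸ I) :=
    Algebra.FiniteType.of_surjective (Ideal.Quotient.mkₐ k I) Ideal.Quotient.mk_surjective
  obtain ⟨g⟩ := nonempty_algHom (k := k) (R := R ⧸ I)
  refine ⟨g.comp (Ideal.Quotient.mkₐ k I), fun a ha => ?_⟩
  change g (Ideal.Quotient.mk I a) = 0
  rw [Ideal.Quotient.eq_zero_iff_mem.2 ha, map_zero]

end Nullstellensatz

section Exponential

variable {k : Type*} [Field k] {R : Type*} [CommRing R] [Algebra k R]

/-- The iterated Leibniz rule. -/
theorem iterate_leibniz (D : Module.End k R) (hD : ∀ a b, D (a * b) = D a * b + a * D b) (n : ℕ)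
    (a b : R) : (D ^ n) (a * b) =
      ∑ m ∈ Finset.HasAntidiagonal.antidiagonal n, n.choose m.1 • ((D ^ m.1) a * (D ^ m.2) b) := by
  let X : Module.End k (R ⊗[k] R) := LinearMap.rTensor R D
  let Y : Module.End k (R ⊗[k] R) := LinearMap.lTensor R D
  have hXY : Commute X Y := by
    change X ∘ₗ Y = Y ∘ₗ X
    rw [LinearMap.rTensor_comp_lTensor, LinearMap.lTensor_comp_rTensor]
  have h1 : ∀ n, (D ^ n) ∘ₗ LinearMap.mul' k R = LinearMap.mul' k R ∘ₗ ((X + Y) ^ n) := by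
    intro n
    induction n with
    | zero => rfl
    | succ n ih =>
      have h2 : D ∘ₗ LinearMap.mul' k R = LinearMap.mul' k R ∘ₗ (X + Y) := by
        ext a b
        simp [X, Y, hD]
      rw [pow_succ', pow_succ', Module.End.mul_eq_comp, Module.End.mul_eq_comp,
        LinearMap.comp_assoc, ih, ← LinearMap.comp_assoc, h2, LinearMap.comp_assoc]
  have h3 := LinearMap.congr_fun (h1 n) (a ⊗ₜ b)
  rw [hXY.add_pow'] at h3
  simpa [X, Y, LinearMap.rTensor_pow, LinearMap.lTensor_pow, LinearMap.sum_apply,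
    -nsmul_eq_mul] using h3

/-- The formal flow `a ↦ ∑ ε(Dⁿ a) Tⁿ / n!` of an endomorphism. -/
def expLin (ε : R →ₐ[k] k) (D : Module.End k R) : R →ₗ[k] PowerSeries k where
  toFun a := PowerSeries.mk fun n => (n.factorial : k)⁻¹ * ε ((D ^ n) a)
  map_add' a b := by ext n; simp [mul_add]
  map_smul' c a := by ext n; simp [mul_left_comm]

theorem coeff_expLin (ε : R →ₐ[k] k) (D : Module.End k R) (n : ℕ) (a : R) :
    PowerSeries.coeff n (expLin ε D a) = (n.factorial : k)⁻¹ * ε ((D ^ n) a) :=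
  PowerSeries.coeff_mk n fun n => (n.factorial : k)⁻¹ * ε ((D ^ n) a)

/-- The formal flow of a derivation is an algebra map to power series. -/
def expHom [CharZero k] (ε : R →ₐ[k] k) (D : Module.End k R)
    (hD : ∀ a b, D (a * b) = D a * b + a * D b) :
    R →ₐ[k] PowerSeries k :=
  AlgHom.ofLinearMap (expLin ε D)
    (by
      have h1 : D 1 = 0 := by simpa using hD 1 1
      ext n
      rw [coeff_expLin, PowerSeries.coeff_one]
      cases n with
      | zero => simp
      | succ n => simp [pow_succ, h1])
    (fun a b => by
      ext n
      rw [coeff_expLin, PowerSeries.coeff_mul, iterate_leibniz D hD, map_sum, Finset.mul_sum]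
      refine Finset.sum_congr rfl fun m hm => ?_
      rw [Finset.HasAntidiagonal.mem_antidiagonal] at hm
      subst hm
      rw [coeff_expLin, coeff_expLin, map_nsmul, map_mul, nsmul_eq_mul,
        Nat.choose_symm_add, Nat.add_choose,
        Nat.cast_div (Nat.factorial_mul_factorial_dvd_factorial_add _ _)
          (by exact_mod_cast (Nat.mul_ne_zero (Nat.factorial_ne_zero _) (Nat.factorial_ne_zero _)))]
      have h1 : ((m.1 + m.2).factorial : k) ≠ 0 := Nat.cast_ne_zero.2 (Nat.factorial_ne_zero _)
      have h2 : (m.1.factorial : k) ≠ 0 := Nat.cast_ne_zero.2 (Nat.factorial_ne_zero _)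
      have h3 : (m.2.factorial : k) ≠ 0 := Nat.cast_ne_zero.2 (Nat.factorial_ne_zero _)
      push_cast
      field_simp)

theorem coeff_expHom [CharZero k] (ε : R →ₐ[k] k) (D : Module.End k R)
    (hD : ∀ a b, D (a * b) = D a * b + a * D b) (n : ℕ) (a : R) :
    PowerSeries.coeff n (expHom ε D hD a) = (n.factorial : k)⁻¹ * ε ((D ^ n) a) :=
  coeff_expLin ε D n a

end Exponential

section Symbols

/-- Modulo `𝔪ᵈ⁺¹` every element of `𝔪ᵈ` is a form of degree `d` in generators of `𝔪` modulo `𝔪²`. -/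
theorem exists_isHomogeneous {k : Type*} [Field k] {R : Type*} [CommRing R] [Algebra k R]
    (ε : R →ₐ[k] k) {ι : Type*} (y : ι → R) (hy : ∀ i, ε (y i) = 0)
    (hspan : ∀ x, ε x = 0 → ∃ w ∈ Submodule.span k (Set.range y), x - w ∈ RingHom.ker ε ^ 2)
    (d : ℕ) (t : R) (ht : t ∈ RingHom.ker ε ^ d) :
    ∃ F : MvPolynomial ι k, F.IsHomogeneous d ∧
      t - MvPolynomial.aeval y F ∈ RingHom.ker ε ^ (d + 1) := by
  have hlin : ∀ w ∈ Submodule.span k (Set.range y), ∃ F : MvPolynomial ι k, F.IsHomogeneous 1 ∧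
      MvPolynomial.aeval y F = w := by
    intro w hw
    induction hw using Submodule.span_induction with
    | mem x hx =>
      obtain ⟨i, rfl⟩ := hx
      exact ⟨MvPolynomial.X i, MvPolynomial.isHomogeneous_X _ _, by simp⟩
    | zero => exact ⟨0, MvPolynomial.isHomogeneous_zero _ _ _, by simp⟩
    | add a b _ _ ha hb =>
      obtain ⟨F, hF, rfl⟩ := ha
      obtain ⟨F', hF', rfl⟩ := hb
      exact ⟨F + F', hF.add hF', by simp⟩
    | smul c a _ ha =>
      obtain ⟨F, hF, rfl⟩ := ha
      refine ⟨MvPolynomial.C c * F, ?_, by simp [Algebra.smul_def]⟩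
      simpa using (MvPolynomial.isHomogeneous_C ι c).mul hF
  have hmem : ∀ (d : ℕ) (F : MvPolynomial ι k), F.IsHomogeneous d →
      MvPolynomial.aeval y F ∈ RingHom.ker ε ^ d := by
    intro d F hF
    rw [F.as_sum, map_sum]
    refine Ideal.sum_mem _ fun m hm => ?_
    rw [MvPolynomial.aeval_monomial]
    refine Ideal.mul_mem_left _ _ ?_
    have hd : m.degree = d := by
      rw [← hF (MvPolynomial.mem_support_iff.1 hm)]
      simp [Finsupp.weight_apply, Finsupp.degree_apply, Finsupp.sum]
    rw [← hd, Finsupp.degree_apply, Finsupp.prod, ← Finset.prod_pow_eq_pow_sum]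
    exact Ideal.prod_mem_prod fun i _ => Ideal.pow_mem_pow (hy i) _
  induction d generalizing t with
  | zero =>
    refine ⟨MvPolynomial.C (ε t), MvPolynomial.isHomogeneous_C _ _, ?_⟩
    rw [zero_add, pow_one, RingHom.mem_ker]
    simp
  | succ d ih =>
    rw [pow_succ] at ht
    induction ht using Submodule.mul_induction_on' with
    | mem_mul_mem a ha b hb =>
      obtain ⟨F, hF, hF'⟩ := ih a ha
      obtain ⟨w, hw, hw'⟩ := hspan b hb
      obtain ⟨L, hL, rfl⟩ := hlin w hw
      refine ⟨F * L, hF.mul hL, ?_⟩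
      have e : a * b - MvPolynomial.aeval y (F * L) =
          (a - MvPolynomial.aeval y F) * b + MvPolynomial.aeval y F *
            (b - MvPolynomial.aeval y L) := by
        rw [map_mul]
        ring
      rw [e]
      refine Ideal.add_mem _ ?_ ?_
      · rw [pow_succ]
        exact Ideal.mul_mem_mul hF' hb
      · rw [add_assoc, pow_add]
        exact Ideal.mul_mem_mul (hmem d F hF) hw'
    | add a _ b _ ha hb =>
      obtain ⟨F, hF, hF'⟩ := ha
      obtain ⟨L, hL, hL'⟩ := hb
      refine ⟨F + L, hF.add hL, ?_⟩
      rw [map_add, add_sub_add_comm]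
      exact Ideal.add_mem _ hF' hL'

end Symbols

section Cartier

variable {k : Type u} [Field k] {H : Type v} [CommRing H] [HopfAlgebra k H]

/-- Right translation of functions by a point. -/
def translate (g : H →ₐ[k] k) : H →ₐ[k] H :=
  (Algebra.TensorProduct.rid k k H).toAlgHom.comp
    ((Algebra.TensorProduct.map (AlgHom.id k H) g).comp (Bialgebra.comulAlgHom k H))

theorem translate_apply (g : H →ₐ[k] k) (a : H) :
    translate g a = rAct (toConv g.toLinearMap) a := rfl

theorem translate_inv (g : WithConv (H →ₐ[k] k)) (a : H) :
    translate g⁻¹.ofConv (translate g.ofConv a) = a := by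
  have h : (toConv g⁻¹.ofConv.toLinearMap * toConv g.ofConv.toLinearMap : Dual1 k H) = 1 :=
    congrArg (fun f : WithConv (H →ₐ[k] k) => toConv f.ofConv.toLinearMap) (inv_mul_cancel g)
  rw [translate_apply, translate_apply, rAct_rAct, h, rAct_one]

theorem apply_translate_inv (g : WithConv (H →ₐ[k] k)) (a : H) :
    g (translate g⁻¹.ofConv a) = Coalgebra.counit (R := k) a := by
  have h : (toConv g.ofConv.toLinearMap * toConv g⁻¹.ofConv.toLinearMap : Dual1 k H) = 1 :=
    congrArg (fun f : WithConv (H →ₐ[k] k) => toConv f.ofConv.toLinearMap) (mul_inv_cancel g)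
  have h2 := apply_rAct (toConv g⁻¹.ofConv.toLinearMap) (toConv g.ofConv.toLinearMap) a
  rw [h] at h2
  exact h2

/-- A derivation at the identity extends to a derivation of `H` that is invariant under
translations. -/
theorem rAct_mul_of_derivation (δ : H →ₗ[k] k) (hδ : ∀ a b, δ (a * b) =
    δ a * Coalgebra.counit (R := k) b + Coalgebra.counit (R := k) a * δ b) (a b : H) :
    rAct (toConv δ) (a * b) = rAct (toConv δ) a * b + a * rAct (toConv δ) b := by
  have key : ∀ s t : H ⊗[k] H, contractR δ (s * t) = contractR δ s * contractR Coalgebra.counit t +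
      contractR Coalgebra.counit s * contractR δ t := by
    intro s t
    induction s with
    | zero => simp
    | add x y hx hy =>
      simp only [map_add, add_mul, hx, hy]
      ring
    | tmul c d =>
      induction t with
      | zero => simp
      | add x y hx hy =>
        simp only [map_add, mul_add, hx, hy]
        ring
      | tmul c' d' =>
        simp only [Algebra.TensorProduct.tmul_mul_tmul, contractR_tmul, hδ, add_smul,
          smul_mul_smul_comm]
  rw [rAct_apply, rAct_apply, rAct_apply, Bialgebra.comul_mul, key, contractR_counit_comul,
    contractR_counit_comul]

variable [IsAlgClosed k] [Algebra.FiniteType k H]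

/-- In characteristic zero a nilpotent function `t` vanishes to infinite order at the identity. By
induction, `t` is modulo `𝔪ᵈ⁺¹` a form `F` of degree `d` in generators of the maximal ideal `𝔪`. The
formal flow of the invariant derivation with tangent vector `s` kills `t`, as there are no nilpotent
power series, while its coefficient of degree `d` on `t` is `F(s)`. Hence `F = 0`. -/
theorem mem_pow_of_isNilpotent [CharZero k] {t : H} (ht : IsNilpotent t) (d : ℕ) :
    t ∈ RingHom.ker (Bialgebra.counitAlgHom k H) ^ d := by
  set 𝔪 := RingHom.ker (Bialgebra.counitAlgHom k H) with h𝔪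
  have : IsNoetherianRing H := Algebra.FiniteType.isNoetherianRing k H
  let U : Submodule k H := Submodule.span k {1} ⊔ (𝔪 ^ 2).restrictScalars k
  have hfin : FiniteDimensional k (H ⧸ U) := by
    obtain ⟨s, hs⟩ := (isNoetherianRing_iff_ideal_fg H).1 this 𝔪
    have htop : Submodule.span k (U.mkQ '' s) = ⊤ := by
      rw [eq_top_iff]
      rintro x -
      obtain ⟨h, rfl⟩ := U.mkQ_surjective x
      have e : h - algebraMap k H (Coalgebra.counit h) ∈ 𝔪 := by
        rw [h𝔪, RingHom.mem_ker]
        simp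
      have e2 : U.mkQ h = U.mkQ (h - algebraMap k H (Coalgebra.counit h)) := by
        rw [map_sub, eq_comm, sub_eq_self, Submodule.mkQ_apply, Submodule.Quotient.mk_eq_zero,
          Algebra.algebraMap_eq_smul_one]
        exact Submodule.mem_sup_left (Submodule.smul_mem _ _ (Submodule.mem_span_singleton_self _))
      rw [e2]
      generalize h - algebraMap k H (Coalgebra.counit h) = h at e
      rw [← hs] at e
      induction e using Submodule.span_induction with
      | mem x hx => exact Submodule.subset_span ⟨x, hx, rfl⟩
      | zero => simp
      | add x y _ _ hx hy => rw [map_add]; exact Submodule.add_mem _ hx hy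
      | smul a x hx' hx =>
        have hx'' : x ∈ 𝔪 := by rw [← hs]; exact hx'
        have e3 : a • x - Coalgebra.counit (R := k) a • x ∈ U := by
          refine Submodule.mem_sup_right ?_
          change _ ∈ 𝔪 ^ 2
          rw [smul_eq_mul, Algebra.smul_def, ← sub_mul, pow_two]
          refine Ideal.mul_mem_mul ?_ hx''
          rw [h𝔪, RingHom.mem_ker]
          simp
        have e4 : U.mkQ (a • x) = Coalgebra.counit (R := k) a • U.mkQ x := by
          rw [← map_smul, ← sub_eq_zero, ← map_sub, Submodule.mkQ_apply,
            Submodule.Quotient.mk_eq_zero]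
          exact e3
        rw [e4]
        exact Submodule.smul_mem _ _ hx
    classical
    exact ⟨⟨s.image U.mkQ, by rw [Finset.coe_image]; exact htop⟩⟩
  let b := Module.finBasis k (H ⧸ U)
  choose y' hy' using fun i => U.mkQ_surjective (b i)
  let y : Fin (Module.finrank k (H ⧸ U)) → H :=
    fun i => y' i - algebraMap k H (Coalgebra.counit (y' i))
  have hyε : ∀ i, Bialgebra.counitAlgHom k H (y i) = 0 := fun i => by simp [y]
  have hone : U.mkQ 1 = 0 := by
    rw [Submodule.mkQ_apply, Submodule.Quotient.mk_eq_zero]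
    exact Submodule.mem_sup_left (Submodule.mem_span_singleton_self _)
  have hyb : ∀ i, U.mkQ (y i) = b i := fun i => by
    rw [← hy' i, map_sub, Algebra.algebraMap_eq_smul_one, map_smul, hone, smul_zero, sub_zero]
  have hspan : ∀ x, Bialgebra.counitAlgHom k H x = 0 →
      ∃ w ∈ Submodule.span k (Set.range y), x - w ∈ 𝔪 ^ 2 := by
    intro x hx
    refine ⟨∑ i, b.repr (U.mkQ x) i • y i, Submodule.sum_mem _ fun i _ =>
      Submodule.smul_mem _ _ (Submodule.subset_span ⟨i, rfl⟩), ?_⟩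
    have h1 : x - ∑ i, b.repr (U.mkQ x) i • y i ∈ U := by
      rw [← Submodule.Quotient.mk_eq_zero, ← Submodule.mkQ_apply, map_sub, map_sum]
      simp only [map_smul, hyb]
      rw [b.sum_repr, sub_self]
    obtain ⟨c, hc, w, hw, h2⟩ := Submodule.mem_sup.1 h1
    obtain ⟨c, rfl⟩ := Submodule.mem_span_singleton.1 hc
    have hw' : Bialgebra.counitAlgHom k H w = 0 := by
      have := Ideal.pow_le_self two_ne_zero hw
      exact this
    have h3 := congrArg (Bialgebra.counitAlgHom k H) h2
    rw [map_add, hw', map_sub, hx, map_sum] at h3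
    simp only [map_smul, hyε] at h3
    have hc0 : c = 0 := by simpa using h3
    rw [← h2, hc0, zero_smul, zero_add]
    exact hw
  induction d with
  | zero => simp
  | succ d ih =>
    obtain ⟨F, hF, hF'⟩ := exists_isHomogeneous _ y hyε hspan d t ih
    have hF0 : F = 0 := by
      apply MvPolynomial.funext
      intro s
      rw [map_zero]
      -- the derivation at the identity with prescribed values on the generators
      let δ : H →ₗ[k] k := (∑ i, s i • b.coord i) ∘ₗ U.mkQ
      have hδy : ∀ i, δ (y i) = s i := fun i => by
        change (∑ j, s j • b.coord j) (U.mkQ (y i)) = s i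
        rw [hyb, LinearMap.sum_apply, Finset.sum_eq_single i]
        · simp
        · intro j _ hj
          simp [Finsupp.single_eq_of_ne hj]
        · simp
      have hδ1 : δ 1 = 0 := by
        change (∑ j, s j • b.coord j) (U.mkQ 1) = 0
        rw [hone, map_zero]
      have hδ : ∀ a c, δ (a * c) =
          δ a * Coalgebra.counit (R := k) c + Coalgebra.counit (R := k) a * δ c := by
        intro a c
        have h1 : (a - algebraMap k H (Coalgebra.counit a)) *
            (c - algebraMap k H (Coalgebra.counit c)) ∈ U := by
          refine Submodule.mem_sup_right ?_
          change _ ∈ 𝔪 ^ 2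
          rw [pow_two]
          refine Ideal.mul_mem_mul ?_ ?_ <;> rw [h𝔪, RingHom.mem_ker] <;> simp
        have h2 : δ ((a - algebraMap k H (Coalgebra.counit a)) *
            (c - algebraMap k H (Coalgebra.counit c))) = 0 := by
          change (∑ j, s j • b.coord j) (U.mkQ _) = 0
          rw [Submodule.mkQ_apply, (Submodule.Quotient.mk_eq_zero U).2 h1, map_zero]
        have h3 : (a - algebraMap k H (Coalgebra.counit a)) *
            (c - algebraMap k H (Coalgebra.counit c)) = a * c - Coalgebra.counit (R := k) a • c -
            Coalgebra.counit (R := k) c • a +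
              (Coalgebra.counit (R := k) a * Coalgebra.counit (R := k) c) • (1 : H) := by
          simp only [Algebra.smul_def, map_mul]
          ring
        rw [h3, map_add, map_sub, map_sub, map_smul, map_smul, map_smul, hδ1, smul_zero, add_zero]
          at h2
        simp only [smul_eq_mul] at h2
        linear_combination h2
      let φ := expHom (Bialgebra.counitAlgHom k H) (rAct (toConv δ)) (rAct_mul_of_derivation δ hδ)
      have hφt : φ t = 0 := (ht.map φ).eq_zero
      have hφm : ∀ x ∈ 𝔪, PowerSeries.X ∣ φ x := by
        intro x hx
        rw [PowerSeries.X_dvd_iff, ← PowerSeries.coeff_zero_eq_constantCoeff_apply, coeff_expHom]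
        simpa using (show Coalgebra.counit (R := k) x = 0 from hx)
      choose u hu using fun i => hφm (y i) (hyε i)
      have hus : ∀ i, PowerSeries.constantCoeff (u i) = s i := by
        intro i
        have h1 : PowerSeries.coeff 1 (φ (y i)) = s i := by
          rw [coeff_expHom, ← hδy i]
          have h2 := apply_rAct (toConv δ) (1 : Dual1 k H) (y i)
          rw [one_mul] at h2
          simpa using h2
        rw [← h1, hu i, ← PowerSeries.coeff_zero_eq_constantCoeff_apply]
        exact (PowerSeries.coeff_succ_X_mul 0 (u i)).symm
      have h1 : PowerSeries.X ^ (d + 1) ∣ φ (t - MvPolynomial.aeval y F) := by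
        have hmap : 𝔪.map φ ≤ Ideal.span {PowerSeries.X} := by
          rw [Ideal.map_le_iff_le_comap]
          intro x hx
          exact Ideal.mem_span_singleton.2 (hφm x hx)
        have h2 := Ideal.mem_map_of_mem φ hF'
        rw [Ideal.map_pow] at h2
        have h3 := Ideal.pow_right_mono hmap (d + 1) h2
        rwa [Ideal.span_singleton_pow, Ideal.mem_span_singleton] at h3
      rw [map_sub, hφt, zero_sub, dvd_neg] at h1
      have h2 : φ (MvPolynomial.aeval y F) = PowerSeries.X ^ d * MvPolynomial.aeval u F := by
        rw [MvPolynomial.comp_aeval_apply]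
        have e : (φ ∘ y) = fun i => PowerSeries.X * u i := funext hu
        change MvPolynomial.aeval (φ ∘ y) F = _
        rw [e, F.as_sum, map_sum, map_sum, Finset.mul_sum]
        refine Finset.sum_congr rfl fun m hm => ?_
        have hd : m.degree = d := by
          rw [← hF (MvPolynomial.mem_support_iff.1 hm)]
          simp [Finsupp.weight_apply, Finsupp.degree_apply, Finsupp.sum]
        rw [MvPolynomial.aeval_monomial, MvPolynomial.aeval_monomial, ← hd, Finsupp.degree_apply,
          ← Finset.prod_pow_eq_pow_sum]
        simp only [Finsupp.prod, mul_pow, Finset.prod_mul_distrib]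
        ring
      rw [h2, pow_succ] at h1
      have h3 := (mul_dvd_mul_iff_left (pow_ne_zero d PowerSeries.X_ne_zero)).1 h1
      rw [PowerSeries.X_dvd_iff] at h3
      rw [← h3]
      clear h3 h2 h1 hF' hF
      induction F using MvPolynomial.induction_on with
      | C a => simp
      | add p q hp hq => simp only [map_add, hp, hq]
      | mul_X p i hp => simp only [map_mul, hp, MvPolynomial.eval_X, MvPolynomial.aeval_X, hus]
    rw [hF0, map_zero, sub_zero] at hF'
    exact hF'

/-- Cartier's theorem: in characteristic zero the function algebra of an algebraic group is reduced.
A nilpotent function vanishes near the identity by Krull's intersection theorem, and near every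
other point by translation. -/
theorem isReduced_of_charZero [CharZero k] : IsReduced H := by
  have : IsNoetherianRing H := Algebra.FiniteType.isNoetherianRing k H
  refine ⟨fun t ht => ?_⟩
  have hann : ∀ t : H, IsNilpotent t → ∃ s, Coalgebra.counit (R := k) s = 1 ∧ s * t = 0 := by
    intro t ht
    have h1 : t ∈ (⨅ i : ℕ, RingHom.ker (Bialgebra.counitAlgHom k H) ^ i • ⊤ : Submodule H H) := by
      rw [Submodule.mem_iInf]
      intro i
      rw [smul_eq_mul, Ideal.mul_top]
      exact mem_pow_of_isNilpotent ht i
    obtain ⟨r, hr⟩ := (Ideal.mem_iInf_smul_pow_eq_bot_iff _ t).1 h1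
    refine ⟨1 - r.1, ?_, ?_⟩
    · have h2 : Coalgebra.counit (R := k) r.1 = 0 := r.2
      rw [map_sub, h2, Bialgebra.counit_one, sub_zero]
    · rw [sub_mul, one_mul, sub_eq_zero]
      exact hr.symm
  by_contra hne
  have htop : Ideal.span {t} ≠ ⊥ := by simpa using hne
  have hI : (Submodule.span H {t}).annihilator ≠ ⊤ := by
    rw [Ne, Submodule.annihilator_eq_top_iff]
    exact htop
  obtain ⟨g, hg⟩ := exists_point_of_ne_top (k := k) hI
  obtain ⟨s, hs, hst⟩ := hann (translate g t) (ht.map _)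
  have h1 := congrArg (translate (toConv g)⁻¹.ofConv) hst
  rw [map_mul, map_zero, translate_inv (toConv g)] at h1
  have h2 := hg (translate (toConv g)⁻¹.ofConv s) (by
    rw [Submodule.mem_annihilator_span_singleton]
    exact h1)
  have h3 := apply_translate_inv (toConv g) s
  rw [hs] at h3
  exact zero_ne_one (h2.symm.trans h3)

end Cartier

/-! ### Relative invariants of a commutative normal subgroup -/

section Local

variable {k : Type*} [Field k]

/-- In a finite-dimensional algebra, an idempotent cuts out the local factor at a point. -/
theorem exists_idempotent {P : Type*} [CommRing P] [Algebra k P] [FiniteDimensional k P]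
    (ε : P →ₐ[k] k) : ∃ (e : P) (n : ℕ), ε e = 1 ∧ ∀ x ∈ RingHom.ker ε ^ n, e * x = 0 := by
  have : IsArtinianRing P := IsArtinianRing.of_finite k P
  obtain ⟨n, hn⟩ := IsArtinian.monotone_stabilizes
    ⟨fun n : ℕ => OrderDual.toDual ((RingHom.ker ε) ^ n), fun m n h => Ideal.pow_le_pow_right h⟩
  have hn' : ∀ m, n ≤ m → RingHom.ker ε ^ n = RingHom.ker ε ^ m := fun m h =>
    congrArg OrderDual.ofDual (hn m h)
  have hid : IsIdempotentElem (RingHom.ker ε ^ (n + 1)) := by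
    change _ * _ = _
    rw [← pow_add, ← hn' (n + 1) (by omega), ← hn' _ (by omega)]
  obtain ⟨e, he, he'⟩ := (Ideal.isIdempotentElem_iff_of_fg _
    ((isNoetherianRing_iff_ideal_fg P).1 inferInstance _)).1 hid
  have heε : ε e = 0 := by
    have h1 : e ∈ RingHom.ker ε ^ (n + 1) := by rw [he']; exact Submodule.mem_span_singleton_self e
    exact Ideal.pow_le_self (by omega) h1
  refine ⟨1 - e, n + 1, by rw [map_sub, map_one, heε, sub_zero], fun x hx => ?_⟩
  rw [he'] at hx
  obtain ⟨y, rfl⟩ := Submodule.mem_span_singleton.1 hx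
  rw [smul_eq_mul, mul_left_comm, sub_mul, one_mul, he.eq, sub_self, mul_zero]

/-- An element of `P ⊗ Q` agrees with its value at a point of `P` modulo the ideal of that point. -/
theorem sub_one_tmul_mem {P Q : Type*} [CommRing P] [Algebra k P] [CommRing Q] [Algebra k Q]
    (ε : P →ₐ[k] k) (t : P ⊗[k] Q) :
    t - 1 ⊗ₜ contractL ε.toLinearMap t ∈
      (RingHom.ker ε).map (Algebra.TensorProduct.includeLeft : P →ₐ[k] P ⊗[k] Q) := by
  induction t with
  | zero => simp
  | add x y hx hy =>
    rw [map_add, TensorProduct.tmul_add, add_sub_add_comm]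
    exact Ideal.add_mem _ hx hy
  | tmul p q =>
    have e : p ⊗ₜ[k] q - 1 ⊗ₜ contractL ε.toLinearMap (p ⊗ₜ[k] q) =
        (1 ⊗ₜ q) * (Algebra.TensorProduct.includeLeft : P →ₐ[k] P ⊗[k] Q)
          (p - algebraMap k P (ε p)) := by
      rw [contractL_tmul, Algebra.TensorProduct.includeLeft_apply,
        Algebra.TensorProduct.tmul_mul_tmul, one_mul, mul_one, TensorProduct.sub_tmul,
        Algebra.algebraMap_eq_smul_one, TensorProduct.smul_tmul]
      rfl
    rw [e]
    refine Ideal.mul_mem_left _ _ (Ideal.mem_map_of_mem _ ?_)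
    rw [RingHom.mem_ker]
    simp

/-- Over a finite-dimensional base `P`, a family `t` is constant near a point, up to a power. In
characteristic `p` the power is one by which Frobenius kills the maximal ideal of the local factor
at the point; in characteristic zero `P` is assumed reduced, so that this local factor is a field
and no power is needed. -/
theorem exists_pow_eq {P Q : Type*} [CommRing P] [Algebra k P] [FiniteDimensional k P] [CommRing Q]
    [Algebra k Q] (ε : P →ₐ[k] k) (ε' : Q →ₐ[k] k) (hred : CharZero k → IsReduced P)
    (t : P ⊗[k] Q) :
    ∃ (e : P) (m : ℕ), ε e = 1 ∧ m ≠ 0 ∧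
      (e ⊗ₜ[k] (1 : Q)) * t ^ m = e ⊗ₜ ((contractL ε.toLinearMap t) ^ m) := by
  obtain ⟨e, n, he, hen⟩ := exists_idempotent ε
  set l := contractL ε.toLinearMap t with hl
  have h1 := sub_one_tmul_mem ε t
  rw [← hl] at h1
  have hkill : ∀ (I : Ideal P), (∀ x ∈ I, e * x = 0) →
      ∀ y ∈ I.map (Algebra.TensorProduct.includeLeft : P →ₐ[k] P ⊗[k] Q),
        (e ⊗ₜ[k] (1 : Q)) * y = 0 := by
    intro I hI y hy
    induction hy using Submodule.span_induction with
    | mem x hx =>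
      obtain ⟨x, hx, rfl⟩ := hx
      change (e ⊗ₜ[k] (1 : Q)) * (x ⊗ₜ[k] (1 : Q)) = 0
      rw [Algebra.TensorProduct.tmul_mul_tmul, hI x hx, TensorProduct.zero_tmul]
    | zero => rw [mul_zero]
    | add a b _ _ ha hb => rw [mul_add, ha, hb, add_zero]
    | smul a b _ hb => rw [smul_eq_mul, mul_left_comm, hb, mul_zero]
  obtain ⟨p, hp⟩ := CharP.exists k
  rcases CharP.char_is_prime_or_zero k p with hpr | rfl
  · have : Fact p.Prime := ⟨hpr⟩
    have hnt : Nontrivial (P ⊗[k] Q) :=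
      (Algebra.TensorProduct.lift ε ε' (fun _ _ => mul_comm _ _)).toRingHom.domain_nontrivial
    have : CharP (P ⊗[k] Q) p :=
      charP_of_injective_algebraMap (algebraMap k (P ⊗[k] Q)).injective p
    refine ⟨e, p ^ n, he, pow_ne_zero _ hpr.ne_zero, ?_⟩
    have h2 := Ideal.pow_mem_pow h1 (p ^ n)
    have h3 := Ideal.pow_le_pow_right (n.lt_pow_self hpr.one_lt).le h2
    rw [← Ideal.map_pow] at h3
    have h4 := hkill _ hen _ h3
    rw [sub_pow_char_pow, mul_sub, sub_eq_zero, Algebra.TensorProduct.tmul_pow, one_pow,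
      Algebra.TensorProduct.tmul_mul_tmul, mul_one, one_mul] at h4
    exact h4
  · have : CharZero k := CharP.charP_to_charZero k
    have := hred this
    refine ⟨e, 1, he, one_ne_zero, ?_⟩
    have h2 : ∀ x ∈ RingHom.ker ε, e * x = 0 := by
      intro x hx
      have h3 : IsNilpotent (e * x) := by
        refine ⟨n + 1, ?_⟩
        rw [mul_pow, pow_succ e, mul_assoc, hen, mul_zero]
        exact Ideal.pow_le_pow_right (Nat.le_succ n) (Ideal.pow_mem_pow hx _)
      exact h3.eq_zero
    have h4 := hkill _ h2 _ h1
    rw [mul_sub, sub_eq_zero, Algebra.TensorProduct.tmul_mul_tmul, mul_one, one_mul] at h4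
    rw [pow_one, pow_one]
    exact h4

end Local

section SemiInvariant

variable {k : Type u} [Field k] {H : Type v} [CommRing H] [HopfAlgebra k H]
  {A : ClosedSubgroup k H}

/-- The algebra map out of `O(G) ⊗ O(A)` given by a point of `G` and a point of `A`. -/
def pairHom {B : Type*} [CommRing B] [Algebra k B] (g : WithConv (H →ₐ[k] B))
    (f : WithConv (A.Fun →ₐ[k] B)) : H ⊗[k] A.Fun →ₐ[k] B :=
  Algebra.TensorProduct.lift g.ofConv f.ofConv (fun _ _ => mul_comm _ _)

/-- `A.conj` is the universal conjugate. -/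
theorem pairHom_conj {B : Type*} [CommRing B] [Algebra k B] (g : WithConv (H →ₐ[k] B))
    (f : WithConv (A.Fun →ₐ[k] B)) (a : H) : pairHom g f (A.conj a) = (g * A.res f * g⁻¹) a := by
  have e1 : (pairHom g f).comp Algebra.TensorProduct.includeLeft = g.ofConv := by
    ext b
    change g b * f.ofConv 1 = g b
    rw [map_one, mul_one]
  have e2 : (pairHom g f).comp ((Algebra.TensorProduct.includeRight).comp
      (Ideal.Quotient.mkₐ k A.ideal)) = (A.res f).ofConv := by
    ext b
    change g.ofConv 1 * (A.res f).ofConv b = (A.res f).ofConv b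
    rw [map_one, one_mul]
  have e : g * A.res f * g⁻¹ = toConv ((pairHom g f).comp A.conj.ofConv) := by
    rw [ClosedSubgroup.conj, AlgHom.comp_convMul_distrib, AlgHom.comp_convMul_distrib]
    simp only [← AlgHom.comp_assoc] at e2 ⊢
    rw [e2, e1]
    rfl
  rw [e]
  rfl

variable {h : H}

/-- If `h` restricts to a character on `A`, so do all its conjugates. -/
theorem conj_mul_apply (hA : A.IsNormal) (hmul : ∀ (B : Type v) [CommRing B] [Algebra k B]
    (g : WithConv (H →ₐ[k] B)) (f : WithConv (A.Fun →ₐ[k] B)),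
    (g * A.res f) h = g h * A.res f h) (B : Type v) [CommRing B] [Algebra k B]
    (g : WithConv (H →ₐ[k] B)) (f₁ f₂ : WithConv (A.Fun →ₐ[k] B)) :
    pairHom g (f₁ * f₂) (A.conj h) = pairHom g f₁ (A.conj h) * pairHom g f₂ (A.conj h) := by
  obtain ⟨f₁', h₁⟩ := hA.exists_res g f₁
  obtain ⟨f₂', h₂⟩ := hA.exists_res g f₂
  rw [pairHom_conj, pairHom_conj, pairHom_conj, h₁, h₂, ← hmul B (A.res f₁') f₂', ← h₁, ← h₂,
    map_mul]
  congr 2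
  group

/-- A point `L` of `A × A`, composed with the product of `A`, is the product of the two components
of `L`. -/
theorem comp_comul_eq_mul {B : Type*} [CommRing B] [Algebra k B] (L : A.Fun ⊗[k] A.Fun →ₐ[k] B) :
    toConv (L.comp (Bialgebra.comulAlgHom k A.Fun)) =
      toConv (L.comp Algebra.TensorProduct.includeLeft) *
        toConv (L.comp Algebra.TensorProduct.includeRight) := by
  apply WithConv.ext
  apply AlgHom.ext
  intro q
  change L (Coalgebra.comul q) = LinearMap.mul' k B (TensorProduct.map
    (L.comp Algebra.TensorProduct.includeLeft).toLinearMap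
    (L.comp Algebra.TensorProduct.includeRight).toLinearMap (Coalgebra.comul q))
  generalize Coalgebra.comul (R := k) q = t
  induction t with
  | zero => simp
  | add x y hx hy => simp only [map_add, hx, hy]
  | tmul a b => simp [← map_mul]

theorem conj_comul_apply (hA : A.IsNormal) (hmul : ∀ (B : Type v) [CommRing B] [Algebra k B]
    (g : WithConv (H →ₐ[k] B)) (f : WithConv (A.Fun →ₐ[k] B)),
    (g * A.res f) h = g h * A.res f h) (B : Type v) [CommRing B] [Algebra k B]
    (g : WithConv (H →ₐ[k] B)) (L : A.Fun ⊗[k] A.Fun →ₐ[k] B) :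
    pairHom g (toConv (L.comp (Bialgebra.comulAlgHom k A.Fun))) (A.conj h) =
      pairHom g (toConv (L.comp Algebra.TensorProduct.includeLeft)) (A.conj h) *
        pairHom g (toConv (L.comp Algebra.TensorProduct.includeRight)) (A.conj h) := by
  rw [comp_comul_eq_mul, conj_mul_apply hA hmul]

/-- If `A` is commutative, `gf` and `g` conjugate points of `A` in the same way for `f` in `A`. -/
theorem conj_res_eq (hc : A.IsCommutative) {B : Type*} [CommRing B] [Algebra k B]
    (g : WithConv (H →ₐ[k] B)) (f n : WithConv (A.Fun →ₐ[k] B)) :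
    g * A.res f * A.res n * (g * A.res f)⁻¹ = g * A.res n * g⁻¹ := by
  have : Coalgebra.IsCocomm k A.Fun := hc
  have e : A.res f * A.res n = A.res n * A.res f := by
    rw [← map_mul, ← map_mul]
    exact congrArg _ (mul_comm f n)
  rw [mul_assoc g, e]
  group

/-- The lemma `contractR_conj_mul`, with generic points `g` of `G` and `L` of `A × A` in an algebra
`B` and with `Φ : B → H` the evaluation of `ξ ⊗ η` on the second of them. -/
theorem contractR_conj_mul_aux (hA : A.IsNormal)
    (hmul : ∀ (B : Type v) [CommRing B] [Algebra k B]
    (g : WithConv (H →ₐ[k] B)) (f : WithConv (A.Fun →ₐ[k] B)),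
    (g * A.res f) h = g h * A.res f h) (ξ η : A.Fun →ₗ[k] k) (B : Type v) [CommRing B] [Algebra k B]
    (g : H →ₐ[k] B) (L : A.Fun ⊗[k] A.Fun →ₐ[k] B) (Φ : B →ₗ[k] H)
    (hΦ : ∀ a t, Φ (g a * L t) = LinearMap.mul' k k (TensorProduct.map ξ η t) • a) :
    contractR ξ (A.conj h) * contractR η (A.conj h) =
      contractR (toConv ξ * toConv η).ofConv (A.conj h) := by
  have h5 := congrArg Φ (conj_comul_apply hA hmul B (toConv g) L)
  generalize A.conj h = c at h5 ⊢
  have e1 : ∀ c, Φ (pairHom (toConv g) (toConv (L.comp (Bialgebra.comulAlgHom k A.Fun))) c) =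
      contractR (toConv ξ * toConv η).ofConv c := by
    intro c
    induction c with
    | zero => simp
    | add x y hx hy => simp only [map_add, hx, hy]
    | tmul a q =>
      change Φ (g a * L (Coalgebra.comul q)) = _
      rw [hΦ, contractR_tmul]
      rfl
  have e2 : ∀ c c', Φ (pairHom (toConv g) (toConv (L.comp Algebra.TensorProduct.includeLeft)) c *
      pairHom (toConv g) (toConv (L.comp Algebra.TensorProduct.includeRight)) c') =
      contractR ξ c * contractR η c' := by
    intro c c'
    induction c with
    | zero => simp
    | add x y hx hy => simp only [map_add, add_mul, hx, hy]
    | tmul a q =>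
      induction c' with
      | zero => simp
      | add x y hx hy => simp only [map_add, mul_add, hx, hy]
      | tmul a' q' =>
        change Φ (g a * L (q ⊗ₜ 1) * (g a' * L (1 ⊗ₜ q'))) = _
        rw [mul_mul_mul_comm, ← map_mul, ← map_mul, hΦ, Algebra.TensorProduct.tmul_mul_tmul,
          mul_one, one_mul, contractR_tmul, contractR_tmul, smul_mul_smul_comm]
        rfl
  rw [e1, e2] at h5
  exact h5.symm

/-- The functions `g ↦ ξ(n ↦ h(g n g⁻¹))` multiply by convolution of the functionals `ξ`. -/
theorem contractR_conj_mul (hA : A.IsNormal) (hmul : ∀ (B : Type v) [CommRing B] [Algebra k B]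
    (g : WithConv (H →ₐ[k] B)) (f : WithConv (A.Fun →ₐ[k] B)),
    (g * A.res f) h = g h * A.res f h) (ξ η : A.Fun →ₗ[k] k) :
    contractR ξ (A.conj h) * contractR η (A.conj h) =
      contractR (toConv ξ * toConv η).ofConv (A.conj h) := by
  refine contractR_conj_mul_aux hA hmul ξ η (H ⊗[k] (A.Fun ⊗[k] A.Fun))
    Algebra.TensorProduct.includeLeft Algebra.TensorProduct.includeRight
    (contractR (LinearMap.mul' k k ∘ₗ TensorProduct.map ξ η)) fun a t => ?_
  rw [Algebra.TensorProduct.includeLeft_apply, Algebra.TensorProduct.includeRight_apply,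
    Algebra.TensorProduct.tmul_mul_tmul, mul_one, one_mul, contractR_tmul]
  rfl

/-- The functions `g ↦ ξ(n ↦ h(g n g⁻¹))` are invariant, as `A` is commutative. -/
theorem contractR_conj_mem_invariants (hc : A.IsCommutative) (ξ : A.Fun →ₗ[k] k) :
    contractR ξ (A.conj h) ∈ A.invariants := by
  intro B _ _ g f
  let L : B →ₐ[k] B ⊗[k] A.Fun := Algebra.TensorProduct.includeLeft
  let n : WithConv (A.Fun →ₐ[k] B ⊗[k] A.Fun) := toConv Algebra.TensorProduct.includeRight
  have key : ∀ g' : WithConv (H →ₐ[k] B), contractR ξ ((toConv (L.comp g'.ofConv) * A.res n *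
      (toConv (L.comp g'.ofConv))⁻¹) h) = g' (contractR ξ (A.conj h)) := by
    intro g'
    rw [← pairHom_conj]
    generalize A.conj h = c
    induction c with
    | zero => simp
    | add x y hx hy => simp only [map_add, hx, hy]
    | tmul a q =>
      change contractR ξ ((g'.ofConv a ⊗ₜ[k] (1 : A.Fun)) * ((1 : B) ⊗ₜ[k] q)) = g'.ofConv _
      rw [Algebra.TensorProduct.tmul_mul_tmul, mul_one, one_mul, contractR_tmul, contractR_tmul,
        map_smul]
  rw [← key, ← key, comp_point_mul]
  have e : (toConv (L.comp (A.res f).ofConv) : WithConv (H →ₐ[k] B ⊗[k] A.Fun)) =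
      A.res (toConv (L.comp f.ofConv)) := rfl
  rw [e]
  set f' : WithConv (A.Fun →ₐ[k] B ⊗[k] A.Fun) := toConv (L.comp f.ofConv)
  exact congrArg (fun x : WithConv (H →ₐ[k] B ⊗[k] A.Fun) => contractR ξ (x h))
    (conj_res_eq hc _ f' n)

variable [IsAlgClosed k] [Algebra.FiniteType k H]

/-- If the function `h` restricts to a character of `A` and is multiplied by it under right
translations by `A`, there is a function that is multiplied by the inverse character and does not
vanish at the identity. The functions `g ↦ ξ(n ↦ h(gng⁻¹))` form a finite-dimensional algebra `P` of
invariants, so that by `exists_pow_eq` a power of the character is not moved by conjugation near the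
identity. Hence `e S(h)ᵐ hᵐ⁻¹` has the required property, where `e` in `P` is supported near the
identity and `m` is the exponent of that power. -/
theorem exists_semiInvariant (hA : A.IsNormal) (hc : A.IsCommutative)
    (hε : Coalgebra.counit (R := k) h = 1)
    (hmul : ∀ (B : Type v) [CommRing B] [Algebra k B]
      (g : WithConv (H →ₐ[k] B)) (f : WithConv (A.Fun →ₐ[k] B)),
      (g * A.res f) h = g h * A.res f h) :
    ∃ f' : H, Coalgebra.counit (R := k) f' = 1 ∧ ∀ (B : Type v) [CommRing B] [Algebra k B]
      (g : WithConv (H →ₐ[k] B)) (f : WithConv (A.Fun →ₐ[k] B)),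
      (g * A.res f) f' * A.res f h = g f' := by
  let ev : (A.Fun →ₗ[k] k) →ₗ[k] H :=
    { toFun := fun ξ => contractR ξ (A.conj h)
      map_add' := fun f g => by simp [contractR, LinearMap.lTensor_add]
      map_smul' := fun a f => by simp [contractR, LinearMap.lTensor_smul] }
  have hone : ev Coalgebra.counit = 1 := by
    have h1 := pairHom_conj (A := A) (toConv (AlgHom.id k H)) 1 h
    rw [map_one, mul_one, mul_inv_cancel] at h1
    have h2 : ∀ c, pairHom (A := A) (toConv (AlgHom.id k H)) 1 c =
        contractR Coalgebra.counit c := by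
      intro c
      induction c with
      | zero => simp
      | add x y hx hy => simp only [map_add, hx, hy]
      | tmul a q =>
        change a * algebraMap k H (Coalgebra.counit q) = _
        rw [contractR_tmul, mul_comm, ← Algebra.smul_def]
    rw [h2] at h1
    change contractR Coalgebra.counit (A.conj h) = 1
    rw [h1]
    change algebraMap k H (Coalgebra.counit h) = 1
    rw [hε, map_one]
  -- the values of all coordinates of `A.conj h`; a finite-dimensional algebra
  let P : Subalgebra k H :=
    { carrier := Set.range ev
      mul_mem' := by
        rintro _ _ ⟨ξ, rfl⟩ ⟨η, rfl⟩
        exact ⟨_, (contractR_conj_mul hA hmul ξ η).symm⟩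
      add_mem' := by
        rintro _ _ ⟨ξ, rfl⟩ ⟨η, rfl⟩
        exact ⟨ξ + η, map_add _ _ _⟩
      algebraMap_mem' := fun a => ⟨a • Coalgebra.counit, by
        rw [map_smul, hone, Algebra.algebraMap_eq_smul_one]⟩ }
  obtain ⟨U, hU, hUc⟩ := exists_finite_contractR (A.conj h)
  have hfin : FiniteDimensional k P := by
    have hle : Subalgebra.toSubmodule P ≤ U := by
      rintro _ ⟨ξ, rfl⟩
      exact hUc ξ
    exact Submodule.finiteDimensional_of_le hle
  obtain ⟨r, hr⟩ := mem_range_map (U := Subalgebra.toSubmodule P) (U' := ⊤) (t := A.conj h)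
    (fun f => Submodule.mem_top) (fun g => ⟨g, rfl⟩)
  let t : P ⊗[k] A.Fun := LinearMap.lTensor P (Submodule.subtype ⊤) r
  have ht : Algebra.TensorProduct.map P.val (AlgHom.id k A.Fun) t = A.conj h := by
    rw [← hr]
    change TensorProduct.map _ _ (TensorProduct.map LinearMap.id _ r) = _
    rw [← LinearMap.comp_apply, ← TensorProduct.map_comp]
    rfl
  let εP : P →ₐ[k] k := (Bialgebra.counitAlgHom k H).comp P.val
  obtain ⟨e, m, he, hm, hem⟩ := exists_pow_eq εP (Bialgebra.counitAlgHom k A.Fun) (fun _ => by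
    have : IsReduced H := isReduced_of_charZero (k := k)
    exact isReduced_of_injective P.val Subtype.val_injective) t
  have hl : contractL εP.toLinearMap t = Ideal.Quotient.mk A.ideal h := by
    have h1 := pairHom_conj (A := A) (1 : WithConv (H →ₐ[k] A.Fun)) (toConv (AlgHom.id k A.Fun)) h
    rw [one_mul, inv_one, mul_one] at h1
    refine Eq.trans ?_ h1
    rw [← ht]
    generalize t = c
    induction c with
    | zero => simp
    | add x y hx hy => simp only [map_add, hx, hy]
    | tmul a q =>
      change contractL εP.toLinearMap _ = algebraMap k A.Fun (Coalgebra.counit a.1) * q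
      rw [contractL_tmul, ← Algebra.smul_def]
      rfl
  rw [hl] at hem
  -- where `e` does not vanish, conjugation fixes the `m`-th power of the character
  have hstar : ∀ (B : Type v) [CommRing B] [Algebra k B]
      (g : WithConv (H →ₐ[k] B)) (f : WithConv (A.Fun →ₐ[k] B)),
      g e.1 * (g * A.res f * g⁻¹) h ^ m = g e.1 * A.res f h ^ m := by
    intro B _ _ g f
    have h1 := congrArg (fun t => pairHom g f
      (Algebra.TensorProduct.map P.val (AlgHom.id k A.Fun) t)) hem
    beta_reduce at h1
    rw [map_mul, map_pow, ht, map_mul, map_pow, pairHom_conj] at h1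
    change (g e.1 * f.ofConv 1) * _ = g e.1 * f.ofConv (_ ^ m) at h1
    rw [map_one, mul_one, map_pow] at h1
    exact h1
  have hinv : e.1 ∈ A.invariants := by
    obtain ⟨ξ, hξ⟩ := e.2
    rw [← hξ]
    exact contractR_conj_mem_invariants hc ξ
  obtain ⟨m, rfl⟩ : ∃ m', m = m' + 1 := Nat.exists_eq_succ_of_ne_zero hm
  refine ⟨e.1 * HopfAlgebra.antipode k h ^ (m + 1) * h ^ m, ?_, ?_⟩
  · have h1 : Coalgebra.counit (R := k) e.1 = 1 := he
    rw [Bialgebra.counit_mul, Bialgebra.counit_mul, Bialgebra.counit_pow, Bialgebra.counit_pow,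
      HopfAlgebra.counit_antipode, hε, h1]
    simp
  · intro B _ _ g f
    have h1 : (g * A.res f)⁻¹ h * (g * A.res f * g⁻¹) h = g⁻¹ h := by
      obtain ⟨f₁, hf₁⟩ := hA.exists_res g f⁻¹
      obtain ⟨f₂, hf₂⟩ := hA.exists_res g f
      have e1 : (g * A.res f)⁻¹ = g⁻¹ * A.res f₁ := by
        rw [← hf₁, map_inv]
        group
      have e2 := hmul B (g⁻¹ * A.res f₁) f₂
      rw [e1, hf₂, ← e2, ← hf₁, ← hf₂, map_inv]
      congr 1
      group
    simp only [map_mul, map_pow, ← point_inv_apply]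
    rw [hmul, hinv B g f]
    calc g e.1 * (g * A.res f)⁻¹ h ^ (m + 1) * (g h * A.res f h) ^ m * A.res f h
        = (g e.1 * A.res f h ^ (m + 1)) * (g * A.res f)⁻¹ h ^ (m + 1) * g h ^ m := by ring
      _ = g e.1 * ((g * A.res f)⁻¹ h * (g * A.res f * g⁻¹) h) ^ (m + 1) * g h ^ m := by
          rw [← hstar]; ring
      _ = _ := by rw [h1]

end SemiInvariant

/-! ### Quotients by commutative normal subgroups -/

section Minors

variable {k : Type u} [Field k] {H : Type v} [CommRing H] [HopfAlgebra k H]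

theorem contractL_assoc_tmul {V W X : Type*} [AddCommGroup V] [Module k V] [AddCommGroup W]
    [Module k W] [AddCommGroup X] [Module k X] (f : V →ₗ[k] k) (s : V ⊗[k] W) (x : X) :
    contractL f (TensorProduct.assoc k V W X (s ⊗ₜ x)) = contractL f s ⊗ₜ x := by
  induction s with
  | zero => simp
  | add x y hx hy => simp only [map_add, TensorProduct.add_tmul, hx, hy]
  | tmul a b => simp [TensorProduct.smul_tmul']

/-- A finite-dimensional subspace has a basis adapted to the kernel of a linear map. -/
theorem exists_basis_adapted {k V W : Type*} [Field k] [AddCommGroup V] [Module k V]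
    [AddCommGroup W] [Module k W] (π : V →ₗ[k] W) (E : Submodule k V) [FiniteDimensional k E] :
    ∃ (n m : ℕ) (b : Module.Basis (Fin n ⊕ Fin m) k E) (θ : Fin m → W →ₗ[k] k),
      (∀ s, π (b (Sum.inl s)) = 0) ∧
      (∀ r r', θ r (π (b (Sum.inr r'))) = if r' = r then 1 else 0) ∧
      ∀ x ∈ E, π x = 0 → x ∈ Submodule.span k (Set.range fun s => (b (Sum.inl s) : V)) := by
  let N : Submodule k E := LinearMap.ker (π ∘ₗ E.subtype)
  have hNfd : FiniteDimensional k N := FiniteDimensional.finiteDimensional_submodule N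
  let b₁ := Module.finBasis k N
  let b₂ := Module.finBasis k (E ⧸ N)
  have hb₁ : ∀ s, (Module.Basis.sumQuot b₁ b₂ (Sum.inl s) : E) = (b₁ s : E) :=
    fun s => Module.Basis.sumQuot_inl _ _ s
  have hinj : Function.Injective (N.liftQ (π ∘ₗ E.subtype) le_rfl) := by
    rw [← LinearMap.ker_eq_bot]
    exact Submodule.ker_liftQ_eq_bot _ _ _ le_rfl
  obtain ⟨ρ, hρ⟩ := LinearMap.exists_leftInverse_of_injective _ (LinearMap.ker_eq_bot.2 hinj)
  have hρE : ∀ x : E, ρ (π x) = N.mkQ x := fun x => LinearMap.congr_fun hρ (N.mkQ x)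
  refine ⟨_, _, Module.Basis.sumQuot b₁ b₂, fun r => b₂.coord r ∘ₗ ρ, fun s => ?_, fun r r' => ?_,
    fun x hx hxI => ?_⟩
  · rw [hb₁]
    exact (b₁ s).2
  · rw [LinearMap.comp_apply, hρE, Submodule.mkQ_apply, Module.Basis.sumQuot_inr,
      ← Finsupp.single_apply, ← b₂.repr_self]
    rfl
  · have h := congrArg (E.subtype ∘ₗ N.subtype) (b₁.sum_repr ⟨⟨x, hx⟩, hxI⟩)
    rw [map_sum] at h
    change _ = x at h
    rw [← h]
    refine Submodule.sum_mem _ fun s _ => ?_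
    rw [map_smul]
    refine Submodule.smul_mem _ _ (Submodule.subset_span ⟨s, ?_⟩)
    change ((Module.Basis.sumQuot b₁ b₂ (Sum.inl s) : E) : V) = _
    rw [hb₁]
    rfl

/-- The matrix coefficients `a i j` of a finite-dimensional space of functions stable under right
translations, with respect to a generating family `w`. -/
structure CoeffData (k : Type u) [Field k] (H : Type v) [CommRing H] [HopfAlgebra k H]
    (ι : Type*) [Fintype ι] [DecidableEq ι] where
  w : ι → H
  a : ι → ι → H
  comul_w : ∀ j, Coalgebra.comul (R := k) (w j) = ∑ i, w i ⊗ₜ a i j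
  comul_a : ∀ i j, Coalgebra.comul (R := k) (a i j) = ∑ l, a i l ⊗ₜ a l j
  counit_a : ∀ i j, Coalgebra.counit (R := k) (a i j) = if i = j then 1 else 0

theorem CoeffData.mul_apply {ι : Type*} [Fintype ι] [DecidableEq ι] (d : CoeffData k H ι)
    {B : Type*} [CommRing B] [Algebra k B] (g g' : WithConv (H →ₐ[k] B)) (i j : ι) :
    (g * g') (d.a i j) = ∑ l, g (d.a i l) * g' (d.a l j) := by
  rw [point_mul_apply, d.comul_a, map_sum, map_sum]
  rfl

theorem CoeffData.w_eq {ι : Type*} [Fintype ι] [DecidableEq ι] (d : CoeffData k H ι) (j : ι) :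
    d.w j = ∑ i, Coalgebra.counit (R := k) (d.w i) • d.a i j := by
  conv_lhs => rw [← contractL_counit_comul (k := k) (d.w j), d.comul_w, map_sum]
  simp

/-- A subspace stable under right translations and adapted to a closed subgroup `A` has matrix
coefficients that are block triangular on `A`. -/
theorem exists_coeffData (A : ClosedSubgroup k H) (E : Submodule k H) [FiniteDimensional k E]
    (hE : ∀ d ∈ E, ∀ f : H →ₗ[k] k, contractR f (Coalgebra.comul d) ∈ E) :
    ∃ (n m : ℕ) (d : CoeffData k H (Fin n ⊕ Fin m)),
      (∀ s, d.w (Sum.inl s) ∈ A.ideal) ∧ (∀ r s, d.a (Sum.inr r) (Sum.inl s) ∈ A.ideal) ∧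
      ∀ x ∈ E, x ∈ A.ideal → x ∈ Submodule.span k (Set.range fun s => d.w (Sum.inl s)) := by
  classical
  let π : H →ₗ[k] A.Fun := (Ideal.Quotient.mkₐ k A.ideal).toLinearMap
  obtain ⟨n, m, b, θ, hb0, hθ, hspan⟩ := exists_basis_adapted π E
  let w := fun i => (b i : H)
  have hwI : ∀ s, w (Sum.inl s) ∈ A.ideal := fun s => by
    rw [← Ideal.Quotient.eq_zero_iff_mem]
    exact hb0 s
  -- functionals on `H` dual to the family `w`
  choose wd hwd using fun i => LinearMap.exists_extend (b.coord i)
  have hwd' : ∀ i j, wd i (w j) = if j = i then 1 else 0 := fun i j => by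
    rw [← Finsupp.single_apply, ← b.repr_self]
    exact LinearMap.congr_fun (hwd i) (b j)
  have hE' : ∀ x ∈ E, Coalgebra.comul (R := k) x =
      ∑ i, w i ⊗ₜ contractL (wd i) (Coalgebra.comul (R := k) x) := by
    intro x hx
    refine sub_eq_zero.1 (eq_zero_of_contractR fun g => ?_)
    have h1 := b.sum_repr ⟨_, hE x hx g⟩
    have h2 := congrArg E.subtype h1
    rw [map_sum] at h2
    rw [map_sub, map_sum, sub_eq_zero]
    refine Eq.trans h2.symm (Finset.sum_congr rfl fun i _ => ?_)
    rw [contractR_tmul, apply_contractL_eq, map_smul]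
    congr 1
    exact (LinearMap.congr_fun (hwd i) ⟨_, hE x hx g⟩).symm
  have hw : ∀ j, Coalgebra.comul (R := k) (w j) =
      ∑ i, w i ⊗ₜ contractL (wd i) (Coalgebra.comul (R := k) (w j)) := fun j => hE' _ (b j).2
  refine ⟨_, _, ⟨w, fun i j => contractL (wd i) (Coalgebra.comul (w j)), hw, ?_, ?_⟩, hwI, ?_, ?_⟩
  · intro i j
    have h := congrArg (contractL (wd i)) (Coalgebra.coassoc_apply (R := k) (w j)).symm
    rw [contractL_lTensor] at h
    rw [h]
    conv_lhs => rw [hw j]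
    simp only [map_sum, LinearMap.rTensor_tmul, contractL_assoc_tmul]
  · intro i j
    rw [apply_contractL_eq, contractR_counit_comul, hwd']
    simp only [eq_comm]
  · intro r s
    rw [← Ideal.Quotient.eq_zero_iff_mem]
    have h : TensorProduct.map π π (Coalgebra.comul (R := k) (w (Sum.inl s))) = 0 :=
      A.isHopfIdeal.map_mkQ_comul_eq_zero (hwI s)
    rw [hw, map_sum] at h
    have h1 := congrArg (contractL (θ r)) h
    rw [map_zero, map_sum, Fintype.sum_sum_type] at h1
    have hz : ∀ s', π (w (Sum.inl s')) = 0 := fun s' => Ideal.Quotient.eq_zero_iff_mem.2 (hwI s')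
    simp only [TensorProduct.map_tmul, contractL_tmul, hz,
      show ∀ r', θ r (π (w (Sum.inr r'))) = _ from hθ r, map_zero,
      zero_smul, Finset.sum_const_zero, zero_add, ite_smul, one_smul, Finset.sum_ite_eq',
      Finset.mem_univ, if_true] at h1
    exact h1
  · exact fun x hx hxI => hspan x hx (Ideal.Quotient.eq_zero_iff_mem.2 hxI)

/-- The minor of the coefficients of the first `n` columns given by the rows `φ`. -/
def CoeffData.minor {n m : ℕ} (d : CoeffData k H (Fin n ⊕ Fin m)) (φ : Fin n → Fin n ⊕ Fin m) : H :=
  Matrix.det (Matrix.of fun t s => d.a (φ t) (Sum.inl s))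

theorem CoeffData.counit_minor_inl {n m : ℕ} (d : CoeffData k H (Fin n ⊕ Fin m)) :
    Coalgebra.counit (R := k) (d.minor Sum.inl) = 1 := by
  change Bialgebra.counitAlgHom k H _ = 1
  rw [CoeffData.minor, AlgHom.map_det, ← Matrix.det_one (n := Fin n)]
  congr 1
  ext i j
  change Coalgebra.counit (R := k) (d.a _ _) = _
  simp [d.counit_a, Matrix.one_apply]

theorem CoeffData.counit_minor_update {n m : ℕ} (d : CoeffData k H (Fin n ⊕ Fin m)) (t : Fin n)
    (r : Fin m) :
    Coalgebra.counit (R := k) (d.minor (Function.update Sum.inl t (Sum.inr r))) = 0 := by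
  change Bialgebra.counitAlgHom k H _ = 0
  rw [CoeffData.minor, AlgHom.map_det]
  refine Matrix.det_eq_zero_of_row_eq_zero t fun s => ?_
  change Coalgebra.counit (R := k) (d.a _ _) = 0
  simp [d.counit_a]

/-- By block triangularity on `A`, the minors are relative invariants of `A`. -/
theorem CoeffData.mul_res_minor {A : ClosedSubgroup k H} {n m : ℕ}
    (d : CoeffData k H (Fin n ⊕ Fin m))
    (hd : ∀ r s, d.a (Sum.inr r) (Sum.inl s) ∈ A.ideal) (φ : Fin n → Fin n ⊕ Fin m)
    (B : Type*) [CommRing B] [Algebra k B] (g : WithConv (H →ₐ[k] B))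
    (f : WithConv (A.Fun →ₐ[k] B)) :
    (g * A.res f) (d.minor φ) = g (d.minor φ) * A.res f (d.minor Sum.inl) := by
  have e : ∀ (g' : WithConv (H →ₐ[k] B)) (ψ : Fin n → Fin n ⊕ Fin m), g' (d.minor ψ) =
      Matrix.det (Matrix.of fun t s => g' (d.a (ψ t) (Sum.inl s))) := fun g' ψ =>
    AlgHom.map_det g'.ofConv _
  rw [e, e, e, ← Matrix.det_mul]
  congr 1
  ext t s
  rw [Matrix.of_apply, d.mul_apply, Fintype.sum_sum_type]
  have h0 : ∀ r, A.res f (d.a (Sum.inr r) (Sum.inl s)) = 0 := fun r => by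
    rw [A.res_apply, Ideal.Quotient.eq_zero_iff_mem.2 (hd r s)]
    exact map_zero f.ofConv
  simp [h0, Matrix.mul_apply]

/-- Cramer's rule: a row all of whose maximal minors against an invertible square matrix vanish is
zero. -/
theorem row_eq_zero_of_det_updateRow {R : Type*} [CommRing R] {n : ℕ}
    (T : Matrix (Fin n) (Fin n) R) (f : R) (hT : T.det * f = 1) (v : Fin n → R)
    (hv : ∀ t, (T.updateRow t v).det * f = 0) : v = 0 := by
  have h0 : ∀ t, (T.updateRow t v).det = 0 := fun t => by
    have h := congrArg (fun x => T.det * x) (hv t)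
    rwa [mul_left_comm, hT, mul_one, mul_zero] at h
  have h1 : Matrix.cramer T.transpose v = 0 := by
    ext t
    rw [Matrix.cramer_transpose_apply, h0]
    rfl
  have h2 := Matrix.mulVec_cramer T.transpose v
  rw [h1, Matrix.mulVec_zero, Matrix.det_transpose] at h2
  have h3 := congrArg (f • ·) h2
  simpa [smul_smul, mul_comm f, hT] using h3.symm

/-- The augmentation ideal of the algebra of functions on `G / A`, extended to `H`. -/
def ClosedSubgroup.augIdeal (A : ClosedSubgroup k H) : Ideal H :=
  Ideal.span ((fun z => z - algebraMap k H (Coalgebra.counit (R := k) z)) '' A.invariants)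

/-- The functions `w` that vanish on `A` lie in the ideal generated by the invariants vanishing at
the identity. Times the function of `exists_semiInvariant`, the minors become invariants, hence
constants modulo that ideal; these constants are those of the identity matrix, so that by Cramer the
lower left block vanishes modulo the ideal. -/
theorem CoeffData.mem_augIdeal [IsAlgClosed k] [Algebra.FiniteType k H] {A : ClosedSubgroup k H}
    (hA : A.IsNormal) (hc : A.IsCommutative) {n m : ℕ} (d : CoeffData k H (Fin n ⊕ Fin m))
    (hw : ∀ s, d.w (Sum.inl s) ∈ A.ideal)
    (hd : ∀ r s, d.a (Sum.inr r) (Sum.inl s) ∈ A.ideal) (s : Fin n) :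
    d.w (Sum.inl s) ∈ A.augIdeal := by
  obtain ⟨f', hf', hinv⟩ := exists_semiInvariant hA hc d.counit_minor_inl
    (fun B _ _ g f => d.mul_res_minor hd Sum.inl B g f)
  have hz : ∀ φ, d.minor φ * f' ∈ A.invariants := fun φ => by
    rw [A.mem_invariants]
    intro B _ _ g f
    change (g * A.res f).ofConv _ = g.ofConv _
    rw [map_mul, map_mul]
    change (g * A.res f) (d.minor φ) * (g * A.res f) f' = g (d.minor φ) * g f'
    rw [d.mul_res_minor hd, ← hinv B g f]
    ring
  let q := Ideal.Quotient.mk A.augIdeal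
  have hq : ∀ φ, q (d.minor φ) * q f' =
      q (algebraMap k H (Coalgebra.counit (R := k) (d.minor φ))) := fun φ => by
    have h1 := Ideal.Quotient.eq.2 (Ideal.subset_span (Set.mem_image_of_mem _ (hz φ)) :
      _ ∈ A.augIdeal)
    rw [Bialgebra.counit_mul, hf', mul_one] at h1
    rw [← map_mul]
    exact h1
  let T : Matrix (Fin n) (Fin n) (H ⧸ A.augIdeal) :=
    Matrix.of fun t s => q (d.a (Sum.inl t) (Sum.inl s))
  have e : ∀ φ, q (d.minor φ) = Matrix.det (Matrix.of fun t s => q (d.a (φ t) (Sum.inl s))) :=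
    fun φ => RingHom.map_det q _
  have hrow : ∀ r s, d.a (Sum.inr r) (Sum.inl s) ∈ A.augIdeal := by
    intro r s
    rw [← Ideal.Quotient.eq_zero_iff_mem]
    have := row_eq_zero_of_det_updateRow T (q f') (by
      have := hq Sum.inl
      rwa [d.counit_minor_inl, map_one, map_one, e] at this)
      (fun s => q (d.a (Sum.inr r) (Sum.inl s))) (fun t => by
        have := hq (Function.update Sum.inl t (Sum.inr r))
        rw [d.counit_minor_update, map_zero, map_zero, e] at this
        rw [← this]
        congr 2
        ext i j
        by_cases h : i = t
        · subst h; simp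
        · simp [h, T])
    exact congrFun this s
  rw [d.w_eq, Fintype.sum_sum_type]
  refine add_mem (Ideal.sum_mem _ fun i _ => ?_) (Ideal.sum_mem _ fun i _ => ?_)
  · rw [show Coalgebra.counit (R := k) (d.w (Sum.inl i)) = 0 from
      A.isHopfIdeal.counit_eq_zero (hw i), zero_smul]
    exact zero_mem _
  · exact Submodule.smul_of_tower_mem _ _ (hrow i s)

end Minors

section Quotient

/-- A property of subspaces closed under sums that holds locally for elements holds for finite sets
of elements. -/
theorem exists_finite_of_finset {k V : Type*} [Field k] [AddCommGroup V] [Module k V]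
    {P : Submodule k V → Prop} (h0 : P ⊥) (hsup : ∀ D E, P D → P E → P (D ⊔ E))
    {Z : Submodule k V}
    (h : ∀ c ∈ Z, ∃ D : Submodule k V, FiniteDimensional k D ∧ P D ∧ c ∈ D ∧ D ≤ Z)
    (S : Finset V) (hS : ∀ c ∈ S, c ∈ Z) :
    ∃ D : Submodule k V, FiniteDimensional k D ∧ P D ∧ (∀ c ∈ S, c ∈ D) ∧ D ≤ Z := by
  classical
  induction S using Finset.induction_on with
  | empty => exact ⟨⊥, inferInstance, h0, by simp, bot_le⟩
  | insert a S _ ih =>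
    obtain ⟨D, hD, pD, aD, lD⟩ := h a (hS a (Finset.mem_insert_self a S))
    obtain ⟨E, hE, pE, aE, lE⟩ := ih fun c hc => hS c (Finset.mem_insert_of_mem hc)
    refine ⟨D ⊔ E, inferInstance, hsup D E pD pE, fun c hc => ?_, sup_le lD lE⟩
    rcases Finset.mem_insert.1 hc with rfl | hc
    · exact le_sup_left (a := D) aD
    · exact le_sup_right (a := D) (aE c hc)

variable {k : Type u} [Field k] {H : Type v} [CommRing H] [HopfAlgebra k H]

theorem antipode_antipode_apply (a : H) :
    HopfAlgebra.antipode k (HopfAlgebra.antipode k a) = a := by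
  have h := inv_inv (toConv (AlgHom.id k H))
  exact congrArg (fun f : WithConv (H →ₐ[k] H) => f a) h

/-- The antipode is an antihomomorphism of coalgebras. -/
theorem comul_antipode (a : H) : Coalgebra.comul (R := k) (HopfAlgebra.antipode k a) =
    TensorProduct.map (HopfAlgebra.antipode k) (HopfAlgebra.antipode k)
      (TensorProduct.comm k H H (Coalgebra.comul (R := k) a)) := by
  let g : WithConv (H →ₐ[k] H ⊗[k] H) := toConv Algebra.TensorProduct.includeLeft
  let f : WithConv (H →ₐ[k] H ⊗[k] H) := toConv Algebra.TensorProduct.includeRight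
  have hgf : g * f = toConv (Bialgebra.comulAlgHom k H) := by
    apply WithConv.ext
    ext x
    refine (point_mul_apply g f x).trans ?_
    change _ = Coalgebra.comul (R := k) x
    generalize Coalgebra.comul (R := k) x = t
    induction t with
    | zero => simp
    | add x y hx hy => simp only [map_add, hx, hy]
    | tmul x y => simp [g, f]
  have h := congrArg (fun f : WithConv (H →ₐ[k] H ⊗[k] H) => f a) (mul_inv_rev g f)
  rw [hgf] at h
  change Coalgebra.comul (R := k) (HopfAlgebra.antipode k a) = _ at h
  rw [h]
  refine (point_mul_apply _ _ a).trans ?_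
  generalize Coalgebra.comul (R := k) a = t
  induction t with
  | zero => simp
  | add x y hx hy => simp only [map_add, hx, hy]
  | tmul x y =>
    change f (HopfAlgebra.antipode k x) * g (HopfAlgebra.antipode k y) = _
    change (1 ⊗ₜ HopfAlgebra.antipode k x : H ⊗[k] H) * (HopfAlgebra.antipode k y ⊗ₜ 1) = _
    simp

theorem contractL_map_comm {V W X Y : Type*} [AddCommGroup V] [Module k V] [AddCommGroup W]
    [Module k W] [AddCommGroup X] [Module k X] [AddCommGroup Y] [Module k Y] (f : Y →ₗ[k] k)
    (L : V →ₗ[k] Y) (M : W →ₗ[k] X) (t : W ⊗[k] V) :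
    contractL f (TensorProduct.map L M (TensorProduct.comm k W V t)) =
      M (contractR (f ∘ₗ L) t) := by
  induction t with
  | zero => simp
  | add x y hx hy => simp only [map_add, hx, hy]
  | tmul x y => simp

theorem contractR_map_comm {V W X Y : Type*} [AddCommGroup V] [Module k V] [AddCommGroup W]
    [Module k W] [AddCommGroup X] [Module k X] [AddCommGroup Y] [Module k Y] (f : X →ₗ[k] k)
    (L : V →ₗ[k] Y) (M : W →ₗ[k] X) (t : W ⊗[k] V) :
    contractR f (TensorProduct.map L M (TensorProduct.comm k W V t)) =
      L (contractL (f ∘ₗ M) t) := by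
  induction t with
  | zero => simp
  | add x y hx hy => simp only [map_add, hx, hy]
  | tmul x y => simp

theorem IsSubcoalgebra.map_antipode {D : Submodule k H} (hD : IsSubcoalgebra D) :
    IsSubcoalgebra (D.map (HopfAlgebra.antipode k)) := by
  constructor
  · rintro _ ⟨d, hd, rfl⟩ f
    rw [comul_antipode, contractL_map_comm]
    exact Submodule.mem_map_of_mem (hD.right d hd _)
  · rintro _ ⟨d, hd, rfl⟩ f
    rw [comul_antipode, contractR_map_comm]
    exact Submodule.mem_map_of_mem (hD.left d hd _)

/-- The ideal of a commutative closed normal subgroup `A` is generated by the functions `d - d(1)`,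
where `d` runs through a finite-dimensional coalgebra `D` of functions that are constant on the
cosets of `A`. This replaces the construction of the quotient group `G/A`: `D` generates enough
functions on it. -/
theorem exists_quotient [IsAlgClosed k] [Algebra.FiniteType k H] {A : ClosedSubgroup k H}
    (hA : A.IsNormal) (hc : A.IsCommutative) :
    ∃ D : Submodule k H, FiniteDimensional k D ∧ IsSubcoalgebra D ∧
      (∀ d ∈ D, HopfAlgebra.antipode k d ∈ D) ∧
      (∀ d ∈ D, d - algebraMap k H (Coalgebra.counit d) ∈ A.ideal) ∧
      A.ideal ≤ Ideal.span ((fun d => d - algebraMap k H (Coalgebra.counit (R := k) d)) '' D) := by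
  have : IsNoetherianRing H := Algebra.FiniteType.isNoetherianRing k H
  have hle : A.ideal ≤ A.augIdeal := by
    obtain ⟨S, hS⟩ := (isNoetherian_def.1 this) A.ideal
    obtain ⟨E, hE, sE, SE, -⟩ := exists_finite_of_finset (k := k) (Z := (⊤ : Submodule k H))
      (P := fun E => ∀ d ∈ E, ∀ f : H →ₗ[k] k, contractR f (Coalgebra.comul d) ∈ E)
      (by simp) (fun D E hD hE x hx f => by
        obtain ⟨d, hd, e, he, rfl⟩ := Submodule.mem_sup.1 hx
        rw [map_add, map_add]
        exact Submodule.add_mem_sup (hD d hd f) (hE e he f))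
      (fun c _ => by
        obtain ⟨U, h1, h2, h3⟩ := exists_finite_contractR_stable (k := k) c
        exact ⟨U, h1, h3, h2, le_top⟩) S (fun _ _ => trivial)
    obtain ⟨n, m, d, hw, hd, hspan⟩ := exists_coeffData A E sE
    rw [← hS]
    refine Ideal.span_le.2 fun x hx => ?_
    have hxI : x ∈ A.ideal := hS ▸ Ideal.subset_span hx
    refine (Submodule.span_le.2 ?_ : _ ≤ A.augIdeal.restrictScalars k) (hspan x (SE x hx) hxI)
    rintro _ ⟨s, rfl⟩
    exact d.mem_augIdeal hA hc hw hd s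
  -- a finite set of invariants suffices, and it is contained in a finite-dimensional coalgebra
  obtain ⟨S, hSs, hS⟩ := (Submodule.fg_span_iff_fg_span_finset_subset
    ((fun z => z - algebraMap k H (Coalgebra.counit (R := k) z)) '' (A.invariants : Set H))).1
      ((isNoetherian_def.1 this) _)
  classical
  obtain ⟨T, hT, rfl⟩ := Finset.subset_set_image_iff.1 hSs
  have hsub : IsSubcoalgebra (Subalgebra.toSubmodule A.invariants) :=
    ⟨fun z hz f => A.contractL_mem_invariants hz f, fun z hz f => hA.contractR_mem_invariants hz f⟩
  obtain ⟨D₀, hD₀, sD, TD, lD⟩ := exists_finite_of_finset (k := k) (P := IsSubcoalgebra)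
    ⟨by simp, by simp⟩ (fun D E hD hE => hD.sup hE)
    (fun c hc => exists_finite_subcoalgebra hsub hc) T hT
  have hD : D₀ ⊔ D₀.map (HopfAlgebra.antipode k) ≤ Subalgebra.toSubmodule A.invariants := by
    refine sup_le lD ?_
    rintro _ ⟨d, hd, rfl⟩
    exact hA.antipode_mem_invariants (lD hd)
  refine ⟨D₀ ⊔ D₀.map (HopfAlgebra.antipode k), inferInstance, sD.sup sD.map_antipode, ?_,
    fun d hd => A.sub_counit_mem (hD hd), ?_⟩
  · intro x hx
    obtain ⟨d, hd, e, ⟨e', he', rfl⟩, rfl⟩ := Submodule.mem_sup.1 hx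
    rw [map_add, antipode_antipode_apply, add_comm]
    exact Submodule.add_mem_sup he' (Submodule.mem_map_of_mem hd)
  · refine hle.trans ?_
    change Ideal.span _ ≤ _
    rw [Ideal.span, hS]
    refine Ideal.span_mono ?_
    rw [Finset.coe_image]
    exact Set.image_mono fun c hc => le_sup_left (a := D₀) (TD c hc)

end Quotient

/-! ### The twisted algebra `H_J` -/

section TwistedProduct

variable {k : Type u} [Field k] {H : Type v} [CommRing H] [HopfAlgebra k H]

theorem comp_rAct {C : Type*} [AddCommGroup C] [Module k C] [Coalgebra k C] {B : Type*} [Ring B]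
    [Algebra k B] (L : C →ₗ[k] B) (f : WithConv (C →ₗ[k] k)) :
    toConv (L ∘ₗ rAct f) = toConv L * scal B f := by
  ext c
  let r := Coalgebra.Repr.arbitrary k c
  change L (rAct f c) = (toConv L * scal B f) c
  rw [r.convMul_apply, rAct_apply, ← r.eq, map_sum, map_sum]
  refine Finset.sum_congr rfl fun i _ => ?_
  rw [contractR_tmul, map_smul, Algebra.smul_def, Algebra.commutes]
  rfl

/-- In `Hom(C, B ⊗ E)`, the product of `f ⊗ 1` and `1 ⊗ g` is `c ↦ f(c₁) ⊗ g(c₂)`. -/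
theorem includeLeft_mul_includeRight {C : Type*} [AddCommGroup C] [Module k C] [Coalgebra k C]
    {B E : Type*} [Ring B] [Algebra k B] [Ring E] [Algebra k E] (f : C →ₗ[k] B) (g : C →ₗ[k] E) :
    toConv ((Algebra.TensorProduct.includeLeft : B →ₐ[k] B ⊗[k] E).toLinearMap ∘ₗ f) *
      toConv ((Algebra.TensorProduct.includeRight : E →ₐ[k] B ⊗[k] E).toLinearMap ∘ₗ g) =
      toConv (TensorProduct.map f g ∘ₗ Coalgebra.comul) := by
  ext c
  let r := Coalgebra.Repr.arbitrary k c
  change _ = TensorProduct.map f g (Coalgebra.comul (R := k) c)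
  refine (r.convMul_apply _ _).trans ?_
  rw [← r.eq, map_sum]
  refine Finset.sum_congr rfl fun i _ => ?_
  simp

theorem comul_eq_includeLeft_mul_includeRight :
    toConv (Coalgebra.comul : H →ₗ[k] H ⊗[k] H) =
      toConv (Algebra.TensorProduct.includeLeft : H →ₐ[k] H ⊗[k] H).toLinearMap *
      toConv (Algebra.TensorProduct.includeRight : H →ₐ[k] H ⊗[k] H).toLinearMap := by
  have h := includeLeft_mul_includeRight (LinearMap.id : H →ₗ[k] H) (LinearMap.id : H →ₗ[k] H)
  rw [TensorProduct.map_id] at h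
  exact h.symm

/-- The product `a ⊗ b ↦ ∑ a₁b₁ J(a₂, b₂)`, as an element of `Hom(H ⊗ H, H)`. -/
def twMul (J : (Dual2 k H)ˣ) : WithConv (H ⊗[k] H →ₗ[k] H) := mulConv * scal H J.val

/-- `(ab) ⊗ c`, with the twisted product of `a` and `b`, in terms of convolution. -/
theorem toConv_q₁ (J : (Dual2 k H)ˣ) : toConv (TensorProduct.map (twMul J).ofConv LinearMap.id) =
    toConv (q₁ k H).toLinearMap * scal (H ⊗[k] H) (pull (q₂ k H) k J.val) := by
  have e1 : scal (H ⊗[k] H) (pull (q₂ k H) k J.val) =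
      toConv (TensorProduct.map (scal H J.val).ofConv (1 : WithConv (H →ₗ[k] H)).ofConv) := by
    apply WithConv.ext
    ext a b c
    change algebraMap k (H ⊗[k] H) (J.val.ofConv (Coalgebra.counit (R := k) c • (a ⊗ₜ[k] b))) =
      (algebraMap k H (J.val.ofConv (a ⊗ₜ[k] b))) ⊗ₜ (algebraMap k H (Coalgebra.counit (R := k) c))
    rw [map_smul, smul_eq_mul]
    simp only [Algebra.algebraMap_eq_smul_one,
      Algebra.TensorProduct.one_def, TensorProduct.smul_tmul', TensorProduct.tmul_smul, smul_smul]
  have e2 : toConv (q₁ k H).toLinearMap =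
      toConv (TensorProduct.map (mulConv (k := k) (H := H)).ofConv
        (toConv (LinearMap.id : H →ₗ[k] H)).ofConv) := rfl
  rw [e1, e2, TensorProduct.map_convMul_map, mul_one]
  rfl

/-- The reassociation `(a ⊗ b) ⊗ c ↦ a ⊗ (b ⊗ c)` on `H`. -/
abbrev assocHom (k : Type u) [Field k] (H : Type v) [CommRing H] [HopfAlgebra k H] :
    (H ⊗[k] H) ⊗[k] H →ₗc[k] H ⊗[k] (H ⊗[k] H) :=
  (Coalgebra.TensorProduct.assoc k k H H H).toCoalgHom

/-- `a ⊗ (bc)`, with the twisted product of `b` and `c`, in terms of convolution. -/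
theorem toConv_q₃ (J : (Dual2 k H)ˣ) :
    toConv (TensorProduct.map LinearMap.id (twMul J).ofConv ∘ₗ (assocHom k H).toLinearMap) =
    toConv (q₃ k H).toLinearMap * scal (H ⊗[k] H) (pull (q₄ k H) k J.val) := by
  have e1 : scal (H ⊗[k] H) (pull (q₄ k H) k J.val) = pull (assocHom k H) (H ⊗[k] H)
      (toConv (TensorProduct.map (1 : WithConv (H →ₗ[k] H)).ofConv (scal H J.val).ofConv)) := by
    apply WithConv.ext
    ext a b c
    change algebraMap k (H ⊗[k] H) (J.val.ofConv ((Coalgebra.counit (R := k) a • b) ⊗ₜ[k] c)) =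
      (algebraMap k H (Coalgebra.counit (R := k) a)) ⊗ₜ (algebraMap k H (J.val.ofConv (b ⊗ₜ[k] c)))
    rw [← TensorProduct.smul_tmul', map_smul, smul_eq_mul]
    simp only [Algebra.algebraMap_eq_smul_one, Algebra.TensorProduct.one_def,
      TensorProduct.smul_tmul', TensorProduct.tmul_smul, smul_smul, mul_comm]
  have e2 : toConv (q₃ k H).toLinearMap = pull (assocHom k H) (H ⊗[k] H)
      (toConv (TensorProduct.map (toConv (LinearMap.id : H →ₗ[k] H)).ofConv
        (mulConv (k := k) (H := H)).ofConv)) := rfl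
  rw [e1, e2, ← map_mul, TensorProduct.map_convMul_map, mul_one]
  rfl

/-- The cocycle equation says that the twisted product is associative. -/
theorem twMul_assoc {J : (Dual2 k H)ˣ} (hJ : IsHopf2Cocycle J) (a b c : H) :
    (twMul J) ((twMul J) (a ⊗ₜ b) ⊗ₜ c) = (twMul J) (a ⊗ₜ (twMul J) (b ⊗ₜ c)) := by
  have h1 : toConv ((twMul J).ofConv ∘ₗ TensorProduct.map (twMul J).ofConv LinearMap.id) =
      pull (q₁ k H) H mulConv * scal H (pull (q₁ k H) k J.val * pull (q₂ k H) k J.val) := by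
    have h := comp_mul_scal (twMul J).ofConv (pull (q₂ k H) k J.val) (toConv (q₁ k H).toLinearMap)
    rw [← toConv_q₁] at h
    refine h.trans ?_
    rw [map_mul, ← mul_assoc]
    congr 1
    exact map_mul (pull (q₁ k H) H) mulConv (scal H J.val)
  have h2 : toConv ((twMul J).ofConv ∘ₗ TensorProduct.map LinearMap.id (twMul J).ofConv ∘ₗ
      (assocHom k H).toLinearMap) =
      pull (q₃ k H) H mulConv * scal H (pull (q₃ k H) k J.val * pull (q₄ k H) k J.val) := by
    have h := comp_mul_scal (twMul J).ofConv (pull (q₄ k H) k J.val) (toConv (q₃ k H).toLinearMap)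
    rw [← toConv_q₃] at h
    refine h.trans ?_
    rw [map_mul, ← mul_assoc]
    congr 1
    exact map_mul (pull (q₃ k H) H) mulConv (scal H J.val)
  have h3 : pull (q₁ k H) H mulConv = pull (q₃ k H) H mulConv := by
    apply WithConv.ext
    ext a b c
    exact mul_assoc a b c
  rw [hJ.cocycle, h3, ← h2] at h1
  exact congrArg (fun f : WithConv ((H ⊗[k] H) ⊗[k] H →ₗ[k] H) => f ((a ⊗ₜ b) ⊗ₜ c)) h1

theorem twMul_one_left {J : (Dual2 k H)ˣ} (hJ : IsHopf2Cocycle J) (a : H) :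
    (twMul J) (1 ⊗ₜ a) = a := by
  have h : pull inr H (twMul J) = toConv LinearMap.id := by
    have h1 : pull inr H (scal H J.val) = scal H (pull inr k J.val) := rfl
    rw [twMul, map_mul, h1, (left_one_iff _).1 hJ.left_one, map_one, mul_one]
    apply WithConv.ext
    ext a
    change LinearMap.mul' k H ((inr : H →ₗc[k] H ⊗[k] H) a) = a
    rw [inr_apply]
    simp
  have h1 := congrArg (fun f : WithConv (H →ₗ[k] H) => f a) h
  change (twMul J) ((inr : H →ₗc[k] H ⊗[k] H) a) = a at h1
  rwa [inr_apply] at h1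

theorem twMul_one_right {J : (Dual2 k H)ˣ} (hJ : IsHopf2Cocycle J) (a : H) :
    (twMul J) (a ⊗ₜ 1) = a := by
  have h : pull inl H (twMul J) = toConv LinearMap.id := by
    have h1 : pull inl H (scal H J.val) = scal H (pull inl k J.val) := rfl
    rw [twMul, map_mul, h1, (right_one_iff _).1 hJ.right_one, map_one, mul_one]
    apply WithConv.ext
    ext a
    change LinearMap.mul' k H ((inl : H →ₗc[k] H ⊗[k] H) a) = a
    rw [inl_apply]
    simp
  have h1 := congrArg (fun f : WithConv (H →ₗ[k] H) => f a) h
  change (twMul J) ((inl : H →ₗc[k] H ⊗[k] H) a) = a at h1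
  rwa [inl_apply] at h1

/-- The algebra `H_J`: the vector space `H` with the product `a · b = ∑ a₁b₁ J(a₂, b₂)`. A type
synonym, so that it carries this product and not that of `H`. -/
def Tw (_ : Z2inv k H) : Type v := H

variable (J : Z2inv k H)

instance twAddCommGroup : AddCommGroup (Tw J) := inferInstanceAs (AddCommGroup H)

instance : Module k (Tw J) := inferInstanceAs (Module k H)

/-- The identity, as a linear isomorphism from `H` to `H_J`. -/
def tw : H ≃ₗ[k] Tw J := LinearEquiv.refl k H

instance : Mul (Tw J) := ⟨fun a b => tw J ((twMul J.val) ((tw J).symm a ⊗ₜ (tw J).symm b))⟩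

instance : One (Tw J) := ⟨tw J 1⟩

theorem tw_mul_tw (a b : H) : tw J a * tw J b = tw J ((twMul J.val) (a ⊗ₜ b)) := rfl

theorem tw_one : tw J 1 = 1 := rfl

instance : Ring (Tw J) where
  __ := twAddCommGroup J
  mul_assoc a b c := twMul_assoc J.2.1 a b c
  one_mul a := twMul_one_left J.2.1 a
  mul_one a := twMul_one_right J.2.1 a
  zero_mul a := by
    change (twMul J.val).ofConv ((0 : H) ⊗ₜ[k] _) = 0
    rw [TensorProduct.zero_tmul, map_zero]
  mul_zero a := by
    change (twMul J.val).ofConv (_ ⊗ₜ[k] (0 : H)) = 0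
    rw [TensorProduct.tmul_zero, map_zero]
  left_distrib a b c := by
    change (twMul J.val).ofConv (_ ⊗ₜ[k] (tw J).symm (b + c)) = _
    rw [map_add, TensorProduct.tmul_add, map_add]
    rfl
  right_distrib a b c := by
    change (twMul J.val).ofConv ((tw J).symm (a + b) ⊗ₜ[k] _) = _
    rw [map_add, TensorProduct.add_tmul, map_add]
    rfl

instance : Algebra k (Tw J) := Algebra.ofModule
  (fun r a b => by
    change (twMul J.val).ofConv ((tw J).symm (r • a) ⊗ₜ[k] _) = _
    rw [map_smul, ← TensorProduct.smul_tmul', map_smul]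
    rfl)
  (fun r a b => by
    change (twMul J.val).ofConv (_ ⊗ₜ[k] (tw J).symm (r • b)) = _
    rw [map_smul, TensorProduct.tmul_smul, map_smul]
    rfl)

/-- The coproduct is multiplicative from the twisted product to the product of `H` on the left and
the twisted product on the right. -/
theorem map_twMul_comul (J : (Dual2 k H)ˣ) : TensorProduct.map (LinearMap.mul' k H)
    (twMul J).ofConv ∘ₗ Coalgebra.comul = Coalgebra.comul ∘ₗ (twMul J).ofConv := by
  apply WithConv.toConv_injective
  have h1 := comp_mul_scal (Algebra.TensorProduct.includeRight : H →ₐ[k] H ⊗[k] H).toLinearMap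
    J.val (mulConv (k := k) (H := H))
  have h2 := comp_mul_scal (Coalgebra.comul : H →ₗ[k] H ⊗[k] H) J.val (mulConv (k := k) (H := H))
  rw [← includeLeft_mul_includeRight]
  refine Eq.trans ?_ h2.symm
  rw [twMul, h1, ← mul_assoc]
  congr 1
  have h3 := congrArg (pull (Bialgebra.mulCoalgHom k H) (H ⊗[k] H))
    (comul_eq_includeLeft_mul_includeRight (k := k) (H := H))
  rw [map_mul] at h3
  exact h3.symm

/-- The coproduct, as an algebra homomorphism `H_J → H ⊗ H_J`. -/
def twComul : Tw J →ₐ[k] H ⊗[k] Tw J :=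
  AlgHom.ofLinearMap (LinearMap.lTensor H (tw J).toLinearMap ∘ₗ Coalgebra.comul ∘ₗ
      (tw J).symm.toLinearMap)
    (by
      change LinearMap.lTensor H _ (Coalgebra.comul (R := k) (1 : H)) = _
      rw [Bialgebra.comul_one]
      rfl)
    (fun a b => by
      let r := Coalgebra.Repr.arbitrary k ((tw J).symm a)
      let s := Coalgebra.Repr.arbitrary k ((tw J).symm b)
      have h := LinearMap.congr_fun (map_twMul_comul J.val) ((tw J).symm a ⊗ₜ (tw J).symm b)
      rw [LinearMap.comp_apply, comul_tmul_eq_sum r s] at h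
      change LinearMap.lTensor H _ (Coalgebra.comul (R := k) ((twMul J.val) _)) =
        LinearMap.lTensor H _ (Coalgebra.comul (R := k) ((tw J).symm a)) *
          LinearMap.lTensor H _ (Coalgebra.comul (R := k) ((tw J).symm b))
      rw [← r.eq, ← s.eq, map_sum, map_sum, Finset.sum_mul_sum]
      refine (congrArg _ h.symm).trans ?_
      simp only [map_sum]
      refine Finset.sum_congr rfl fun i _ => Finset.sum_congr rfl fun j _ => ?_
      rw [TensorProduct.map_tmul, LinearMap.lTensor_tmul, LinearMap.lTensor_tmul,
        LinearMap.lTensor_tmul, Algebra.TensorProduct.tmul_mul_tmul]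
      rfl)

theorem twComul_tw (a : H) :
    twComul J (tw J a) = LinearMap.lTensor H (tw J).toLinearMap (Coalgebra.comul (R := k) a) := rfl

/-- The commutation rule `c · a = ∑ R'(c₁, a₁) a₂ · c₂` of `H_J`, with `R' = J * J₂₁⁻¹`. It uses
that `J` is invariant. -/
theorem tw_mul_comm {ι κ : Type*} {c a : H} (r : Coalgebra.Repr k c ι) (s : Coalgebra.Repr k a κ) :
    tw J c * tw J a = ∑ i ∈ r.index, ∑ j ∈ s.index,
      (J.val * (swap J.val)⁻¹).val (r.left i ⊗ₜ s.left j) •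
        (tw J (s.right j) * tw J (r.right i)) := by
  have h0 : twMul J.val = scal H J.val.val * mulConv := J.2.2.eq.symm
  have h1 : pull (flipHom k H) H (twMul J.val) = scal H (swap J.val).val * mulConv := by
    rw [h0, map_mul]
    congr 1
    apply WithConv.ext
    ext a b
    exact mul_comm b a
  have h2 : twMul J.val =
      scal H (J.val * (swap J.val)⁻¹).val * pull (flipHom k H) H (twMul J.val) := by
    rw [h1, ← mul_assoc, ← map_mul, ← Units.val_mul, inv_mul_cancel_right, h0]
  have h3 : tw J ((twMul J.val) (c ⊗ₜ a)) = tw J ((scal H (J.val * (swap J.val)⁻¹).val *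
      pull (flipHom k H) H (twMul J.val)) (c ⊗ₜ a)) := by rw [← h2]
  rw [conv_tmul r s, map_sum] at h3
  rw [tw_mul_tw, h3]
  refine Finset.sum_congr rfl fun i _ => ?_
  rw [map_sum]
  refine Finset.sum_congr rfl fun j _ => ?_
  rw [tw_mul_tw, ← map_smul, Algebra.smul_def]
  rfl

end TwistedProduct

/-! ### The Galois map of `H_J` -/

section Galois

variable {k : Type*} [Field k] {Q : Type*} [CommRing Q] [Algebra k Q] {B : Type*} [Ring B]
  [Algebra k B]

/-- The Galois map `b ⊗ b' ↦ ρ(b)(1 ⊗ b')` of a coaction `ρ` of `Q` on the algebra `B`. -/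
def galMap (ρ : B →ₐ[k] Q ⊗[k] B) : B ⊗[k] B →ₗ[k] Q ⊗[k] B :=
  LinearMap.mul' k (Q ⊗[k] B) ∘ₗ TensorProduct.map ρ.toLinearMap
    (Algebra.TensorProduct.includeRight : B →ₐ[k] Q ⊗[k] B).toLinearMap

theorem galMap_tmul (ρ : B →ₐ[k] Q ⊗[k] B) (b b' : B) :
    galMap ρ (b ⊗ₜ b') = ρ b * (1 ⊗ₜ b') := rfl

theorem galMap_mul_right (ρ : B →ₐ[k] Q ⊗[k] B) (t : B ⊗[k] B) (y : B) :
    galMap ρ (t * (1 ⊗ₜ y)) = galMap ρ t * (1 ⊗ₜ y) := by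
  induction t with
  | zero => simp
  | add x y hx hy => simp only [add_mul, map_add, hx, hy]
  | tmul b b' => simp [galMap_tmul, mul_assoc]

/-- The map `q ⊗ b ↦ κ(q)(1 ⊗ b)`. -/
def galInv {Q E : Type*} [AddCommGroup Q] [Module k Q] [Ring E] [Algebra k E]
    (κ : Q →ₗ[k] E ⊗[k] B) : Q ⊗[k] B →ₗ[k] E ⊗[k] B :=
  LinearMap.mul' k (E ⊗[k] B) ∘ₗ TensorProduct.map κ
    (Algebra.TensorProduct.includeRight : B →ₐ[k] E ⊗[k] B).toLinearMap

theorem galInv_tmul {Q E : Type*} [AddCommGroup Q] [Module k Q] [Ring E] [Algebra k E]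
    (κ : Q →ₗ[k] E ⊗[k] B) (q : Q) (b : B) :
    galInv κ (q ⊗ₜ b) = κ q * (1 ⊗ₜ b) := rfl

theorem galMap_galInv {ρ : B →ₐ[k] Q ⊗[k] B} {κ : Q →ₗ[k] B ⊗[k] B}
    (hκ : ∀ q, galMap ρ (κ q) = q ⊗ₜ 1) (t : Q ⊗[k] B) : galMap ρ (galInv κ t) = t := by
  induction t with
  | zero => simp
  | add x y hx hy => simp only [map_add, hx, hy]
  | tmul q b => rw [galInv_tmul, galMap_mul_right, hκ]; simp

theorem galInv_coaction {ρ : B →ₐ[k] Q ⊗[k] B} {κ : Q →ₗ[k] B ⊗[k] B}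
    (hκ : ∀ q, galMap ρ (κ q) = q ⊗ₜ 1) (hinj : Function.Injective (galMap ρ)) (b : B) :
    galInv κ (ρ b) = b ⊗ₜ 1 := by
  apply hinj
  rw [galMap_galInv hκ, galMap_tmul, ← Algebra.TensorProduct.one_def, mul_one]

/-- The product of `B ⊗ Bᵒᵖ`: `(r ⊗ l, r' ⊗ l') ↦ rr' ⊗ l'l`. -/
def starMul : B ⊗[k] B →ₗ[k] B ⊗[k] B →ₗ[k] B ⊗[k] B :=
  TensorProduct.map₂ (LinearMap.mul k B) (LinearMap.mul k B).flip

theorem starMul_tmul (r l r' l' : B) :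
    starMul (r ⊗ₜ[k] l) (r' ⊗ₜ l') = (r * r') ⊗ₜ (l' * l) := rfl

theorem galMap_starMul (ρ : B →ₐ[k] Q ⊗[k] B) (t u : B ⊗[k] B) (q : Q)
    (hu : galMap ρ u = q ⊗ₜ 1) : galMap ρ (starMul t u) = galMap ρ t * (q ⊗ₜ 1) := by
  induction t with
  | zero => simp
  | add x y hx hy => simp only [map_add, LinearMap.add_apply, add_mul, hx, hy]
  | tmul r l =>
    have h : galMap ρ (starMul (r ⊗ₜ l) u) = ρ r * galMap ρ u * (1 ⊗ₜ l) := by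
      clear hu
      induction u with
      | zero => simp
      | add x y hx hy => simp only [map_add, mul_add, add_mul, hx, hy]
      | tmul r' l' => simp [starMul_tmul, galMap_tmul, mul_assoc]
    rw [h, hu, galMap_tmul, mul_assoc, mul_assoc]
    simp

/-- An algebra homomorphism intertwines the products of `B ⊗ Bᵒᵖ`. -/
theorem map_starMul {E : Type*} [Ring E] [Algebra k E] (p : B →ₐ[k] E) (t u : B ⊗[k] B) :
    TensorProduct.map p.toLinearMap p.toLinearMap (starMul t u) =
      starMul (TensorProduct.map p.toLinearMap p.toLinearMap t)
        (TensorProduct.map p.toLinearMap p.toLinearMap u) := by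
  induction t with
  | zero => simp
  | add x y hx hy => simp only [map_add, LinearMap.add_apply, hx, hy]
  | tmul r l =>
    induction u with
    | zero => simp
    | add x y hx hy => simp only [map_add, hx, hy]
    | tmul r' l' => simp [starMul_tmul]

end Galois

section TwistedGalois

variable {k : Type u} [Field k] {H : Type v} [CommRing H] [HopfAlgebra k H]

/-- `b ⊗ b' ↦ b₁ ⊗ b₂b'`. -/
def shear : H ⊗[k] H →ₗ[k] H ⊗[k] H := galMap (Bialgebra.comulAlgHom k H)

/-- `h ↦ h₁ ⊗ S(h₂)`. -/
def coshear : H →ₗ[k] H ⊗[k] H := LinearMap.lTensor H (HopfAlgebra.antipode k) ∘ₗ Coalgebra.comul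

theorem shear_coshear (h : H) : shear (k := k) (coshear (k := k) h) = h ⊗ₜ 1 := by
  let i₂ : H →ₐ[k] H ⊗[k] H := Algebra.TensorProduct.includeRight
  have h1 : toConv (shear ∘ₗ coshear) = toConv (Coalgebra.comul : H →ₗ[k] H ⊗[k] H) *
      toConv (i₂.toLinearMap ∘ₗ HopfAlgebra.antipode k) := by
    ext a
    let r := Coalgebra.Repr.arbitrary k a
    change shear (LinearMap.lTensor H _ (Coalgebra.comul (R := k) a)) = _
    refine Eq.trans ?_ (r.convMul_apply _ _).symm
    rw [← r.eq, map_sum, map_sum]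
    rfl
  have h2 : toConv i₂.toLinearMap * toConv (i₂.toLinearMap ∘ₗ HopfAlgebra.antipode k) = 1 := by
    have := LinearMap.algHom_comp_convMul_distrib i₂ (toConv (LinearMap.id : H →ₗ[k] H))
      (toConv (HopfAlgebra.antipode k))
    rw [LinearMap.id_mul_antipode] at this
    apply WithConv.ext
    refine this.symm.trans ?_
    ext a
    change i₂ (algebraMap k H _) = algebraMap k _ _
    rw [AlgHom.commutes]
  rw [comul_eq_includeLeft_mul_includeRight, mul_assoc, h2, mul_one] at h1
  exact congrArg (fun f : WithConv (H →ₗ[k] H ⊗[k] H) => f h) h1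

/-- The Galois map of `H` itself is injective; the inverse is built from `coshear`. -/
theorem shear_injective : Function.Injective (shear : H ⊗[k] H →ₗ[k] H ⊗[k] H) := by
  let i₂ : H →ₐ[k] H ⊗[k] H := Algebra.TensorProduct.includeRight
  have hcos : ∀ a : H, galInv coshear (Coalgebra.comul (R := k) a) = a ⊗ₜ 1 := by
    intro a
    let i₁ : WithConv (H →ₗ[k] H ⊗[k] H) :=
      toConv (Algebra.TensorProduct.includeLeft : H →ₐ[k] H ⊗[k] H).toLinearMap
    have h1 : toConv (galInv coshear ∘ₗ Coalgebra.comul) = toConv (coshear (k := k) (H := H)) *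
        toConv i₂.toLinearMap := by
      ext a
      let r := Coalgebra.Repr.arbitrary k a
      change galInv coshear (Coalgebra.comul (R := k) a) = _
      refine Eq.trans ?_ (r.convMul_apply _ _).symm
      rw [← r.eq, map_sum]
      rfl
    have h2 : toConv (i₂.toLinearMap ∘ₗ HopfAlgebra.antipode k) * toConv i₂.toLinearMap = 1 := by
      have := LinearMap.algHom_comp_convMul_distrib i₂ (toConv (HopfAlgebra.antipode k))
        (toConv (LinearMap.id : H →ₗ[k] H))
      rw [LinearMap.antipode_mul_id] at this
      apply WithConv.ext
      refine this.symm.trans ?_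
      ext a
      change i₂ (algebraMap k H _) = algebraMap k _ _
      rw [AlgHom.commutes]
    have h3 : toConv (coshear (k := k) (H := H)) =
        i₁ * toConv (i₂.toLinearMap ∘ₗ HopfAlgebra.antipode k) :=
      (includeLeft_mul_includeRight (LinearMap.id : H →ₗ[k] H) (HopfAlgebra.antipode k)).symm
    rw [h3, mul_assoc, h2, mul_one] at h1
    exact congrArg (fun f : WithConv (H →ₗ[k] H ⊗[k] H) => f a) h1
  refine Function.LeftInverse.injective (g := galInv coshear) fun t => ?_
  induction t with
  | zero => simp
  | add x y hx hy => simp only [map_add, hx, hy]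
  | tmul a b =>
    have h : ∀ t : H ⊗[k] H, galInv (coshear (k := k)) (t * (1 ⊗ₜ b)) =
        galInv coshear t * (1 ⊗ₜ b) := by
      intro t
      induction t with
      | zero => simp
      | add x y hx hy => simp only [add_mul, map_add, hx, hy]
      | tmul x y => simp [galInv_tmul, mul_assoc]
    rw [shear, galMap_tmul, h]
    change galInv coshear (Coalgebra.comul (R := k) a) * _ = _
    rw [hcos]
    simp

variable (J : Z2inv k H)

/-- The Galois map of `H_J` is that of `H` after the action of `J` on `H ⊗ H`, which is invertible.
-/
theorem galMap_twComul (t : H ⊗[k] H) :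
    galMap (twComul J) (TensorProduct.map (tw J).toLinearMap (tw J).toLinearMap t) =
      LinearMap.lTensor H (tw J).toLinearMap (shear (rAct J.val.val t)) := by
  have h1 : toConv (shear ∘ₗ rAct J.val.val) =
      toConv (TensorProduct.map (p₁ k H).toLinearMap (twMul J.val).ofConv ∘ₗ Coalgebra.comul) := by
    rw [comp_rAct, ← includeLeft_mul_includeRight, twMul]
    have h2 := comp_mul_scal (Algebra.TensorProduct.includeRight : H →ₐ[k] H ⊗[k] H).toLinearMap
      J.val.val (mulConv (k := k) (H := H))
    rw [h2, ← mul_assoc]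
    congr 1
    rw [includeLeft_mul_includeRight]
    apply WithConv.ext
    ext a b
    let r := Coalgebra.Repr.arbitrary k a
    let s := Coalgebra.Repr.arbitrary k b
    change Coalgebra.comul (R := k) a * (1 ⊗ₜ b) = TensorProduct.map (p₁ k H).toLinearMap
      (LinearMap.mul' k H) (Coalgebra.comul (R := k) (a ⊗ₜ[k] b))
    rw [comul_tmul_eq_sum r s, ← r.eq, Finset.sum_mul, map_sum]
    refine Finset.sum_congr rfl fun i _ => ?_
    rw [map_sum]
    conv_lhs => rw [← Coalgebra.sum_counit_smul s]
    rw [TensorProduct.tmul_sum, Finset.mul_sum]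
    refine Finset.sum_congr rfl fun j _ => ?_
    rw [TensorProduct.map_tmul]
    change _ = (Coalgebra.counit (R := k) (s.left j) • r.left i) ⊗ₜ (r.right i * s.right j)
    simp [TensorProduct.smul_tmul']
  have h2 := congrArg (fun f : WithConv (H ⊗[k] H →ₗ[k] H ⊗[k] H) =>
    LinearMap.lTensor H (tw J).toLinearMap (f t)) h1
  refine Eq.trans ?_ h2.symm
  clear h1 h2
  induction t with
  | zero => simp
  | add x y hx hy => simp only [map_add, hx, hy]
  | tmul a b =>
    let r := Coalgebra.Repr.arbitrary k a
    let s := Coalgebra.Repr.arbitrary k b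
    change twComul J (tw J a) * (1 ⊗ₜ tw J b) = LinearMap.lTensor H _ (TensorProduct.map
      (p₁ k H).toLinearMap (twMul J.val).ofConv (Coalgebra.comul (R := k) (a ⊗ₜ[k] b)))
    rw [twComul_tw, comul_tmul_eq_sum r s, ← r.eq, map_sum, Finset.sum_mul, map_sum, map_sum]
    refine Finset.sum_congr rfl fun i _ => ?_
    conv_lhs => rw [← Coalgebra.sum_counit_smul s]
    rw [map_sum, TensorProduct.tmul_sum, Finset.mul_sum, map_sum, map_sum]
    refine Finset.sum_congr rfl fun j _ => ?_
    rw [TensorProduct.map_tmul, LinearMap.lTensor_tmul, LinearMap.lTensor_tmul, map_smul,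
      Algebra.TensorProduct.tmul_mul_tmul, mul_one, mul_smul_comm]
    change r.left i ⊗ₜ (_ • (tw J (r.right i) * tw J (s.right j))) =
      (Coalgebra.counit (R := k) (s.left j) • r.left i) ⊗ₜ (tw J (r.right i) * tw J (s.right j))
    rw [TensorProduct.smul_tmul]

theorem rAct_inv_rAct {C : Type*} [AddCommGroup C] [Module k C] [Coalgebra k C]
    (f : (WithConv (C →ₗ[k] k))ˣ) (c : C) : rAct f⁻¹.val (rAct f.val c) = c := by
  rw [rAct_rAct, Units.inv_mul, rAct_one]

theorem galMap_twComul_injective : Function.Injective (galMap (twComul J)) := by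
  intro t u htu
  let e := TensorProduct.congr (tw J) (tw J)
  obtain ⟨t, rfl⟩ := e.surjective t
  obtain ⟨u, rfl⟩ := e.surjective u
  rw [show e t = TensorProduct.map (tw J).toLinearMap (tw J).toLinearMap t from rfl,
    show e u = TensorProduct.map (tw J).toLinearMap (tw J).toLinearMap u from rfl,
    galMap_twComul, galMap_twComul] at htu
  have h1 := shear_injective ((LinearEquiv.lTensor H (tw J)).injective htu)
  rw [← rAct_inv_rAct J.val t, h1, rAct_inv_rAct]

/-- The translation map `H → H_J ⊗ H_J`: the inverse of the Galois map, restricted to `H ⊗ 1`. -/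
def trans : H →ₗ[k] Tw J ⊗[k] Tw J :=
  TensorProduct.map (tw J).toLinearMap (tw J).toLinearMap ∘ₗ rAct J.val⁻¹.val ∘ₗ coshear

theorem galMap_trans (h : H) : galMap (twComul J) (trans J h) = h ⊗ₜ 1 := by
  have h1 := rAct_inv_rAct J.val⁻¹ (coshear (k := k) h)
  rw [inv_inv] at h1
  rw [trans, LinearMap.comp_apply, galMap_twComul, LinearMap.comp_apply, h1, shear_coshear]
  rfl

theorem trans_mul (a b : H) : trans J (a * b) = starMul (trans J a) (trans J b) := by
  apply galMap_twComul_injective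
  rw [galMap_starMul _ _ _ b (galMap_trans J b), galMap_trans, galMap_trans]
  simp

theorem contractL_rAct_tmul (F : Dual2 k H) (f : H →ₗ[k] k) (a b : H) :
    contractL f (rAct F (a ⊗ₜ b)) = contractR (F.ofConv ∘ₗ TensorProduct.mk k H H
      (contractL f (Coalgebra.comul a))) (Coalgebra.comul b) := by
  let r := Coalgebra.Repr.arbitrary k a
  let s := Coalgebra.Repr.arbitrary k b
  have h1 : contractL f (Coalgebra.comul (R := k) a) =
      ∑ i ∈ r.index, f (r.left i) • r.right i := by
    rw [← r.eq, map_sum]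
    simp
  rw [rAct_apply, comul_tmul_eq_sum r s, h1, ← s.eq]
  simp only [map_sum, contractR_tmul, contractL_tmul, LinearMap.comp_apply, map_smul,
    TensorProduct.mk_apply, LinearMap.sum_apply, LinearMap.smul_apply, Finset.sum_smul,
    smul_eq_mul]
  rw [Finset.sum_comm]
  refine Finset.sum_congr rfl fun j _ => Finset.sum_congr rfl fun i _ => ?_
  rw [mul_comm, mul_smul]

theorem contractR_rAct_tmul (F : Dual2 k H) (f : H →ₗ[k] k) (a b : H) :
    contractR f (rAct F (a ⊗ₜ b)) = contractR (F.ofConv ∘ₗ (TensorProduct.mk k H H).flip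
      (contractL f (Coalgebra.comul b))) (Coalgebra.comul a) := by
  let r := Coalgebra.Repr.arbitrary k a
  let s := Coalgebra.Repr.arbitrary k b
  have h1 : contractL f (Coalgebra.comul (R := k) b) =
      ∑ i ∈ s.index, f (s.left i) • s.right i := by
    rw [← s.eq, map_sum]
    simp
  rw [rAct_apply, comul_tmul_eq_sum r s, h1, ← r.eq]
  simp only [map_sum, contractR_tmul, LinearMap.comp_apply, map_smul,
    LinearMap.flip_apply, TensorProduct.mk_apply, LinearMap.sum_apply, LinearMap.smul_apply,
    Finset.sum_smul, smul_eq_mul]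
  refine Finset.sum_congr rfl fun j _ => Finset.sum_congr rfl fun i _ => ?_
  rw [mul_comm, mul_smul]

/-- The translation map sends a subcoalgebra stable under the antipode to its tensor square, as it
is `h ↦ h₁ ⊗ S(h₂)` followed by the action of `J⁻¹`. -/
theorem exists_trans_eq {D : Submodule k H} (hD : IsSubcoalgebra D)
    (hS : ∀ d ∈ D, HopfAlgebra.antipode k d ∈ D) {d : H} (hd : d ∈ D) :
    ∃ t : D ⊗[k] D, trans J d = TensorProduct.map ((tw J).toLinearMap ∘ₗ D.subtype)
      ((tw J).toLinearMap ∘ₗ D.subtype) t := by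
  have h1 : coshear (k := k) d ∈ LinearMap.range (TensorProduct.map D.subtype D.subtype) := by
    refine mem_range_map (fun f => ?_) (fun g => ?_)
    · rw [coshear, LinearMap.comp_apply, contractL_lTensor]
      exact hS _ (hD.left d hd f)
    · have : ∀ t : H ⊗[k] H, contractR g (LinearMap.lTensor H (HopfAlgebra.antipode k) t) =
          contractR (g ∘ₗ HopfAlgebra.antipode k) t := fun t => by
        induction t with
        | zero => simp
        | add x y hx hy => simp only [map_add, hx, hy]
        | tmul x y => simp
      rw [coshear, LinearMap.comp_apply, this]
      exact hD.right d hd _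
  have h2 : ∀ t : D ⊗[k] D, rAct J.val⁻¹.val (TensorProduct.map D.subtype D.subtype t) ∈
      LinearMap.range (TensorProduct.map D.subtype D.subtype) := by
    intro t
    induction t with
    | zero => rw [map_zero, map_zero]; exact zero_mem _
    | add x y hx hy => rw [map_add, map_add]; exact add_mem hx hy
    | tmul x y =>
      refine mem_range_map (fun f => ?_) (fun g => ?_)
      · rw [TensorProduct.map_tmul, contractL_rAct_tmul]
        exact hD.right _ y.2 _
      · rw [TensorProduct.map_tmul, contractR_rAct_tmul]
        exact hD.right _ x.2 _
  obtain ⟨t, ht⟩ := h1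
  obtain ⟨u, hu⟩ := h2 t
  refine ⟨u, ?_⟩
  rw [TensorProduct.map_comp, LinearMap.comp_apply, hu, ht]
  rfl

/-- For every algebra homomorphism `φ : H_J → B` with `B ≠ 0`, the map `h ↦ h₁ ⊗ φ(h₂)` is
injective, as `h ⊗ 1` in `H_J ⊗ B` can be recovered with the translation map. -/
theorem eq_zero_of_lTensor_twComul {B : Type*} [Ring B] [Algebra k B] [Nontrivial B]
    (φ : Tw J →ₐ[k] B) {h : Tw J} (h0 : LinearMap.lTensor H φ.toLinearMap (twComul J h) = 0) :
    h = 0 := by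
  have h1 : ∀ t : H ⊗[k] Tw J, galInv (LinearMap.lTensor (Tw J) φ.toLinearMap ∘ₗ trans J)
      (LinearMap.lTensor H φ.toLinearMap t) =
      LinearMap.lTensor (Tw J) φ.toLinearMap (galInv (trans J) t) := by
    intro t
    induction t with
    | zero => simp
    | add x y hx hy => simp only [map_add, hx, hy]
    | tmul q b =>
      rw [LinearMap.lTensor_tmul, galInv_tmul, galInv_tmul, LinearMap.comp_apply]
      generalize trans J q = s
      induction s with
      | zero => simp
      | add x y hx hy => simp only [map_add, add_mul, hx, hy]
      | tmul x y => simp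
  have h2 := h1 (twComul J h)
  rw [h0, map_zero, galInv_coaction (galMap_trans J) (galMap_twComul_injective J),
    LinearMap.lTensor_tmul] at h2
  have h3 : (φ.toLinearMap 1 : B) ≠ 0 := by
    change φ 1 ≠ 0
    rw [map_one]
    exact one_ne_zero
  obtain ⟨f, hf⟩ := Module.Projective.exists_dual_eq_one k h3
  have h4 := congrArg (contractR f) h2
  rw [contractR_tmul, hf, one_smul, map_zero] at h4
  exact h4.symm

end TwistedGalois

/-! ### Galois objects are cleft -/

section Weights

variable {k : Type*} [Field k] {Q : Type*} [CommRing Q] [HopfAlgebra k Q]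

theorem lTensor_contractR_assoc {Q M N : Type*} [AddCommGroup Q] [Module k Q]
    [AddCommGroup M] [Module k M] [AddCommGroup N] [Module k N] (x : N →ₗ[k] k)
    (ρ : M →ₗ[k] Q ⊗[k] M) (t : M ⊗[k] N) :
    LinearMap.lTensor Q (contractR x) (TensorProduct.assoc k Q M N (LinearMap.rTensor N ρ t)) =
      ρ (contractR x t) := by
  induction t with
  | zero => simp
  | add x y hx hy => simp only [map_add, hx, hy]
  | tmul m n =>
    rw [LinearMap.rTensor_tmul, contractR_tmul, map_smul]
    generalize ρ m = s
    induction s with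
    | zero => simp
    | add x y hx hy => simp only [map_add, TensorProduct.add_tmul, smul_add, hx, hy]
    | tmul q m' => simp

/-- Over an algebraically closed field, every non-zero subcomodule of a comodule over a
cocommutative coalgebra contains a weight vector. -/
theorem exists_weight_vector [IsAlgClosed k] [Coalgebra.IsCocomm k Q] {M : Type*} [AddCommGroup M]
    [Module k M] (ρ : M →ₗ[k] Q ⊗[k] M)
    (hρ : LinearMap.lTensor Q ρ ∘ₗ ρ =
      (TensorProduct.assoc k Q Q M).toLinearMap ∘ₗ LinearMap.rTensor M Coalgebra.comul ∘ₗ ρ)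
    (hε : ∀ m, contractL Coalgebra.counit (ρ m) = m) (U : Submodule k M)
    (hU : ∀ m ∈ U, ∀ f : Q →ₗ[k] k, contractL f (ρ m) ∈ U) {m₀ : M} (hm₀ : m₀ ∈ U)
    (hne : m₀ ≠ 0) : ∃ m ∈ U, m ≠ 0 ∧ ∃ g, ρ m = g ⊗ₜ m := by
  classical
  obtain ⟨V, hV, hmV, sV⟩ := exists_finite_subcomodule ρ hρ hε m₀
  have hex : ∃ n : ℕ, ∃ W : Submodule k M, FiniteDimensional k W ∧ W ≤ U ∧ W ≠ ⊥ ∧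
      (∀ m ∈ W, ∀ f : Q →ₗ[k] k, contractL f (ρ m) ∈ W) ∧ Module.finrank k W = n :=
    ⟨_, V ⊓ U, Submodule.finiteDimensional_inf_left V U, inf_le_right,
      (Submodule.ne_bot_iff _).2 ⟨m₀, ⟨hmV, hm₀⟩, hne⟩,
      fun m hm f => ⟨sV m hm.1 f, hU m hm.2 f⟩, rfl⟩
  obtain ⟨W, hW, hWU, hWne, sW, hn⟩ := Nat.find_spec hex
  have hmin : ∀ W' : Submodule k M, W' ≤ W → W' ≠ ⊥ →
      (∀ m ∈ W', ∀ f : Q →ₗ[k] k, contractL f (ρ m) ∈ W') → W' = W := by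
    intro W' hle hne' hs
    have hfd : FiniteDimensional k W' := Submodule.finiteDimensional_of_le hle
    have h1 := Nat.find_min' hex ⟨W', hfd, hle.trans hWU, hne', hs, rfl⟩
    exact Submodule.eq_of_le_of_finrank_le hle (hn ▸ h1)
  -- on a simple subcomodule, every functional acts by a scalar
  have hscal : ∀ f : Q →ₗ[k] k, ∃ c : k, ∀ m ∈ W, contractL f (ρ m) = c • m := by
    intro f
    have : Nontrivial W := Submodule.nontrivial_iff_ne_bot.2 hWne
    let T : Module.End k W := (contractL f ∘ₗ ρ).restrict fun m hm => sW m hm f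
    obtain ⟨c, hc⟩ := Module.End.exists_eigenvalue T
    obtain ⟨w, hw⟩ := hc.exists_hasEigenvector
    refine ⟨c, ?_⟩
    let W' : Submodule k M := W ⊓ LinearMap.ker (contractL f ∘ₗ ρ - c • LinearMap.id)
    have hker : ∀ m, m ∈ LinearMap.ker (contractL f ∘ₗ ρ - c • LinearMap.id) ↔
        contractL f (ρ m) = c • m := fun m => by
      rw [LinearMap.mem_ker, LinearMap.sub_apply, sub_eq_zero]
      rfl
    have hW' : W' = W := by
      refine hmin W' inf_le_left ((Submodule.ne_bot_iff _).2 ⟨w, ⟨w.2, (hker _).2 ?_⟩, ?_⟩) ?_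
      · exact congrArg Subtype.val hw.apply_eq_smul
      · exact fun h => hw.2 (Subtype.ext h)
      · rintro m ⟨hm, hm'⟩ h
        refine ⟨sW m hm h, (hker _).2 ?_⟩
        rw [contractL_comul_comp f h ρ hρ, mul_comm, ← contractL_comul_comp h f ρ hρ,
          (hker m).1 hm', map_smul, map_smul]
    intro m hm
    rw [← hW'] at hm
    exact (hker m).1 hm.2
  obtain ⟨m, hm, hm0⟩ := (Submodule.ne_bot_iff _).1 hWne
  obtain ⟨ξ, hξ⟩ := Module.Projective.exists_dual_eq_one k hm0
  refine ⟨m, hWU hm, hm0, contractR ξ (ρ m), sub_eq_zero.1 (eq_zero_of_contractL fun f => ?_)⟩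
  obtain ⟨c, hc⟩ := hscal f
  rw [map_sub, sub_eq_zero, contractL_tmul, ← apply_contractL_eq, hc m hm, map_smul, hξ,
    smul_eq_mul, mul_one]

/-- The weight of a non-zero weight vector is grouplike. -/
theorem isGroupLikeElem_of_weight {M : Type*} [AddCommGroup M]
    [Module k M] (ρ : M →ₗ[k] Q ⊗[k] M)
    (hρ : LinearMap.lTensor Q ρ ∘ₗ ρ =
      (TensorProduct.assoc k Q Q M).toLinearMap ∘ₗ LinearMap.rTensor M Coalgebra.comul ∘ₗ ρ)
    (hε : ∀ m, contractL Coalgebra.counit (ρ m) = m) {m : M} (hm : m ≠ 0) {g : Q}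
    (hg : ρ m = g ⊗ₜ m) : IsGroupLikeElem k g := by
  obtain ⟨ξ, hξ⟩ := Module.Projective.exists_dual_eq_one k hm
  constructor
  · have h := congrArg ξ (hε m)
    rw [hg, contractL_tmul, map_smul, hξ, smul_eq_mul, mul_one] at h
    exact h
  · have h := congrArg (LinearMap.lTensor Q (contractR ξ)) (LinearMap.congr_fun hρ m)
    simp only [LinearMap.comp_apply, hg, LinearMap.lTensor_tmul, LinearEquiv.coe_coe] at h
    rw [lTensor_contractR_assoc] at h
    simp only [contractR_tmul, hξ, one_smul] at h
    exact h.symm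

end Weights

section Cleft

variable {k : Type*} [Field k] {Q : Type*} [CommRing Q] [HopfAlgebra k Q]
  {B : Type*} [Ring B] [Algebra k B]

/-- A Galois object over `Q` in which left multiplication by a weight vector can be moved to the
right: a left `Q`-comodule algebra `B` whose Galois map is bijective, the inverse being given by the
translation map `κ`. -/
structure IsGaloisObject (ρ : B →ₐ[k] Q ⊗[k] B) (κ : Q →ₗ[k] B ⊗[k] B) : Prop where
  coassoc : LinearMap.lTensor Q ρ.toLinearMap ∘ₗ ρ.toLinearMap =
    (TensorProduct.assoc k Q Q B).toLinearMap ∘ₗ LinearMap.rTensor B Coalgebra.comul ∘ₗ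
      ρ.toLinearMap
  counit : ∀ b, contractL Coalgebra.counit (ρ b) = b
  injective : Function.Injective (galMap ρ)
  galMap_apply : ∀ q, galMap ρ (κ q) = q ⊗ₜ 1
  exists_mul_eq : ∀ b g, ρ b = g ⊗ₜ b → ∀ c, ∃ c', c * b = b * c'

namespace IsGaloisObject

variable {ρ : B →ₐ[k] Q ⊗[k] B} {κ : Q →ₗ[k] B ⊗[k] B} (h : IsGaloisObject ρ κ)
include h

/-- Weight vectors are invertible: the translation map gives a left inverse, and by `exists_mul_eq`
it is also a right inverse. -/
theorem isUnit_of_weight {b : B} {g : Q} (hb : b ≠ 0) (hg : ρ b = g ⊗ₜ b) :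
    ∃ b', b * b' = 1 ∧ b' * b = 1 := by
  obtain ⟨ξ, hξ⟩ := Module.Projective.exists_dual_eq_one k hb
  have h1 := congrArg (contractL ξ) (galInv_coaction h.galMap_apply h.injective b)
  have h2 : ∀ t : B ⊗[k] B, contractL ξ (t * (1 ⊗ₜ b)) = contractL ξ t * b := fun t => by
    induction t with
    | zero => simp
    | add x y hx hy => simp only [add_mul, map_add, hx, hy]
    | tmul x y => simp
  rw [hg, galInv_tmul, h2, contractL_tmul, hξ, one_smul] at h1
  obtain ⟨u', hu'⟩ := h.exists_mul_eq b g hg (contractL ξ (κ g))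
  rw [h1] at hu'
  refine ⟨u', hu'.symm, ?_⟩
  have h3 : contractL ξ (κ g) = u' := by
    rw [← mul_one (contractL ξ (κ g)), hu', ← mul_assoc, h1, one_mul]
  rw [← h3, h1]

theorem trans_eq {b b' : B} {g : Q} (hb : b * b' = 1) (hg : ρ b = g ⊗ₜ b) :
    κ g = b ⊗ₜ b' := by
  apply h.injective
  rw [h.galMap_apply, galMap_tmul, hg, Algebra.TensorProduct.tmul_mul_tmul, hb, mul_one]

/-- Weight spaces are at most one-dimensional. -/
theorem exists_smul_of_weight {b c : B} {g : Q} (hb : b ≠ 0) (hg : ρ b = g ⊗ₜ b) (hc : c ≠ 0)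
    (hgc : ρ c = g ⊗ₜ c) : ∃ r : k, b = r • c := by
  have : Nontrivial B := nontrivial_of_ne b 0 hb
  obtain ⟨b', hb', -⟩ := h.isUnit_of_weight hb hg
  obtain ⟨c', hc', -⟩ := h.isUnit_of_weight hc hgc
  have hb0 : b' ≠ 0 := by
    rintro rfl
    rw [mul_zero] at hb'
    exact zero_ne_one hb'
  obtain ⟨ξ, hξ⟩ := Module.Projective.exists_dual_eq_one k hb0
  have h1 := congrArg (contractR ξ) ((h.trans_eq hb' hg).symm.trans (h.trans_eq hc' hgc))
  rw [contractR_tmul, contractR_tmul, hξ, one_smul] at h1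
  exact ⟨_, h1⟩

/-- There is a functional that is non-zero on all weight vectors, as there is up to scalars one
weight vector for each weight and the weights are linearly independent. -/
theorem exists_functional [Nontrivial B] : ∃ x : B →ₗ[k] k, x 1 = 1 ∧
    ∀ b g, b ≠ 0 → ρ b = g ⊗ₜ b → x b ≠ 0 := by
  let W := {g : Q // ∃ b : B, b ≠ 0 ∧ ρ b = g ⊗ₜ b}
  choose v hv0 hv using fun g : W => g.2
  have hW : LinearIndependent k (fun g : W => g.1) := by
    have := linearIndepOn_isGroupLikeElem (R := k) (A := Q)
    exact LinearIndepOn.mono this (t := {g : Q | ∃ b : B, b ≠ 0 ∧ ρ b = g ⊗ₜ b})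
      fun g ⟨b, hb, hg⟩ => isGroupLikeElem_of_weight ρ.toLinearMap h.coassoc h.counit hb hg
  have hli : LinearIndependent k v := by
    rw [linearIndependent_iff'] at hW ⊢
    intro s c hc g hg
    obtain ⟨ξ, hξ⟩ := Module.Projective.exists_dual_eq_one k (hv0 g)
    have h1 := congrArg (fun b => contractR ξ (ρ b)) hc
    simp only [map_sum, map_smul, hv, contractR_tmul, smul_smul, map_zero] at h1
    have h2 := hW s _ h1 g hg
    rwa [hξ, mul_one] at h2
  obtain ⟨x, hx⟩ := Module.exists_dual_forall_apply_eq_one (linearIndepOn_univ_iff.2 hli)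
  replace hx := fun i => hx i (Set.mem_univ i)
  have hx' : ∀ b g, b ≠ 0 → ρ b = g ⊗ₜ b → x b ≠ 0 := by
    intro b g hb hg h0
    let g' : W := ⟨g, b, hb, hg⟩
    obtain ⟨r, hr⟩ := h.exists_smul_of_weight hb hg (hv0 g') (hv g')
    rw [hr, map_smul, hx, smul_eq_mul, mul_one] at h0
    exact hb (by rw [hr, h0, zero_smul])
  have hx1 : x 1 ≠ 0 := hx' 1 1 one_ne_zero (by rw [map_one]; rfl)
  refine ⟨(x 1)⁻¹ • x, by simp [hx1], fun b g hb hg => ?_⟩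
  simpa [hx1] using hx' b g hb hg

theorem comul_contractR (x : B →ₗ[k] k) (b : B) :
    Coalgebra.comul (R := k) (contractR x (ρ b)) =
      LinearMap.lTensor Q (contractR x ∘ₗ ρ.toLinearMap) (ρ b) := by
  have h1 := congrArg (LinearMap.lTensor Q (contractR x)) (LinearMap.congr_fun h.coassoc b)
  simp only [LinearMap.comp_apply, LinearEquiv.coe_coe] at h1
  rw [lTensor_contractR_assoc] at h1
  rw [LinearMap.lTensor_comp, LinearMap.comp_apply]
  exact h1.symm

/-- A functional that does not vanish on weight vectors gives an embedding of the comodule `B` into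
`Q`, since the kernel would contain a weight vector. -/
theorem injective_of_weights [IsAlgClosed k] [Coalgebra.IsCocomm k Q] {x : B →ₗ[k] k}
    (hx : ∀ b g, b ≠ 0 → ρ b = g ⊗ₜ b → x b ≠ 0) :
    Function.Injective (contractR x ∘ₗ ρ.toLinearMap) := by
  rw [← LinearMap.ker_eq_bot, Submodule.eq_bot_iff]
  intro b hb
  by_contra hne
  obtain ⟨c, hc, hc0, g, hg⟩ := exists_weight_vector ρ.toLinearMap h.coassoc h.counit
    (LinearMap.ker (contractR x ∘ₗ ρ.toLinearMap)) (fun m hm f => by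
      rw [LinearMap.mem_ker, LinearMap.comp_apply] at hm
      have h1 := h.comul_contractR x m
      rw [show contractR x (ρ m) = 0 from hm, map_zero] at h1
      rw [LinearMap.mem_ker, ← contractL_lTensor]
      change contractL f (LinearMap.lTensor Q _ (ρ m)) = 0
      rw [← h1, map_zero]) hb hne
  have h1 : x c • g = 0 := by
    rw [← contractR_tmul, ← hg]
    exact hc
  have hg1 := isGroupLikeElem_of_weight ρ.toLinearMap h.coassoc h.counit hc0 hg
  exact (smul_ne_zero (hx c g hc0 hg) hg1.ne_zero) h1

/-- The translation map is `Q`-colinear for the coaction on the first factor of `B ⊗ B`. -/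
theorem lTensor_trans (q : Q) : TensorProduct.assoc k Q B B
    (LinearMap.rTensor B ρ.toLinearMap (κ q)) =
      LinearMap.lTensor Q κ (Coalgebra.comul (R := k) q) := by
  apply Module.Flat.lTensor_preserves_injective_linearMap (M := Q) (galMap ρ) h.injective
  have h1 : ∀ t : B ⊗[k] B, LinearMap.lTensor Q (galMap ρ) (TensorProduct.assoc k Q B B
      (LinearMap.rTensor B ρ.toLinearMap t)) =
      TensorProduct.assoc k Q Q B (LinearMap.rTensor B Coalgebra.comul (galMap ρ t)) := by
    intro t
    induction t with
    | zero => simp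
    | add x y hx hy => simp only [map_add, hx, hy]
    | tmul b c =>
      have h2 : ∀ t : Q ⊗[k] B, TensorProduct.assoc k Q Q B (LinearMap.rTensor B
          (Coalgebra.comul (R := k)) (t * (1 ⊗ₜ c))) = TensorProduct.assoc k Q Q B
          (LinearMap.rTensor B Coalgebra.comul t) * (1 ⊗ₜ (1 ⊗ₜ c)) := by
        intro t
        induction t with
        | zero => simp
        | add x y hx hy => simp only [map_add, add_mul, hx, hy]
        | tmul q b =>
          rw [Algebra.TensorProduct.tmul_mul_tmul, mul_one, LinearMap.rTensor_tmul,
            LinearMap.rTensor_tmul]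
          generalize Coalgebra.comul (R := k) q = s
          induction s with
          | zero => simp
          | add x y hx hy => simp only [map_add, TensorProduct.add_tmul, add_mul, hx, hy]
          | tmul x y => simp
      rw [galMap_tmul, h2]
      have h3 := LinearMap.congr_fun h.coassoc b
      simp only [LinearMap.comp_apply, LinearEquiv.coe_coe, AlgHom.toLinearMap_apply] at h3
      rw [← h3, LinearMap.rTensor_tmul, AlgHom.toLinearMap_apply]
      generalize ρ b = s
      induction s with
      | zero => simp
      | add x y hx hy => simp only [map_add, TensorProduct.add_tmul, add_mul, hx, hy]
      | tmul x y => simp [galMap_tmul]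
  rw [h1, h.galMap_apply, LinearMap.rTensor_tmul]
  generalize Coalgebra.comul (R := k) q = s
  induction s with
  | zero => simp
  | add x y hx hy => simp only [map_add, TensorProduct.add_tmul, hx, hy]
  | tmul x y => simp [h.galMap_apply]

theorem coaction_contractR_trans (x : B →ₗ[k] k) (q : Q) : ρ (contractR x (κ q)) =
    LinearMap.lTensor Q (contractR x ∘ₗ κ) (Coalgebra.comul (R := k) q) := by
  rw [LinearMap.lTensor_comp, LinearMap.comp_apply, ← h.lTensor_trans, lTensor_contractR_assoc]
  rfl

/-- The translation map of a grouplike `g` is `b ⊗ b⁻¹` for a vector `b` of weight `g`, and `b⁻¹` is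
again a weight vector. -/
theorem contractR_trans_ne_zero [Nontrivial B] {x : B →ₗ[k] k}
    (hx : ∀ b g, b ≠ 0 → ρ b = g ⊗ₜ b → x b ≠ 0) {g : Q} (hg : IsGroupLikeElem k g) :
    contractR x (κ g) ≠ 0 := by
  have h1 : κ g ≠ 0 := by
    intro h0
    have h2 := h.galMap_apply g
    rw [h0, map_zero] at h2
    obtain ⟨ξ, hξ⟩ := Module.Projective.exists_dual_eq_one k (one_ne_zero (α := B))
    have h3 := congrArg (contractR ξ) h2
    rw [map_zero, contractR_tmul, hξ, one_smul] at h3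
    exact hg.ne_zero h3.symm
  have h2 : ∃ η : B →ₗ[k] k, contractR η (κ g) ≠ 0 := by
    by_contra! hcon
    exact h1 (eq_zero_of_contractR hcon)
  obtain ⟨η, hη⟩ := h2
  obtain ⟨b, hb0, hb⟩ : ∃ b : B, b ≠ 0 ∧ ρ b = g ⊗ₜ b := by
    refine ⟨contractR η (κ g), hη, ?_⟩
    rw [h.coaction_contractR_trans, hg.comul_eq_tmul_self, LinearMap.lTensor_tmul]
    rfl
  obtain ⟨b', hb', hb''⟩ := h.isUnit_of_weight hb0 hb
  have hw : ρ b' = HopfAlgebra.antipode k g ⊗ₜ b' := by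
    have e1 : ρ b * (HopfAlgebra.antipode k g ⊗ₜ b') = 1 := by
      rw [hb, Algebra.TensorProduct.tmul_mul_tmul, hb', hg.mul_antipode_cancel,
        Algebra.TensorProduct.one_def]
    have e2 : ρ b' * ρ b = 1 := by rw [← map_mul, hb'', map_one]
    rw [← mul_one (ρ b'), ← e1, ← mul_assoc, e2, one_mul]
  have hb0' : b' ≠ 0 := by
    intro h0
    rw [h0, mul_zero] at hb'
    exact zero_ne_one hb'
  rw [h.trans_eq hb' hb, contractR_tmul]
  exact smul_ne_zero (hx _ _ hb0' hw) hb0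

/-- A functional that does not vanish on weight vectors also gives an embedding of `Q` into `B`. -/
theorem trans_injective_of_weights [Nontrivial B] [IsAlgClosed k] [Coalgebra.IsCocomm k Q]
    {x : B →ₗ[k] k}
    (hx : ∀ b g, b ≠ 0 → ρ b = g ⊗ₜ b → x b ≠ 0) : Function.Injective (contractR x ∘ₗ κ) := by
  rw [injective_iff_map_eq_zero]
  intro q hq
  by_contra hne
  have hstab : ∀ m ∈ LinearMap.ker (contractR x ∘ₗ κ), ∀ f : Q →ₗ[k] k,
      contractL f (Coalgebra.comul (R := k) m) ∈ LinearMap.ker (contractR x ∘ₗ κ) := by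
    intro m hm f
    have h1 := h.coaction_contractR_trans x m
    rw [show contractR x (κ m) = 0 from hm, map_zero] at h1
    rw [LinearMap.mem_ker, ← contractL_lTensor, ← h1, map_zero]
  obtain ⟨c, hc, hc0, g, hg⟩ := exists_weight_vector (k := k) (Q := Q) (M := Q)
    Coalgebra.comul lTensor_comul_comp_comul contractL_counit_comul
    (LinearMap.ker (contractR x ∘ₗ κ)) hstab hq hne
  have hg1 : IsGroupLikeElem k g := isGroupLikeElem_of_weight (k := k) (Q := Q) (M := Q)
    Coalgebra.comul lTensor_comul_comp_comul contractL_counit_comul hc0 hg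
  have h1 := contractR_counit_comul (k := k) c
  rw [hg, contractR_tmul] at h1
  have h2 : contractR x (κ c) = 0 := hc
  rw [← h1, map_smul, map_smul] at h2
  rcases smul_eq_zero.1 h2 with h3 | h3
  · rw [h3, zero_smul] at h1
    exact hc0 h1.symm
  · exact h.contractR_trans_ne_zero hx hg1 h3

/-- A Galois object is cleft: it is isomorphic to `Q` as a comodule. There are embeddings in both
directions, and the composite embedding `Q → Q` is the action of a functional, hence bijective by
`isUnit_of_rAct_injective`. -/
theorem exists_bijective [Nontrivial B] [IsAlgClosed k] [Coalgebra.IsCocomm k Q] :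
    ∃ x : B →ₗ[k] k, x 1 = 1 ∧ Function.Bijective (contractR x ∘ₗ ρ.toLinearMap) := by
  obtain ⟨x, hx1, hx⟩ := h.exists_functional
  have hT := h.injective_of_weights hx
  refine ⟨x, hx1, hT, ?_⟩
  have hs := h.trans_injective_of_weights hx
  let φ : WithConv (Q →ₗ[k] k) :=
    toConv (Coalgebra.counit ∘ₗ (contractR x ∘ₗ ρ.toLinearMap) ∘ₗ (contractR x ∘ₗ κ))
  have hφ : ∀ q, (contractR x ∘ₗ ρ.toLinearMap) ((contractR x ∘ₗ κ) q) = rAct φ q := by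
    intro q
    have h2 := congrArg (contractR Coalgebra.counit) (h.comul_contractR x (contractR x (κ q)))
    rw [contractR_counit_comul, h.coaction_contractR_trans x q] at h2
    rw [LinearMap.comp_apply, LinearMap.comp_apply, AlgHom.toLinearMap_apply,
      h.coaction_contractR_trans x q, h2, rAct_apply]
    generalize Coalgebra.comul (R := k) q = t
    induction t with
    | zero => simp
    | add x y hx hy => simp only [map_add, hx, hy]
    | tmul a b =>
      rw [LinearMap.lTensor_tmul, LinearMap.lTensor_tmul, contractR_tmul, contractR_tmul]
      rfl
  have hu : IsUnit φ := isUnit_of_rAct_injective fun q hq => by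
    rw [← hφ] at hq
    exact hs (hT (by rw [hq, map_zero, map_zero]))
  intro q
  refine ⟨(contractR x ∘ₗ κ) (rAct hu.unit⁻¹.val q), ?_⟩
  rw [hφ, rAct_rAct, IsUnit.mul_val_inv, rAct_one]

end IsGaloisObject

end Cleft

/-! ### Fibres of `H_J` over a central subalgebra -/

section Torsion

/-- A torsion-free element is sent to `1` by a functional with values in the field of fractions. -/
theorem exists_linearMap_apply_eq_one {R K N : Type*} [CommRing R] [Field K] [Algebra R K]
    [Module.Flat R K] [AddCommGroup N] [Module R N] {n : N} (hn : ∀ r : R, r • n = 0 → r = 0) :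
    ∃ F : N →ₗ[R] K, F n = 1 := by
  have hu : Function.Injective (LinearMap.toSpanSingleton R N n) := by
    rw [injective_iff_map_eq_zero]
    exact hn
  have h2 := Module.Flat.lTensor_preserves_injective_linearMap (M := K) _ hu
  have h3 : (1 : K) ⊗ₜ[R] n ≠ 0 := by
    intro h0
    have h4 := @h2 ((1 : K) ⊗ₜ 1) 0 (by
      rw [map_zero, LinearMap.lTensor_tmul, LinearMap.toSpanSingleton_apply, one_smul, h0])
    have h5 := congrArg (TensorProduct.rid R K) h4
    rw [TensorProduct.rid_tmul, one_smul, map_zero] at h5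
    exact one_ne_zero h5
  obtain ⟨F, hF⟩ := Module.Projective.exists_dual_eq_one K h3
  exact ⟨F.restrictScalars R ∘ₗ TensorProduct.mk R K N 1, hF⟩

/-- Let `Z` act on `M` and let `m` be an element with trivial annihilator.  If `z₀` has prime
annihilator `𝔭`, there is an equivariant map from `M` to the residue field of `𝔭` that sends `m` to
`1`: it is the composite of the action of `z₀`, whose image is killed by `𝔭`, with a functional. -/
theorem exists_equivariant {k Z : Type*} [Field k] [CommRing Z] [Algebra k Z] (𝔭 : Ideal Z)
    [𝔭.IsPrime] {z₀ : Z} (hz₀ : ∀ z, z ∈ 𝔭 ↔ z * z₀ = 0) {M : Type*} [AddCommGroup M] [Module k M]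
    (act : Z →ₐ[k] Module.End k M) (m : M) (hm : ∀ z, act z m = 0 → z = 0) :
    ∃ f : M →ₗ[k] FractionRing (Z ⧸ 𝔭), f m = 1 ∧
      ∀ z x, f (act z x) = algebraMap (Z ⧸ 𝔭) _ (Ideal.Quotient.mk 𝔭 z) * f x := by
  let instM : Module Z M := Module.compHom M act.toRingHom
  have hsmul : ∀ (z : Z) (x : M), z • x = act z x := fun _ _ => rfl
  let N := Submodule.torsionBySet Z M (𝔭 : Set Z)
  let K := FractionRing (Z ⧸ 𝔭)
  let T : M →ₗ[Z] N := LinearMap.codRestrict N (LinearMap.lsmul Z M z₀) fun x => by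
    rw [Submodule.mem_torsionBySet_iff]
    rintro ⟨p, hp⟩
    change p • z₀ • x = 0
    rw [smul_smul, (hz₀ p).1 hp, zero_smul]
  have hT : ∀ z x, T (z • x) = (Ideal.Quotient.mk 𝔭 z) • T x := by
    intro z x
    rw [map_smul]
    rfl
  have hu : ∀ q : Z ⧸ 𝔭, q • T m = 0 → q = 0 := by
    intro q hq
    obtain ⟨z, rfl⟩ := Ideal.Quotient.mk_surjective q
    rw [← hT] at hq
    have h1 : z₀ • z • m = 0 := congrArg Subtype.val hq
    rw [smul_smul, hsmul] at h1
    rw [Ideal.Quotient.eq_zero_iff_mem, hz₀, mul_comm]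
    exact hm _ h1
  have : Module.Flat (Z ⧸ 𝔭) K := IsLocalization.flat K (nonZeroDivisors (Z ⧸ 𝔭))
  obtain ⟨F, hF⟩ := exists_linearMap_apply_eq_one (K := K) hu
  have hF' : ∀ z x, F (T (act z x)) =
      algebraMap (Z ⧸ 𝔭) _ (Ideal.Quotient.mk 𝔭 z) * F (T x) := by
    intro z x
    rw [← hsmul, hT, map_smul, Algebra.smul_def]
  refine ⟨{ toFun := fun x => F (T x), map_add' := fun x y => ?_, map_smul' := fun c x => ?_ },
    hF, hF'⟩
  · rw [map_add, map_add]
  · have h4 := hF' (algebraMap k Z c) x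
    rw [AlgHom.commutes, Module.algebraMap_end_apply] at h4
    rw [h4, RingHom.id_apply, Algebra.smul_def]
    rfl

end Torsion

section Fiber

variable {k : Type u} [Field k] {H : Type v} [CommRing H] [HopfAlgebra k H] (J : Z2inv k H)

/-- The subalgebra of `H_J` generated by a finite-dimensional central subspace, as a commutative
ring `Z` with an embedding `j` into `H_J`. -/
theorem exists_center (D : Submodule k H) [FiniteDimensional k D]
    (hcent : ∀ d ∈ D, ∀ a : Tw J, a * tw J d = tw J d * a) :
    ∃ (Z : Type v) (_ : CommRing Z) (_ : Algebra k Z) (j : Z →ₐ[k] Tw J),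
      Algebra.FiniteType k Z ∧ Function.Injective j ∧
      j.range = Algebra.adjoin k (D.map (tw J).toLinearMap : Set (Tw J)) := by
  have := Algebra.isMulCommutative_adjoin k (s := (D.map (tw J).toLinearMap : Set (Tw J))) (by
    rintro _ - _ ⟨d, hd, rfl⟩
    exact hcent d hd _)
  let instZ : CommRing (Algebra.adjoin k (D.map (tw J).toLinearMap : Set (Tw J))) :=
    { (inferInstance : Ring (Algebra.adjoin k (D.map (tw J).toLinearMap : Set (Tw J)))) with
      mul_comm := this.is_comm.comm }
  refine ⟨Algebra.adjoin k (D.map (tw J).toLinearMap : Set (Tw J)), instZ, inferInstance,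
    Subalgebra.val _, ?_, Subtype.val_injective, Subalgebra.range_val _⟩
  have hfg : (Algebra.adjoin k (D.map (tw J).toLinearMap : Set (Tw J))).FG := by
    obtain ⟨T, hT⟩ := (Submodule.fg_iff_finiteDimensional (D.map (tw J).toLinearMap)).2
      inferInstance
    rw [← hT, Algebra.adjoin_span]
    exact Subalgebra.fg_adjoin_finset T
  exact (Subalgebra.fg_iff_finiteType _).1 hfg

/-- The functions whose translation has its second component in a subalgebra of `H_J`. -/
def transSubalgebra {Z : Type*} [CommRing Z] [Algebra k Z] (j : Z →ₐ[k] Tw J) :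
    Subalgebra k H where
  carrier := {a | trans J a ∈ LinearMap.range (LinearMap.lTensor (Tw J) j.toLinearMap)}
  mul_mem' := by
    rintro a b ⟨s, hs⟩ ⟨t, ht⟩
    change trans J (a * b) ∈ LinearMap.range _
    rw [trans_mul, ← hs, ← ht]
    clear hs ht
    induction s with
    | zero => rw [map_zero, map_zero]; exact zero_mem _
    | add x y hx hy => rw [map_add, map_add, LinearMap.add_apply]; exact add_mem hx hy
    | tmul r l =>
      induction t with
      | zero => rw [map_zero, map_zero]; exact zero_mem _
      | add x y hx hy => rw [map_add, map_add]; exact add_mem hx hy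
      | tmul r' l' =>
        exact ⟨(r * r') ⊗ₜ (l' * l), by
          rw [LinearMap.lTensor_tmul, LinearMap.lTensor_tmul, LinearMap.lTensor_tmul, starMul_tmul,
            AlgHom.toLinearMap_apply, map_mul]
          rfl⟩
  add_mem' := by
    intro a b ha hb
    change trans J (a + b) ∈ LinearMap.range _
    rw [map_add]
    exact add_mem ha hb
  algebraMap_mem' c := by
    refine ⟨c • (1 ⊗ₜ 1), ?_⟩
    have h1 : trans J 1 = 1 ⊗ₜ 1 := by
      apply galMap_twComul_injective
      rw [galMap_trans, galMap_tmul, map_one, one_mul]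
    rw [Algebra.algebraMap_eq_smul_one, map_smul, map_smul, h1, LinearMap.lTensor_tmul,
      AlgHom.toLinearMap_apply, map_one]

theorem contractR_lTensor {V W X : Type*} [AddCommGroup V] [Module k V] [AddCommGroup W]
    [Module k W] [AddCommGroup X] [Module k X] (f : X →ₗ[k] k) (L : W →ₗ[k] X) (t : V ⊗[k] W) :
    contractR f (LinearMap.lTensor V L t) = contractR (f ∘ₗ L) t := by
  induction t with
  | zero => simp
  | add x y hx hy => simp only [map_add, hx, hy]
  | tmul v w => simp

variable {J} {D : Submodule k H} (hD : IsSubcoalgebra D)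
  (hS : ∀ d ∈ D, HopfAlgebra.antipode k d ∈ D)

theorem IsSubcoalgebra.exists_comul_eq (hD : IsSubcoalgebra D) {d : H} (hd : d ∈ D) :
    ∃ t : D ⊗[k] D, TensorProduct.map D.subtype D.subtype t = Coalgebra.comul (R := k) d :=
  mem_range_map (hD.left d hd) (hD.right d hd)

include hD hS in
/-- The coaction maps the central subalgebra `Z` to `Y ⊗ Z`, where `Y` is the algebra of functions
whose translation has its second component in `Z`. For elements of `D` this holds as `D` is a
coalgebra stable under the antipode. -/
theorem twComul_mem_range {Z : Type*} [CommRing Z] [Algebra k Z] {j : Z →ₐ[k] Tw J}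
    (hj : j.range = Algebra.adjoin k (D.map (tw J).toLinearMap : Set (Tw J))) (z : Z) :
    twComul J (j z) ∈
      (Algebra.TensorProduct.map (transSubalgebra J j).val j).range := by
  have hDj : ∀ d : D, ∃ z, j z = tw J d := fun d => by
    have : tw J d ∈ j.range := hj ▸ Algebra.subset_adjoin ⟨d, d.2, rfl⟩
    exact this
  choose y hy using hDj
  have hDt : ∀ d ∈ D, d ∈ transSubalgebra J j := by
    intro d hd
    obtain ⟨t, ht⟩ := exists_trans_eq J hD hS hd
    change trans J d ∈ LinearMap.range _
    rw [ht]
    clear ht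
    induction t with
    | zero => rw [map_zero]; exact zero_mem _
    | add x y hx hy => rw [map_add]; exact add_mem hx hy
    | tmul a b => exact ⟨tw J a ⊗ₜ y b, by rw [LinearMap.lTensor_tmul]; exact congrArg _ (hy b)⟩
  have hle : j.range ≤ Subalgebra.comap (twComul J)
      (Algebra.TensorProduct.map (transSubalgebra J j).val j).range := by
    rw [hj, Algebra.adjoin_le_iff]
    rintro _ ⟨d, hd, rfl⟩
    obtain ⟨t, ht⟩ := hD.exists_comul_eq hd
    change LinearMap.lTensor H (tw J).toLinearMap (Coalgebra.comul (R := k) d) ∈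
      (Algebra.TensorProduct.map (transSubalgebra J j).val j).range
    rw [← ht]
    clear ht
    induction t with
    | zero => rw [map_zero, map_zero]; exact zero_mem _
    | add x y hx hy => rw [map_add, map_add]; exact add_mem hx hy
    | tmul a b =>
      refine ⟨(⟨a, hDt a a.2⟩ : transSubalgebra J j) ⊗ₜ y b, ?_⟩
      change (a : H) ⊗ₜ j (y b) = _
      rw [hy]
      rfl
  exact hle ⟨z, rfl⟩

include hD hS in
/-- The fibre of `H_J` at a point `χ` of its central subalgebra `Z` is not zero.  For `z` in `Z`,
put `θ(z) = ∑ z₁ χ(z₂)`; this is an injective homomorphism from `Z` to `H`.  If `f` and `g` are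
maps from `H` and from `H_J` to a residue field of `Z` that are `Z`-linear, where `z` acts on `H` by
`S(θ(z))`, then `h ↦ ∑ f(h₁) g(h₂)` factors through the fibre at `χ`. -/
theorem one_notMem_span [Nontrivial H] {Z : Type*} [CommRing Z] [Algebra k Z]
    [Algebra.FiniteType k Z] {j : Z →ₐ[k] Tw J} (hinj : Function.Injective j)
    (hj : j.range = Algebra.adjoin k (D.map (tw J).toLinearMap : Set (Tw J)))
    (hcomm : ∀ (z : Z) (a : Tw J), a * j z = j z * a) (χ : Z →ₐ[k] k) :
    (1 : Tw J) ∉ Ideal.span (Set.range fun z => j z - algebraMap k (Tw J) (χ z)) := by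
  let Y := transSubalgebra J j
  let m : Y ⊗[k] Z →ₐ[k] H ⊗[k] Tw J := Algebra.TensorProduct.map Y.val j
  have hm : Function.Injective m := TensorProduct.map_injective_of_flat_flat
    Y.val.toLinearMap j.toLinearMap Subtype.val_injective hinj
  let δ : Z →ₐ[k] Y ⊗[k] Z := ((AlgEquiv.ofInjective m hm).symm : m.range →ₐ[k] Y ⊗[k] Z).comp
    (((twComul J).comp j).codRestrict m.range fun z => twComul_mem_range hD hS hj z)
  have hδ : ∀ z, m (δ z) = twComul J (j z) := fun z =>
    congrArg Subtype.val ((AlgEquiv.ofInjective m hm).apply_symm_apply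
      ⟨twComul J (j z), twComul_mem_range hD hS hj z⟩)
  let evχ : Y ⊗[k] Z →ₐ[k] H := Algebra.TensorProduct.lift Y.val
    ((Algebra.ofId k H).comp χ) fun _ _ => mul_comm _ _
  let θ : Z →ₐ[k] H := evχ.comp δ
  let t : Z →ₐ[k] H := (HopfAlgebra.antipodeAlgHom k H).comp θ
  -- an extension of `χ` to a functional on `H`
  obtain ⟨ν, hν⟩ := LinearMap.exists_leftInverse_of_injective j.toLinearMap
    (LinearMap.ker_eq_bot.2 hinj)
  let x : Tw J →ₗ[k] k := χ.toLinearMap ∘ₗ ν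
  have hx : ∀ z, x (j z) = χ z := fun z => congrArg χ (LinearMap.congr_fun hν z)
  have hx1 : x 1 = 1 := by rw [← map_one j, hx, map_one]
  let x₀ : Dual1 k H := toConv (x ∘ₗ (tw J).toLinearMap)
  have hev : ∀ u, evχ u = contractR x (m u) := by
    intro u
    induction u with
    | zero => simp
    | add a b ha hb => simp only [map_add, ha, hb]
    | tmul y w =>
      change (y : H) * algebraMap k H (χ w) = contractR x ((y : H) ⊗ₜ j w)
      rw [contractR_tmul, hx, mul_comm, ← Algebra.smul_def]
  have hθ : ∀ z, θ z = rAct x₀ ((tw J).symm (j z)) := by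
    intro z
    change evχ (δ z) = _
    rw [hev, hδ]
    exact contractR_lTensor x (tw J).toLinearMap _
  have hθinj : ∀ z, θ z = 0 → z = 0 := by
    -- `z` is recovered from `θ(z)` with the translation map, as `x` is multiplicative on `Z`
    have h1 : ∀ u, contractR x (galInv (trans J) (m u)) = contractR x (trans J (evχ u)) := by
      intro u
      induction u with
      | zero => simp
      | add a b ha hb => simp only [map_add, ha, hb]
      | tmul y w =>
        obtain ⟨s, hs⟩ := y.2
        change contractR x (trans J y * (1 ⊗ₜ j w)) =
          contractR x (trans J ((y : H) * algebraMap k H (χ w)))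
        rw [mul_comm (y : H), ← Algebra.smul_def, map_smul, map_smul, ← hs]
        clear hs
        induction s with
        | zero => simp
        | add a b ha hb => simp only [map_add, add_mul, smul_add, ha, hb]
        | tmul r l =>
          rw [LinearMap.lTensor_tmul, AlgHom.toLinearMap_apply, Algebra.TensorProduct.tmul_mul_tmul,
            mul_one, ← map_mul, contractR_tmul, contractR_tmul, hx, hx, map_mul, smul_smul,
            mul_comm]
    intro z hz
    have h2 := h1 (δ z)
    rw [hδ, galInv_coaction (galMap_trans J) (galMap_twComul_injective J), contractR_tmul, hx1,
      one_smul, show evχ (δ z) = 0 from hz, map_zero, map_zero] at h2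
    exact hinj (h2.trans (map_zero j).symm)
  have ht : ∀ z, t z = 0 → z = 0 := fun z hz => by
    refine hθinj z ?_
    rw [← antipode_antipode_apply (k := k) (θ z)]
    change HopfAlgebra.antipode k (t z) = 0
    rw [hz, map_zero]
  -- applied to the coaction of `z`, this is `∑ z₁ S(z₂) χ(z₃) = χ(z)`
  let evt : Y ⊗[k] Z →ₐ[k] H := Algebra.TensorProduct.lift Y.val t fun _ _ => mul_comm _ _
  have hevt : ∀ z, evt (δ z) = algebraMap k H (χ z) := by
    intro z
    let τ : Tw J →ₗ[k] H := HopfAlgebra.antipode k ∘ₗ rAct x₀ ∘ₗ (tw J).symm.toLinearMap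
    have hτ : ∀ w, τ (j w) = t w := fun w => congrArg (HopfAlgebra.antipode k) (hθ w).symm
    have h1 : ∀ u, evt u = LinearMap.mul' k H (LinearMap.lTensor H τ (m u)) := by
      intro u
      induction u with
      | zero => simp
      | add a b ha hb => simp only [map_add, ha, hb]
      | tmul y w =>
        change (y : H) * t w = (y : H) * τ (j w)
        rw [hτ]
    have h2 : (toConv LinearMap.id * toConv (HopfAlgebra.antipode k ∘ₗ rAct x₀) :
        WithConv (H →ₗ[k] H)) = scal H x₀ := by
      rw [comp_rAct, ← mul_assoc, LinearMap.id_mul_antipode, one_mul]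
    have h3 := congrArg (fun f : WithConv (H →ₗ[k] H) => f ((tw J).symm (j z))) h2
    rw [h1, hδ, ← hx]
    refine Eq.trans ?_ h3
    let r := Coalgebra.Repr.arbitrary k ((tw J).symm (j z))
    refine Eq.trans ?_ (r.convMul_apply _ _).symm
    change LinearMap.mul' k H (LinearMap.lTensor H τ (LinearMap.lTensor H (tw J).toLinearMap
      (Coalgebra.comul (R := k) ((tw J).symm (j z))))) = _
    rw [← r.eq]
    simp only [map_sum, LinearMap.lTensor_tmul, LinearMap.mul'_apply]
    rfl
  -- a prime ideal of `Z` that is the annihilator of an element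
  have : Nontrivial Z := by
    refine nontrivial_of_ne 1 0 fun h0 => ?_
    have h1 := congrArg j h0
    rw [map_one, map_zero] at h1
    exact one_ne_zero (α := H) h1
  have : IsNoetherianRing Z := Algebra.FiniteType.isNoetherianRing k Z
  obtain ⟨𝔭, h𝔭, -⟩ := exists_le_isAssociatedPrime_of_isNoetherianRing Z (1 : Z) one_ne_zero
  have hprime : 𝔭.IsPrime := h𝔭.1
  obtain ⟨z₀, hz₀⟩ : ∃ z₀ : Z, ∀ z, z ∈ 𝔭 ↔ z * z₀ = 0 := by
    obtain ⟨-, z₀, rfl⟩ := isAssociatedPrime_iff.1 h𝔭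
    exact ⟨z₀, fun z => by rw [Submodule.mem_colon_singleton, Submodule.mem_bot, smul_eq_mul]⟩
  obtain ⟨f, hf1, hf⟩ := exists_equivariant 𝔭 hz₀ ((Algebra.lmul k H).comp t) 1 fun z hz =>
    ht z (by simpa using hz)
  obtain ⟨g, hg1, hg⟩ := exists_equivariant 𝔭 hz₀ ((Algebra.lmul k (Tw J)).comp j) 1 fun z hz =>
    hinj (by simpa using hz)
  -- `Ψ` composed with the coaction vanishes on the ideal of the fibre and is `1` at `1`
  let Ψ : H ⊗[k] Tw J →ₗ[k] FractionRing (Z ⧸ 𝔭) := LinearMap.mul' k _ ∘ₗ TensorProduct.map f g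
  have hΨ : ∀ X u, Ψ (X * m u) = Ψ (X * (evt u ⊗ₜ 1)) := by
    intro X u
    induction X with
    | zero => rw [zero_mul, zero_mul]
    | add a b ha hb => rw [add_mul, add_mul, map_add, map_add, ha, hb]
    | tmul a b =>
      induction u with
      | zero => rw [map_zero, map_zero, TensorProduct.zero_tmul]
      | add c d hc hd =>
        rw [map_add, map_add, TensorProduct.add_tmul, mul_add, mul_add, map_add, map_add, hc, hd]
      | tmul y w =>
        have e1 : m (y ⊗ₜ w) = (y : H) ⊗ₜ j w := rfl
        have e2 : evt (y ⊗ₜ w) = (y : H) * t w := rfl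
        rw [e1, e2, Algebra.TensorProduct.tmul_mul_tmul, Algebra.TensorProduct.tmul_mul_tmul]
        change f (a * y) * g (b * j w) = f (a * (y * t w)) * g (b * 1)
        rw [hcomm, mul_one, ← mul_assoc, mul_comm _ (t w)]
        have h1 : f (t w * (a * y)) = _ := hf w (a * y)
        have h2 : g (j w * b) = _ := hg w b
        rw [h1, h2]
        ring
  have hΨ' : ∀ a z, Ψ (twComul J (a * (j z - algebraMap k (Tw J) (χ z)))) = 0 := by
    intro a z
    rw [mul_sub, map_sub, map_sub, map_mul, ← hδ, hΨ, hevt, sub_eq_zero]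
    rw [map_mul (twComul J), AlgHom.commutes, Algebra.TensorProduct.algebraMap_apply]
  intro h1
  have h2 : ∀ b ∈ Ideal.span (Set.range fun z => j z - algebraMap k (Tw J) (χ z)),
      ∀ a, Ψ (twComul J (a * b)) = 0 := by
    intro b hb
    induction hb using Submodule.span_induction with
    | mem b hb =>
      obtain ⟨z, rfl⟩ := hb
      exact fun a => hΨ' a z
    | zero => intro a; rw [mul_zero, map_zero, map_zero]
    | add b c _ _ hb hc => intro a; rw [mul_add, map_add, map_add, hb, hc, add_zero]
    | smul c b _ hb => intro a; rw [smul_eq_mul, ← mul_assoc]; exact hb _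
  have h3 := h2 1 h1 1
  rw [one_mul, map_one, Algebra.TensorProduct.one_def] at h3
  change f 1 * g 1 = 0 at h3
  rw [hf1, hg1, one_mul] at h3
  exact one_ne_zero h3

end Fiber

/-! ### A Galois object over `O(A)` -/

section Descent

variable {k : Type u} [Field k] {H : Type v} [CommRing H] [HopfAlgebra k H]

theorem IsSubcoalgebra.exists_repr {D : Submodule k H} (hD : IsSubcoalgebra D) {d : H}
    (hd : d ∈ D) : ∃ s : Coalgebra.Repr k d (D × D),
      (∀ i, s.left i ∈ D) ∧ ∀ i, s.right i ∈ D := by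
  obtain ⟨t, ht⟩ := hD.exists_comul_eq hd
  obtain ⟨S, hS⟩ := TensorProduct.exists_finset t
  refine ⟨⟨S, fun i => i.1, fun i => i.2, ?_⟩, fun i => i.1.2, fun i => i.2.2⟩
  rw [← ht, hS, map_sum]
  rfl

theorem upull_inl_swap (J : (Dual2 k H)ˣ) : upull inl (swap J) = upull inr J := by
  apply Units.ext
  apply WithConv.ext
  ext a
  change J.val.ofConv (flipHom k H ((inl : H →ₗc[k] H ⊗[k] H) a)) =
    J.val.ofConv ((inr : H →ₗc[k] H ⊗[k] H) a)
  rw [inl_apply, inr_apply, flipHom_apply]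

theorem IsHopf2Cocycle.upull_inl {J : (Dual2 k H)ˣ} (hJ : IsHopf2Cocycle J) : upull inl J = 1 :=
  Units.ext ((right_one_iff _).1 hJ.right_one)

theorem IsHopf2Cocycle.upull_inl_swap {J : (Dual2 k H)ˣ} (hJ : IsHopf2Cocycle J) :
    upull inl (swap J) = 1 :=
  (InvCocycle.upull_inl_swap J).trans (Units.ext ((left_one_iff _).1 hJ.left_one))

theorem mul_inv_swap_apply_one {J : (Dual2 k H)ˣ} (hJ : IsHopf2Cocycle J) (a : H) :
    (J * (swap J)⁻¹).val (a ⊗ₜ 1) = Coalgebra.counit (R := k) a := by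
  refine (right_one_iff _).2 (congrArg Units.val (?_ : upull inl (J * (swap J)⁻¹) = 1)) a
  rw [map_mul, map_inv, hJ.upull_inl, hJ.upull_inl_swap, inv_one, one_mul]

theorem rMatrix_apply_one {J : (Dual2 k H)ˣ} (hJ : IsHopf2Cocycle J) (a : H) :
    (rMatrix J).val (a ⊗ₜ 1) = Coalgebra.counit (R := k) a := by
  refine (right_one_iff _).2 (congrArg Units.val (?_ : upull inl (rMatrix J) = 1)) a
  rw [rMatrix, map_mul, map_inv, hJ.upull_inl, hJ.upull_inl_swap, inv_one, one_mul]

variable {J : Z2inv k H} {A : ClosedSubgroup k H} {R₀ : (Dual2 k A.Fun)ˣ}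
  (hR₀ : A.lift R₀ = J.val * (swap J.val)⁻¹) {D : Submodule k H} (hD : IsSubcoalgebra D)
  (hS : ∀ d ∈ D, HopfAlgebra.antipode k d ∈ D)
  (hDA : ∀ d ∈ D, d - algebraMap k H (Coalgebra.counit (R := k) d) ∈ A.ideal)

theorem ClosedSubgroup.mk_eq_algebraMap {A : ClosedSubgroup k H} {D : Submodule k H}
    (hDA : ∀ d ∈ D, d - algebraMap k H (Coalgebra.counit (R := k) d) ∈ A.ideal) {d : H}
    (hd : d ∈ D) :
    Ideal.Quotient.mk A.ideal d = Coalgebra.counit (R := k) d • (1 : A.Fun) := by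
  have h := Ideal.Quotient.eq.2 (hDA d hd)
  rw [h, ← Algebra.algebraMap_eq_smul_one]
  rfl

include hR₀ hD hDA in
/-- Functions on `G/A` are central in `H_J` if `J * J₂₁⁻¹` descends to `A`. -/
theorem mul_tw_comm {d : H} (hd : d ∈ D) (a : Tw J) : a * tw J d = tw J d * a := by
  obtain ⟨a, rfl⟩ := (tw J).surjective a
  obtain ⟨s, hs, -⟩ := hD.exists_repr hd
  let r := Coalgebra.Repr.arbitrary k a
  rw [tw_mul_comm J r s]
  have h1 : ∀ i j, (J.val * (swap J.val)⁻¹).val (r.left i ⊗ₜ s.left j) =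
      Coalgebra.counit (R := k) (r.left i) * Coalgebra.counit (R := k) (s.left j) := by
    intro i j
    have h2 := mul_inv_swap_apply_one J.2.1 (r.left i)
    rw [← hR₀, ClosedSubgroup.lift_apply] at h2 ⊢
    rw [ClosedSubgroup.mk_eq_algebraMap hDA (hs j), TensorProduct.tmul_smul]
    refine (map_smul R₀.val.ofConv _ _).trans ?_
    rw [smul_eq_mul, mul_comm]
    exact congrArg (· * _) h2
  conv_rhs => rw [← Coalgebra.sum_counit_smul r, ← Coalgebra.sum_counit_smul s]
  simp only [map_sum, map_smul, Finset.sum_mul_sum, smul_mul_smul_comm, h1]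
  rw [Finset.sum_comm]
  simp only [mul_comm]

include hR₀ hD hDA hS in
/-- A non-zero quotient `B` of `H_J` in which the elements of `D` become scalars, universal with
respect to these relations: the fibre of `H_J` at a point of the central subalgebra generated by
`D`, which exists by the Nullstellensatz. -/
theorem exists_fiber [IsAlgClosed k] [Nontrivial H] [FiniteDimensional k D] :
    ∃ (B : Type v) (_ : Ring B) (_ : Algebra k B) (_ : Nontrivial B) (p : Tw J →ₐ[k] B)
      (c : H → k), Function.Surjective p ∧ (∀ d ∈ D, p (tw J d) = algebraMap k B (c d)) ∧
      ∀ (E : Type v) [Ring E] [Algebra k E] (φ : Tw J →ₐ[k] E),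
        (∀ d ∈ D, φ (tw J d) = algebraMap k E (c d)) → ∃ ψ : B →ₐ[k] E, ψ.comp p = φ := by
  have hcent := fun d (hd : d ∈ D) => mul_tw_comm hR₀ hD hDA hd
  obtain ⟨Z, _, _, j, _, hinj, hj⟩ := exists_center J D hcent
  have hcomm : ∀ (z : Z) (a : Tw J), a * j z = j z * a := by
    have h1 : j.range ≤ Subalgebra.center k (Tw J) := by
      rw [hj, Algebra.adjoin_le_iff]
      rintro _ ⟨d, hd, rfl⟩
      exact Subalgebra.mem_center_iff.2 (hcent d hd)
    exact fun z => Subalgebra.mem_center_iff.1 (h1 ⟨z, rfl⟩)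
  have hDj : ∀ d ∈ D, ∃ z, j z = tw J d := fun d hd => by
    have : tw J d ∈ j.range := hj ▸ Algebra.subset_adjoin ⟨d, hd, rfl⟩
    exact this
  have : Nontrivial Z := by
    refine nontrivial_of_ne 1 0 fun h0 => ?_
    have h1 := congrArg j h0
    rw [map_one, map_zero] at h1
    exact one_ne_zero (α := H) h1
  obtain ⟨χ⟩ := nonempty_algHom (k := k) (R := Z)
  let I : Ideal (Tw J) := Ideal.span (Set.range fun z => j z - algebraMap k (Tw J) (χ z))
  have hI : I.IsTwoSided := by
    refine ⟨fun {a} b ha => ?_⟩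
    induction ha using Submodule.span_induction with
    | mem a ha =>
      obtain ⟨z, rfl⟩ := ha
      have h1 : (j z - algebraMap k (Tw J) (χ z)) * b = b * (j z - algebraMap k (Tw J) (χ z)) := by
        rw [sub_mul, mul_sub, hcomm, Algebra.commutes]
      change (j z - algebraMap k (Tw J) (χ z)) * b ∈ I
      rw [h1]
      exact I.mul_mem_left b (Ideal.subset_span ⟨z, rfl⟩)
    | zero => rw [zero_mul]; exact zero_mem _
    | add x y _ _ hx hy => rw [add_mul]; exact add_mem hx hy
    | smul c x _ hx => rw [smul_eq_mul, mul_assoc]; exact I.mul_mem_left c hx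
  have h1 := one_notMem_span hD hS hinj hj hcomm χ
  have hnt : Nontrivial (Tw J ⧸ I) :=
    Ideal.Quotient.nontrivial_iff.2 ((Ideal.ne_top_iff_one I).2 h1)
  choose! y hy using hDj
  refine ⟨Tw J ⧸ I, inferInstance, inferInstance, hnt, Ideal.Quotient.mkₐ k I, fun d => χ (y d),
    Ideal.Quotient.mkₐ_surjective k I, fun d hd => ?_, fun E _ _ φ hφ => ?_⟩
  · rw [← hy d hd, ← AlgHom.commutes (Ideal.Quotient.mkₐ k I), ← sub_eq_zero, ← map_sub]
    exact Ideal.Quotient.eq_zero_iff_mem.2 (Ideal.subset_span ⟨y d, rfl⟩)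
  · have h2 : ∀ z, φ (j z) = algebraMap k E (χ z) := by
      let S : Subalgebra k Z := AlgHom.equalizer (φ.comp j) ((Algebra.ofId k E).comp χ)
      have h3 : j.range ≤ S.map j := by
        rw [hj, Algebra.adjoin_le_iff]
        rintro _ ⟨d, hd, rfl⟩
        refine ⟨y d, ?_, hy d hd⟩
        change φ (j (y d)) = algebraMap k E (χ (y d))
        rw [hy d hd, hφ d hd]
      intro z
      obtain ⟨z', hz', hzz⟩ := h3 ⟨z, rfl⟩
      exact hinj hzz ▸ hz'
    refine ⟨Ideal.Quotient.liftₐ I φ fun a ha => ?_, ?_⟩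
    · have h3 : I ≤ RingHom.ker φ := by
        rw [Ideal.span_le]
        rintro _ ⟨z, rfl⟩
        change φ _ = 0
        rw [map_sub, h2, AlgHom.commutes, sub_self]
      exact h3 ha
    · ext a
      rfl

include hR₀ hD hS hDA in
/-- If `J * J₂₁⁻¹` descends to `A`, then `H_J` has a quotient that is a Galois object over `O(A)`,
with coaction induced by that of `H` on `H_J`. -/
theorem exists_isGaloisObject [IsAlgClosed k] [Nontrivial H] [FiniteDimensional k D]
    (hA : A.ideal ≤ Ideal.span ((fun d => d - algebraMap k H (Coalgebra.counit (R := k) d)) '' D)) :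
    ∃ (B : Type v) (_ : Ring B) (_ : Algebra k B) (_ : Nontrivial B) (p : Tw J →ₐ[k] B)
      (ρ : B →ₐ[k] A.Fun ⊗[k] B) (κ : A.Fun →ₗ[k] B ⊗[k] B),
      Function.Surjective p ∧ IsGaloisObject ρ κ ∧
      ∀ h, ρ (p (tw J h)) = TensorProduct.map (Ideal.Quotient.mkₐ k A.ideal).toLinearMap
        (p.toLinearMap ∘ₗ (tw J).toLinearMap) (Coalgebra.comul (R := k) h) := by
  obtain ⟨B, _, _, hB, p, c, hp, hpD, hlift⟩ := exists_fiber hR₀ hD hS hDA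
  let π : H →ₐ[k] A.Fun := Ideal.Quotient.mkₐ k A.ideal
  have hπD : ∀ d ∈ D, π d = Coalgebra.counit (R := k) d • 1 := fun d hd =>
    ClosedSubgroup.mk_eq_algebraMap hDA hd
  let pt : H →ₗ[k] B := p.toLinearMap ∘ₗ (tw J).toLinearMap
  have hpt : ∀ b, ∃ h, pt h = b := fun b => by
    obtain ⟨a, ha⟩ := hp b
    exact ⟨(tw J).symm a, ha⟩
  have hmap : ∀ a, Algebra.TensorProduct.map π p (twComul J (tw J a)) =
      TensorProduct.map π.toLinearMap pt (Coalgebra.comul (R := k) a) := by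
    intro a
    rw [twComul_tw]
    change TensorProduct.map π.toLinearMap p.toLinearMap _ = _
    rw [LinearMap.lTensor, ← LinearMap.comp_apply, ← TensorProduct.map_comp]
    rfl
  -- the coaction
  obtain ⟨ρ, hρ⟩ := hlift (A.Fun ⊗[k] B) ((Algebra.TensorProduct.map π p).comp (twComul J)) (by
    intro d hd
    obtain ⟨s, hs, hs'⟩ := hD.exists_repr hd
    rw [AlgHom.comp_apply, hmap, ← s.eq, map_sum]
    have h1 : ∀ i, TensorProduct.map π.toLinearMap pt (s.left i ⊗ₜ s.right i) =
        (1 : A.Fun) ⊗ₜ[k] (pt (Coalgebra.counit (R := k) (s.left i) • s.right i)) := by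
      intro i
      rw [TensorProduct.map_tmul, AlgHom.toLinearMap_apply, hπD _ (hs i), map_smul,
        TensorProduct.smul_tmul]
    simp only [h1]
    rw [← TensorProduct.tmul_sum, ← map_sum, Coalgebra.sum_counit_smul]
    change (1 : A.Fun) ⊗ₜ[k] p (tw J d) = _
    rw [hpD d hd, Algebra.algebraMap_eq_smul_one, TensorProduct.tmul_smul,
      Algebra.algebraMap_eq_smul_one]
    rfl)
  have hρ' : ∀ a, ρ (p a) = Algebra.TensorProduct.map π p (twComul J a) := fun a =>
    congrArg (fun f : Tw J →ₐ[k] A.Fun ⊗[k] B => f a) hρ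
  have hρt : ∀ h, ρ (pt h) = TensorProduct.map π.toLinearMap pt (Coalgebra.comul (R := k) h) :=
    fun h => (hρ' _).trans (hmap h)
  have hgal : ∀ t, galMap ρ (TensorProduct.map p.toLinearMap p.toLinearMap t) =
      Algebra.TensorProduct.map π p (galMap (twComul J) t) := by
    intro t
    induction t with
    | zero => simp
    | add x y hx hy => simp only [map_add, hx, hy]
    | tmul a b => simp [galMap_tmul, hρ']
  -- the translation map
  let L : H →ₗ[k] B ⊗[k] B := TensorProduct.map p.toLinearMap p.toLinearMap ∘ₗ trans J
  have hgalL : ∀ h, galMap ρ (L h) = π h ⊗ₜ 1 := by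
    intro h
    change galMap ρ (TensorProduct.map p.toLinearMap p.toLinearMap (trans J h)) = _
    rw [hgal, galMap_trans, Algebra.TensorProduct.map_tmul, map_one]
  have hLmul : ∀ a b, L (a * b) = starMul (L a) (L b) := by
    intro a b
    change TensorProduct.map _ _ (trans J (a * b)) = _
    rw [trans_mul, map_starMul]
    rfl
  -- the translation of `d` lies in the square of `D`, hence becomes a scalar; the Galois map shows
  -- which one
  have hLD : ∀ d ∈ D, L d = Coalgebra.counit (R := k) d • (1 ⊗ₜ 1) := by
    intro d hd
    obtain ⟨t, ht⟩ := exists_trans_eq J hD hS hd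
    have h1 : ∃ s : k, L d = s • (1 ⊗ₜ 1) := by
      change ∃ s : k, TensorProduct.map p.toLinearMap p.toLinearMap (trans J d) = s • (1 ⊗ₜ 1)
      rw [ht]
      clear ht
      induction t with
      | zero => exact ⟨0, by simp⟩
      | add x y hx hy =>
        obtain ⟨s, hs⟩ := hx
        obtain ⟨s', hs'⟩ := hy
        exact ⟨s + s', by rw [map_add, map_add, hs, hs', add_smul]⟩
      | tmul x y =>
        refine ⟨c x * c y, ?_⟩
        change p (tw J x) ⊗ₜ[k] p (tw J y) = _
        rw [hpD _ x.2, hpD _ y.2, Algebra.algebraMap_eq_smul_one, Algebra.algebraMap_eq_smul_one,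
          TensorProduct.smul_tmul_smul]
    obtain ⟨s, hs⟩ := h1
    have h2 := hgalL d
    rw [hs, hπD d hd, map_smul, galMap_tmul, map_one, one_mul, ← TensorProduct.smul_tmul'] at h2
    have h3 := congrArg (contractL (Coalgebra.counit (R := k) (A := A.Fun))) h2
    rw [map_smul, map_smul, contractL_tmul, Bialgebra.counit_one, one_smul] at h3
    rw [hs, smul_left_injective k (one_ne_zero (α := B)) h3]
  -- so the translation map descends to `O(A)`, whose ideal is generated by the `d - ε(d)`
  have hLA : ∀ a ∈ A.ideal, L a = 0 := by
    intro a ha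
    have h1 := hA ha
    clear ha
    induction h1 using Submodule.span_induction with
    | mem x hx =>
      obtain ⟨d, hd, rfl⟩ := hx
      rw [map_sub, hLD d hd, Algebra.algebraMap_eq_smul_one, map_smul, sub_eq_zero]
      congr 1
      change _ = TensorProduct.map p.toLinearMap p.toLinearMap (trans J 1)
      rw [show trans J 1 = 1 ⊗ₜ 1 from galMap_twComul_injective J (by
        rw [galMap_trans, galMap_tmul, map_one, one_mul])]
      simp
    | zero => exact map_zero L
    | add x y _ _ hx hy => rw [map_add, hx, hy, add_zero]
    | smul b x _ hx => rw [smul_eq_mul, hLmul, hx, map_zero]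
  obtain ⟨σ, hσ⟩ := LinearMap.exists_rightInverse_of_surjective π.toLinearMap
    (LinearMap.range_eq_top.2 (Ideal.Quotient.mkₐ_surjective k A.ideal))
  let κ : A.Fun →ₗ[k] B ⊗[k] B := L ∘ₗ σ
  have hκ : ∀ h, κ (π h) = L h := by
    intro h
    change L (σ (π h)) = L h
    rw [← sub_eq_zero, ← map_sub]
    refine hLA _ (Ideal.Quotient.eq_zero_iff_mem.1 ?_)
    rw [map_sub, sub_eq_zero]
    exact LinearMap.congr_fun hσ (π h)
  have hπ : ∀ q, ∃ h, π h = q := Ideal.Quotient.mk_surjective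
  have hgκ : ∀ q, galMap ρ (κ q) = q ⊗ₜ 1 := by
    intro q
    obtain ⟨h, rfl⟩ := hπ q
    rw [hκ, hgalL]
  refine ⟨B, inferInstance, inferInstance, hB, p, ρ, κ, hp, ⟨?_, ?_, ?_, hgκ, ?_⟩, hρt⟩
  · apply LinearMap.ext
    intro b
    obtain ⟨h, rfl⟩ := hpt b
    have h1 : LinearMap.lTensor A.Fun ρ.toLinearMap ∘ₗ TensorProduct.map π.toLinearMap pt =
        TensorProduct.map π.toLinearMap (TensorProduct.map π.toLinearMap pt) ∘ₗ
          LinearMap.lTensor H (Coalgebra.comul (R := k)) := by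
      ext a b
      change π a ⊗ₜ ρ (pt b) = _
      rw [hρt]
      rfl
    have h2 : (TensorProduct.assoc k A.Fun A.Fun B).toLinearMap ∘ₗ
        LinearMap.rTensor B Coalgebra.comul ∘ₗ TensorProduct.map π.toLinearMap pt =
        TensorProduct.map π.toLinearMap (TensorProduct.map π.toLinearMap pt) ∘ₗ
          (TensorProduct.assoc k H H H).toLinearMap ∘ₗ
          LinearMap.rTensor H (Coalgebra.comul (R := k)) := by
      ext a b
      change TensorProduct.assoc k A.Fun A.Fun B
        (Coalgebra.comul (R := k) (Ideal.Quotient.mk A.ideal a) ⊗ₜ pt b) =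
        TensorProduct.map π.toLinearMap (TensorProduct.map π.toLinearMap pt)
          (TensorProduct.assoc k H H H (Coalgebra.comul (R := k) a ⊗ₜ b))
      rw [Bialgebra.Quotient.comul_mk]
      exact (LinearMap.congr_fun (TensorProduct.map_map_comp_assoc_eq π.toLinearMap
        π.toLinearMap pt) (Coalgebra.comul (R := k) a ⊗ₜ b)).symm
    have h3 := LinearMap.congr_fun h1 (Coalgebra.comul (R := k) h)
    have h4 := LinearMap.congr_fun h2 (Coalgebra.comul (R := k) h)
    have h5 := Coalgebra.coassoc_apply (R := k) h
    simp only [LinearMap.comp_apply, LinearEquiv.coe_coe] at h3 h4 ⊢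
    rw [AlgHom.toLinearMap_apply, hρt, h3, h4, h5]
  · intro b
    obtain ⟨h, rfl⟩ := hpt b
    rw [hρt]
    have h1 : ∀ t : H ⊗[k] H, contractL Coalgebra.counit (TensorProduct.map π.toLinearMap pt t) =
        pt (contractL Coalgebra.counit t) := by
      intro t
      induction t with
      | zero => simp
      | add x y hx hy => simp only [map_add, hx, hy]
      | tmul x y =>
        rw [TensorProduct.map_tmul, contractL_tmul, contractL_tmul, map_smul]
        rfl
    rw [h1, contractL_counit_comul]
  · have h1 : ∀ t : H ⊗[k] Tw J, galInv κ (Algebra.TensorProduct.map π p t) =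
        TensorProduct.map p.toLinearMap p.toLinearMap (galInv (trans J) t) := by
      intro t
      induction t with
      | zero => simp
      | add x y hx hy => simp only [map_add, hx, hy]
      | tmul a b =>
        rw [Algebra.TensorProduct.map_tmul, galInv_tmul, galInv_tmul, hκ]
        exact (congrArg (_ * ·) (by simp)).trans
          (map_mul (Algebra.TensorProduct.map p p) (trans J a) (1 ⊗ₜ b)).symm
    have h2 : ∀ b, galInv κ (ρ b) = b ⊗ₜ 1 := by
      intro b
      obtain ⟨a, rfl⟩ := hp b
      rw [hρ', h1, galInv_coaction (galMap_trans J) (galMap_twComul_injective J)]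
      simp
    refine Function.LeftInverse.injective (g := galInv κ) fun t => ?_
    induction t with
    | zero => simp
    | add x y hx hy => simp only [map_add, hx, hy]
    | tmul a b =>
      have h3 : ∀ t : A.Fun ⊗[k] B, galInv κ (t * (1 ⊗ₜ b)) = galInv κ t * (1 ⊗ₜ b) := by
        intro t
        induction t with
        | zero => simp
        | add x y hx hy => simp only [add_mul, map_add, hx, hy]
        | tmul x y => simp [galInv_tmul, mul_assoc]
      rw [galMap_tmul, h3, h2]
      simp
  · intro b g hg b'
    obtain ⟨a, rfl⟩ := hpt b
    obtain ⟨e, rfl⟩ := hpt b'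
    let r := Coalgebra.Repr.arbitrary k e
    let s := Coalgebra.Repr.arbitrary k a
    refine ⟨∑ i ∈ r.index, R₀.val.ofConv (π (r.left i) ⊗ₜ g) • pt (r.right i), ?_⟩
    have h1 : pt e * pt a = p (tw J e * tw J a) := (map_mul p _ _).symm
    have h2 : ∀ i, ∑ j ∈ s.index, R₀.val.ofConv (π (r.left i) ⊗ₜ π (s.left j)) • pt (s.right j) =
        R₀.val.ofConv (π (r.left i) ⊗ₜ g) • pt a := by
      intro i
      have h3 := congrArg (contractL (R₀.val.ofConv ∘ₗ TensorProduct.mk k _ _ (π (r.left i))))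
        ((hρt a).symm.trans hg)
      rw [← s.eq, map_sum, map_sum] at h3
      simp only [TensorProduct.map_tmul, contractL_tmul] at h3
      exact h3
    rw [h1, tw_mul_comm J r s, map_sum, Finset.mul_sum]
    refine Finset.sum_congr rfl fun i _ => ?_
    rw [mul_smul_comm, ← smul_mul_assoc, ← h2, Finset.sum_mul, map_sum]
    refine Finset.sum_congr rfl fun j _ => ?_
    rw [map_smul, map_mul, ← hR₀, smul_mul_assoc]
    rfl

end Descent

/-! ### Gauge transformations -/

section Gauge

/-- Functionals pulled back from different factors of a tensor product commute. -/
theorem commute_pull_rid_lid {k : Type*} [Field k] {V W : Type*} [AddCommGroup V] [Module k V]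
    [Coalgebra k V] [AddCommGroup W] [Module k W] [Coalgebra k W] (f : WithConv (V →ₗ[k] k))
    (g : WithConv (W →ₗ[k] k)) {φ : V ⊗[k] W →ₗc[k] V} {ψ : V ⊗[k] W →ₗc[k] W}
    (hφ : ∀ v w, φ (v ⊗ₜ w) = Coalgebra.counit (R := k) w • v)
    (hψ : ∀ v w, ψ (v ⊗ₜ w) = Coalgebra.counit (R := k) v • w) :
    Commute (pull φ k f) (pull ψ k g) := by
  have e1 : pull φ k f = toConv ((Algebra.TensorProduct.lid k k).toAlgHom.toLinearMap ∘ₗ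
      (toConv (TensorProduct.map f.ofConv (1 : WithConv (W →ₗ[k] k)).ofConv)).ofConv) := by
    apply WithConv.ext
    ext v w
    change f.ofConv (φ (v ⊗ₜ w)) = f.ofConv v * Coalgebra.counit (R := k) w
    rw [hφ, map_smul, smul_eq_mul, mul_comm]
  have e2 : pull ψ k g = toConv ((Algebra.TensorProduct.lid k k).toAlgHom.toLinearMap ∘ₗ
      (toConv (TensorProduct.map (1 : WithConv (V →ₗ[k] k)).ofConv g.ofConv)).ofConv) := by
    apply WithConv.ext
    ext v w
    change g.ofConv (ψ (v ⊗ₜ w)) = Coalgebra.counit (R := k) v * g.ofConv w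
    rw [hψ, map_smul, smul_eq_mul]
  have h1 := LinearMap.algHom_comp_convMul_distrib (Algebra.TensorProduct.lid k k).toAlgHom
    (toConv (TensorProduct.map f.ofConv (1 : WithConv (W →ₗ[k] k)).ofConv))
    (toConv (TensorProduct.map (1 : WithConv (V →ₗ[k] k)).ofConv g.ofConv))
  have h2 := LinearMap.algHom_comp_convMul_distrib (Algebra.TensorProduct.lid k k).toAlgHom
    (toConv (TensorProduct.map (1 : WithConv (V →ₗ[k] k)).ofConv g.ofConv))
    (toConv (TensorProduct.map f.ofConv (1 : WithConv (W →ₗ[k] k)).ofConv))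
  rw [TensorProduct.map_convMul_map, mul_one, one_mul] at h1 h2
  rw [e1, e2]
  exact WithConv.ext (h1.symm.trans h2)

/-- The manipulation in the group of units of `(H ⊗ H ⊗ H)*` behind the invariance of the cocycle
equation under gauge transformations: `a`, `b`, `c`, `d` are the four factors of the cocycle
equation and `zᵢ` is `x⁻¹` on the `i`-th leg. -/
theorem gauge_group_identity {G : Type*} [Group G] {X a b c d u w z₁ z₂ z₃ : G}
    (h : a * b = c * d) (h₁ : Commute z₃ u) (h₂ : Commute z₃ b) (h₃ : Commute z₃ (z₁ * z₂))
    (h₅ : Commute z₁ d) :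
    X * a * (u⁻¹ * z₃) * (u * b * (z₁ * z₂)) = X * c * (z₁ * w⁻¹) * (w * d * (z₂ * z₃)) := by
  calc X * a * (u⁻¹ * z₃) * (u * b * (z₁ * z₂))
      = X * a * u⁻¹ * (z₃ * (u * b * (z₁ * z₂))) := by simp only [mul_assoc]
    _ = X * (a * b) * z₁ * z₂ * z₃ := by
      rw [((h₁.mul_right h₂).mul_right h₃).eq]
      group
    _ = X * c * (d * z₁) * z₂ * z₃ := by rw [h]; simp only [mul_assoc]
    _ = X * c * (z₁ * w⁻¹) * (w * d * (z₂ * z₃)) := by rw [← h₅.eq]; group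

variable {k : Type u} [Field k] {H : Type v} [CommRing H] [HopfAlgebra k H]

theorem gauge_gauge (x y : (Dual1 k H)ˣ) (J : (Dual2 k H)ˣ) :
    gauge x (gauge y J) = gauge (x * y) J := by
  simp only [gauge, mul_inv_rev, map_mul, mul_assoc]

theorem gauge_one_left (J : (Dual2 k H)ˣ) : gauge 1 J = J := by simp [gauge]

theorem gauge_one (x : (Dual1 k H)ˣ) : gauge x 1 = coboundary x := by
  rw [gauge, mul_one, coboundary]

theorem swap_coprod (x : (Dual1 k H)ˣ) : swap (coprod x) = coprod x := by
  apply Units.ext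
  apply WithConv.ext
  ext a b
  change x.val.ofConv (b * a) = x.val.ofConv (a * b)
  rw [mul_comm]

theorem swap_tensorSq (x : (Dual1 k H)ˣ) : swap (tensorSq x) = tensorSq x := by
  apply Units.ext
  apply WithConv.ext
  ext a b
  exact mul_comm (x.val b) (x.val a)

theorem mul_apply_one (f g : Dual1 k H) : (f * g) 1 = f 1 * g 1 := by
  change (toConv f.ofConv * toConv g.ofConv : Dual1 k H) 1 = _
  rw [LinearMap.convMul_apply, Bialgebra.comul_one]
  rfl

theorem inv_apply_one {x : (Dual1 k H)ˣ} (hx : x.val 1 = 1) : x⁻¹.val 1 = 1 := by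
  have h := mul_apply_one x⁻¹.val x.val
  rw [hx, mul_one, ← Units.val_mul, inv_mul_cancel] at h
  refine h.symm.trans ?_
  exact Bialgebra.counit_one

theorem upull_tensorSq {C : Type*} [AddCommGroup C] [Module k C] [Coalgebra k C]
    (φ : C →ₗc[k] H ⊗[k] H) (x : (Dual1 k H)ˣ) : upull φ (tensorSq x) =
      upull ((p₁ k H).comp φ) x * upull ((p₂ k H).comp φ) x := by
  apply Units.ext
  change pull φ k (outer x.val x.val) = _
  rw [outer_eq, map_mul]
  rfl

/-- A gauge transformation normalized at `1` sends Hopf 2-cocycles to Hopf 2-cocycles. -/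
theorem IsHopf2Cocycle.gauge {J : (Dual2 k H)ˣ} (hJ : IsHopf2Cocycle J) {x : (Dual1 k H)ˣ}
    (hx : x.val 1 = 1) : IsHopf2Cocycle (gauge x J) := by
  have hx' := inv_apply_one hx
  refine ⟨?_, ?_, ?_⟩
  · have hext : ∀ {φ ψ : (H ⊗[k] H) ⊗[k] H →ₗc[k] H},
        (∀ a b c : H, φ ((a ⊗ₜ b) ⊗ₜ c) = ψ ((a ⊗ₜ b) ⊗ₜ c)) → ∀ y : (Dual1 k H)ˣ,
        upull φ y = upull ψ y := by
      intro φ ψ h y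
      apply Units.ext
      apply WithConv.ext
      ext a b c
      exact congrArg y.val.ofConv (h a b c)
    let y := x⁻¹
    let X := upull (q₁ k H) (coprod x)
    let z₁ := upull ((p₁ k H).comp (q₂ k H)) y
    let z₂ := upull ((p₂ k H).comp (q₂ k H)) y
    let z₃ := upull ((p₂ k H).comp (q₄ k H)) y
    have e1 : upull (q₁ k H) (tensorSq y) = upull (q₂ k H) (coprod y) * z₃ := by
      rw [upull_tensorSq]
      congr 1
      · refine hext (ψ := (Bialgebra.mulCoalgHom k H).comp (q₂ k H)) (fun a b c => ?_) y
        change Coalgebra.counit (R := k) c • (a * b) =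
          LinearMap.mul' k H (Coalgebra.counit (R := k) c • (a ⊗ₜ b))
        rw [map_smul]
        rfl
      · refine hext (fun a b c => ?_) y
        change Coalgebra.counit (R := k) (a * b) • c =
          Coalgebra.counit (R := k) (Coalgebra.counit (R := k) a • b) • c
        rw [Bialgebra.counit_mul, map_smul]
        rfl
    have e3 : upull (q₃ k H) (tensorSq y) = z₁ * upull (q₄ k H) (coprod y) := by
      rw [upull_tensorSq]
      congr 1
      · refine hext (fun a b c => ?_) y
        change Coalgebra.counit (R := k) (b * c) • a =
          p₁ k H (Coalgebra.counit (R := k) c • (a ⊗ₜ b))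
        rw [map_smul, p₁_apply, Bialgebra.counit_mul, smul_smul, mul_comm]
      · refine hext (ψ := (Bialgebra.mulCoalgHom k H).comp (q₄ k H)) (fun a b c => ?_) y
        change Coalgebra.counit (R := k) a • (b * c) = (Coalgebra.counit (R := k) a • b) * c
        rw [smul_mul_assoc]
    have e4 : upull (q₄ k H) (tensorSq y) = z₂ * z₃ := by
      rw [upull_tensorSq]
      congr 1
      refine hext (fun a b c => ?_) y
      change Coalgebra.counit (R := k) c • (Coalgebra.counit (R := k) a • b) =
        p₂ k H (Coalgebra.counit (R := k) c • (a ⊗ₜ b))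
      rw [map_smul, p₂_apply]
    have hX : upull (q₃ k H) (coprod x) = X := by
      refine hext (φ := (Bialgebra.mulCoalgHom k H).comp (q₃ k H))
        (ψ := (Bialgebra.mulCoalgHom k H).comp (q₁ k H)) (fun a b c => ?_) x
      exact (mul_assoc a b c).symm
    have hz₃ : ∀ F : (Dual2 k H)ˣ, Commute z₃ (upull (q₂ k H) F) := by
      intro F
      refine Units.ext (commute_pull_rid_lid F.val y.val (fun v w => ?_) (fun v w => ?_)).symm
      · rfl
      · induction v with
        | zero => simp
        | add a b ha hb => simp only [TensorProduct.add_tmul, map_add, add_smul, ha, hb]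
        | tmul a b =>
          change Coalgebra.counit (R := k) (Coalgebra.counit (R := k) a • b) • w =
            (Coalgebra.counit (R := k) b * Coalgebra.counit (R := k) a) • w
          rw [map_smul, smul_eq_mul, mul_comm]
    have hz₁ : ∀ F : (Dual2 k H)ˣ, Commute z₁ (upull (q₄ k H) F) := by
      intro F
      let α : (H ⊗[k] H) ⊗[k] H →ₗc[k] H ⊗[k] (H ⊗[k] H) := assocHom k H
      let α' : H ⊗[k] (H ⊗[k] H) →ₗc[k] (H ⊗[k] H) ⊗[k] H :=
        (Coalgebra.TensorProduct.assoc k k H H H).symm.toCoalgHom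
      have h1 := commute_pull_rid_lid (φ := ((p₁ k H).comp (q₂ k H)).comp α')
        (ψ := (q₄ k H).comp α') y.val F.val (fun v w => ?_) (fun v w => ?_)
      · have h2 := h1.map (pull α k)
        have e5 : pull α k (pull (((p₁ k H).comp (q₂ k H)).comp α') k y.val) = z₁.val := by
          apply WithConv.ext
          ext a b c
          rfl
        have e6 : pull α k (pull ((q₄ k H).comp α') k F.val) = (upull (q₄ k H) F).val := by
          apply WithConv.ext
          ext a b c
          rfl
        rw [e5, e6] at h2
        exact Units.ext h2
      · induction w with
        | zero => simp
        | add a b ha hb => simp only [TensorProduct.tmul_add, map_add, add_smul, ha, hb]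
        | tmul a b =>
          change p₁ k H (Coalgebra.counit (R := k) b • (v ⊗ₜ a)) =
            (Coalgebra.counit (R := k) b * Coalgebra.counit (R := k) a) • v
          rw [map_smul, p₁_apply, smul_smul]
      · induction w with
        | zero => simp
        | add a b ha hb => simp only [TensorProduct.tmul_add, map_add, smul_add, ha, hb]
        | tmul a b =>
          change (Coalgebra.counit (R := k) v • a) ⊗ₜ b = Coalgebra.counit (R := k) v • (a ⊗ₜ b)
          rw [TensorProduct.smul_tmul']
    have hc : upull (q₁ k H) J * upull (q₂ k H) J = upull (q₃ k H) J * upull (q₄ k H) J :=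
      Units.ext hJ.cocycle
    have hu : ∀ φ : (H ⊗[k] H) ⊗[k] H →ₗc[k] H ⊗[k] H,
        upull φ (coprod y) = (upull φ (coprod x))⁻¹ := fun φ => by rw [map_inv, map_inv]
    have e2 : upull (q₂ k H) (tensorSq y) = z₁ * z₂ := upull_tensorSq _ _
    rw [hu] at e1 e3
    have hg : ∀ φ : (H ⊗[k] H) ⊗[k] H →ₗc[k] H ⊗[k] H, upull φ (InvCocycle.gauge x J) =
        upull φ (coprod x) * upull φ J * upull φ (tensorSq y) := fun φ => by
      rw [InvCocycle.gauge, map_mul, map_mul]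
    have key : upull (q₁ k H) (InvCocycle.gauge x J) * upull (q₂ k H) (InvCocycle.gauge x J) =
        upull (q₃ k H) (InvCocycle.gauge x J) * upull (q₄ k H) (InvCocycle.gauge x J) := by
      rw [hg, hg, hg, hg, e1, e2, e3, e4, hX]
      exact gauge_group_identity hc (hz₃ _) (hz₃ _) (e2 ▸ hz₃ (tensorSq y)) (hz₁ _)
    exact congrArg Units.val key
  · intro a
    have h1 : upull inl (InvCocycle.gauge x J) = 1 := by
      have e1 : upull inl (coprod x) = x := by
        apply Units.ext
        apply WithConv.ext
        ext a
        change x.val.ofConv (LinearMap.mul' k H ((inl : H →ₗc[k] H ⊗[k] H) a)) = x.val.ofConv a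
        rw [inl_apply, LinearMap.mul'_apply, mul_one]
      have e2 : upull inl (tensorSq x⁻¹) = x⁻¹ := by
        apply Units.ext
        apply WithConv.ext
        ext a
        change (outer x⁻¹.val x⁻¹.val) ((inl : H →ₗc[k] H ⊗[k] H) a) = x⁻¹.val a
        rw [inl_apply, outer_apply, hx', mul_one]
      have e3 : upull inl J = 1 := Units.ext ((right_one_iff _).1 hJ.right_one)
      rw [InvCocycle.gauge, map_mul, map_mul, e1, e2, e3, mul_one, mul_inv_cancel]
    exact (right_one_iff _).2 (congrArg Units.val h1) a
  · intro a
    have h1 : upull inr (InvCocycle.gauge x J) = 1 := by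
      have e1 : upull inr (coprod x) = x := by
        apply Units.ext
        apply WithConv.ext
        ext a
        change x.val.ofConv (LinearMap.mul' k H ((inr : H →ₗc[k] H ⊗[k] H) a)) = x.val.ofConv a
        rw [inr_apply, LinearMap.mul'_apply, one_mul]
      have e2 : upull inr (tensorSq x⁻¹) = x⁻¹ := by
        apply Units.ext
        apply WithConv.ext
        ext a
        change (outer x⁻¹.val x⁻¹.val) ((inr : H →ₗc[k] H ⊗[k] H) a) = x⁻¹.val a
        rw [inr_apply, outer_apply, hx', one_mul]
      have e3 : upull inr J = 1 := Units.ext ((left_one_iff _).1 hJ.left_one)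
      rw [InvCocycle.gauge, map_mul, map_mul, e1, e2, e3, mul_one, mul_inv_cancel]
    exact (left_one_iff _).2 (congrArg Units.val h1) a

/-- The cocycle equation descends along the surjection `O(G) → O(A)`. -/
theorem ClosedSubgroup.isHopf2Cocycle_of_lift (A : ClosedSubgroup k H) {K : (Dual2 k A.Fun)ˣ}
    (h : IsHopf2Cocycle (A.lift K)) : IsHopf2Cocycle K := by
  refine ⟨?_, fun a => ?_, fun a => ?_⟩
  · let P : (H ⊗[k] H) ⊗[k] H →ₗc[k] (A.Fun ⊗[k] A.Fun) ⊗[k] A.Fun :=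
      Coalgebra.TensorProduct.map A.proj₂ A.proj
    have hP : Function.Surjective P :=
      TensorProduct.map_surjective A.proj₂_surjective Ideal.Quotient.mk_surjective
    apply pull_injective hP k
    have h1 := h.cocycle
    have e1 : pull P k (pull (q₁ k A.Fun) k K.val) = pull (q₁ k H) k (A.lift K).val := by
      apply WithConv.ext
      ext a b c
      rfl
    have e2 : pull P k (pull (q₂ k A.Fun) k K.val) = pull (q₂ k H) k (A.lift K).val := by
      apply WithConv.ext
      ext a b c
      rfl
    have e3 : pull P k (pull (q₃ k A.Fun) k K.val) = pull (q₃ k H) k (A.lift K).val := by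
      apply WithConv.ext
      ext a b c
      rfl
    have e4 : pull P k (pull (q₄ k A.Fun) k K.val) = pull (q₄ k H) k (A.lift K).val := by
      apply WithConv.ext
      ext a b c
      rfl
    rw [map_mul, map_mul, e1, e2, e3, e4, h1]
  · obtain ⟨a, rfl⟩ := Ideal.Quotient.mk_surjective a
    exact h.right_one a
  · obtain ⟨a, rfl⟩ := Ideal.Quotient.mk_surjective a
    exact h.left_one a

end Gauge

/-! ### Existence of a minimal cocycle -/

section Minimal

variable {k : Type u} [Field k] {H : Type v} [CommRing H] [HopfAlgebra k H]

theorem rAct_outer (f g : Dual1 k H) (a b : H) :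
    rAct (outer f g) (a ⊗ₜ[k] b) = rAct f a ⊗ₜ rAct g b := by
  let r := Coalgebra.Repr.arbitrary k a
  let s := Coalgebra.Repr.arbitrary k b
  have h1 : rAct f a = ∑ i ∈ r.index, f (r.right i) • r.left i := by
    rw [rAct_apply, ← r.eq, map_sum]
    rfl
  have h2 : rAct g b = ∑ i ∈ s.index, g (s.right i) • s.left i := by
    rw [rAct_apply, ← s.eq, map_sum]
    rfl
  rw [rAct_apply, comul_tmul_eq_sum r s, h1, h2, map_sum, TensorProduct.sum_tmul]
  refine Finset.sum_congr rfl fun i _ => ?_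
  rw [map_sum, TensorProduct.tmul_sum]
  refine Finset.sum_congr rfl fun j _ => ?_
  rw [contractR_tmul, TensorProduct.smul_tmul_smul]
  rfl

theorem rMatrix_inv (J : (Dual2 k H)ˣ) : rMatrix J⁻¹ = (J * (swap J)⁻¹)⁻¹ := by
  rw [rMatrix, map_inv, inv_inv, mul_inv_rev, inv_inv]

theorem IsInvariant.commute_coprod {J : (Dual2 k H)ˣ} (iJ : IsInvariant J) (x : (Dual1 k H)ˣ) :
    Commute J (coprod x) := Units.ext (commute_of_isInvariant iJ x.val)

/-- Gauge transformations do not change `J * J₂₁⁻¹` if it is invariant. -/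
theorem gauge_mul_inv_swap {J : (Dual2 k H)ˣ} (iJ : IsInvariant J) (x : (Dual1 k H)ˣ) :
    gauge x J * (swap (gauge x J))⁻¹ = J * (swap J)⁻¹ := by
  have h := (iJ.mul iJ.swap.inv).commute_coprod x
  simp only [gauge, map_mul, swap_coprod, swap_tensorSq, mul_inv_rev, map_inv, inv_inv]
  rw [show coprod x * J * (tensorSq x)⁻¹ * (tensorSq x * ((swap J)⁻¹ * (coprod x)⁻¹)) =
    coprod x * (J * (swap J)⁻¹) * (coprod x)⁻¹ by group, ← h.eq, mul_inv_cancel_right]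

/-- A cotriangular structure has the same left and right radicals, up to the antipode. -/
theorem IsNondegenerate.swap {r : (Dual2 k H)ˣ} (hr : IsCotriangular r) (hn : IsNondegenerate r) :
    IsNondegenerate (InvCocycle.swap r) := by
  intro a ha
  have h1 : HopfAlgebra.antipode k a = 0 := hn _ fun b => by
    rw [hr.antipode_right]
    exact ha b
  rw [← antipode_antipode_apply (k := k) a, h1, map_zero]

/-- The action of a functional is a map of left comodules. -/
theorem comul_rAct {C : Type*} [AddCommGroup C] [Module k C] [Coalgebra k C]
    (f : WithConv (C →ₗ[k] k)) (c : C) :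
    LinearMap.lTensor C (rAct f) (Coalgebra.comul (R := k) c) = Coalgebra.comul (rAct f c) := by
  have h := LinearMap.congr_fun (lTensor_comul_comp_comul (k := k) (C := C)) c
  simp only [LinearMap.comp_apply, LinearEquiv.coe_coe] at h
  rw [rAct, LinearMap.lTensor_comp_apply, h, lTensor_contractR_assoc]
  rfl

/-- A comodule isomorphism `T` from a quotient of `H_J` to `O(A)` with `T(b) = ∑ b₁ x(b₂)`
transports the product of that quotient to a twisted product of `O(A)`; this makes `J` gauge
equivalent to the lift of the twisting functional `K(q, q') = x(T⁻¹(q) T⁻¹(q'))`. -/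
theorem exists_lift_eq_gauge {J : Z2inv k H} {A : ClosedSubgroup k H} {B : Type*} [Ring B]
    [Algebra k B] [Nontrivial B] {p : Tw J →ₐ[k] B} {ρ : B →ₐ[k] A.Fun ⊗[k] B}
    (hρ : ∀ h, ρ (p (tw J h)) = TensorProduct.map (Ideal.Quotient.mkₐ k A.ideal).toLinearMap
      (p.toLinearMap ∘ₗ (tw J).toLinearMap) (Coalgebra.comul (R := k) h))
    {x : B →ₗ[k] k} (hx1 : x 1 = 1)
    (hbij : Function.Bijective (contractR x ∘ₗ ρ.toLinearMap)) :
    ∃ (K : (Dual2 k A.Fun)ˣ) (X : (Dual1 k H)ˣ), X.val 1 = 1 ∧ A.lift K = gauge X J.val := by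
  let π : H →ₗ[k] A.Fun := (Ideal.Quotient.mkₐ k A.ideal).toLinearMap
  let pt : H →ₗ[k] B := p.toLinearMap ∘ₗ (tw J).toLinearMap
  let T := LinearEquiv.ofBijective (contractR x ∘ₗ ρ.toLinearMap) hbij
  let ξ : Dual1 k H := toConv (x ∘ₗ pt)
  have hmap : ∀ (f : B →ₗ[k] k) (t : H ⊗[k] H),
      contractR f (TensorProduct.map π pt t) = π (contractR (f ∘ₗ pt) t) := by
    intro f t
    induction t with
    | zero => simp
    | add x y hx hy => simp only [map_add, hx, hy]
    | tmul x y => rw [TensorProduct.map_tmul, contractR_tmul, contractR_tmul, map_smul]; rfl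
  have hT : ∀ h, T (pt h) = π (rAct ξ h) := by
    intro h
    change contractR x (ρ (p (tw J h))) = _
    rw [hρ, hmap]
    rfl
  -- `ξ` is invertible: if it kills `h`, all `h₁ ⊗ p(h₂)` vanish, as `T` is injective and colinear
  have hξ : IsUnit ξ := isUnit_of_rAct_injective fun h hh => by
    have h1 : ∀ t : H ⊗[k] H, LinearMap.lTensor H (π ∘ₗ rAct ξ) t =
        LinearMap.lTensor H T.toLinearMap (LinearMap.lTensor H pt t) := by
      intro t
      rw [← LinearMap.lTensor_comp_apply]
      congr 2
      exact LinearMap.ext fun a => (hT a).symm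
    have h2 : LinearMap.lTensor H (rAct ξ) (Coalgebra.comul (R := k) h) = 0 := by
      rw [comul_rAct, hh, map_zero]
    have h4 := h1 (Coalgebra.comul (R := k) h)
    rw [LinearMap.lTensor_comp_apply, h2, map_zero] at h4
    have h5 : LinearMap.lTensor H pt (Coalgebra.comul (R := k) h) = 0 :=
      (LinearEquiv.lTensor H T).injective (h4.symm.trans (map_zero (LinearEquiv.lTensor H T)).symm)
    have h6 : tw J h = 0 := by
      refine eq_zero_of_lTensor_twComul J p ?_
      rw [twComul_tw, ← LinearMap.lTensor_comp_apply]
      exact h5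
    exact h6
  obtain ⟨X, hX⟩ := hξ
  have hX1 : X.val 1 = 1 := by
    rw [hX]
    change x (p (tw J 1)) = 1
    rw [tw_one, map_one, hx1]
  let K₀ : Dual2 k A.Fun := toConv (x ∘ₗ LinearMap.mul' k B ∘ₗ
    TensorProduct.map T.symm.toLinearMap T.symm.toLinearMap)
  have hK₀ : pull A.proj₂ k K₀ = (gauge X J.val).val := by
    have h1 : (coprod X * J.val).val = pull A.proj₂ k K₀ * (tensorSq X).val := by
      apply WithConv.ext
      apply TensorProduct.ext'
      intro a b
      have h2 := comp_mul_scal X.val.ofConv J.val.val (mulConv (k := k) (H := H))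
      rw [scal_self] at h2
      have h3 : (coprod X * J.val).val (a ⊗ₜ b) = X.val ((twMul J.val) (a ⊗ₜ b)) :=
        (congrArg (fun f : Dual2 k H => f (a ⊗ₜ b)) h2).symm
      have h4 : (pull A.proj₂ k K₀ * (tensorSq X).val) (a ⊗ₜ b) =
          K₀ (π (rAct X.val a) ⊗ₜ π (rAct X.val b)) := by
        rw [← apply_rAct]
        change (pull A.proj₂ k K₀) (rAct (outer X.val X.val) (a ⊗ₜ b)) = _
        rw [rAct_outer]
        rfl
      refine h3.trans (Eq.trans ?_ h4.symm)
      rw [hX, ← hT, ← hT]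
      change x (p (tw J a * tw J b)) = x (T.symm (T (pt a)) * T.symm (T (pt b)))
      rw [T.symm_apply_apply, T.symm_apply_apply, map_mul]
      rfl
    rw [gauge, Units.val_mul, h1, mul_assoc, ← Units.val_mul, ← map_mul, mul_inv_cancel, map_one,
      Units.val_one, mul_one]
  obtain ⟨K, hK⟩ := isUnit_of_isUnit_pull A.proj₂_surjective (f := K₀) (hK₀ ▸ Units.isUnit _)
  exact ⟨K, X, hX1, Units.ext (by rw [← hK₀, ← hK]; rfl)⟩

/-- If `R^{J⁻¹}` comes from a non-degenerate cotriangular structure `r` on a commutative normal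
subgroup `A`, then `J` is gauge equivalent to the lift of a Hopf 2-cocycle `K` for `A`. It is
minimal: as `O(A)` is cocommutative, `R^K = K * K₂₁⁻¹`, which lifts to `J * J₂₁⁻¹`, the inverse of
`R^{J⁻¹}`. -/
theorem exists_minimal_of_lift [IsAlgClosed k] [Nontrivial H] [Algebra.FiniteType k H]
    {J : Z2inv k H} {A : ClosedSubgroup k H} (hcomm : A.IsCommutative) (hnorm : A.IsNormal)
    {r : (Dual2 k A.Fun)ˣ} (hr : A.lift r = rMatrix J⁻¹.val) (hrc : IsCotriangular r)
    (hrn : IsNondegenerate r) :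
    ∃ (K : (Dual2 k A.Fun)ˣ) (x : (Dual1 k H)ˣ), IsHopf2Cocycle K ∧
      IsNondegenerate (rMatrix K) ∧ J.val = gauge x (A.lift K) := by
  have hR₀ : A.lift r⁻¹ = J.val * (swap J.val)⁻¹ := by
    rw [map_inv, hr]
    change (rMatrix J.val⁻¹)⁻¹ = _
    rw [rMatrix_inv, inv_inv]
  obtain ⟨D, _, hD, hS, hDA, hA⟩ := exists_quotient hnorm hcomm
  obtain ⟨B, _, _, _, p, ρ, κ, -, hgal, hρ⟩ := exists_isGaloisObject hR₀ hD hS hDA hA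
  have : Coalgebra.IsCocomm k A.Fun := hcomm
  obtain ⟨x, hx1, hbij⟩ := hgal.exists_bijective
  obtain ⟨K, X, hX1, hlift⟩ := exists_lift_eq_gauge hρ hx1 hbij
  refine ⟨K, X⁻¹, A.isHopf2Cocycle_of_lift (hlift ▸ J.2.1.gauge hX1), ?_, ?_⟩
  · have h1 : rMatrix K = K * (swap K)⁻¹ := Units.ext (mul_comm _ _)
    have h2 : rMatrix K = r⁻¹ := by
      apply A.lift_injective
      rw [h1, hR₀, map_mul, map_inv, A.lift_swap, hlift, gauge_mul_inv_swap J.2.2]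
    rw [h2, ← hrc.swap_eq_inv]
    exact hrn.swap hrc
  · rw [hlift, gauge_gauge, inv_mul_cancel, gauge_one_left]

/-- An invariant Hopf 2-cocycle `J` is gauge equivalent to the lift of a minimal one for the
subgroup attached to the radical of `R^{J⁻¹}`. -/
theorem exists_minimal [IsAlgClosed k] [Nontrivial H] [Algebra.FiniteType k H] (J : Z2inv k H) :
    (isCotriangular_rMatrix J⁻¹.2.1 J⁻¹.2.2).radical ∈ Supp J.val := by
  let hR := isCotriangular_rMatrix J⁻¹.2.1 J⁻¹.2.2
  obtain ⟨r, hr, hrc, hrn⟩ := hR.exists_lift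
  obtain ⟨K, x, hK, hKn, hx⟩ := exists_minimal_of_lift hR.radical_isCommutative
    (hR.radical_isNormal (isInvariant_rMatrix J⁻¹.2.2)) hr hrc hrn
  exact ⟨K, hK, hKn, x, hx⟩

end Minimal

/-! ### `Ad`, the support and the Drinfeld element -/

section Adjoint

variable {k : Type u} [Field k] {H : Type v} [CommRing H] [HopfAlgebra k H]

/-- Composition with `Ad(x) ⊗ Ad(x)` is conjugation by `x ⊗ x`. -/
theorem comp_map_Ad (x : (Dual1 k H)ˣ) {E : Type*} [Ring E] [Algebra k E] (L : H ⊗[k] H →ₗ[k] E) :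
    toConv (L ∘ₗ TensorProduct.map (Ad x) (Ad x)) =
      scal E (tensorSq x).val * toConv L * scal E (tensorSq x⁻¹).val := by
  have e1 : ∀ y : (Dual1 k H)ˣ, scal (H ⊗[k] H) (tensorSq y).val =
      toConv (TensorProduct.map (scal H y.val).ofConv (scal H y.val).ofConv) := by
    intro y
    apply WithConv.ext
    ext a b
    change algebraMap k (H ⊗[k] H) (y.val.ofConv a * y.val.ofConv b) =
      (algebraMap k H (y.val.ofConv a)) ⊗ₜ (algebraMap k H (y.val.ofConv b))
    simp only [Algebra.algebraMap_eq_smul_one, Algebra.TensorProduct.one_def,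
      TensorProduct.smul_tmul', TensorProduct.tmul_smul, smul_smul, mul_comm]
  have e2 : toConv (TensorProduct.map (Ad x) (Ad x)) = scal (H ⊗[k] H) (tensorSq x).val *
      toConv (LinearMap.id : H ⊗[k] H →ₗ[k] H ⊗[k] H) * scal (H ⊗[k] H) (tensorSq x⁻¹).val := by
    have e0 : toConv (LinearMap.id : H ⊗[k] H →ₗ[k] H ⊗[k] H) =
        toConv (TensorProduct.map (toConv (LinearMap.id : H →ₗ[k] H)).ofConv
          (toConv (LinearMap.id : H →ₗ[k] H)).ofConv) := by
      apply WithConv.ext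
      ext a b
      rfl
    rw [e1, e1, e0, TensorProduct.map_convMul_map, TensorProduct.map_convMul_map]
    rfl
  have h1 := comp_mul_scal L (tensorSq x⁻¹).val (scal (H ⊗[k] H) (tensorSq x).val *
      toConv (LinearMap.id : H ⊗[k] H →ₗ[k] H ⊗[k] H))
  rw [comp_scal_mul, ← e2] at h1
  exact h1

theorem tensorSq_conj (x : (Dual1 k H)ˣ) (F : Dual2 k H) :
    (tensorSq x).val * F * (tensorSq x⁻¹).val =
      toConv (F.ofConv ∘ₗ TensorProduct.map (Ad x) (Ad x)) := by
  rw [comp_map_Ad, scal_self, scal_self]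

/-- `Ad(x)` is a homomorphism of coalgebras. -/
theorem comul_Ad (x : (Dual1 k H)ˣ) (h : H) : Coalgebra.comul (R := k) (Ad x h) =
    TensorProduct.map (Ad x) (Ad x) (Coalgebra.comul (R := k) h) := by
  have h1 : toConv (Coalgebra.comul ∘ₗ Ad x) =
      toConv (TensorProduct.map (Ad x) (Ad x) ∘ₗ (Coalgebra.comul : H →ₗ[k] H ⊗[k] H)) := by
    have h2 : ∀ L : H →ₗ[k] H ⊗[k] H, toConv (L ∘ₗ Ad x) =
        scal (H ⊗[k] H) x.val * toConv L * scal (H ⊗[k] H) x⁻¹.val := fun L => by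
      rw [Ad, comp_mul_scal, comp_scal_mul]
      rfl
    have h3 : scal (H ⊗[k] H) x⁻¹.val * scal (H ⊗[k] H) x.val = 1 := by
      rw [← map_mul, Units.inv_mul, map_one]
    rw [h2, ← includeLeft_mul_includeRight, h2, h2, comul_eq_includeLeft_mul_includeRight]
    simp only [mul_assoc]
    rw [← mul_assoc (scal (H ⊗[k] H) x⁻¹.val) (scal (H ⊗[k] H) x.val), h3, one_mul]
  exact congrArg (fun f : WithConv (H →ₗ[k] H ⊗[k] H) => f h) h1

theorem comp_Ad_scalar (f : Dual1 k H) (x : (Dual1 k H)ˣ) :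
    toConv (f.ofConv ∘ₗ Ad x) = x.val * f * x⁻¹.val := by
  rw [Ad, comp_mul_scal, comp_scal_mul, scal_self, scal_self]
  rfl

theorem counit_Ad (x : (Dual1 k H)ˣ) (h : H) :
    Coalgebra.counit (R := k) (Ad x h) = Coalgebra.counit (R := k) h := by
  have h1 := comp_Ad_scalar 1 x
  rw [mul_one, Units.mul_inv] at h1
  exact congrArg (fun f : Dual1 k H => f h) h1

end Adjoint

section Support

variable {k : Type u} [Field k] {H : Type v} [CommRing H] [HopfAlgebra k H]

/-- If two functionals agree on `H ⊗ D`, where `D` is a subcoalgebra, so do their products with a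
third one. -/
theorem mul_apply_eq_of_eq {D : Submodule k H} (hD : IsSubcoalgebra D) {F F' : Dual2 k H}
    (h : ∀ a, ∀ d ∈ D, F (a ⊗ₜ d) = F' (a ⊗ₜ d)) (G : Dual2 k H) (a d : H) (hd : d ∈ D) :
    (F * G) (a ⊗ₜ d) = (F' * G) (a ⊗ₜ d) ∧ (G * F) (a ⊗ₜ d) = (G * F') (a ⊗ₜ d) := by
  obtain ⟨s, hs, hs'⟩ := hD.exists_repr hd
  let r := Coalgebra.Repr.arbitrary k a
  rw [conv_tmul r s, conv_tmul r s, conv_tmul r s, conv_tmul r s]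
  exact ⟨Finset.sum_congr rfl fun i _ => Finset.sum_congr rfl fun j _ => by rw [h _ _ (hs j)],
    Finset.sum_congr rfl fun i _ => Finset.sum_congr rfl fun j _ => by rw [h _ _ (hs' j)]⟩

/-- If a functional is trivial on `H ⊗ D`, where `D` is a subcoalgebra, so are its conjugates. -/
theorem conj_apply_of_trivial {D : Submodule k H} (hD : IsSubcoalgebra D) {F : (Dual2 k H)ˣ}
    (h : ∀ a, ∀ d ∈ D, F.val (a ⊗ₜ d) = (1 : Dual2 k H) (a ⊗ₜ d)) (G : (Dual2 k H)ˣ) (a d : H)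
    (hd : d ∈ D) : (G * F * G⁻¹).val (a ⊗ₜ d) = (1 : Dual2 k H) (a ⊗ₜ d) := by
  have h1 := (mul_apply_eq_of_eq hD
    (fun a d hd => (mul_apply_eq_of_eq hD h G.val a d hd).2) G⁻¹.val a d hd).1
  rw [mul_one, Units.mul_inv] at h1
  exact h1

theorem apply_eq_one_iff {R : Dual2 k H} {a : H}
    (h : R (a ⊗ₜ 1) = Coalgebra.counit (R := k) a) (d : H) :
    R (a ⊗ₜ d) = (1 : Dual2 k H) (a ⊗ₜ d) ↔
      R (a ⊗ₜ (d - algebraMap k H (Coalgebra.counit (R := k) d))) = 0 := by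
  have h1 : R (a ⊗ₜ (d - algebraMap k H (Coalgebra.counit (R := k) d))) =
      R (a ⊗ₜ d) - Coalgebra.counit (R := k) d * R (a ⊗ₜ 1) := by
    change R.ofConv _ = _
    rw [TensorProduct.tmul_sub, Algebra.algebraMap_eq_smul_one, TensorProduct.tmul_smul, map_sub,
      map_smul]
    rfl
  have h2 : (1 : Dual2 k H) (a ⊗ₜ d) =
      Coalgebra.counit (R := k) d * Coalgebra.counit (R := k) a := by
    rw [← outer_one, outer_apply, mul_comm]
    rfl
  rw [h1, h, sub_eq_zero, h2]

theorem IsCotriangular.apply_eq_one_iff {R : (Dual2 k H)ˣ} (hR : IsCotriangular R) (d : H) :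
    (∀ a, R.val (a ⊗ₜ d) = (1 : Dual2 k H) (a ⊗ₜ d)) ↔
      d - algebraMap k H (Coalgebra.counit (R := k) d) ∈ hR.radicalIdeal :=
  forall_congr' fun a => InvCocycle.apply_eq_one_iff (hR.one_right a) d

/-- If `H` is cocommutative, the restriction of `R^K` to the diagonal is trivial. -/
theorem rMatrix_comul [Coalgebra.IsCocomm k H] (K : (Dual2 k H)ˣ) (q : H) :
    (rMatrix K).val (Coalgebra.comul (R := k) q) = Coalgebra.counit (R := k) q := by
  have h4 : upull (Coalgebra.comulCoalgHom k H) (swap K) =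
      upull (Coalgebra.comulCoalgHom k H) K := by
    apply Units.ext
    apply WithConv.ext
    ext q
    change K.val.ofConv (TensorProduct.comm k _ _ (Coalgebra.comul (R := k) q)) =
      K.val.ofConv (Coalgebra.comul (R := k) q)
    rw [Coalgebra.comm_comul]
  have h5 : upull (Coalgebra.comulCoalgHom k H) (rMatrix K) = 1 := by
    rw [rMatrix, map_mul, map_inv, h4, inv_mul_cancel]
  exact congrArg (fun f : (Dual1 k H)ˣ => f.val q) h5

/-- The Drinfeld element is the restriction of `r` to the diagonal, as `r(S(a), b) = r(b, a)`. By
gauge equivalence `r` and `R^K`, lifted to `G`, are conjugate by `x ⊗ x`, so that their restrictions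
to the diagonal are conjugate by `x`; the latter is trivial by `rMatrix_comul`. -/
theorem drinfeldElement_eq_one (J : Z2inv k H) {A : ClosedSubgroup k H} (hA : A ∈ Supp J.val)
    (hc : A.IsCommutative) {r : (Dual2 k A.Fun)ˣ} (hr : IsCotriangular r)
    (hl : A.lift r = rMatrix J.val) : drinfeldElement r = 1 := by
  obtain ⟨K, -, -, x, hx⟩ := hA
  have : Coalgebra.IsCocomm k A.Fun := hc
  have h1 : rMatrix J.val = tensorSq x * A.lift (rMatrix K) * tensorSq x⁻¹ := by
    rw [hx, A.lift_rMatrix]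
    simp only [rMatrix, gauge, map_mul, swap_coprod, swap_tensorSq, map_inv, mul_inv_rev, inv_inv]
    group
  have h2 : ∀ h, (rMatrix J.val).val (Coalgebra.comul (R := k) h) =
      (A.lift (rMatrix K)).val (Coalgebra.comul (R := k) (Ad x h)) := by
    intro h
    rw [h1, comul_Ad, Units.val_mul, Units.val_mul, tensorSq_conj]
    rfl
  apply WithConv.ext
  apply LinearMap.ext
  intro q
  obtain ⟨h, rfl⟩ := Ideal.Quotient.mk_surjective q
  have h6 : ∀ t : A.Fun ⊗[k] A.Fun, r.val.ofConv (TensorProduct.map (HopfAlgebra.antipode k)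
      LinearMap.id (TensorProduct.comm k _ _ t)) = r.val.ofConv t := by
    intro t
    induction t with
    | zero => simp
    | add x y hx hy => simp only [map_add, hx, hy]
    | tmul a b => exact hr.antipode_left b a
  refine (h6 _).trans ?_
  rw [Bialgebra.Quotient.comul_mk]
  change (A.lift r).val (Coalgebra.comul (R := k) h) = Coalgebra.counit (R := k) h
  rw [hl, h2, ← counit_Ad x h]
  have h7 := rMatrix_comul K (Ideal.Quotient.mk A.ideal (Ad x h))
  rw [Bialgebra.Quotient.comul_mk] at h7
  exact h7

variable [IsAlgClosed k] [Algebra.FiniteType k H]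

/-- The radical of `R^{J⁻¹}` is contained in that of `R^J`, as `R^{J⁻¹}` and the inverse of `R^J`
are conjugate by `J₂₁` and both are trivial on functions on the quotient of `G` by the former. -/
theorem radicalIdeal_inv_le (J : Z2inv k H) :
    (isCotriangular_rMatrix J⁻¹.2.1 J⁻¹.2.2).radicalIdeal ≤
      (isCotriangular_rMatrix J.2.1 J.2.2).radicalIdeal := by
  let hR := isCotriangular_rMatrix J⁻¹.2.1 J⁻¹.2.2
  obtain ⟨D, -, hD, -, hDA, hA⟩ := exists_quotient (hR.radical_isNormal
    (isInvariant_rMatrix J⁻¹.2.2)) hR.radical_isCommutative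
  refine hA.trans (Ideal.span_le.2 ?_)
  rintro _ ⟨d, hd, rfl⟩
  refine ((isCotriangular_rMatrix J.2.1 J.2.2).apply_eq_one_iff d).1 fun a => ?_
  have h1 : ∀ a, ∀ d ∈ D, (rMatrix J⁻¹.val).val (a ⊗ₜ d) = (1 : Dual2 k H) (a ⊗ₜ d) :=
    fun a d hd => (hR.apply_eq_one_iff d).2 (hDA d hd) a
  have h2 : ∀ a, ∀ d ∈ D, (rMatrix J⁻¹.val)⁻¹.val (a ⊗ₜ d) = (1 : Dual2 k H) (a ⊗ₜ d) := by
    intro a d hd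
    have h3 := (mul_apply_eq_of_eq hD h1 (rMatrix J⁻¹.val)⁻¹.val a d hd).1
    rw [one_mul, Units.mul_inv] at h3
    exact h3.symm
  have h4 := conj_apply_of_trivial hD h2 (swap J.val)⁻¹ a d hd
  change ((swap J.val)⁻¹ * (rMatrix J.val⁻¹)⁻¹ * (swap J.val)⁻¹⁻¹).val (a ⊗ₜ d) = _ at h4
  rw [rMatrix_inv, inv_inv, inv_inv, ← mul_assoc, inv_mul_cancel_right] at h4
  exact h4

/-- `R^J` and `R^{J⁻¹}` have the same radical. -/
theorem radical_inv (J : Z2inv k H) : (isCotriangular_rMatrix J⁻¹.2.1 J⁻¹.2.2).radical =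
    (isCotriangular_rMatrix J.2.1 J.2.2).radical := by
  have h1 := radicalIdeal_inv_le J
  have h2 := radicalIdeal_inv_le J⁻¹
  have h3 : (isCotriangular_rMatrix J⁻¹.2.1 J⁻¹.2.2).radicalIdeal =
      (isCotriangular_rMatrix J.2.1 J.2.2).radicalIdeal := le_antisymm h1 (by
    intro a ha
    refine h2 ?_
    rw [IsCotriangular.mem_radicalIdeal] at ha ⊢
    rw [inv_inv]
    exact ha)
  unfold IsCotriangular.radical
  congr 1

/-- The support of an invariant Hopf 2-cocycle consists of the subgroup defined by the radical of
`R^J`. It belongs to the support by `exists_minimal`. Conversely, if `J` is gauge equivalent to the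
lift of a minimal `K` for `A`, then `J * J₂₁⁻¹`, which does not change under gauge transformations,
is lifted from `A`, so that the ideal of `A` is contained in the radical; and `R^J` and the lift of
`R^K` are conjugate, so that a function constant on the cosets of the radical subgroup pairs
trivially under `R^K` and the ideal of the radical is contained in that of `A`. -/
theorem supp_eq (J : Z2inv k H) :
    Supp J.val = {(isCotriangular_rMatrix J.2.1 J.2.2).radical} := by
  have : Nontrivial H := (Bialgebra.counitAlgHom k H).toRingHom.domain_nontrivial
  rw [← radical_inv]
  let hR := isCotriangular_rMatrix J⁻¹.2.1 J⁻¹.2.2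
  refine Set.eq_singleton_iff_unique_mem.2 ⟨exists_minimal J, ?_⟩
  rintro A ⟨K, hK2, hK, x, hx⟩
  have hL : A.lift K = gauge x⁻¹ J.val := by
    rw [hx, gauge_gauge, inv_mul_cancel, gauge_one_left]
  have hle : A.ideal ≤ hR.radical.ideal := by
    intro a ha
    change ∀ b, (rMatrix J⁻¹.val).val (b ⊗ₜ a) = 0
    intro b
    have h1 : rMatrix J⁻¹.val = A.lift (K * (swap K)⁻¹)⁻¹ := by
      change rMatrix J.val⁻¹ = _
      rw [rMatrix_inv, map_inv, map_mul, map_inv, A.lift_swap, hL, gauge_mul_inv_swap J.2.2]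
    rw [h1, A.lift_ideal_right _ ha]
  have hge : hR.radical.ideal ≤ A.ideal := by
    obtain ⟨D, -, hD, -, hDA, hA⟩ := exists_quotient (hR.radical_isNormal
      (isInvariant_rMatrix J⁻¹.2.2)) hR.radical_isCommutative
    refine hA.trans (Ideal.span_le.2 ?_)
    rintro _ ⟨d, hd, rfl⟩
    have h1 : ∀ a, ∀ d ∈ D, (rMatrix J.val).val (a ⊗ₜ d) = (1 : Dual2 k H) (a ⊗ₜ d) :=
      fun a d hd => ((isCotriangular_rMatrix J.2.1 J.2.2).apply_eq_one_iff d).2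
        (radicalIdeal_inv_le J (hDA d hd)) a
    have h2 : rMatrix (A.lift K) =
        (tensorSq x)⁻¹ * rMatrix J.val * (tensorSq x)⁻¹⁻¹ := by
      rw [hx]
      simp only [rMatrix, gauge, map_mul, swap_coprod, swap_tensorSq, map_inv, mul_inv_rev, inv_inv]
      group
    have h3 : ∀ a, (A.lift (rMatrix K)).val (a ⊗ₜ d) = (1 : Dual2 k H) (a ⊗ₜ d) := by
      intro a
      rw [A.lift_rMatrix, h2]
      exact conj_apply_of_trivial hD h1 _ a d hd
    refine (A.mem_ideal_iff hK).2 fun a => (apply_eq_one_iff ?_ d).1 (h3 a)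
    exact rMatrix_apply_one hK2 (Ideal.Quotient.mk A.ideal a)
  have heq : A.ideal = hR.radical.ideal := le_antisymm hle hge
  cases A
  change _ = hR.radical
  generalize hR.radical = A' at heq
  cases A'
  congr 1

/-- The radical of `R^J` and the form induced by `R^J` on it make up an element `(Supp(J), R^J)` of
`𝓑(G)`. -/
theorem exists_bset (J : Z2inv k H) :
    ∃ b : BSet k H, Supp J.val = {b.A} ∧ b.A.lift b.R = rMatrix J.val := by
  let hR := isCotriangular_rMatrix J.2.1 J.2.2
  have iR := isInvariant_rMatrix J.2.2
  obtain ⟨r, hr, hrc, hrn⟩ := hR.exists_lift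
  exact ⟨{ A := hR.radical
           R := r
           commutative := hR.radical_isCommutative
           normal := hR.radical_isNormal iR
           cotriangular := hrc
           minimal := hrn
           drinfeld := drinfeldElement_eq_one J ((supp_eq J).symm ▸ rfl)
             hR.radical_isCommutative hrc hr
           invariant := hr.symm ▸ iR.isGInvariant }, supp_eq J, hr⟩

end Support

/-! ### Coboundaries -/

section Coboundaries

variable {k : Type u} [Field k] {H : Type v} [CommRing H] [HopfAlgebra k H]

theorem rMatrix_one : rMatrix (1 : (Dual2 k H)ˣ) = 1 := by simp [rMatrix]

theorem swap_coboundary (x : (Dual1 k H)ˣ) : swap (coboundary x) = coboundary x := by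
  rw [coboundary, map_mul, swap_coprod, swap_tensorSq]

theorem rMatrix_mul_of_swap_eq {F : (Dual2 k H)ˣ} (hF : swap F = F) (J : (Dual2 k H)ˣ) :
    rMatrix (F * J) = rMatrix J := by
  rw [rMatrix, map_mul, hF, mul_inv_rev, rMatrix]
  group

/-- `∂(x)` is invariant precisely if `Ad(x)` is multiplicative: the maps `Ad(x) ∘ m` and `m ∘ (Ad(x)
⊗ Ad(x))` are the conjugates of `m` by `x ∘ m` and by `x ⊗ x`. -/
theorem isInvariant_coboundary_iff (x : (Dual1 k H)ˣ) :
    IsInvariant (coboundary x) ↔ ∀ a b, Ad x (a * b) = Ad x a * Ad x b := by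
  let c := Units.map (scal H) (coprod x)
  let t := Units.map (scal H) (tensorSq x)
  have h1 : toConv (Ad x ∘ₗ LinearMap.mul' k H) = c.val * mulConv * c⁻¹.val := by
    change pull (Bialgebra.mulCoalgHom k H) H (scal H x.val * toConv LinearMap.id *
      scal H x⁻¹.val) = _
    rw [map_mul, map_mul]
    rfl
  have h2 : toConv (LinearMap.mul' k H ∘ₗ TensorProduct.map (Ad x) (Ad x)) =
      t.val * mulConv * t⁻¹.val := by
    rw [comp_map_Ad, map_inv]
    rfl
  have h3 : (∀ a b, Ad x (a * b) = Ad x a * Ad x b) ↔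
      c.val * mulConv * c⁻¹.val = t.val * mulConv (k := k) (H := H) * t⁻¹.val := by
    rw [← h1, ← h2]
    constructor
    · intro h
      apply WithConv.ext
      ext a b
      exact h a b
    · intro h a b
      exact congrArg (fun f : WithConv (H ⊗[k] H →ₗ[k] H) => f (a ⊗ₜ b)) h
  have h4 : c.val * mulConv * c⁻¹.val = t.val * mulConv (k := k) (H := H) * t⁻¹.val ↔
      IsInvariant ((tensorSq x)⁻¹ * coprod x) := by
    rw [IsInvariant]
    change _ ↔ Commute ((Units.map (scal H) ((tensorSq x)⁻¹ * coprod x) :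
      (WithConv (H ⊗[k] H →ₗ[k] H))ˣ) : WithConv (H ⊗[k] H →ₗ[k] H)) mulConv
    rw [map_mul, map_inv, Commute, SemiconjBy, Units.mul_inv_eq_iff_eq_mul]
    change c.val * mulConv = t.val * mulConv * t⁻¹.val * c.val ↔
      (t⁻¹.val * c.val) * mulConv = mulConv * (t⁻¹.val * c.val)
    rw [mul_assoc t⁻¹.val, Units.inv_mul_eq_iff_eq_mul]
    simp only [mul_assoc]
  rw [h3, h4]
  constructor
  · intro h
    have h5 := h.commute_coprod x
    have h6 : (tensorSq x)⁻¹ * coprod x = coboundary x := by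
      have h7 : (tensorSq x)⁻¹ = (coprod x)⁻¹ * coboundary x := by
        rw [coboundary, map_inv, inv_mul_cancel_left]
      rw [h7, mul_assoc, h5.eq, inv_mul_cancel_left]
    rwa [h6]
  · intro h
    have h5 := h.commute_coprod x
    have h6 : (tensorSq x)⁻¹ * coprod x = coboundary x := by
      rw [← mul_left_inj (coprod x), h5.eq, coboundary, map_inv, mul_assoc]
    rwa [h6] at h

theorem Ad_one_apply (x : (Dual1 k H)ˣ) : Ad x 1 = 1 := by
  have h : ∀ f g : WithConv (H →ₗ[k] H), (f * g) 1 = f 1 * g 1 := by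
    intro f g
    change (toConv f.ofConv * toConv g.ofConv : WithConv (H →ₗ[k] H)) 1 = _
    rw [LinearMap.convMul_apply, Bialgebra.comul_one]
    rfl
  have h1 : x.val 1 * x⁻¹.val 1 = 1 := by
    rw [← mul_apply_one, Units.mul_inv]
    exact Bialgebra.counit_one
  change (scal H x.val * toConv LinearMap.id * scal H x⁻¹.val : WithConv (H →ₗ[k] H)) 1 = 1
  rw [h, h]
  change algebraMap k H (x.val 1) * 1 * algebraMap k H (x⁻¹.val 1) = 1
  rw [mul_one, ← map_mul, h1, map_one]

theorem isHopf2Cocycle_coboundary {x : (Dual1 k H)ˣ} (hx : x.val 1 = 1) :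
    IsHopf2Cocycle (coboundary x) := by
  rw [← gauge_one]
  exact (Z2inv k H).one_mem.1.gauge hx

/-- `∂(x)` as an invariant Hopf 2-cocycle. -/
def coboundaryZ (x : (Dual1 k H)ˣ) (hx : x.val 1 = 1)
    (hm : ∀ a b, Ad x (a * b) = Ad x a * Ad x b) : Z2inv k H :=
  ⟨coboundary x, isHopf2Cocycle_coboundary hx, (isInvariant_coboundary_iff x).2 hm⟩

/-- On those `x` with `∂(x)` invariant, `x ↦ ∂(x)` reverses products, as does `x ↦ Ad(x)`. -/
theorem coboundary_mul_of_isInvariant {x y : (Dual1 k H)ˣ} (hx : IsInvariant (coboundary x)) :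
    coboundary (y * x) = coboundary x * coboundary y := by
  have h := hx.commute_coprod y
  rw [coboundary, map_mul, mul_inv_rev, map_mul, mul_assoc, ← mul_assoc (coprod x),
    ← coboundary, ← mul_assoc, ← h.eq, mul_assoc]
  rfl

/-- `Ad(x)` as an automorphism of the Hopf algebra `H`. -/
def AdEquiv (x : (Dual1 k H)ˣ) (hm : ∀ a b, Ad x (a * b) = Ad x a * Ad x b) : H ≃ₐc[k] H :=
  have h : ∀ x y : (Dual1 k H)ˣ, x * y = 1 → ∀ a, Ad y (Ad x a) = a := fun x y hxy a => by
    have h1 := LinearMap.congr_fun (Ad_comp_Ad y x) a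
    rw [hxy, Ad_one] at h1
    exact h1
  BialgEquiv.ofAlgEquiv
    (AlgEquiv.ofLinearEquiv
      (LinearEquiv.ofLinearMap (Ad x) (Ad x⁻¹) (LinearMap.ext (h _ _ (inv_mul_cancel x)))
        (LinearMap.ext (h _ _ (mul_inv_cancel x)))) (Ad_one_apply x) hm)
    (AlgHom.ext (counit_Ad x)) (AlgHom.ext fun a => (comul_Ad x a).symm)

theorem Ad_eq_id_iff (x : (Dual1 k H)ˣ) : Ad x = LinearMap.id ↔ IsCentral x := by
  constructor
  · intro h f
    have h1 := comp_Ad_scalar f x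
    rw [h] at h1
    change f = _ at h1
    rw [Units.eq_mul_inv_iff_mul_eq] at h1
    exact h1.symm
  · intro h
    apply LinearMap.ext
    intro a
    rw [← sub_eq_zero, ← Module.forall_dual_apply_eq_zero_iff k]
    intro f
    rw [map_sub, sub_eq_zero]
    have h1 := comp_Ad_scalar (toConv f) x
    rw [(h _).eq, mul_assoc, Units.mul_inv, mul_one] at h1
    exact congrArg (fun f : Dual1 k H => f a) h1

/-- `∂(x)` is trivial precisely if `x` is a point of `G`. -/
theorem coboundary_eq_one_iff (x : (Dual1 k H)ˣ) :
    coboundary x = 1 ↔ ∃ g : WithConv (H →ₐ[k] k), x = pointUnit g := by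
  rw [coboundary, map_inv, mul_inv_eq_one]
  constructor
  · intro h
    have hm : ∀ a b, x.val (a * b) = x.val a * x.val b := fun a b =>
      congrArg (fun f : (Dual2 k H)ˣ => f.val (a ⊗ₜ b)) h
    have h1 : x.val 1 = 1 := by
      have h2 : x.val 1 * x⁻¹.val 1 = 1 := by
        rw [← mul_apply_one, Units.mul_inv]
        exact Bialgebra.counit_one
      have h3 := hm 1 1
      rw [mul_one] at h3
      exact (mul_eq_left₀ (left_ne_zero_of_mul_eq_one h2)).1 h3.symm
    exact ⟨toConv (AlgHom.ofLinearMap x.val.ofConv h1 hm), Units.ext rfl⟩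
  · rintro ⟨g, rfl⟩
    apply Units.ext
    apply WithConv.ext
    ext a b
    exact map_mul g.ofConv a b

/-- Scaling `x` achieves `x(1) = 1` without changing `Ad(x)`. -/
theorem exists_normalized (x : (Dual1 k H)ˣ) : ∃ y : (Dual1 k H)ˣ, y.val 1 = 1 ∧ Ad y = Ad x := by
  have h2 : x.val 1 * x⁻¹.val 1 = 1 := by
    rw [← mul_apply_one, Units.mul_inv]
    exact Bialgebra.counit_one
  have h3 : x⁻¹.val 1 * x.val 1 = 1 := by rw [mul_comm, h2]
  let y : (Dual1 k H)ˣ := ⟨x⁻¹.val 1 • x.val, x.val 1 • x⁻¹.val,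
    by rw [smul_mul_smul_comm, h3, one_smul, Units.mul_inv],
    by rw [smul_mul_smul_comm, h2, one_smul, Units.inv_mul]⟩
  refine ⟨y, h3, ?_⟩
  have h4 : ∀ (c : k) (f : Dual1 k H), scal H (c • f) = c • scal H f := fun c f => by
    apply WithConv.ext
    exact LinearMap.comp_smul _ c _
  change (scal H (x⁻¹.val 1 • x.val) * toConv LinearMap.id *
    scal H (x.val 1 • x⁻¹.val) : WithConv (H →ₗ[k] H)).ofConv = _
  rw [h4, h4, smul_mul_assoc, smul_mul_smul_comm, h3, one_smul]
  rfl

end Coboundaries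

/-! ### The classification -/

section Classification

variable {k : Type u} [Field k] {H : Type v} [CommRing H] [HopfAlgebra k H]

/-- An element `(A, R)` of `𝓑(G)` is determined by the lift of `R` to `G`. -/
theorem BSet.ext_of_lift {b b' : BSet k H} (h : b.A.lift b.R = b'.A.lift b'.R) : b = b' := by
  have h1 : b.A.ideal = b'.A.ideal := by
    ext a
    rw [b.A.mem_ideal_iff b.minimal, b'.A.mem_ideal_iff b'.minimal, h]
  obtain ⟨⟨I, hI⟩, R, _, _, _, _, _, _⟩ := b
  obtain ⟨⟨I', hI'⟩, R', _, _, _, _, _, _⟩ := b'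
  obtain rfl : I = I' := h1
  obtain rfl : R = R' := ClosedSubgroup.lift_injective _ h
  rfl

theorem rMatrix_mul_coboundary {J : (Dual2 k H)ˣ} (iJ : IsInvariant J) {c : (Dual1 k H)ˣ}
    (hc : IsCentral c) : rMatrix (J * coboundary c) = rMatrix J := by
  have h1 : Commute J (coboundary c) := (iJ.commute_coprod c).mul_right
    (Units.ext (hc.inv.outer J.val).symm)
  rw [h1.eq, rMatrix_mul_of_swap_eq (swap_coboundary c)]

/-- `R^J` depends only on the class of `J`. -/
theorem rMatrix_eq_of_mk_eq {J J' : Z2inv k H} (h : (J : H2inv k H) = J') :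
    rMatrix J.val = rMatrix J'.val := by
  obtain ⟨c, hc, hJ⟩ := QuotientGroup.eq.1 h
  have h1 : J'.val = J.val * coboundary c := by
    rw [← hJ]
    exact (mul_inv_cancel_left J.val J'.val).symm
  rw [h1, rMatrix_mul_coboundary J.2.2 hc]

theorem IsTheta.apply_eq_iff {Θ : H2inv k H → BSet k H} (hΘ : IsTheta Θ) (J J' : Z2inv k H) :
    Θ (J : H2inv k H) = Θ (J' : H2inv k H) ↔ rMatrix J.val = rMatrix J'.val := by
  rw [← (hΘ J).2, ← (hΘ J').2]
  exact ⟨congrArg fun b : BSet k H => b.A.lift b.R, BSet.ext_of_lift⟩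

section Existence

variable [IsAlgClosed k] [Algebra.FiniteType k H]

/-- The map `Θ` is well defined. -/
theorem existsUnique_isTheta : ∃! Θ : H2inv k H → BSet k H, IsTheta Θ := by
  choose b hb hb' using exists_bset (k := k) (H := H)
  have key : ∀ J : Z2inv k H, b (Quotient.out (J : H2inv k H)) = b J := fun J =>
    BSet.ext_of_lift ((hb' _).trans
      ((rMatrix_eq_of_mk_eq (QuotientGroup.out_eq' _)).trans (hb' J).symm))
  refine ⟨fun c => b (Quotient.out c), fun J => ?_, fun Θ hΘ => ?_⟩
  · exact ⟨(hb J).trans (congrArg (fun b : BSet k H => ({b.A} : Set _)) (key J).symm),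
      (congrArg (fun b : BSet k H => b.A.lift b.R) (key J)).trans (hb' J)⟩
  · funext c
    obtain ⟨J, rfl⟩ := QuotientGroup.mk_surjective c
    exact BSet.ext_of_lift ((hΘ J).2.trans ((hb' J).symm.trans
      (congrArg (fun b : BSet k H => b.A.lift b.R) (key J).symm)))

/-- An invariant Hopf 2-cocycle `F` with `F₂₁ = F` is a coboundary: its support is trivial, and the
only Hopf 2-cocycle for the trivial group is the trivial one. -/
theorem exists_eq_coboundary (F : Z2inv k H) (hF : swap F.val = F.val) :
    ∃ x : (Dual1 k H)ˣ, x.val 1 = 1 ∧ F.val = coboundary x := by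
  have hR1 : rMatrix F.val = 1 := by rw [rMatrix, hF, inv_mul_cancel]
  let hR := isCotriangular_rMatrix F.2.1 F.2.2
  obtain ⟨K, hK, -, x, hx⟩ : hR.radical ∈ Supp F.val := (supp_eq F).symm ▸ rfl
  have hI : ∀ a, Ideal.Quotient.mk hR.radical.ideal a =
      Coalgebra.counit (R := k) a • (1 : hR.radical.Fun) := by
    intro a
    refine ClosedSubgroup.mk_eq_algebraMap (D := ⊤) (fun d _ => ?_) Submodule.mem_top
    exact (hR.apply_eq_one_iff d).1 fun a => by rw [hR1]; rfl
  have hl : hR.radical.lift K = 1 := by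
    apply Units.ext
    apply WithConv.ext
    apply TensorProduct.ext'
    intro a b
    change K.val.ofConv (Ideal.Quotient.mk _ a ⊗ₜ Ideal.Quotient.mk _ b) = (1 : Dual2 k H) (a ⊗ₜ b)
    rw [hI a, ← TensorProduct.smul_tmul', map_smul, ← outer_one, outer_apply]
    exact congrArg _ (hK.left_one _)
  rw [hl, gauge_one] at hx
  refine ⟨x, ?_, hx⟩
  have h1 := F.2.1.left_one 1
  rw [hx, Bialgebra.counit_one] at h1
  have h2 : (coboundary x).val (1 ⊗ₜ 1) = x.val 1 * (x⁻¹.val 1 * x⁻¹.val 1) := by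
    rw [coboundary]
    change (toConv (coprod x).val.ofConv * toConv (tensorSq x⁻¹).val.ofConv : Dual2 k H)
      (1 ⊗ₜ 1) = _
    rw [LinearMap.convMul_apply, ← Algebra.TensorProduct.one_def, Bialgebra.comul_one]
    change x.val.ofConv (1 * 1) * _ = _
    rw [mul_one]
    rfl
  have h3 : x.val 1 * x⁻¹.val 1 = 1 := by
    rw [← mul_apply_one, Units.mul_inv]
    exact Bialgebra.counit_one
  rw [h2, ← mul_assoc, h3, one_mul] at h1
  rw [h1, mul_one] at h3
  exact h3

end Existence

theorem CoInt.exists_normalized (f : CoInt k H) :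
    ∃ x : (Dual1 k H)ˣ, x.val 1 = 1 ∧ ∀ h, f.val h = Ad x h := by
  obtain ⟨x, hx⟩ := f.2
  obtain ⟨y, hy, hxy⟩ := InvCocycle.exists_normalized x
  exact ⟨y, hy, fun h => by rw [hx, hxy]⟩

theorem CoInt.map_mul {f : CoInt k H} {x : (Dual1 k H)ˣ} (hx : ∀ h, f.val h = Ad x h) (a b : H) :
    Ad x (a * b) = Ad x a * Ad x b := by
  rw [← hx, ← hx, ← hx]
  exact _root_.map_mul f.val a b

/-- The class of `∂(x)` depends only on `Ad(x)`. -/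
theorem mk_coboundaryZ_eq {x y : (Dual1 k H)ˣ} (h : Ad x = Ad y) {hx hy hmx hmy} :
    (coboundaryZ x hx hmx : H2inv k H) = coboundaryZ y hy hmy := by
  have hz : IsCentral (y * x⁻¹) := by
    rw [← Ad_eq_id_iff, ← Ad_comp_Ad, ← h, Ad_comp_Ad, mul_inv_cancel, Ad_one]
  refine QuotientGroup.eq.2 ⟨_, hz, ?_⟩
  have h1 := coboundary_mul (y := x) hz
  rw [inv_mul_cancel_right] at h1
  change (coboundary x)⁻¹ * coboundary y = _
  have h2 : IsInvariant (coboundary x) := (isInvariant_coboundary_iff x).2 hmx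
  have h3 : Commute (coboundary x) (coboundary (y * x⁻¹)) :=
    (h2.commute_coprod _).mul_right (Units.ext (hz.inv.outer (coboundary x).val).symm)
  rw [h1, ← h3.eq, inv_mul_cancel_left]

/-- `Ad(x) ↦ [∂(x)]` on `Int(G)`, where `x(1) = 1`. -/
def intToH2 (k : Type u) [Field k] (H : Type v) [CommRing H] [HopfAlgebra k H] :
    CoInt k H →* H2inv k H :=
  MonoidHom.mk' (fun f => (coboundaryZ (CoInt.exists_normalized f).choose
      (CoInt.exists_normalized f).choose_spec.1
      (CoInt.map_mul (CoInt.exists_normalized f).choose_spec.2) : H2inv k H)) (by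
    intro f g
    obtain ⟨hx, hf⟩ := (CoInt.exists_normalized f).choose_spec
    obtain ⟨hy, hg⟩ := (CoInt.exists_normalized g).choose_spec
    obtain ⟨hz, hfg⟩ := (CoInt.exists_normalized (f * g)).choose_spec
    generalize (CoInt.exists_normalized f).choose = x at hx hf ⊢
    generalize (CoInt.exists_normalized g).choose = y at hy hg ⊢
    generalize (CoInt.exists_normalized (f * g)).choose = z at hz hfg ⊢
    have h1 : Ad z = Ad (y * x) := by
      apply LinearMap.ext
      intro h
      rw [← hfg, ← Ad_comp_Ad]
      change f.val (g.val h) = Ad x (Ad y h)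
      rw [hf, hg]
    have hyx : (y * x).val 1 = 1 := by rw [Units.val_mul, mul_apply_one, hx, hy, mul_one]
    rw [mk_coboundaryZ_eq (y := y * x) h1 (hy := hyx) (hmy := h1 ▸ CoInt.map_mul hfg),
      ← QuotientGroup.mk_mul]
    congr 1
    apply Subtype.ext
    exact coboundary_mul_of_isInvariant
      ((isInvariant_coboundary_iff x).2 (CoInt.map_mul hf)))

theorem intToH2_apply {f : CoInt k H} {x : (Dual1 k H)ˣ} (hf : ∀ h, f.val h = Ad x h)
    (hx : x.val 1 = 1) : intToH2 k H f = (coboundaryZ x hx (CoInt.map_mul hf) : H2inv k H) :=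
  mk_coboundaryZ_eq (LinearMap.ext fun h => by
    rw [← (CoInt.exists_normalized f).choose_spec.2, hf])

theorem intToH2_eq_one_iff (f : CoInt k H) : intToH2 k H f = 1 ↔ f.val ∈ CoInn k H := by
  obtain ⟨x, hx, hf⟩ := CoInt.exists_normalized f
  rw [intToH2_apply hf hx, QuotientGroup.eq_one_iff]
  constructor
  · rintro ⟨c, hc, hxc⟩
    have h1 : coboundary (c⁻¹ * x) = 1 := by
      rw [coboundary_mul hc.inv]
      change _ * (coboundaryZ x hx (CoInt.map_mul hf)).val = 1
      rw [hxc, ← coboundary_mul hc.inv, inv_mul_cancel]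
      simp [coboundary]
    obtain ⟨g, hg⟩ := (coboundary_eq_one_iff _).1 h1
    refine ⟨g, fun h => ?_⟩
    rw [← hg, ← Ad_comp_Ad, (Ad_eq_id_iff _).2 hc.inv]
    exact hf h
  · rintro ⟨g, hg⟩
    have h1 : IsCentral (x * (pointUnit g)⁻¹) := by
      have h2 : Ad x = Ad (pointUnit g) := LinearMap.ext fun h => by rw [← hf, hg]
      rw [← Ad_eq_id_iff, ← Ad_comp_Ad, h2, Ad_comp_Ad, mul_inv_cancel, Ad_one]
    refine ⟨_, h1, ?_⟩
    have h3 := coboundary_mul (y := pointUnit g) h1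
    rw [inv_mul_cancel_right, (coboundary_eq_one_iff _).2 ⟨g, rfl⟩, mul_one] at h3
    exact h3

/-- The homomorphism `Int(G)/Inn(G) → H²_inv(G)`. -/
def intModInnToH2 (k : Type u) [Field k] (H : Type v) [CommRing H] [HopfAlgebra k H] :
    IntModInn k H →* H2inv k H :=
  QuotientGroup.lift _ (intToH2 k H) fun f hf => (intToH2_eq_one_iff f).2 hf

theorem intModInnToH2_injective : Function.Injective (intModInnToH2 k H) := by
  rw [injective_iff_map_eq_one]
  intro c hc
  obtain ⟨f, rfl⟩ := QuotientGroup.mk_surjective c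
  exact (QuotientGroup.eq_one_iff f).2 ((intToH2_eq_one_iff f).1 hc)

/-- The class of an invariant cocycle of the form `∂(x)` is in the image of `Int(G)/Inn(G)`. -/
theorem mem_range_intModInnToH2 {x : (Dual1 k H)ˣ} (hx : x.val 1 = 1)
    {F : Z2inv k H} (hF : F.val = coboundary x) : (F : H2inv k H) ∈ (intModInnToH2 k H).range := by
  have hm := (isInvariant_coboundary_iff x).1 (hF ▸ F.2.2)
  let f : CoInt k H := ⟨AdEquiv x hm, x, fun _ => rfl⟩
  refine ⟨f, ?_⟩
  change intToH2 k H f = _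
  rw [intToH2_apply (f := f) (fun _ => rfl) hx]
  congr 1
  exact Subtype.ext hF.symm

/-- The fibres of `Θ` are the cosets of `N`: the value of `Θ` at `[J]` amounts to `R^J`, and `R^{J'}
= R^J` means that `J' * J⁻¹` is symmetric, hence of the form `∂(x)` by `exists_eq_coboundary`. -/
theorem mem_fiber_iff [IsAlgClosed k] [Algebra.FiniteType k H] {Θ : H2inv k H → BSet k H}
    (hΘ : IsTheta Θ) (c d : H2inv k H) :
    Θ d = Θ c ↔ ∃ n ∈ (intModInnToH2 k H).range, d = n * c := by
  obtain ⟨J, rfl⟩ := QuotientGroup.mk_surjective c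
  obtain ⟨J', rfl⟩ := QuotientGroup.mk_surjective d
  refine (hΘ.apply_eq_iff J' J).trans ⟨fun h => ?_, ?_⟩
  · -- `J' * J⁻¹` is symmetric
    have h1 : swap (J' * J⁻¹).val = (J' * J⁻¹).val := by
      change swap (J'.val * J.val⁻¹) = J'.val * J.val⁻¹
      have h2 : (swap J'.val)⁻¹ * J'.val = (swap J.val)⁻¹ * J.val := h
      rw [map_mul, map_inv, eq_mul_inv_iff_mul_eq, mul_assoc, ← h2, mul_inv_cancel_left]
    obtain ⟨x, hx, hF⟩ := exists_eq_coboundary (J' * J⁻¹) h1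
    refine ⟨_, mem_range_intModInnToH2 hx hF, ?_⟩
    rw [← QuotientGroup.mk_mul, inv_mul_cancel_right]
  · rintro ⟨_, ⟨c, rfl⟩, h⟩
    obtain ⟨f, rfl⟩ := QuotientGroup.mk_surjective c
    obtain ⟨x, hx, hf⟩ := CoInt.exists_normalized f
    have h1 : intModInnToH2 k H f = (coboundaryZ x hx (CoInt.map_mul hf) : H2inv k H) :=
      intToH2_apply hf hx
    rw [h1, ← QuotientGroup.mk_mul] at h
    rw [rMatrix_eq_of_mk_eq h]
    exact rMatrix_mul_of_swap_eq (swap_coboundary x) J.val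

theorem IsTheta.apply_one {Θ : H2inv k H → BSet k H} (hΘ : IsTheta Θ) : Θ 1 = BSet.e k H := by
  refine BSet.ext_of_lift ((hΘ 1).2.trans ?_)
  refine Eq.trans ?_ (map_one (BSet.e k H).A.lift).symm
  exact rMatrix_one

end Classification

end

end InvCocycle

theorem mainTheorem6 {k : Type*} [Field k] [IsAlgClosed k]
    {H : Type*} [CommRing H] [HopfAlgebra k H] [Algebra.FiniteType k H] :
    (∃! Θ : InvCocycle.H2inv k H → InvCocycle.BSet k H, InvCocycle.IsTheta Θ) ∧
    ∃ φ : InvCocycle.IntModInn k H →* InvCocycle.H2inv k H,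
      Function.Injective φ ∧
      (∀ (f : InvCocycle.CoInt k H) (x : (InvCocycle.Dual1 k H)ˣ),
        (∀ h : H, f.val h = InvCocycle.Ad x h) → x.val 1 = 1 →
          ∃ J : InvCocycle.Z2inv k H, J.val = InvCocycle.gauge x 1 ∧
            φ (f : InvCocycle.IntModInn k H) = (J : InvCocycle.H2inv k H)) ∧
      ∀ Θ : InvCocycle.H2inv k H → InvCocycle.BSet k H, InvCocycle.IsTheta Θ →
        (∀ c : InvCocycle.H2inv k H,
          Θ ⁻¹' {Θ c} = {d | ∃ n ∈ φ.range, d = n * c}) ∧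
        (Function.Injective Θ ↔ InvCocycle.CoInt k H = InvCocycle.CoInn k H) ∧
        Θ ⁻¹' {InvCocycle.BSet.e k H} = (φ.range : Set (InvCocycle.H2inv k H)) ∧
        Nonempty (φ.range ≃* InvCocycle.IntModInn k H) := by
  refine ⟨InvCocycle.existsUnique_isTheta, InvCocycle.intModInnToH2 k H,
    InvCocycle.intModInnToH2_injective, fun f x hf hx =>
      ⟨InvCocycle.coboundaryZ x hx (InvCocycle.CoInt.map_mul hf), (InvCocycle.gauge_one x).symm,
        InvCocycle.intToH2_apply hf hx⟩, fun Θ hΘ => ⟨fun c => ?_, ⟨fun h => ?_, fun h => ?_⟩, ?_,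
      ⟨(MonoidHom.ofInjective InvCocycle.intModInnToH2_injective).symm⟩⟩⟩
  · ext d
    exact InvCocycle.mem_fiber_iff hΘ c d
  · apply le_antisymm
    · intro f hf
      refine (InvCocycle.intToH2_eq_one_iff ⟨f, hf⟩).1 (h ?_)
      exact (InvCocycle.mem_fiber_iff hΘ 1 _).2
        ⟨_, ⟨((⟨f, hf⟩ : InvCocycle.CoInt k H) : InvCocycle.IntModInn k H), rfl⟩, (mul_one _).symm⟩
    · rintro f ⟨g, hg⟩
      exact ⟨_, hg⟩
  · intro d c hdc
    obtain ⟨_, ⟨n, rfl⟩, rfl⟩ := (InvCocycle.mem_fiber_iff hΘ c d).1 hdc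
    obtain ⟨f, rfl⟩ := QuotientGroup.mk_surjective n
    have h1 : InvCocycle.intModInnToH2 k H (f : InvCocycle.IntModInn k H) = 1 :=
      (InvCocycle.intToH2_eq_one_iff f).2 (h ▸ f.2)
    rw [h1, one_mul]
  · ext d
    rw [← hΘ.apply_one]
    refine (InvCocycle.mem_fiber_iff hΘ 1 d).trans ⟨?_, fun h => ⟨d, h, (mul_one d).symm⟩⟩
    rintro ⟨n, hn, rfl⟩
    rw [mul_one]
    exact hn
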